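/- An instance consists of $n$ jobs and $m$ unrelated machines; job $j$ has a release time $r_j\in\mathbb{N}_0$, a weight $w_j\in\mathbb{N}$, $w_j\ge 1$, and for each machine $i$ a processing time $p_{ij}\in\{1,2,\dots\}\cup\{\infty\}$, where for every $j$ some $p_{ij}$ is finite. Let $p_{\max}$ be the largest finite $p_{ij}$. A (preemptive) schedule is a finite set of pieces; each piece runs one job $j$ on one machine $i$ with $p_{ij}<\infty$ during an interval of positive length that starts no earlier than $r_j$. Pieces on the same machine do not overlap, pieces of the same job do not overlap, and every job is completely processed: if it runs for $x_{ij}$ time units in total on machine $i$, then $\sum_{i} x_{ij}/p_{ij}=1$. In the setting without migration, all pieces of a job are moreover on the same machine. The completion time $C_j$ is the end of the last piece of $j$. The model of computation is the real RAM with unit costs: integer memory with addition, truncated subtraction, comparison and indirect addressing, real memory with exact $+,-,\cdot,/$ and comparison, conversion of integers to reals (but no rounding), and real constants in programs. **Theorem.** There is an absolute constant $C>0$ such that in each of the two settings (with and without migration), for every real $\varepsilon>0$ and every real $p>0$, there is an algorithm (a single program for all $n$, $m$ and all instances) that halts on every instance and outputs a schedule whose objective value $$\Bigl(\sum_j w_j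 (C_j-r_j)^p\Bigr)^{1/p}$$ is at most $(1+\varepsilon)$ times that of every schedule of the same setting. If $n\,p_{\max}\ge 2$, then, with $\varepsilon':=\min\{\varepsilon,1\}$, its running time is at most $$C\,n\log n+\left(\frac{n\,p_{\max}}{\varepsilon'}\right)^{C\cdot 2^m m\log(n\,p_{\max})/\varepsilon'} .$$ -/

import Mathlib

namespace FlowTime

/-! ### The scheduling problem -/

/-- An instance with `n` jobs and `m` unrelated machines. The processing time `proc i j` of job `j`
on machine `i` is a positive integer or `⊤` (job `j` cannot run on machine `i`); every job can run
on some machine. Release times are nonnegative integers, weights are positive integers. -/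
structure SchedInstance (n m : ℕ) where
  release : Fin n → ℕ
  weight : Fin n → ℕ
  proc : Fin m → Fin n → ℕ∞
  weight_pos : ∀ j, 1 ≤ weight j
  proc_pos : ∀ i j, 1 ≤ proc i j
  runnable : ∀ j, ∃ i, proc i j ≠ ⊤

/-- The largest finite processing time (`0` if there is none; note `ENat.toNat ⊤ = 0`). -/
def SchedInstance.pmax {n m : ℕ} (I : SchedInstance n m) : ℕ :=
  Finset.univ.sup fun i => Finset.univ.sup fun j => (I.proc i j).toNat

/-- One uninterrupted execution of `job` on `machine` during `[start, finish)`. -/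
structure Piece (n m : ℕ) where
  job : Fin n
  machine : Fin m
  start : ℝ
  finish : ℝ

/-- A preemptive schedule: finitely many pieces, in any order. -/
abbrev Schedule (n m : ℕ) := List (Piece n m)

/-- The two settings: a job may, or may not, be resumed on a different machine. -/
inductive Setting
  | migration
  | noMigration

/-- Feasible preemptive schedules. Each piece lies after the release time of its job and on a machine
that can run the job; no machine runs two jobs at once and no job runs on two machines at once;
each job is completely processed, where a time span of length `t` on machine `i` contributes the
fraction `t / proc i j` of job `j`. Without migration, each job uses one machine only. -/
structure Feasible {n m : ℕ} (I : SchedInstance n m) (setting : Setting) (S : Schedule n m) :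
    Prop where
  start_lt_finish : ∀ a ∈ S, a.start < a.finish
  release_le : ∀ a ∈ S, (I.release a.job : ℝ) ≤ a.start
  finite_proc : ∀ a ∈ S, I.proc a.machine a.job ≠ ⊤
  disjoint : S.Pairwise fun a b =>
    a.machine = b.machine ∨ a.job = b.job → a.finish ≤ b.start ∨ b.finish ≤ a.start
  completed : ∀ j, ((S.filter fun a => a.job = j).map fun a =>
    (a.finish - a.start) / ((I.proc a.machine j).toNat : ℝ)).sum = 1
  one_machine : setting = Setting.noMigration →
    ∀ a ∈ S, ∀ b ∈ S, a.job = b.job → a.machine = b.machine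

/-- The completion time `C_j`: the latest end of a piece of job `j` (all times are nonnegative). -/
noncomputable def completion {n m : ℕ} (S : Schedule n m) (j : Fin n) : ℝ :=
  ((S.filter fun a => a.job = j).map fun a => a.finish).foldr max 0

/-- The objective `(∑ j, w_j (C_j - r_j) ^ p) ^ (1 / p)`. -/
noncomputable def cost {n m : ℕ} (I : SchedInstance n m) (p : ℝ) (S : Schedule n m) : ℝ :=
  (∑ j, (I.weight j : ℝ) * (completion S j - (I.release j : ℝ)) ^ p) ^ (1 / p)

/-! ### The machine model: a real RAM with unit costs

The memory consists of integer arrays and real arrays, all of them infinite; a program refers to its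
(finitely many) arrays by fixed numbers and to the cells of an array by computed indices. Natural
numbers can only be added, subtracted and compared (no multiplication, division or bit operations);
real numbers can be added, subtracted, multiplied, divided and compared (no rounding). A natural
number can be converted to a real number, but not vice versa. Every evaluated operation, literal,
memory access, test and assignment costs one step. -/

structure Memory where
  nat : ℕ → ℕ → ℕ
  real : ℕ → ℕ → ℝ

/-- Integer expressions; `get a i` is cell `i` of integer array `a`; `sub` truncates at `0`. -/
inductive NExpr
  | lit (k : ℕ)
  | get (a : ℕ) (i : NExpr)
  | add (e f : NExpr)
  | sub (e f : NExpr)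

/-- Real expressions; `get a i` is cell `i` of real array `a`, and `cast` converts an integer. -/
inductive RExpr
  | lit (c : ℝ)
  | cast (e : NExpr)
  | get (a : ℕ) (i : NExpr)
  | add (e f : RExpr)
  | sub (e f : RExpr)
  | mul (e f : RExpr)
  | div (e f : RExpr)

/-- The comparisons `e ≤ f`. -/
inductive Cond
  | natLe (e f : NExpr)
  | realLe (e f : RExpr)

inductive Prog
  | skip
  | setNat (a : ℕ) (i : NExpr) (e : NExpr)
  | setReal (a : ℕ) (i : NExpr) (e : RExpr)
  | seq (P Q : Prog)
  | ite (c : Cond) (P Q : Prog)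
  | loop (c : Cond) (P : Prog)

def NExpr.eval (s : Memory) : NExpr → ℕ
  | lit k => k
  | get a i => s.nat a (i.eval s)
  | add e f => e.eval s + f.eval s
  | sub e f => e.eval s - f.eval s

noncomputable def RExpr.eval (s : Memory) : RExpr → ℝ
  | lit c => c
  | cast e => (e.eval s : ℝ)
  | get a i => s.real a (i.eval s)
  | add e f => e.eval s + f.eval s
  | sub e f => e.eval s - f.eval s
  | mul e f => e.eval s * f.eval s
  | div e f => e.eval s / f.eval s

def Cond.eval (s : Memory) : Cond → Prop
  | natLe e f => e.eval s ≤ f.eval s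
  | realLe e f => e.eval s ≤ f.eval s

/-- The number of steps for evaluating an expression: the number of its operations and leaves. -/
def NExpr.steps : NExpr → ℕ
  | lit _ => 1
  | get _ i => i.steps + 1
  | add e f => e.steps + f.steps + 1
  | sub e f => e.steps + f.steps + 1

def RExpr.steps : RExpr → ℕ
  | lit _ => 1
  | cast e => e.steps + 1
  | get _ i => i.steps + 1
  | add e f => e.steps + f.steps + 1
  | sub e f => e.steps + f.steps + 1
  | mul e f => e.steps + f.steps + 1
  | div e f => e.steps + f.steps + 1

def Cond.steps : Cond → ℕ
  | natLe e f => e.steps + f.steps + 1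
  | realLe e f => e.steps + f.steps + 1

def Memory.setNat (s : Memory) (a i v : ℕ) : Memory :=
  { s with nat := Function.update s.nat a (Function.update (s.nat a) i v) }

noncomputable def Memory.setReal (s : Memory) (a i : ℕ) (v : ℝ) : Memory :=
  { s with real := Function.update s.real a (Function.update (s.real a) i v) }

/-- `Runs P s t s'`: started on memory `s`, the program `P` halts after exactly `t` steps with
memory `s'`. -/
inductive Runs : Prog → Memory → ℕ → Memory → Prop
  | skip (s : Memory) : Runs Prog.skip s 1 s
  | setNat (s : Memory) (a : ℕ) (i e : NExpr) :
      Runs (Prog.setNat a i e) s (i.steps + e.steps + 1) (s.setNat a (i.eval s) (e.eval s))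
  | setReal (s : Memory) (a : ℕ) (i : NExpr) (e : RExpr) :
      Runs (Prog.setReal a i e) s (i.steps + e.steps + 1) (s.setReal a (i.eval s) (e.eval s))
  | seq {P Q : Prog} {s s' s'' : Memory} {t t' : ℕ} :
      Runs P s t s' → Runs Q s' t' s'' → Runs (Prog.seq P Q) s (t + t') s''
  | ite_true {c : Cond} {P Q : Prog} {s s' : Memory} {t : ℕ} :
      c.eval s → Runs P s t s' → Runs (Prog.ite c P Q) s (c.steps + t) s'
  | ite_false {c : Cond} {P Q : Prog} {s s' : Memory} {t : ℕ} :
      ¬ c.eval s → Runs Q s t s' → Runs (Prog.ite c P Q) s (c.steps + t) s'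
  | loop_false {c : Cond} {P : Prog} {s : Memory} :
      ¬ c.eval s → Runs (Prog.loop c P) s c.steps s
  | loop_true {c : Cond} {P : Prog} {s s' s'' : Memory} {t t' : ℕ} :
      c.eval s → Runs P s t s' → Runs (Prog.loop c P) s' t' s'' →
        Runs (Prog.loop c P) s (c.steps + t + t') s''

/-- The initial memory for an instance. Integer array `0` holds `n` and `m`, array `1` the release
times, array `2` the weights, and array `3` the processing times, with `proc i j` in cell `i * n + j`
and `0` in place of `⊤`. All other cells are `0`. -/
noncomputable def inputMemory {n m : ℕ} (I : SchedInstance n m) : Memory where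
  nat := fun a k =>
    match a with
    | 0 => if k = 0 then n else if k = 1 then m else 0
    | 1 => if h : k < n then I.release ⟨k, h⟩ else 0
    | 2 => if h : k < n then I.weight ⟨k, h⟩ else 0
    | 3 => if h : k < m * n then
        (I.proc (finProdFinEquiv.symm ⟨k, h⟩).1 (finProdFinEquiv.symm ⟨k, h⟩).2).toNat else 0
    | _ => 0
  real := fun _ _ => 0

/-- The memory `s` holds the schedule `S` as output: cell `0` of integer array `4` is the number of
pieces; job, machine, start and end of the `q`-th piece are in cell `q` of the integer arrays `5` and
`6` and of the real arrays `0` and `1`. -/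
def Outputs {n m : ℕ} (s : Memory) (S : Schedule n m) : Prop :=
  s.nat 4 0 = S.length ∧
  ∀ (q : ℕ) (h : q < S.length),
    s.nat 5 q = (S[q].job : ℕ) ∧ s.nat 6 q = (S[q].machine : ℕ) ∧
    s.real 0 q = S[q].start ∧ s.real 1 q = S[q].finish

/-- The running time bound `C n log n + (n p_max / ε) ^ (C 2 ^ m m log (n p_max) / ε)`. -/
noncomputable def timeBound {n m : ℕ} (C ε : ℝ) (I : SchedInstance n m) : ℝ :=
  C * ((n : ℝ) * Real.log n) +
    ((n : ℝ) * (I.pmax : ℝ) / ε) ^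
      (C * ((2 : ℝ) ^ m * (m : ℝ) * Real.log ((n : ℝ) * (I.pmax : ℝ)) / ε))

end FlowTime

/-!
Scaling the time by `E`, which is about `7 / ε`, and rounding every flow time up to some
`(a + 2) * 2 ^ k / E` with `a ≤ 2 * E` costs a factor `1 + ε` (`exists_rounding`). It is thus enough
to choose for each job such a bound, which turns into a deadline, and to decide whether all
deadlines can be met; the objective is then a sum over the jobs. The deadlines of scale `k` are
multiples of `2 ^ k`, so only `O(E)` deadlines of each scale matter at any time. Flow times above
`2 * n * pmax` are never needed (`Feasible.exists_fsched`): there are `O(log (n * pmax))` scales, and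
long gaps between release times can be cut (`ShiftEquiv`).

A dynamic program decides, slot by slot, which job each machine runs. A job is settled once it is
bound to a single machine for the rest of the time. Settled jobs with the same deadline and machine
are interchangeable, hence only their total load matters; of the unsettled jobs the program
remembers the remaining work, but it admits at most `8 * m * 2 ^ m` of them per deadline (none
without migration). Partial schedules that agree in this respect are equivalent (`EqRec`), and only
a cheapest one of each class is kept. The number of classes (`length_le_X`) yields the exponent
`2 ^ m * m * log (n * pmax) / ε` of the running time.

Few unsettled jobs suffice. Let the jobs with a common deadline be given, and for each set `S` of
machines the time in which exactly the machines in `S` work on them. Sharing out these times among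
the jobs is a linear program, and a sparse solution (`exists_few_split`) makes all but few jobs use
one machine only; the theorem of Birkhoff and von Neumann (`exists_matchings`) turns it into a
schedule again. A sparse combination of configurations in each tick can be rounded up to whole slots
if each tick is slightly extended, and this delay is paid for by the rounding of the deadlines. So
every feasible schedule gives an admissible plan (`Feasible.exists_plan`), which the dynamic program
follows up to equivalence (`Shadow`). Conversely each record it keeps is `Sound` and can be written
out as a schedule that meets its deadlines (`Sound.feasible`).

For programs of the real RAM, `Wp Z` is a weakest precondition calculus in which every loop makes at
most `Z` rounds; the number of steps is then at most a polynomial in `Z` (`Prog.bound_le`). With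
this, `algorithm_spec` states that the program implements the dynamic program.
-/

namespace FlowTime

open Finset (range card_le_card mem_filter sum_congr sum_erase_add ne_of_mem_erase
  sum_eq_sum_Ico_succ_bot mul_sum exists_ne_zero_of_sum_ne_zero mem_univ sum_eq_zero sum_range_succ
  sum_add_distrib card_filter_add_card_filter_not univ sum_comm sum_const sum_nonneg sum_le_sum
  single_le_sum sum_eq_single sum_div sum_mul sum_range sum_filter mem_range)
open Function (update update_self update_of_ne)
open List (mem_append mem_cons map_cons getElem_mem length_set forall_mem_cons not_mem_nil
  length_append cons_append nil_append mem_append_left mem_cons_of_mem mem_cons_self)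
open Set (mem_union mem_ofPred_eq mem_singleton_iff inter_subset_right inter_subset_left)
open NExpr (eval)
open Nat (reduceEqDiff cast_nonneg lt_succ_iff_lt_or_eq succ_pos cast_le le_mul_of_pos_right
  succ_mul pow_le_pow_left one_le_two_pow)

/-! ### A program logic for the machine model -/

/-- The number of steps of a program all of whose loops run for at most `Z` rounds each time they
are entered. -/
def Prog.bound (Z : ℕ) : Prog → ℕ
  | .skip => 1
  | .setNat _ i e => i.steps + e.steps + 1
  | .setReal _ i e => i.steps + e.steps + 1
  | .seq P Q => P.bound Z + Q.bound Z
  | .ite c P Q => c.steps + (P.bound Z + Q.bound Z)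
  | .loop c P => c.steps + Z * (c.steps + P.bound Z)

/-- The integer arrays that a program assigns to. -/
def Prog.mods : Prog → List ℕ
  | .skip => []
  | .setNat a _ _ => [a]
  | .setReal _ _ _ => []
  | .seq P Q => P.mods ++ Q.mods
  | .ite _ P Q => P.mods ++ Q.mods
  | .loop _ P => P.mods

/-- The real arrays that a program assigns to. -/
def Prog.rmods : Prog → List ℕ
  | .skip => []
  | .setNat _ _ _ => []
  | .setReal a _ _ => [a]
  | .seq P Q => P.rmods ++ Q.rmods
  | .ite _ P Q => P.rmods ++ Q.rmods
  | .loop _ P => P.rmods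

/-- `P`, started on `s`, halts within the step bound `P.bound Z` in a memory that satisfies `Q`. -/
def Wp (Z : ℕ) (P : Prog) (s : Memory) (Q : Memory → Prop) : Prop :=
  ∃ t s', Runs P s t s' ∧ t ≤ P.bound Z ∧ Q s'

/-- The memories `s` and `s'` agree on all arrays that `P` does not assign to. -/
def Frame (P : Prog) (s s' : Memory) : Prop :=
  (∀ a, a ∉ P.mods → s'.nat a = s.nat a) ∧ ∀ a, a ∉ P.rmods → s'.real a = s.real a

@[simp] theorem setNat_nat (s : Memory) (a i v b j : ℕ) :
    (s.setNat a i v).nat b j = if b = a ∧ j = i then v else s.nat b j := by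
  obtain rfl | h := eq_or_ne b a
  · obtain rfl | h' := eq_or_ne j i
    · simp [Memory.setNat]
    · simp [Memory.setNat, h']
  · simp [Memory.setNat, h]

@[simp] theorem setNat_real (s : Memory) (a i v : ℕ) : (s.setNat a i v).real = s.real := rfl

@[simp] theorem setReal_nat (s : Memory) (a i : ℕ) (v : ℝ) : (s.setReal a i v).nat = s.nat := rfl

@[simp] theorem setReal_real (s : Memory) (a i : ℕ) (v : ℝ) (b j : ℕ) :
    (s.setReal a i v).real b j = if b = a ∧ j = i then v else s.real b j := by
  obtain rfl | h := eq_or_ne b a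
  · obtain rfl | h' := eq_or_ne j i
    · simp [Memory.setReal]
    · simp [Memory.setReal, h']
  · simp [Memory.setReal, h]

theorem setNat_nat_of_ne (s : Memory) {a b : ℕ} (i v : ℕ) (h : b ≠ a) :
    (s.setNat a i v).nat b = s.nat b := by
  simp [Memory.setNat, h]

theorem setReal_real_of_ne (s : Memory) {a b : ℕ} (i : ℕ) (v : ℝ) (h : b ≠ a) :
    (s.setReal a i v).real b = s.real b := by
  simp [Memory.setReal, h]

theorem Runs.frame {P : Prog} {s s' : Memory} {t : ℕ} (h : Runs P s t s') : Frame P s s' := by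
  induction h with
  | skip s => exact ⟨fun _ _ => rfl, fun _ _ => rfl⟩
  | setNat s a i e =>
    refine ⟨fun b hb => setNat_nat_of_ne _ _ _ ?_, fun _ _ => rfl⟩
    simpa [Prog.mods] using hb
  | setReal s a i e =>
    refine ⟨fun _ _ => rfl, fun b hb => setReal_real_of_ne _ _ _ ?_⟩
    simpa [Prog.rmods] using hb
  | seq _ _ ih ih' =>
    refine ⟨fun b hb => ?_, fun b hb => ?_⟩
    · simp only [Prog.mods, mem_append, not_or] at hb
      rw [ih'.1 b hb.2, ih.1 b hb.1]
    · simp only [Prog.rmods, mem_append, not_or] at hb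
      rw [ih'.2 b hb.2, ih.2 b hb.1]
  | ite_true _ _ ih =>
    refine ⟨fun b hb => ?_, fun b hb => ?_⟩
    · simp only [Prog.mods, mem_append, not_or] at hb
      exact ih.1 b hb.1
    · simp only [Prog.rmods, mem_append, not_or] at hb
      exact ih.2 b hb.1
  | ite_false _ _ ih =>
    refine ⟨fun b hb => ?_, fun b hb => ?_⟩
    · simp only [Prog.mods, mem_append, not_or] at hb
      exact ih.1 b hb.2
    · simp only [Prog.rmods, mem_append, not_or] at hb
      exact ih.2 b hb.2
  | loop_false _ => exact ⟨fun _ _ => rfl, fun _ _ => rfl⟩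
  | loop_true _ _ _ ih ih' =>
    refine ⟨fun b hb => ?_, fun b hb => ?_⟩
    · rw [ih'.1 b hb, ih.1 b hb]
    · rw [ih'.2 b hb, ih.2 b hb]

section rules

variable {Z : ℕ} {P P' : Prog} {s : Memory} {Q Q' : Memory → Prop}

theorem Wp.mono (h : Wp Z P s Q) (hQ : ∀ s', Q s' → Q' s') : Wp Z P s Q' := by
  obtain ⟨t, s', h1, h2, h3⟩ := h
  exact ⟨t, s', h1, h2, hQ _ h3⟩

theorem Wp.mono_frame (h : Wp Z P s Q) (hQ : ∀ s', Frame P s s' → Q s' → Q' s') :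
    Wp Z P s Q' := by
  obtain ⟨t, s', h1, h2, h3⟩ := h
  exact ⟨t, s', h1, h2, hQ _ h1.frame h3⟩

theorem wp_skip (h : Q s) : Wp Z Prog.skip s Q := ⟨1, s, .skip s, le_rfl, h⟩

theorem wp_setNat {a : ℕ} {i e : NExpr} (h : Q (s.setNat a (i.eval s) (e.eval s))) :
    Wp Z (.setNat a i e) s Q := ⟨_, _, .setNat s a i e, le_rfl, h⟩

theorem wp_setReal {a : ℕ} {i : NExpr} {e : RExpr} (h : Q (s.setReal a (i.eval s) (e.eval s))) :
    Wp Z (.setReal a i e) s Q := ⟨_, _, .setReal s a i e, le_rfl, h⟩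

theorem wp_seq (h : Wp Z P s fun s' => Wp Z P' s' Q) : Wp Z (.seq P P') s Q := by
  obtain ⟨t, s', h1, h2, t', s'', h3, h4, h5⟩ := h
  exact ⟨_, _, .seq h1 h3, Nat.add_le_add h2 h4, h5⟩

theorem wp_ite {c : Cond} (h1 : c.eval s → Wp Z P s Q) (h2 : ¬ c.eval s → Wp Z P' s Q) :
    Wp Z (.ite c P P') s Q := by
  by_cases hc : c.eval s
  · obtain ⟨t, s', h3, h4, h5⟩ := h1 hc
    exact ⟨_, _, .ite_true hc h3, by simp only [Prog.bound]; omega, h5⟩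
  · obtain ⟨t, s', h3, h4, h5⟩ := h2 hc
    exact ⟨_, _, .ite_false hc h3, by simp only [Prog.bound]; omega, h5⟩

/-- A sequence of programs. -/
def block : List Prog → Prog
  | [] => .skip
  | P :: l => .seq P (block l)

theorem wp_nil (h : Q s) : Wp Z (block []) s Q := wp_skip h

theorem wp_cons {l : List Prog} (h : Wp Z P s fun s' => Wp Z (block l) s' Q) :
    Wp Z (block (P :: l)) s Q := wp_seq h

/-- The integer variable number `a`: cell `0` of array `a`. -/
abbrev nv (a : ℕ) : NExpr := .get a (.lit 0)

/-- Assignment to the integer variable `a`. -/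
abbrev sv (a : ℕ) (e : NExpr) : Prog := .setNat a (.lit 0) e

/-- `for v in 0, …, b - 1`. The bound `b` is evaluated in each round. -/
def forN (v : ℕ) (b : NExpr) (body : Prog) : Prog :=
  .seq (sv v (.lit 0))
    (.loop (.natLe (.add (nv v) (.lit 1)) b) (.seq body (sv v (.add (nv v) (.lit 1)))))

theorem wp_loop_of_rounds {c : Cond} (B : ℕ) (Inv : ℕ → Memory → Prop)
    (hc : ∀ k s, k ≤ B → Inv k s → (c.eval s ↔ k < B))
    (step : ∀ k s, k < B → Inv k s → Wp Z P s (Inv (k + 1)))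
    (post : ∀ s, Inv B s → Q s) (r : ℕ) :
    ∀ k s, k + r = B → Inv k s →
      ∃ t s', Runs (.loop c P) s t s' ∧ t ≤ c.steps + r * (c.steps + P.bound Z) ∧ Q s' := by
  induction r with
  | zero =>
    intro k s hk h
    have : k = B := by omega
    subst this
    exact ⟨_, s, .loop_false (by rw [hc _ _ le_rfl h]; omega), by simp, post _ h⟩
  | succ r ih =>
    intro k s hk h
    obtain ⟨t, s', h1, h2, h3⟩ := step k s (by omega) h
    obtain ⟨t', s'', h4, h5, h6⟩ := ih (k + 1) s' (by omega) h3
    refine ⟨_, s'', .loop_true ((hc _ _ (by omega) h).2 (by omega)) h1 h4, ?_, h6⟩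
    rw [Nat.add_mul]; omega

theorem wp_loop {c : Cond} (B : ℕ) (hB : B ≤ Z) (Inv : ℕ → Memory → Prop) (h0 : Inv 0 s)
    (hc : ∀ k s, k ≤ B → Inv k s → (c.eval s ↔ k < B))
    (step : ∀ k s, k < B → Inv k s → Wp Z P s (Inv (k + 1)))
    (post : ∀ s, Inv B s → Q s) : Wp Z (.loop c P) s Q := by
  obtain ⟨t, s', h1, h2, h3⟩ := wp_loop_of_rounds B Inv hc step post B 0 s (by omega) h0
  refine ⟨t, s', h1, h2.trans ?_, h3⟩
  simp only [Prog.bound]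
  gcongr

/-- The rule for counting loops: the invariant may not depend on the loop variable, and the loop
variable is not assigned to by the body. -/
theorem wp_for {v : ℕ} {b : NExpr} {body : Prog} (B : ℕ) (hB : B ≤ Z) (Inv : ℕ → Memory → Prop)
    (hv : v ∉ body.mods) (h0 : Inv 0 s)
    (hInv : ∀ k s x, Inv k s → Inv k (s.setNat v 0 x))
    (hb : ∀ k s, Inv k s → b.eval s = B)
    (step : ∀ k s, k < B → s.nat v 0 = k → Inv k s → Wp Z body s (Inv (k + 1)))
    (post : ∀ s, Inv B s → Q s) : Wp Z (forN v b body) s Q := by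
  refine wp_seq (wp_setNat ?_)
  refine wp_loop B hB (fun k s => Inv k s ∧ s.nat v 0 = k) ⟨hInv _ _ _ h0, by simp [eval]⟩
    ?_ ?_ (fun s h => post s h.1)
  · intro k s hk h
    simp only [Cond.eval, eval, hb k s h.1, h.2]
    omega
  · intro k s hk h
    refine wp_seq ((step k s hk h.2 h.1).mono_frame fun s' hf h' => wp_setNat ⟨hInv _ _ _ h', ?_⟩)
    simp [eval, hf.1 v hv, h.2]

end rules

/-! ### The dynamic program -/

/-- The numerical parameters of the dynamic program. Time is divided into slots, and `R` slots make
up a tick. Processing job `j` on machine `i` for one slot contributes `v i j` of the `V` work units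
of the job, which may start in slot `rs j`; all deadlines lie in the first `KH + 1` ticks. The
flow times considered are `(a + 2) * 2 ^ k / E` with `a ≤ 2 * E` and `2 ^ k ≤ N`; the costs of such
a flow time for a job of weight one is `kap a * tp ^ k`. -/
structure Par where
  n : ℕ
  m : ℕ
  E : ℕ
  N : ℕ
  KH : ℕ
  R : ℕ
  V : ℕ
  cap : ℕ
  v : ℕ → ℕ → ℕ
  rs : ℕ → ℕ
  w : ℕ → ℕ
  kap : ℕ → ℝ
  tp : ℝ

/-- The last slot of the dynamic program; it is not before any deadline. -/
def Par.H (P : Par) : ℕ := P.R * P.KH + P.R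

/-- Division rounded up. -/
def cdiv (r v : ℕ) : ℕ := (r + v - 1) / v

theorem cdiv_eq {r v q : ℕ} (hv : 1 ≤ v) (h1 : r ≤ q * v) (h2 : q = 0 ∨ (q - 1) * v < r) :
    cdiv r v = q := by
  unfold cdiv
  rcases h2 with rfl | h2
  · have : r = 0 := by omega
    subst this
    exact Nat.div_eq_of_lt (by omega)
  · rcases q with _ | q
    · have : r = 0 := by omega
      omega
    · simp only [Nat.add_sub_cancel] at h2
      rw [Nat.add_mul] at h1
      refine Nat.div_eq_of_lt_le ?_ ?_
      · rw [Nat.add_mul]; omega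
      · rw [Nat.add_mul, Nat.add_mul]; omega

theorem le_cdiv_mul (r : ℕ) {v : ℕ} (hv : 1 ≤ v) : r ≤ cdiv r v * v := by
  unfold cdiv
  have := Nat.div_add_mod (r + v - 1) v
  have h2 := Nat.mod_lt (r + v - 1) (show v > 0 by omega)
  rw [mul_comm v] at this
  omega

theorem cdiv_le {r v q : ℕ} (h : r ≤ q * v) : cdiv r v ≤ q := by
  unfold cdiv
  rcases Nat.eq_zero_or_pos v with rfl | hv
  · simp
  · rw [← Nat.lt_succ_iff, Nat.div_lt_iff_lt_mul hv, succ_mul]; omega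

theorem cdiv_le_self (r v : ℕ) (hv : 1 ≤ v) : cdiv r v ≤ r :=
  cdiv_le (le_mul_of_pos_right r hv)

theorem cdiv_mul_lt (r : ℕ) {v : ℕ} (hv : 1 ≤ v) : cdiv r v * v < r + v := by
  have : cdiv r v * v ≤ r + v - 1 := Nat.div_mul_le_self _ _
  omega

/-- The due slot of job `j` for the flow time with parameters `k` and `a`. Up to the shift by `R`
it is a multiple of `R * 2 ^ k`, so that only few due slots are relevant at any moment. -/
def Par.due (P : Par) (j k a : ℕ) : ℕ :=
  cdiv (P.rs j) (P.R * 2 ^ k) * (P.R * 2 ^ k) + a * (P.R * 2 ^ k) + P.R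

/-- The upper bound on the flow time of a job with parameters `k` and `a`. -/
noncomputable def Par.flow (P : Par) (k a : ℕ) : ℝ := ((a : ℝ) + 2) * 2 ^ k / P.E

/-- A partial schedule. `D j` is the due slot of job `j` (`0` before its release). If `M j = 0`, the
job may still run on all machines and has `R j` work units left; if `M j = i + 1`, it is settled on
machine `i` and needs `R j` more slots there. `L j` is the number of the slot after the last one in
which the job ran while unsettled. The history lists the decisions `(j + 1, i, t)`: job `j` runs
on machine `i` in slot `t`; a first component `0` stands for an idle step. The flow time bounds
`fh` only serve the analysis. -/
structure Rec where
  D : ℕ → ℕ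
  M : ℕ → ℕ
  R : ℕ → ℕ
  L : ℕ → ℕ
  cost : ℝ
  fh : ℕ → ℝ
  hist : List (ℕ × ℕ × ℕ)

/-- Replace the data of job `j` and the cost, and append a decision to the history. -/
def Rec.upd (x : Rec) (j d i r l : ℕ) (c f : ℝ) (act : ℕ × ℕ × ℕ) : Rec where
  D := update x.D j d
  M := update x.M j i
  R := update x.R j r
  L := update x.L j l
  cost := c
  fh := update x.fh j f
  hist := act :: x.hist

/-- Append a decision to the history. -/
def Rec.keep (x : Rec) (act : ℕ × ℕ × ℕ) : Rec := { x with hist := act :: x.hist }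

theorem Rec.upd_self (x : Rec) (j : ℕ) (act : ℕ × ℕ × ℕ) :
    x.upd j (x.D j) (x.M j) (x.R j) (x.L j) x.cost (x.fh j) act = x.keep act := by
  simp [Rec.upd, Rec.keep]

/-- The remaining work of an unsettled job. -/
def Rec.uR (x : Rec) (j : ℕ) : ℕ := if x.M j = 0 then x.R j else 0

/-- The number of slots which the jobs with due slot `d` settled on machine `i - 1` still need. -/
def Rec.load (x : Rec) (n d i : ℕ) : ℕ :=
  ∑ k ∈ range n, if x.D k = d ∧ x.M k = i then x.R k else 0

/-- The equivalence of partial schedules that is used to limit their number: they agree on the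
unsettled jobs and on the total remaining load for each machine and due slot. -/
def EqRec (n : ℕ) (x y : Rec) : Prop :=
  (∀ j < n, x.uR j = y.uR j ∧ (0 < x.uR j → x.D j = y.D j ∧ x.L j = y.L j)) ∧
    ∀ d i, 1 ≤ i → x.load n d i = y.load n d i

theorem EqRec.refl (n : ℕ) (x : Rec) : EqRec n x x := ⟨fun _ _ => ⟨rfl, fun _ => ⟨rfl, rfl⟩⟩,
  fun _ _ _ => rfl⟩

theorem EqRec.symm {n : ℕ} {x y : Rec} (h : EqRec n x y) : EqRec n y x :=
  ⟨fun j hj => ⟨(h.1 j hj).1.symm, fun h' => by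
    have := (h.1 j hj).2 (by rw [(h.1 j hj).1]; exact h')
    exact ⟨this.1.symm, this.2.symm⟩⟩, fun d i hi => (h.2 d i hi).symm⟩

theorem EqRec.trans {n : ℕ} {x y z : Rec} (h : EqRec n x y) (h' : EqRec n y z) : EqRec n x z :=
  ⟨fun j hj => ⟨(h.1 j hj).1.trans (h'.1 j hj).1, fun h0 => by
    have h1 := (h.1 j hj).2 h0
    have h2 := (h'.1 j hj).2 (by rw [← (h.1 j hj).1]; exact h0)
    exact ⟨h1.1.trans h2.1, h1.2.trans h2.2⟩⟩, fun d i hi => (h.2 d i hi).trans (h'.2 d i hi)⟩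

/-- The number of unfinished unsettled jobs other than `j` with due slot `d`. -/
def Rec.others (x : Rec) (n j d : ℕ) : ℕ :=
  ((range n).filter fun q => q ≠ j ∧ x.D q = d ∧ x.M q = 0 ∧ 1 ≤ x.R q).card

/-- The partial schedule that results if job `j`, with due slot `d` and `r` work units left, stays
unsettled (`τ = 0`) or is settled on machine `τ - 1`. At most `cap` jobs with the same due slot may
be unsettled. -/
def Par.typeAt (P : Par) (x : Rec) (j d r l : ℕ) (c f : ℝ) (act : ℕ × ℕ × ℕ) (τ : ℕ) : Set Rec :=
  {y | (τ = 0 ∧ x.others P.n j d < P.cap ∧ y = x.upd j d 0 r l c f act) ∨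
    (1 ≤ τ ∧ 1 ≤ P.v (τ - 1) j ∧ y = x.upd j d τ (cdiv r (P.v (τ - 1) j)) l c f act)}

/-- The successors of a partial schedule when job `j` is considered at the start of slot `now`: the
job may be released, with a choice of its due slot, and it may be settled on a machine. -/
def Par.childA (P : Par) (now j : ℕ) (x : Rec) : Set Rec :=
  {y | (((x.D j = 0 ∧ now < P.rs j) ∨ (x.D j ≠ 0 ∧ (x.R j = 0 ∨ (now < x.D j ∧ x.M j ≠ 0)))) ∧
      y = x.keep (0, 0, now)) ∨
    (x.D j = 0 ∧ P.rs j ≤ now ∧ ∃ k a τ, k < P.N ∧ P.R * 2 ^ k ≤ P.N * P.R ∧ a < 2 * P.E + 1 ∧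
      τ < P.m + 1 ∧ y ∈ P.typeAt x j (P.due j k a) P.V 0
        (x.cost + P.w j * (P.kap a * P.tp ^ k)) (P.flow k a) (0, 0, now) τ) ∨
    (x.D j ≠ 0 ∧ x.R j ≠ 0 ∧ now < x.D j ∧ x.M j = 0 ∧ ∃ τ < P.m + 1,
      y ∈ P.typeAt x j (x.D j) (x.R j) (x.L j) x.cost (x.fh j) (0, 0, now) τ)}

/-- The successors of a partial schedule by a decision which job runs on machine `i` in slot
`now`. -/
def Par.childB (P : Par) (now i : ℕ) (x : Rec) : Set Rec :=
  {y | (∃ j < P.n, 1 ≤ x.R j ∧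
      ((x.M j = i + 1 ∧
        y = x.upd j (x.D j) (x.M j) (x.R j - 1) (x.L j) x.cost (x.fh j) (j + 1, i, now)) ∨
      (x.M j = 0 ∧ x.L j ≤ now ∧ 1 ≤ P.v i j ∧
        y = x.upd j (x.D j) (x.M j) (x.R j - P.v i j) (now + 1) x.cost (x.fh j)
          (j + 1, i, now)))) ∨
    y = x.keep (0, i, now)}

/-- The partial schedule in which nothing has happened. -/
def Rec.root : Rec := ⟨fun _ => 0, fun _ => 0, fun _ => 0, fun _ => 0, 0, fun _ => 0, []⟩

/-- The work units that job `j` received according to a history. -/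
def Par.work (P : Par) (j : ℕ) (h : List (ℕ × ℕ × ℕ)) : ℕ :=
  (h.map fun a => if a.1 = j + 1 then P.v a.2.1 j else 0).sum

/-- A partial schedule is sound with respect to the point in slot `now` where the jobs before `jj`
and the machines before `i` have been dealt with. The function `phi` gives the cost of a
flow time. -/
structure Sound (P : Par) (phi : ℝ → ℝ) (now jj i : ℕ) (x : Rec) : Prop where
  rel : ∀ j < P.n, (x.D j ≠ 0 ↔ P.rs j < now ∨ (P.rs j = now ∧ j < jj))
  unrel : ∀ j < P.n, x.D j = 0 → x.R j = 0 ∧ x.M j = 0 ∧ x.L j = 0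
  pos_v : ∀ j < P.n, x.M j ≠ 0 → 1 ≤ P.v (x.M j - 1) j
  le_V : ∀ j < P.n, x.R j ≤ P.V
  le_L : ∀ j < P.n, x.L j ≤ now + 1
  le_m : ∀ j < P.n, x.M j ≤ P.m
  due : ∀ j < P.n, x.D j ≠ 0 → ∃ k a, P.R * 2 ^ k ≤ P.N * P.R ∧ a ≤ 2 * P.E ∧
    x.D j = P.due j k a ∧ x.fh j = P.flow k a
  now_le : ∀ j < P.n, x.R j ≠ 0 → now ≤ x.D j
  now_lt : ∀ j < P.n, j < jj → x.R j ≠ 0 → now < x.D j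
  cap : ∀ d, ((range P.n).filter fun q => x.D q = d ∧ x.M q = 0 ∧ 1 ≤ x.R q).card ≤ P.cap
  cost : x.cost = ∑ j ∈ range P.n, if x.D j ≠ 0 then (P.w j : ℝ) * phi (x.fh j) else 0
  entry : ∀ a ∈ x.hist, ∀ j, a.1 = j + 1 → j < P.n ∧ a.2.1 < P.m ∧ 1 ≤ P.v a.2.1 j ∧
    P.rs j ≤ a.2.2 ∧ a.2.2 < x.D j ∧ (a.2.2 < now ∨ (a.2.2 = now ∧ a.2.1 < i)) ∧
    (x.M j = 0 → a.2.2 < x.L j) ∧ (x.M j ≠ 0 → a.2.2 = now → a.2.1 + 1 = x.M j)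
  pair : x.hist.Pairwise fun a b => a.1 ≠ 0 → b.1 ≠ 0 → (a.2.1 = b.2.1 ∨ a.1 = b.1) →
    a.2.2 ≠ b.2.2
  work0 : ∀ j < P.n, x.D j ≠ 0 → x.M j = 0 → P.V ≤ x.R j + P.work j x.hist
  work1 : ∀ j < P.n, x.M j ≠ 0 → P.V ≤ x.R j * P.v (x.M j - 1) j + P.work j x.hist
  nomig : P.cap = 0 → ∀ j < P.n, x.D j ≠ 0 → x.M j ≠ 0 ∧ ∀ a ∈ x.hist, a.1 = j + 1 →
    a.2.1 + 1 = x.M j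

theorem sound_root (P : Par) (phi : ℝ → ℝ) : Sound P phi 0 0 0 Rec.root := by
  constructor <;> simp [Rec.root]

theorem Sound.keep {P : Par} {phi : ℝ → ℝ} {now jj i jj' i' : ℕ} {x : Rec}
    (h : Sound P phi now jj i x) (act : ℕ × ℕ × ℕ) (ha : act.1 = 0) (hi : i ≤ i')
    (hrel : ∀ j < P.n, ((P.rs j < now ∨ (P.rs j = now ∧ j < jj)) ↔
      (P.rs j < now ∨ (P.rs j = now ∧ j < jj'))))
    (hlt : ∀ j < P.n, j < jj' → x.R j ≠ 0 → now < x.D j) :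
    Sound P phi now jj' i' (x.keep act) where
  rel j hj := (h.rel j hj).trans (hrel j hj)
  unrel := h.unrel
  pos_v := h.pos_v
  le_V := h.le_V
  le_L := h.le_L
  le_m := h.le_m
  due := h.due
  now_le := h.now_le
  now_lt := hlt
  cap := h.cap
  cost := h.cost
  entry a hm j hj := by
    simp only [Rec.keep, mem_cons] at hm
    rcases hm with rfl | hm
    · omega
    · obtain ⟨h1, h2, h3, h4, h5, h6, h7, h8⟩ := h.entry a hm j hj
      exact ⟨h1, h2, h3, h4, h5, by omega, h7, h8⟩
  pair := List.pairwise_cons.2 ⟨fun b _ h1 => absurd ha h1, h.pair⟩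
  work0 j hj hD hM := by
    refine (h.work0 j hj hD hM).trans ?_
    simp [Rec.keep, Par.work, ha]
  work1 j hj hM := by
    refine (h.work1 j hj hM).trans ?_
    simp [Rec.keep, Par.work, ha]
  nomig hc j hj hD := by
    refine ⟨(h.nomig hc j hj hD).1, fun a hm haj => ?_⟩
    simp only [Rec.keep, mem_cons] at hm
    rcases hm with rfl | hm
    · omega
    · exact (h.nomig hc j hj hD).2 a hm haj

/-- At the end of a slot the next slot begins. -/
theorem Sound.next {P : Par} {phi : ℝ → ℝ} {now : ℕ} {x : Rec}
    (h : Sound P phi now P.n P.m x) : Sound P phi (now + 1) 0 0 x where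
  rel j hj := (h.rel j hj).trans (by omega)
  unrel := h.unrel
  pos_v := h.pos_v
  le_V := h.le_V
  le_L j hj := (h.le_L j hj).trans (by omega)
  le_m := h.le_m
  due := h.due
  now_le j hj hR := h.now_lt j hj hj hR
  now_lt j hj hj' := by omega
  cap := h.cap
  cost := h.cost
  entry a hm j hj := by
    obtain ⟨h1, h2, h3, h4, h5, h6, h7, h8⟩ := h.entry a hm j hj
    exact ⟨h1, h2, h3, h4, h5, by omega, h7, by omega⟩
  pair := h.pair
  work0 := h.work0
  work1 := h.work1
  nomig := h.nomig

section

variable {P : Par} {phi : ℝ → ℝ} {now jj i : ℕ} {x : Rec}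

theorem card_filter_upd_le (n j d i r l : ℕ) (c f : ℝ) (act : ℕ × ℕ × ℕ) (d' : ℕ) :
    ((range n).filter fun q => (x.upd j d i r l c f act).D q = d' ∧
      (x.upd j d i r l c f act).M q = 0 ∧ 1 ≤ (x.upd j d i r l c f act).R q).card ≤
      x.others n j d' + if d = d' ∧ i = 0 ∧ 1 ≤ r then 1 else 0 := by
  classical
  have : ((range n).filter fun q => (x.upd j d i r l c f act).D q = d' ∧
      (x.upd j d i r l c f act).M q = 0 ∧ 1 ≤ (x.upd j d i r l c f act).R q) ⊆
      ((range n).filter fun q => q ≠ j ∧ x.D q = d' ∧ x.M q = 0 ∧ 1 ≤ x.R q) ∪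
      (if d = d' ∧ i = 0 ∧ 1 ≤ r then {j} else ∅) := by
    intro q hq
    obtain ⟨hqn, h1, h2, h3⟩ := mem_filter.1 hq
    rw [Finset.mem_union]
    obtain rfl | hqj := eq_or_ne q j
    · simp only [Rec.upd, update_self] at h1 h2 h3
      right
      rw [if_pos ⟨h1, h2, h3⟩]; simp
    · simp only [Rec.upd, update_of_ne hqj] at h1 h2 h3
      left
      exact mem_filter.2 ⟨hqn, hqj, h1, h2, h3⟩
  refine (card_le_card this).trans ((Finset.card_union_le _ _).trans ?_)
  unfold Rec.others
  split_ifs <;> simp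

theorem others_le (n j d : ℕ) : x.others n j d ≤
    ((range n).filter fun q => x.D q = d ∧ x.M q = 0 ∧ 1 ≤ x.R q).card := by
  refine card_le_card fun q hq => ?_
  simp only [mem_filter] at hq ⊢
  tauto

/-- Releasing or settling a job preserves soundness. -/
theorem Sound.typeAt (h : Sound P phi now jj 0 x) (hjj : jj < P.n) {d r l τ : ℕ} {c f : ℝ}
    (hτ : τ < P.m + 1) (hr : r ≤ P.V) (hl : l = x.L jj) (hM : x.M jj = 0)
    (hrel : P.rs jj ≤ now) (hd0 : d ≠ 0) (hdD : x.D jj = d ∨ x.D jj = 0 ∧ x.L jj = 0)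
    (hdue : ∃ k a, P.R * 2 ^ k ≤ P.N * P.R ∧ a ≤ 2 * P.E ∧ d = P.due jj k a ∧ f = P.flow k a)
    (hnow : now < d)
    (hc : c = ∑ j ∈ range P.n, if update x.D jj d j ≠ 0 then
      (P.w j : ℝ) * phi (update x.fh jj f j) else 0)
    (hwork : P.V ≤ r + P.work jj x.hist) {y : Rec}
    (hy : y ∈ P.typeAt x jj d r l c f (0, 0, now) τ) : Sound P phi now (jj + 1) 0 y := by
  obtain ⟨i, r', hi, hir, hty, hr', hcap, rfl⟩ : ∃ i r', i ≤ P.m ∧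
      (i = 0 ∧ r' = r ∨ i ≠ 0 ∧ 1 ≤ P.v (i - 1) jj ∧ r' = cdiv r (P.v (i - 1) jj)) ∧
      (P.cap = 0 → i ≠ 0) ∧ r' ≤ P.V ∧ (i = 0 → x.others P.n jj d < P.cap) ∧
      y = x.upd jj d i r' l c f (0, 0, now) := by
    rcases hy with ⟨h1, h2, h3⟩ | ⟨h1, h2, h3⟩
    · exact ⟨0, r, by omega, .inl ⟨rfl, rfl⟩, by omega, hr, fun _ => h2, h3⟩
    · exact ⟨τ, _, by omega, .inr ⟨by omega, h2, rfl⟩, by omega,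
        (cdiv_le_self _ _ h2).trans hr, by omega, h3⟩
  have key : ∀ j, j < P.n → j ≠ jj → ((P.rs j < now ∨ (P.rs j = now ∧ j < jj)) ↔
      (P.rs j < now ∨ (P.rs j = now ∧ j < jj + 1))) := by omega
  have hDlt : ∀ a ∈ x.hist, a.1 = jj + 1 → a.2.2 < d := by
    intro a ha haj
    have := (h.entry a ha jj haj).2.2.2.2.1
    rcases hdD with h | h <;> omega
  subst hl
  constructor
  · intro j hj
    obtain rfl | hjj' := eq_or_ne j jj
    · simp [Rec.upd, hd0]; omega
    · simp only [Rec.upd, update_of_ne hjj']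
      exact (h.rel j hj).trans (key j hj hjj')
  · intro j hj hD
    obtain rfl | hjj' := eq_or_ne j jj
    · simp [Rec.upd] at hD; omega
    · simp only [Rec.upd, update_of_ne hjj'] at hD ⊢
      exact h.unrel j hj hD
  · intro j hj
    obtain rfl | hjj' := eq_or_ne j jj
    · simp only [Rec.upd, update_self]
      intro hi0
      rcases hir with hir | hir
      · omega
      · exact hir.2.1
    · simpa [Rec.upd, hjj'] using h.pos_v j hj
  · intro j hj
    obtain rfl | hjj' := eq_or_ne j jj
    · simpa [Rec.upd] using hr'
    · simpa [Rec.upd, hjj'] using h.le_V j hj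
  · intro j hj
    obtain rfl | hjj' := eq_or_ne j jj
    · simpa [Rec.upd] using h.le_L j hj
    · simpa [Rec.upd, hjj'] using h.le_L j hj
  · intro j hj
    obtain rfl | hjj' := eq_or_ne j jj
    · simpa [Rec.upd] using hi
    · simpa [Rec.upd, hjj'] using h.le_m j hj
  · intro j hj
    obtain rfl | hjj' := eq_or_ne j jj
    · simpa [Rec.upd] using fun _ => hdue
    · simpa [Rec.upd, hjj'] using h.due j hj
  · intro j hj
    obtain rfl | hjj' := eq_or_ne j jj
    · simpa [Rec.upd] using fun _ => hnow.le
    · simpa [Rec.upd, hjj'] using h.now_le j hj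
  · intro j hj hlt
    obtain rfl | hjj' := eq_or_ne j jj
    · simpa [Rec.upd] using fun _ => hnow
    · simpa [Rec.upd, hjj'] using h.now_lt j hj (by omega)
  · intro d'
    refine (card_filter_upd_le P.n jj d i r' _ c f (0, 0, now) d').trans ?_
    split_ifs with h'
    · have := hcap h'.2.1
      rw [← h'.1]; omega
    · exact (others_le _ _ _).trans (h.cap d')
  · exact hc.trans (sum_congr rfl fun j _ => by simp [Rec.upd])
  · intro a ha j haj
    simp only [Rec.upd, mem_cons] at ha
    rcases ha with rfl | ha
    · simp at haj
    obtain ⟨h1, h2, h3, h4, h5, h6, h7, h8⟩ := h.entry a ha j haj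
    obtain rfl | hjj' := eq_or_ne j jj
    · simp only [Rec.upd, update_self]
      exact ⟨h1, h2, h3, h4, hDlt a ha haj, h6, fun _ => h7 hM, by omega⟩
    · simp only [Rec.upd, update_of_ne hjj']
      exact ⟨h1, h2, h3, h4, h5, h6, h7, h8⟩
  · exact List.pairwise_cons.2 ⟨fun b _ h1 => absurd rfl h1, h.pair⟩
  · intro j hj
    obtain rfl | hjj' := eq_or_ne j jj
    · simp only [Rec.upd, update_self]
      intro _ hi0
      rcases hir with hir | hir
      · simpa [Par.work, hir.2] using hwork
      · omega
    · simpa only [Rec.upd, update_of_ne hjj', Par.work, map_cons, List.sum_cons,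
        Nat.zero_ne_add_one, if_false, zero_add, (Nat.succ_ne_zero j).symm] using h.work0 j hj
  · intro j hj
    obtain rfl | hjj' := eq_or_ne j jj
    · simp only [Rec.upd, update_self]
      intro hi0
      rcases hir with hir | hir
      · omega
      · refine hwork.trans ?_
        rw [hir.2.2]
        simpa [Par.work] using le_cdiv_mul r hir.2.1
    · simpa only [Rec.upd, update_of_ne hjj', Par.work, map_cons, List.sum_cons,
        Nat.zero_ne_add_one, if_false, zero_add, (Nat.succ_ne_zero j).symm] using h.work1 j hj
  · intro hc0 j hj
    obtain rfl | hjj' := eq_or_ne j jj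
    · simp only [Rec.upd, update_self]
      refine fun _ => ⟨hty hc0, fun a ha haj => ?_⟩
      simp only [mem_cons] at ha
      rcases ha with rfl | ha
      · simp at haj
      have h1 := (h.entry a ha j haj).2.2.2.2.1
      exact absurd hM (h.nomig hc0 j hj (by omega)).1
    · simp only [Rec.upd, update_of_ne hjj']
      intro hD
      refine ⟨(h.nomig hc0 j hj hD).1, fun a ha haj => ?_⟩
      simp only [mem_cons] at ha
      rcases ha with rfl | ha
      · simp at haj
      exact (h.nomig hc0 j hj hD).2 a ha haj

theorem Par.rs_lt_due (P : Par) (j k a : ℕ) (hR : 1 ≤ P.R) : P.rs j < P.due j k a := by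
  have := le_cdiv_mul (P.rs j) (v := P.R * 2 ^ k) (Nat.mul_pos hR (by positivity))
  unfold Par.due
  omega

theorem Sound.childA (h : Sound P phi now jj 0 x) (hjj : jj < P.n) (hR : 1 ≤ P.R)
    (hphi : ∀ k a, P.kap a * P.tp ^ k = phi (P.flow k a))
    {y : Rec}
    (hy : y ∈ P.childA now jj x) : Sound P phi now (jj + 1) 0 y := by
  rcases hy with ⟨h1, rfl⟩ | ⟨h1, h2, k, a, τ, hk, hkN, ha, hτ, hy⟩ | ⟨h1, h2, h3, h4, τ, hτ, hy⟩
  · refine h.keep _ rfl le_rfl (fun j hj => ?_) (fun j hj hlt hRj => ?_)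
    · obtain rfl | hjj' := eq_or_ne j jj
      · have := h.rel j hj
        rcases h1 with h1 | h1 <;> omega
      · omega
    · obtain rfl | hjj' := eq_or_ne j jj
      · rcases h1 with h1 | h1
        · exact absurd (h.unrel j hj h1.1).1 hRj
        · exact (h1.2.resolve_left hRj).1
      · exact h.now_lt j hj (by omega) hRj
  · have hnot := mt (h.rel jj hjj).2 (not_not.2 h1)
    have hrs : P.rs jj = now := by omega
    have hlt := P.rs_lt_due jj k a hR
    refine h.typeAt hjj hτ le_rfl (h.unrel jj hjj h1).2.2.symm (h.unrel jj hjj h1).2.1 h2 (by omega)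
      (.inr ⟨h1, (h.unrel jj hjj h1).2.2⟩) ⟨k, a, hkN, by omega, rfl, rfl⟩ (by omega) ?_ (by omega) hy
    rw [h.cost]
    rw [← sum_erase_add _ _ (mem_range.2 hjj)]
    conv_rhs => rw [← sum_erase_add _ _ (mem_range.2 hjj)]
    have hd0 : P.due jj k a ≠ 0 := by omega
    simp only [update_self, h1, ne_eq, not_true_eq_false, if_false, add_zero, hd0,
      not_false_eq_true, if_true, hphi]
    congr 1
    refine sum_congr rfl fun j hj => ?_
    have : j ≠ jj := ne_of_mem_erase hj
    simp only [update_of_ne this]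
  · refine h.typeAt hjj hτ (h.le_V jj hjj) rfl h4 ?_ h1 (.inl rfl) (h.due jj hjj h1) h3 ?_
      (h.work0 jj hjj h1 h4) hy
    · have := (h.rel jj hjj).1 h1
      omega
    · simpa using h.cost

/-- Running a job preserves soundness. -/
theorem Sound.run (h : Sound P phi now P.n i x) (hi : i < P.m) {j r l : ℕ} (hj : j < P.n)
    (hR : x.R j ≠ 0) (hr : r ≤ x.R j) (hl : l = x.L j ∨ l = now + 1) (hll : x.L j ≤ l)
    (hv : 1 ≤ P.v i j)
    (h0 : x.M j = 0 → x.L j ≤ now ∧ l = now + 1 ∧ x.R j ≤ r + P.v i j)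
    (h1 : x.M j ≠ 0 → x.M j = i + 1 ∧ x.R j ≤ r + 1) :
    Sound P phi now P.n (i + 1)
      (x.upd j (x.D j) (x.M j) r l x.cost (x.fh j) (j + 1, i, now)) := by
  have hD : x.D j ≠ 0 := fun h0 => hR (h.unrel j hj h0).1
  have hrs : P.rs j ≤ now := by
    have := (h.rel j hj).1 hD
    omega
  have hnow := h.now_lt j hj hj hR
  have hDu : update x.D j (x.D j) = x.D := by simp
  have hMu : update x.M j (x.M j) = x.M := by simp
  have hfu : update x.fh j (x.fh j) = x.fh := by simp
  unfold Rec.upd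
  rw [hDu, hMu, hfu]
  have hRle : ∀ q, update x.R j r q ≤ x.R q := by
    intro q
    obtain rfl | hq := eq_or_ne q j
    · simpa using hr
    · simp [update_of_ne hq]
  have hRne : ∀ q, update x.R j r q ≠ 0 → x.R q ≠ 0 := fun q hq => by
    have := hRle q; omega
  have hLle : ∀ q, x.L q ≤ update x.L j l q := by
    intro q
    obtain rfl | hq := eq_or_ne q j
    · simpa using hll
    · simp [update_of_ne hq]
  have hwork : ∀ q, P.work q ((j + 1, i, now) :: x.hist) =
      (if q = j then P.v i j else 0) + P.work q x.hist := by
    intro q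
    obtain rfl | hq := eq_or_ne q j
    · simp [Par.work]
    · simp [Par.work, hq, Ne.symm hq]
  constructor
  · exact h.rel
  · intro q hq hq0
    obtain ⟨e1, e2, e3⟩ := h.unrel q hq hq0
    have hqj : q ≠ j := by rintro rfl; exact hR e1
    simpa only [update_of_ne hqj] using ⟨e1, e2, e3⟩
  · exact h.pos_v
  · exact fun q hq => (hRle q).trans (h.le_V q hq)
  · intro q hq
    have := h.le_L q hq
    obtain rfl | hqj := eq_or_ne q j
    · simp only [update_self]; omega
    · simpa only [update_of_ne hqj] using this
  · exact h.le_m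
  · exact h.due
  · exact fun q hq hq0 => h.now_le q hq (hRne q hq0)
  · exact fun q hq hq' hq0 => h.now_lt q hq hq' (hRne q hq0)
  · intro d
    refine (card_le_card fun q hq => ?_).trans (h.cap d)
    simp only [mem_filter] at hq ⊢
    exact ⟨hq.1, hq.2.1, hq.2.2.1, hq.2.2.2.trans (hRle q)⟩
  · exact h.cost
  · intro a ha q haq
    simp only [mem_cons] at ha
    rcases ha with rfl | ha
    · obtain rfl : q = j := by simpa using haq.symm
      simp only [update_self]
      refine ⟨hj, hi, hv, hrs, hnow, .inr (by simp), fun hM => ?_, fun hM _ => (h1 hM).1.symm⟩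
      have := h0 hM
      omega
    · obtain ⟨h1, h2, h3, h4, h5, h6, h7, h8⟩ := h.entry a ha q haq
      exact ⟨h1, h2, h3, h4, h5, by omega, fun hM => (h7 hM).trans_le (hLle q), h8⟩
  · refine List.pairwise_cons.2 ⟨fun b hb _ hb0 hab => ?_, h.pair⟩
    obtain ⟨q, hq⟩ := Nat.exists_eq_succ_of_ne_zero hb0
    obtain ⟨e1, e2, e3, e4, e5, e6, e7, e8⟩ := h.entry b hb q hq
    simp only at hab ⊢
    rcases hab with hab | hab
    · omega
    · obtain rfl : j = q := by omega
      by_cases hM : x.M j = 0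
      · have := e7 hM
        have := (h0 hM).1
        omega
      · intro ht
        have := e8 hM ht.symm
        have := (h1 hM).1
        omega
  · intro q hq hDq hMq
    rw [hwork]
    obtain rfl | hqj := eq_or_ne q j
    · have := h.work0 q hq hDq hMq
      have := h0 hMq
      simp only [update_self, if_true]
      omega
    · simpa [update_of_ne hqj, hqj] using h.work0 q hq hDq hMq
  · intro q hq hMq
    rw [hwork]
    obtain rfl | hqj := eq_or_ne q j
    · have h2 := h.work1 q hq hMq
      obtain ⟨h3, h4⟩ := h1 hMq
      simp only [update_self, if_true]
      have h5 : x.M q - 1 = i := by omega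
      rw [h5] at h2 ⊢
      have := Nat.mul_le_mul_right (P.v i q) h4
      rw [Nat.add_mul] at this
      omega
    · simpa [update_of_ne hqj, hqj] using h.work1 q hq hMq
  · intro hc q hq hDq
    refine ⟨(h.nomig hc q hq hDq).1, fun a ha haq => ?_⟩
    simp only [mem_cons] at ha
    rcases ha with rfl | ha
    · obtain rfl : q = j := by simpa using haq.symm
      exact (h1 (h.nomig hc q hq hDq).1).1.symm
    · exact (h.nomig hc q hq hDq).2 a ha haq

theorem Sound.childB (h : Sound P phi now P.n i x) (hi : i < P.m) {y : Rec}
    (hy : y ∈ P.childB now i x) : Sound P phi now P.n (i + 1) y := by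
  rcases hy with ⟨j, hj, hR, ⟨hM, rfl⟩ | ⟨hM, hL, hv0, rfl⟩⟩ | rfl
  · exact h.run hi hj (by omega) (by omega) (.inl rfl) le_rfl
      (by simpa [hM] using h.pos_v j hj (by omega)) (by omega)
      (fun _ => ⟨hM, by omega⟩)
  · exact h.run hi hj (by omega) (by omega) (.inr rfl) (by omega) hv0
      (fun _ => ⟨hL, rfl, by omega⟩) (by omega)
  · exact h.keep _ rfl (by omega) (fun _ _ => Iff.rfl) (fun j hj _ => h.now_lt j hj hj)

end

/-! ### Completeness of the dynamic program -/

/-- A schedule in slots, together with the parameters of the deadlines: `sig u i = j + 1` if job `j`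
runs on machine `i` in slot `u`, and `sig u i = 0` if the machine is idle. -/
structure Plan where
  sig : ℕ → ℕ → ℕ
  kk : ℕ → ℕ
  aa : ℕ → ℕ

/-- The due slot of a job according to a plan. -/
def Plan.due (pl : Plan) (P : Par) (j : ℕ) : ℕ := P.due j (pl.kk j) (pl.aa j)

/-- From slot `u` on, job `j` runs on no machine except machine `i`. -/
def Plan.settled (pl : Plan) (P : Par) (u j i : ℕ) : Prop :=
  ∀ u' ≥ u, ∀ i' < P.m, pl.sig u' i' = j + 1 → i' = i

/-- From slot `u` on, job `j` runs on more than one machine. -/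
def Plan.unsettled (pl : Plan) (P : Par) (u j : ℕ) : Prop := ∀ i, ¬ pl.settled P u j i

/-- The work of machine `i` on job `j` in slot `u`. -/
def Plan.fW (pl : Plan) (P : Par) (j u i : ℕ) : ℕ := if pl.sig u i = j + 1 then P.v i j else 0

/-- The number of slots that machine `i'` gives to job `j` in slot `u`, counted for `i' = i`. -/
def Plan.fC (pl : Plan) (j i' u i : ℕ) : ℕ := if i = i' ∧ pl.sig u i = j + 1 then 1 else 0

/-- The total of `f` over all pairs of a slot and a machine from slot `now` and machine `i` on. -/
def Par.fut (P : Par) (f : ℕ → ℕ → ℕ) (now i : ℕ) : ℕ :=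
  ∑ i' ∈ Finset.Ico i P.m, f now i' + ∑ u ∈ Finset.Ico (now + 1) (P.H + 1),
    ∑ i' ∈ range P.m, f u i'

open Classical in
/-- A plan is admissible if it is a schedule in slots that respects its deadlines and if, for each
due slot, only few jobs are unsettled at the same time. -/
structure Plan.OK (pl : Plan) (P : Par) : Prop where
  run : ∀ u i j, i < P.m → pl.sig u i = j + 1 → j < P.n ∧ P.rs j ≤ u ∧ u < pl.due P j ∧ 1 ≤ P.v i j
  inj : ∀ u i i', i < P.m → i' < P.m → pl.sig u i = pl.sig u i' → pl.sig u i ≠ 0 → i = i'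
  work : ∀ j < P.n, P.V ≤ P.fut (pl.fW P j) 0 0
  rs_le : ∀ j < P.n, P.rs j ≤ P.H
  cap : ∀ u d, 2 * ((range P.n).filter fun j => pl.due P j = d ∧ P.rs j ≤ u ∧
    pl.unsettled P u j).card ≤ P.cap
  kk : ∀ j < P.n, 2 ^ pl.kk j ≤ P.N
  aa : ∀ j < P.n, pl.aa j ≤ 2 * P.E

/-- The cost of a plan. -/
noncomputable def Plan.cost (pl : Plan) (P : Par) (j : ℕ) : ℝ :=
  P.w j * (P.kap (pl.aa j) * P.tp ^ pl.kk j)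

theorem Par.fut_step (P : Par) (f : ℕ → ℕ → ℕ) (now : ℕ) {i : ℕ} (hi : i < P.m) :
    P.fut f now i = f now i + P.fut f now (i + 1) := by
  unfold Par.fut
  rw [sum_eq_sum_Ico_succ_bot hi]
  omega

theorem Par.fut_next (P : Par) (f : ℕ → ℕ → ℕ) {now : ℕ} (hn : now < P.H) :
    P.fut f now P.m = P.fut f (now + 1) 0 := by
  unfold Par.fut
  rw [sum_eq_sum_Ico_succ_bot (show now + 1 < P.H + 1 by omega)]
  simp

theorem Par.fut_congr (P : Par) {f g : ℕ → ℕ → ℕ} {now i : ℕ}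
    (h : ∀ u ≥ now, ∀ i' < P.m, f u i' = g u i') : P.fut f now i = P.fut g now i := by
  unfold Par.fut
  congr 1
  · exact sum_congr rfl fun i' hi' => h _ le_rfl _ (Finset.mem_Ico.1 hi').2
  · refine sum_congr rfl fun u hu => sum_congr rfl fun i' hi' => ?_
    exact h _ (by have := (Finset.mem_Ico.1 hu).1; omega) _ (mem_range.1 hi')

theorem Par.fut_mul (P : Par) (f : ℕ → ℕ → ℕ) (now i c : ℕ) :
    P.fut (fun u i' => c * f u i') now i = c * P.fut f now i := by
  simp only [Par.fut, mul_sum, Nat.mul_add]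

theorem Par.exists_of_fut_ne_zero (P : Par) {f : ℕ → ℕ → ℕ} {now i : ℕ} (h : P.fut f now i ≠ 0) :
    ∃ u ≥ now, ∃ i' < P.m, f u i' ≠ 0 := by
  by_contra! h'
  refine h ?_
  rw [P.fut_congr (g := fun _ _ => 0) fun u hu i' hi' => h' u hu i' hi']
  simp [Par.fut]

theorem Par.fut_zero_eq (P : Par) {f : ℕ → ℕ → ℕ} {now : ℕ} (hn : now ≤ P.H)
    (h : ∀ u < now, ∀ i' < P.m, f u i' = 0) : P.fut f 0 0 = P.fut f now 0 := by
  induction now with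
  | zero => rfl
  | succ k ih =>
    rw [ih (by omega) fun u hu => h u (by omega), ← P.fut_next f (by omega)]
    have : ∀ r i, i + r = P.m → P.fut f k i = P.fut f k P.m := by
      intro r
      induction r with
      | zero => intro i hi; rw [Nat.add_zero] at hi; rw [hi]
      | succ r ihr =>
        intro i hi
        rw [P.fut_step f k (by omega), h k (by omega) i (by omega), ihr (i + 1) (by omega)]
        simp
    exact this P.m 0 (by omega)

/-- The partial schedule `y` follows the plan up to the point in slot `now` where the jobs before
`jj` and the machines before `i` have been dealt with. -/
structure Shadow (P : Par) (pl : Plan) (now jj i : ℕ) (y : Rec) : Prop where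
  rel : ∀ j < P.n, y.D j = if P.rs j < now ∨ (P.rs j = now ∧ j < jj) then pl.due P j else 0
  unrel : ∀ j < P.n, y.D j = 0 → y.R j = 0 ∧ y.M j = 0 ∧ y.L j = 0
  work0 : ∀ j < P.n, y.M j = 0 → y.R j ≤ P.fut (pl.fW P j) now i
  work1 : ∀ j < P.n, ∀ i', y.M j = i' + 1 → pl.settled P now j i' ∧ y.R j ≤ P.fut (pl.fC j i') now i
  uns : ∀ j < P.n, y.M j = 0 → y.R j ≠ 0 → if j < jj then pl.unsettled P now j else
    pl.unsettled P (now - 1) j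
  le_L : ∀ j < P.n, y.L j ≤ now + 1
  last : ∀ j < P.n, y.L j ≤ now ∨ ∃ i' < i, pl.sig now i' = j + 1
  cost : y.cost = ∑ j ∈ range P.n, if y.D j ≠ 0 then pl.cost P j else 0

section

variable {P : Par} {pl : Plan} {now jj i : ℕ} {x y : Rec}

theorem shadow_root (P : Par) (pl : Plan) : Shadow P pl 0 0 0 Rec.root := by
  constructor <;> simp [Rec.root]

theorem Plan.settled_le {u u' j : ℕ} (h : pl.settled P u j i) (hu : u ≤ u') :
    pl.settled P u' j i := fun u'' hu'' => h u'' (by omega)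

theorem Shadow.next (h : Shadow P pl now P.n P.m y) (hn : now < P.H) :
    Shadow P pl (now + 1) 0 0 y where
  rel j hj := by
    rw [h.rel j hj]
    congr 1
    simp only [eq_iff_iff]
    omega
  unrel := h.unrel
  work0 j hj hM := by rw [← P.fut_next _ hn]; exact h.work0 j hj hM
  work1 j hj i' hM := by
    rw [← P.fut_next _ hn]
    exact ⟨Plan.settled_le (h.work1 j hj i' hM).1 (by omega), (h.work1 j hj i' hM).2⟩
  uns j hj hM hR := by
    have := h.uns j hj hM hR
    rw [if_pos hj] at this
    simpa using this
  le_L j hj := (h.le_L j hj).trans (by omega)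
  last j hj := .inl (h.le_L j hj)
  cost := h.cost

theorem Rec.load_upd (x : Rec) {n j : ℕ} (hj : j < n) (d i r l : ℕ) (c f : ℝ) (act : ℕ × ℕ × ℕ)
    (d' i' : ℕ) : (x.upd j d i r l c f act).load n d' i' +
      (if x.D j = d' ∧ x.M j = i' then x.R j else 0) =
      x.load n d' i' + if d = d' ∧ i = i' then r else 0 := by
  unfold Rec.load
  rw [← sum_erase_add _ _ (mem_range.2 hj)]
  rw [← sum_erase_add (range n) (fun k => if x.D k = d' ∧ x.M k = i' then x.R k else 0)
    (mem_range.2 hj)]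
  have : ∑ k ∈ (range n).erase j, (if (x.upd j d i r l c f act).D k = d' ∧
      (x.upd j d i r l c f act).M k = i' then (x.upd j d i r l c f act).R k else 0) =
      ∑ k ∈ (range n).erase j, if x.D k = d' ∧ x.M k = i' then x.R k else 0 := by
    refine sum_congr rfl fun k hk => ?_
    have hk := ne_of_mem_erase hk
    simp only [Rec.upd, update_of_ne hk]
  rw [this]
  simp only [Rec.upd, update_self]
  omega

/-- Changing an unsettled job in the same way preserves the equivalence. -/
theorem EqRec.upd {n j : ℕ} (h : EqRec n x y) (hj : j < n) (hx : x.M j = 0) (hy : y.M j = 0)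
    (d i r l : ℕ) (c c' f f' : ℝ) (act act' : ℕ × ℕ × ℕ) :
    EqRec n (x.upd j d i r l c f act) (y.upd j d i r l c' f' act') := by
  refine ⟨fun q hq => ?_, fun d' i' hi' => ?_⟩
  · obtain rfl | hqj := eq_or_ne q j
    · simp [Rec.uR, Rec.upd]
    · have := h.1 q hq
      simpa only [Rec.uR, Rec.upd, update_of_ne hqj] using this
  · have h1 := x.load_upd hj d i r l c f act d' i'
    have h2 := y.load_upd hj d i r l c' f' act' d' i'
    have h3 := h.2 d' i' hi'
    rw [if_neg (by omega)] at h1 h2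
    omega

/-- Using up one slot of jobs with the same due slot settled on the same machine preserves the
equivalence. -/
theorem EqRec.dec {n j q : ℕ} (h : EqRec n x y) (hj : j < n) (hq : q < n) (hM : x.M q ≠ 0)
    (hMM : x.M q = y.M j) (hD : x.D q = y.D j) (hx : 1 ≤ x.R q) (hy : 1 ≤ y.R j)
    (l l' : ℕ) (c c' f f' : ℝ) (act act' : ℕ × ℕ × ℕ) :
    EqRec n (x.upd q (x.D q) (x.M q) (x.R q - 1) l c f act)
      (y.upd j (y.D j) (y.M j) (y.R j - 1) l' c' f' act') := by
  have e1 : ∀ k, (x.upd q (x.D q) (x.M q) (x.R q - 1) l c f act).uR k = x.uR k := by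
    intro k
    obtain rfl | hk := eq_or_ne k q
    · simp [Rec.uR, Rec.upd, hM]
    · simp [Rec.uR, Rec.upd, hk]
  have e2 : ∀ k, (y.upd j (y.D j) (y.M j) (y.R j - 1) l' c' f' act').uR k = y.uR k := by
    intro k
    obtain rfl | hk := eq_or_ne k j
    · simp [Rec.uR, Rec.upd, ← hMM, hM]
    · simp [Rec.uR, Rec.upd, hk]
  refine ⟨fun k hk => ?_, fun d' i' hi' => ?_⟩
  · rw [e1, e2]
    refine ⟨(h.1 k hk).1, fun h0 => ?_⟩
    have hkq : k ≠ q := by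
      rintro rfl
      simp [Rec.uR, hM] at h0
    have hkj : k ≠ j := by
      rintro rfl
      rw [(h.1 k hk).1] at h0
      simp [Rec.uR, ← hMM, hM] at h0
    simpa [Rec.upd, hkq, hkj] using (h.1 k hk).2 h0
  · have h1 := x.load_upd hq (x.D q) (x.M q) (x.R q - 1) l c f act d' i'
    have h2 := y.load_upd hj (y.D j) (y.M j) (y.R j - 1) l' c' f' act' d' i'
    have h3 := h.2 d' i' hi'
    have e : (x.D q = d' ∧ x.M q = i') ↔ (y.D j = d' ∧ y.M j = i') := by rw [hD, hMM]
    by_cases hc : y.D j = d' ∧ y.M j = i'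
    · rw [if_pos (e.2 hc), if_pos (e.2 hc)] at h1
      rw [if_pos hc, if_pos hc] at h2
      omega
    · rw [if_neg (mt e.1 hc), if_neg (mt e.1 hc)] at h1
      rw [if_neg hc, if_neg hc] at h2
      omega

theorem EqRec.others_eq {n j d : ℕ} (h : EqRec n x y) : x.others n j d = y.others n j d := by
  unfold Rec.others
  congr 1
  have key : ∀ x y : Rec, EqRec n x y → ∀ q < n, x.D q = d ∧ x.M q = 0 ∧ 1 ≤ x.R q →
      y.D q = d ∧ y.M q = 0 ∧ 1 ≤ y.R q := by
    rintro x y h q hq ⟨h1, h2, h3⟩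
    have h4 := h.1 q hq
    simp only [Rec.uR, h2, if_true] at h4
    by_cases hy : y.M q = 0
    · rw [if_pos hy] at h4
      exact ⟨by rw [← (h4.2 (by omega)).1, h1], hy, by omega⟩
    · rw [if_neg hy] at h4
      omega
  ext q
  simp only [mem_filter, mem_range]
  constructor
  · rintro ⟨h1, h2, h3⟩
    exact ⟨h1, h2, key x y h q h1 h3⟩
  · rintro ⟨h1, h2, h3⟩
    exact ⟨h1, h2, key y x h.symm q h1 h3⟩

theorem Plan.fW_of_settled {j : ℕ} (h : pl.settled P now j i) (i₀ : ℕ) :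
    P.fut (pl.fW P j) now i₀ = P.v i j * P.fut (pl.fC j i) now i₀ := by
  rw [← P.fut_mul]
  refine P.fut_congr fun u hu i' hi' => ?_
  unfold Plan.fW Plan.fC
  by_cases hs : pl.sig u i' = j + 1
  · obtain rfl := h u hu i' hi' hs
    simp [hs]
  · simp [hs]

theorem Plan.OK.exists_slot (hpl : pl.OK P) {j i₀ : ℕ} (h : P.fut (pl.fW P j) now i₀ ≠ 0) :
    ∃ u ≥ now, ∃ i' < P.m, pl.sig u i' = j + 1 ∧ 1 ≤ P.v i' j ∧ now < pl.due P j := by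
  obtain ⟨u, hu, i', hi', h⟩ := P.exists_of_fut_ne_zero h
  have hs : pl.sig u i' = j + 1 := by
    by_contra hs
    simp [Plan.fW, hs] at h
  obtain ⟨_, _, h3, h4⟩ := hpl.run u i' j hi' hs
  exact ⟨u, hu, i', hi', hs, h4, by omega⟩

/-- The remaining work of a job that follows the plan requires that its deadline lies ahead. -/
theorem Shadow.now_lt_due (h : Shadow P pl now jj i y) (hpl : pl.OK P) {j : ℕ} (hj : j < P.n)
    (hR : y.R j ≠ 0) : now < y.D j := by
  have hD : y.D j ≠ 0 := fun h0 => hR (h.unrel j hj h0).1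
  have hdue : y.D j = pl.due P j := by
    have := h.rel j hj
    split_ifs at this <;> omega
  rw [hdue]
  rcases hM : y.M j with _ | i'
  · have := h.work0 j hj hM
    obtain ⟨_, _, _, _, _, _, h'⟩ := hpl.exists_slot (j := j) (now := now) (i₀ := i) (by omega)
    exact h'
  · obtain ⟨h1, h2⟩ := h.work1 j hj i' hM
    obtain ⟨u, hu, i'', hi'', h⟩ := P.exists_of_fut_ne_zero (f := pl.fC j i') (now := now) (i := i)
      (by omega)
    have hs : pl.sig u i'' = j + 1 := by
      by_contra hs
      simp [Plan.fC, hs] at h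
    have := (hpl.run u i'' j hi'' hs).2.2.1
    omega

/-- The decision whether, and where, a job is settled can be taken in accordance with the plan. -/
theorem Shadow.typeAt (h : Shadow P pl now jj 0 y) (hpl : pl.OK P) (hxy : EqRec P.n x y)
    (hj : jj < P.n) (hxM : x.M jj = 0) (hyM : y.M jj = 0) {r l : ℕ} {c c' f f' : ℝ}
    {act : ℕ × ℕ × ℕ} (hr : r ≠ 0) (hrw : r ≤ P.fut (pl.fW P jj) now 0) (hrs : P.rs jj ≤ now)
    (hl : l ≤ now)
    (hc' : c' = ∑ j ∈ range P.n,
      if update y.D jj (pl.due P jj) j ≠ 0 then pl.cost P j else 0) (hcc : c ≤ c') :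
    ∃ τ < P.m + 1, ∃ x' ∈ P.typeAt x jj (pl.due P jj) r l c f act τ,
      ∃ y', Shadow P pl now (jj + 1) 0 y' ∧ EqRec P.n x' y' ∧ x'.cost ≤ y'.cost := by
  classical
  obtain ⟨u, hu, i₁, hi₁, hs₁, hv₁, hdue⟩ := hpl.exists_slot (j := jj) (now := now) (i₀ := 0)
    (by omega)
  have key : ∀ M' R', (M' = 0 → R' ≤ P.fut (pl.fW P jj) now 0 ∧ pl.unsettled P now jj) →
      (∀ i', M' = i' + 1 → pl.settled P now jj i' ∧ R' ≤ P.fut (pl.fC jj i') now 0) →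
      Shadow P pl now (jj + 1) 0 (y.upd jj (pl.due P jj) M' R' l c' f' act) := by
    intro M' R' h0 h1
    constructor
    · intro j hjn
      obtain rfl | hjj' := eq_or_ne j jj
      · simp only [Rec.upd, update_self]
        rw [if_pos (by omega)]
      · simp only [Rec.upd, update_of_ne hjj', h.rel j hjn]
        congr 1
        simp only [eq_iff_iff]
        omega
    · intro j hjn
      obtain rfl | hjj' := eq_or_ne j jj
      · simp only [Rec.upd, update_self]
        omega
      · simpa [Rec.upd, hjj'] using h.unrel j hjn
    · intro j hjn
      obtain rfl | hjj' := eq_or_ne j jj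
      · simp only [Rec.upd, update_self]
        exact fun hM => (h0 hM).1
      · simpa [Rec.upd, hjj'] using h.work0 j hjn
    · intro j hjn
      obtain rfl | hjj' := eq_or_ne j jj
      · simpa only [Rec.upd, update_self] using h1
      · simpa [Rec.upd, hjj'] using h.work1 j hjn
    · intro j hjn
      obtain rfl | hjj' := eq_or_ne j jj
      · simp only [Rec.upd, update_self]
        rw [if_pos (by omega)]
        exact fun hM _ => (h0 hM).2
      · simp only [Rec.upd, update_of_ne hjj']
        have : j < jj + 1 ↔ j < jj := by omega
        simpa only [this] using h.uns j hjn
    · intro j hjn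
      obtain rfl | hjj' := eq_or_ne j jj
      · simp only [Rec.upd, update_self]
        omega
      · simpa [Rec.upd, hjj'] using h.le_L j hjn
    · intro j hjn
      obtain rfl | hjj' := eq_or_ne j jj
      · simp only [Rec.upd, update_self]
        exact .inl hl
      · simpa [Rec.upd, hjj'] using h.last j hjn
    · exact hc'
  by_cases hun : pl.unsettled P now jj
  · refine ⟨0, by omega, x.upd jj (pl.due P jj) 0 r l c f act, .inl ⟨rfl, ?_, rfl⟩,
      y.upd jj (pl.due P jj) 0 r l c' f' act, key 0 r (fun _ => ⟨hrw, hun⟩) (by omega),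
      hxy.upd hj hxM hyM _ _ _ _ _ _ _ _ _ _, hcc⟩
    rw [hxy.others_eq]
    set A := (range P.n).filter fun q => pl.due P q = pl.due P jj ∧ P.rs q ≤ now ∧
      pl.unsettled P now q with hA
    set B := (range P.n).filter fun q => pl.due P q = pl.due P jj ∧ P.rs q ≤ now - 1 ∧
      pl.unsettled P (now - 1) q with hB
    have hAc : 2 * A.card ≤ P.cap := by convert hpl.cap now (pl.due P jj)
    have hBc : 2 * B.card ≤ P.cap := by convert hpl.cap (now - 1) (pl.due P jj)
    have hjA : jj ∈ A := by simp [hA, hj, hrs, hun]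
    have hsub : ((range P.n).filter fun q => q ≠ jj ∧ y.D q = pl.due P jj ∧ y.M q = 0 ∧
        1 ≤ y.R q) ⊆ A.erase jj ∪ B := by
      intro q hq
      obtain ⟨hqn, hqj, hD, hM, hR⟩ := mem_filter.1 hq
      have hqn' := mem_range.1 hqn
      have hrel := h.rel q hqn'
      have huns := h.uns q hqn' hM (by omega)
      have hrs' : P.rs q < now ∨ P.rs q = now ∧ q < jj := by
        by_contra hcon
        rw [if_neg hcon] at hrel
        have := (h.unrel q hqn' hrel).1
        omega
      rw [if_pos hrs'] at hrel
      rw [Finset.mem_union, Finset.mem_erase, hA, hB, mem_filter, mem_filter]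
      by_cases hlt : q < jj
      · rw [if_pos hlt] at huns
        exact .inl ⟨hqj, hqn, by omega, by omega, huns⟩
      · rw [if_neg hlt] at huns
        exact .inr ⟨hqn, by omega, by omega, huns⟩
    have h1 := (card_le_card hsub).trans (Finset.card_union_le _ _)
    rw [Finset.card_erase_of_mem hjA] at h1
    have := Finset.card_pos.2 ⟨jj, hjA⟩
    unfold Rec.others
    omega
  · obtain ⟨i', hi'⟩ : ∃ i', pl.settled P now jj i' := by simpa [Plan.unsettled] using hun
    obtain rfl := hi' u hu i₁ hi₁ hs₁
    have hfut := Plan.fW_of_settled hi' 0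
    have hle : cdiv r (P.v i₁ jj) ≤ P.fut (pl.fC jj i₁) now 0 := by
      refine cdiv_le ?_
      rw [mul_comm, ← hfut]
      exact hrw
    refine ⟨i₁ + 1, by omega, _, .inr ⟨by omega, hv₁, rfl⟩,
      y.upd jj (pl.due P jj) (i₁ + 1) (cdiv r (P.v i₁ jj)) l c' f' act,
      key _ _ (by omega) fun i' h => ?_, hxy.upd hj hxM hyM _ _ _ _ _ _ _ _ _ _, hcc⟩
    obtain rfl : i₁ = i' := by omega
    exact ⟨hi', hle⟩

theorem Shadow.skip (h : Shadow P pl now jj 0 y)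
    (hrs : P.rs jj ≠ now) (hu : y.M jj = 0 → y.R jj = 0) : Shadow P pl now (jj + 1) 0 y where
  rel j hjn := by
    rw [h.rel j hjn]
    congr 1
    simp only [eq_iff_iff]
    obtain rfl | hjj := eq_or_ne j jj
    · omega
    · omega
  unrel := h.unrel
  work0 := h.work0
  work1 := h.work1
  uns j hjn hM hR := by
    obtain rfl | hjj := eq_or_ne j jj
    · exact absurd (hu hM) hR
    · have : j < jj + 1 ↔ j < jj := by omega
      simpa only [this] using h.uns j hjn hM hR
  le_L := h.le_L
  last := h.last
  cost := h.cost

/-- The plan can be followed when a job is considered at the start of a slot. -/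
theorem Shadow.childA {phi : ℝ → ℝ} (h : Shadow P pl now jj 0 y) (hpl : pl.OK P)
    (hx : Sound P phi now jj 0 x) (hxy : EqRec P.n x y) (hc : x.cost ≤ y.cost)
    (hj : jj < P.n) (hR : 1 ≤ P.R) (hV : 1 ≤ P.V) :
    ∃ x' ∈ P.childA now jj x, ∃ y', Shadow P pl now (jj + 1) 0 y' ∧ EqRec P.n x' y' ∧
      x'.cost ≤ y'.cost := by
  have hxrel := hx.rel jj hj
  have hyrel := h.rel jj hj
  have hd0 : pl.due P jj ≠ 0 := by
    have := P.rs_lt_due jj (pl.kk jj) (pl.aa jj) hR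
    unfold Plan.due
    omega
  rcases lt_trichotomy (P.rs jj) now with hlt | heq | hgt
  · rw [if_pos (.inl hlt)] at hyrel
    have hxD : x.D jj ≠ 0 := hxrel.2 (.inl hlt)
    by_cases hu : y.uR jj = 0
    · refine ⟨_, .inl ⟨.inr ⟨hxD, ?_⟩, rfl⟩, y, h.skip (by omega) ?_, hxy, hc⟩
      · rw [or_iff_not_imp_left]
        intro hR0
        have hxM : x.M jj ≠ 0 := by
          intro h0
          have := (hxy.1 jj hj).1
          rw [hu, Rec.uR, if_pos h0] at this
          exact hR0 this
        refine ⟨?_, hxM⟩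
        have hload := hxy.2 (x.D jj) (x.M jj) (by omega)
        have : x.load P.n (x.D jj) (x.M jj) ≠ 0 := by
          unfold Rec.load
          intro h0
          have := Finset.sum_eq_zero_iff.1 h0 jj (mem_range.2 hj)
          simp at this
          omega
        rw [hload] at this
        obtain ⟨q, hq, hq0⟩ := exists_ne_zero_of_sum_ne_zero this
        have hcond : y.D q = x.D jj ∧ y.M q = x.M jj := by
          by_contra hcon
          simp [hcon] at hq0
        rw [if_pos hcond] at hq0
        rw [← hcond.1]
        exact h.now_lt_due hpl (mem_range.1 hq) hq0
      · intro h0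
        simpa [Rec.uR, h0] using hu
    · have hyM : y.M jj = 0 := by
        by_contra h0
        simp [Rec.uR, h0] at hu
      have hyR : y.R jj ≠ 0 := by simpa [Rec.uR, hyM] using hu
      have h1 := hxy.1 jj hj
      have h2 := h1.2 (by rw [h1.1]; omega)
      have hxM : x.M jj = 0 := by
        by_contra h0
        rw [Rec.uR, if_neg h0] at h1
        omega
      have hRR : x.R jj = y.R jj := by simpa [Rec.uR, hxM, hyM] using h1.1
      have hnow := h.now_lt_due hpl hj hyR
      obtain ⟨τ, hτ, x', hx', y', hy', e1, e2⟩ := h.typeAt (x := x) hpl hxy hj hxM hyM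
        (c := x.cost) (c' := y.cost) (f := x.fh jj) (f' := y.fh jj) (act := (0, 0, now))
        (l := x.L jj) hyR (h.work0 jj hj hyM) (by omega)
        (by
          rw [h2.2]
          rcases h.last jj hj with h | ⟨i', hi', -⟩ <;> omega)
        (by rw [h.cost, ← hyrel]; simp) hc
      refine ⟨x', .inr (.inr ⟨hxD, by omega, by omega, hxM, τ, hτ, ?_⟩), y', hy', e1, e2⟩
      rw [hRR, h2.1, hyrel]
      exact hx'
  · rw [if_neg (by omega)] at hyrel
    have hxD : x.D jj = 0 := by
      by_contra h0
      have := hxrel.1 h0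
      omega
    have hw : P.V ≤ P.fut (pl.fW P jj) now 0 := by
      rw [← P.fut_zero_eq (now := now) (by rw [← heq]; exact hpl.rs_le jj hj)]
      · exact hpl.work jj hj
      · intro u hu i' hi'
        unfold Plan.fW
        rw [if_neg]
        intro hs
        have := (hpl.run u i' jj hi' hs).2.1
        omega
    have hcost : y.cost + P.w jj * (P.kap (pl.aa jj) * P.tp ^ pl.kk jj) =
        ∑ j ∈ range P.n,
          if update y.D jj (pl.due P jj) j ≠ 0 then pl.cost P j else 0 := by
      rw [h.cost]
      rw [← sum_erase_add _ _ (mem_range.2 hj)]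
      conv_rhs => rw [← sum_erase_add _ _ (mem_range.2 hj)]
      simp only [update_self, hyrel, ne_eq, not_true_eq_false, if_false, add_zero, hd0,
        not_false_eq_true, if_true, Plan.cost]
      congr 1
      refine sum_congr rfl fun j hj => ?_
      have : j ≠ jj := ne_of_mem_erase hj
      simp only [update_of_ne this]
    obtain ⟨τ, hτ, x', hx', y', hy', e1, e2⟩ := h.typeAt (x := x) hpl hxy hj
      (hx.unrel jj hj hxD).2.1 (h.unrel jj hj hyrel).2.1
      (c := x.cost + P.w jj * (P.kap (pl.aa jj) * P.tp ^ pl.kk jj))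
      (f := P.flow (pl.kk jj) (pl.aa jj)) (f' := 0) (act := (0, 0, now))
      (l := 0) (r := P.V) (by omega) hw (by omega) (by omega) hcost (by linarith)
    refine ⟨x', .inr (.inl ⟨hxD, by omega, pl.kk jj, pl.aa jj, τ, ?_, ?_, ?_, hτ, hx'⟩), y', hy',
      e1, e2⟩
    · exact Nat.lt_two_pow_self.trans_le (hpl.kk jj hj)
    · rw [mul_comm P.N]
      exact Nat.mul_le_mul_left _ (hpl.kk jj hj)
    · have := hpl.aa jj hj
      omega
  · rw [if_neg (by omega)] at hyrel
    have hxD : x.D jj = 0 := by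
      by_contra h0
      have := hxrel.1 h0
      omega
    exact ⟨_, .inl ⟨.inl ⟨hxD, hgt⟩, rfl⟩, y, h.skip (by omega) (fun _ => (h.unrel jj hj hyrel).1),
      hxy, hc⟩

/-- Idling preserves the relation to the plan. -/
theorem Shadow.idle (h : Shadow P pl now P.n i y) (hi : i < P.m)
    (hid : ∀ j < P.n, pl.sig now i = j + 1 → y.R j = 0) : Shadow P pl now P.n (i + 1) y where
  rel := h.rel
  unrel := h.unrel
  work0 j hj hM := by
    have := h.work0 j hj hM
    rw [P.fut_step _ _ hi, Plan.fW] at this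
    by_cases hs : pl.sig now i = j + 1
    · have := hid j hj hs; omega
    · rw [if_neg hs] at this; omega
  work1 j hj i' hM := by
    obtain ⟨h1, this⟩ := h.work1 j hj i' hM
    refine ⟨h1, ?_⟩
    rw [P.fut_step _ _ hi, Plan.fC] at this
    by_cases hs : pl.sig now i = j + 1
    · have := hid j hj hs; omega
    · rw [if_neg (by tauto)] at this; omega
  uns := h.uns
  le_L := h.le_L
  last j hj := (h.last j hj).imp_right fun ⟨i', h1, h2⟩ => ⟨i', by omega, h2⟩
  cost := h.cost

/-- Running the job that the plan prescribes preserves the relation to the plan. -/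
theorem Shadow.run (h : Shadow P pl now P.n i y) (hi : i < P.m) {j r l : ℕ} (hj : j < P.n)
    (hs : pl.sig now i = j + 1) (hD : y.D j ≠ 0) (hr : r ≤ y.R j) (hl : l ≤ now + 1)
    (act : ℕ × ℕ × ℕ)
    (h0 : y.M j = 0 → r ≤ y.R j - P.v i j) (h1 : y.M j ≠ 0 → r ≤ y.R j - 1) :
    Shadow P pl now P.n (i + 1) (y.upd j (y.D j) (y.M j) r l y.cost (y.fh j) act) := by
  have hDu : update y.D j (y.D j) = y.D := by simp
  have hMu : update y.M j (y.M j) = y.M := by simp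
  have hfu : update y.fh j (y.fh j) = y.fh := by simp
  unfold Rec.upd
  rw [hDu, hMu, hfu]
  have hRle : ∀ q, update y.R j r q ≤ y.R q := by
    intro q
    obtain rfl | hq := eq_or_ne q j
    · simpa using hr
    · simp [update_of_ne hq]
  constructor
  · exact h.rel
  · intro q hq hq0
    obtain ⟨e1, e2, e3⟩ := h.unrel q hq hq0
    have hqj : q ≠ j := by rintro rfl; exact hD hq0
    simpa only [update_of_ne hqj] using ⟨e1, e2, e3⟩
  · intro q hq hM
    have := h.work0 q hq hM
    rw [P.fut_step _ _ hi, Plan.fW] at this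
    obtain rfl | hqj := eq_or_ne q j
    · rw [if_pos hs] at this
      have := h0 hM
      simp only [update_self]
      omega
    · rw [if_neg (by omega)] at this
      simp only [update_of_ne hqj]
      omega
  · intro q hq i' hM
    obtain ⟨e1, e2⟩ := h.work1 q hq i' hM
    refine ⟨e1, ?_⟩
    rw [P.fut_step _ _ hi, Plan.fC] at e2
    obtain rfl | hqj := eq_or_ne q j
    · simp only at hM
      have := h1 (by omega)
      simp only [update_self]
      split_ifs at e2 <;> omega
    · rw [if_neg (by omega)] at e2
      simp only [update_of_ne hqj]
      omega
  · intro q hq hM hR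
    exact h.uns q hq hM (by have := hRle q; simp only at hR; omega)
  · intro q hq
    obtain rfl | hqj := eq_or_ne q j
    · simpa using hl
    · simpa only [update_of_ne hqj] using h.le_L q hq
  · intro q hq
    obtain rfl | hqj := eq_or_ne q j
    · exact .inr ⟨i, by omega, hs⟩
    · simpa only [update_of_ne hqj] using
        (h.last q hq).imp_right fun ⟨i', h1, h2⟩ => ⟨i', by omega, h2⟩
  · exact h.cost

/-- The plan can be followed when the job for a machine is chosen. -/
theorem Shadow.childB (h : Shadow P pl now P.n i y) (hpl : pl.OK P)
    (hxy : EqRec P.n x y) (hc : x.cost ≤ y.cost) (hi : i < P.m) :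
    ∃ x' ∈ P.childB now i x, ∃ y', Shadow P pl now P.n (i + 1) y' ∧ EqRec P.n x' y' ∧
      x'.cost ≤ y'.cost := by
  by_cases hid : ∀ j < P.n, pl.sig now i = j + 1 → y.R j = 0
  · exact ⟨_, .inr rfl, y, h.idle hi hid, hxy, hc⟩
  push Not at hid
  obtain ⟨j, hj, hs, hR⟩ := hid
  obtain ⟨_, _, _, hv⟩ := hpl.run now i j hi hs
  have hD : y.D j ≠ 0 := fun h0 => hR (h.unrel j hj h0).1
  by_cases hM : y.M j = 0
  · have h1 := hxy.1 j hj
    have hyu : y.uR j = y.R j := by simp [Rec.uR, hM]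
    have h2 := h1.2 (by rw [h1.1]; omega)
    have hxM : x.M j = 0 := by
      by_contra h0
      rw [Rec.uR, if_neg h0] at h1
      omega
    have hRR : x.R j = y.R j := by simpa [Rec.uR, hxM, hM] using h1.1
    have hL : x.L j ≤ now := by
      rw [h2.2]
      refine (h.last j hj).resolve_right ?_
      rintro ⟨i', hi', hs'⟩
      have := hpl.inj now i i' hi (by omega) (by rw [hs, hs']) (by omega)
      omega
    refine ⟨_, .inl ⟨j, hj, by omega, .inr ⟨hxM, hL, hv, rfl⟩⟩, _,
      h.run hi hj hs hD (r := y.R j - P.v i j) (by omega) le_rfl (j + 1, i, now) (by omega)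
        (by omega), ?_, hc⟩
    rw [hxM, hM, hRR, h2.1]
    exact hxy.upd hj hxM hM _ _ _ _ _ _ _ _ _ _
  · obtain ⟨i', hi'⟩ := Nat.exists_eq_succ_of_ne_zero hM
    obtain ⟨hset, -⟩ := h.work1 j hj i' hi'
    obtain rfl := hset now le_rfl i hi hs
    have hload : y.load P.n (y.D j) (i + 1) ≠ 0 := by
      unfold Rec.load
      intro h0
      have := Finset.sum_eq_zero_iff.1 h0 j (mem_range.2 hj)
      simp [hi'] at this
      omega
    rw [← hxy.2 _ _ (by omega)] at hload
    obtain ⟨q, hq, hq0⟩ := exists_ne_zero_of_sum_ne_zero hload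
    have hcond : x.D q = y.D j ∧ x.M q = i + 1 := by
      by_contra hcon
      simp [hcon] at hq0
    rw [if_pos hcond] at hq0
    have hqn := mem_range.1 hq
    refine ⟨_, .inl ⟨q, hqn, by omega, .inl ⟨hcond.2, rfl⟩⟩, _,
      h.run hi hj hs hD (r := y.R j - 1) (l := y.L j) (by omega) (h.le_L j hj) (j + 1, i, now)
        (by omega) (by omega), ?_, hc⟩
    exact hxy.dec hj hqn (by omega) (by omega) hcond.1 (by omega) (by omega) _ _ _ _ _ _ _ _

end

/-! ### Layers of the dynamic program -/

/-- The list `acc` represents the set `S` of partial schedules: it contains, for each of them, an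
equivalent one that is at least as cheap, and no two equivalent ones. -/
structure Good (n : ℕ) (acc : List Rec) (S : Set Rec) : Prop where
  mem : ∀ y ∈ acc, y ∈ S
  dom : ∀ y ∈ S, ∃ z ∈ acc, EqRec n z y ∧ z.cost ≤ y.cost
  pw : acc.Pairwise fun y z => ¬ EqRec n y z

/-- The list `acc'` results from `acc` by inserting `y`, where only the cheaper one of two equivalent
partial schedules is kept. -/
def Ins (n : ℕ) (acc : List Rec) (y : Rec) (acc' : List Rec) : Prop :=
  ((∀ z ∈ acc, ¬ EqRec n z y) ∧ acc' = acc ++ [y]) ∨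
    ∃ f, ∃ h : f < acc.length, EqRec n acc[f] y ∧
      ((acc[f].cost ≤ y.cost ∧ acc' = acc) ∨ (y.cost < acc[f].cost ∧ acc' = acc.set f y))

theorem good_nil (n : ℕ) : Good n [] ∅ := ⟨by simp, by simp, .nil⟩

theorem Good.ins {n : ℕ} {acc acc' : List Rec} {S : Set Rec} {y : Rec} (h : Good n acc S)
    (hi : Ins n acc y acc') : Good n acc' (S ∪ {y}) := by
  rcases hi with ⟨h1, rfl⟩ | ⟨f, hf, h1, ⟨h2, rfl⟩ | ⟨h2, rfl⟩⟩
  · refine ⟨?_, ?_, ?_⟩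
    · intro z hz
      rcases mem_append.1 hz with hz | hz
      · exact .inl (h.mem z hz)
      · exact .inr (by simpa using hz)
    · rintro z (hz | rfl)
      · obtain ⟨z', h3, h4⟩ := h.dom z hz
        exact ⟨z', by simp [h3], h4⟩
      · exact ⟨z, by simp, EqRec.refl _ _, le_rfl⟩
    · refine List.pairwise_append.2 ⟨h.pw, by simp, fun a ha b hb => ?_⟩
      obtain rfl : b = y := by simpa using hb
      exact h1 a ha
  · refine ⟨fun z hz => .inl (h.mem z hz), ?_, h.pw⟩
    rintro z (hz | rfl)
    · exact h.dom z hz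
    · exact ⟨acc'[f], getElem_mem hf, h1, h2⟩
  · refine ⟨?_, ?_, ?_⟩
    · intro z hz
      rcases List.mem_or_eq_of_mem_set hz with hz | rfl
      · exact .inl (h.mem z hz)
      · exact .inr rfl
    · have hy : y ∈ acc.set f y := List.mem_iff_getElem.2 ⟨f, by simpa using hf, by simp⟩
      rintro z (hz | rfl)
      · obtain ⟨z', h3, h4, h5⟩ := h.dom z hz
        obtain ⟨q, hq, rfl⟩ := List.mem_iff_getElem.1 h3
        obtain rfl | hqf := eq_or_ne f q
        · exact ⟨y, hy, h1.symm.trans h4, h2.le.trans h5⟩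
        · refine ⟨acc[q], ?_, h4, h5⟩
          exact List.mem_iff_getElem.2 ⟨q, by simpa using hq, by simp [hqf]⟩
      · exact ⟨z, hy, EqRec.refl _ _, le_rfl⟩
    · rw [List.pairwise_iff_getElem]
      intro a b ha hb hab
      have hpw := List.pairwise_iff_getElem.1 h.pw
      rw [length_set] at ha hb
      have h3 := hpw a b ha hb hab
      simp only [List.getElem_set]
      split_ifs with e1 e2 e2
      · omega
      · subst e1
        exact fun h4 => h3 (h1.trans h4)
      · subst e2
        exact fun h4 => h3 (h4.trans h1.symm)
      · exact h3

/-- The invariant of the dynamic program: all partial schedules in the layer are sound, no two are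
equivalent, and every admissible plan is matched by a partial schedule that is at least as cheap. -/
structure LInv (P : Par) (phi : ℝ → ℝ) (now jj i : ℕ) (l : List Rec) : Prop where
  sound : ∀ x ∈ l, Sound P phi now jj i x
  pw : l.Pairwise fun y z => ¬ EqRec P.n y z
  plan : ∀ pl : Plan, pl.OK P → ∃ x ∈ l, ∃ y, Shadow P pl now jj i y ∧ EqRec P.n x y ∧
    x.cost ≤ y.cost

theorem linv_root (P : Par) (phi : ℝ → ℝ) : LInv P phi 0 0 0 [Rec.root] :=
  ⟨by simpa using sound_root P phi, by simp,
    fun pl _ => ⟨_, by simp, _, shadow_root P pl, EqRec.refl _ _, le_rfl⟩⟩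

section

variable {P : Par} {phi : ℝ → ℝ} {now jj i : ℕ} {l l' : List Rec}

theorem LInv.childA (h : LInv P phi now jj 0 l) (hjj : jj < P.n) (hR : 1 ≤ P.R) (hV : 1 ≤ P.V)
    (hphi : ∀ k a, P.kap a * P.tp ^ k = phi (P.flow k a))
    (hl : Good P.n l' {y | ∃ x ∈ l, y ∈ P.childA now jj x}) : LInv P phi now (jj + 1) 0 l' := by
  refine ⟨fun y hy => ?_, hl.pw, fun pl hpl => ?_⟩
  · obtain ⟨x, hx, hy⟩ := hl.mem y hy
    exact (h.sound x hx).childA hjj hR hphi hy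
  · obtain ⟨x, hx, y, h1, h2, h3⟩ := h.plan pl hpl
    obtain ⟨x', hx', y', h4, h5, h6⟩ := h1.childA hpl (h.sound x hx) h2 h3 hjj hR hV
    obtain ⟨z, hz, h7, h8⟩ := hl.dom x' ⟨x, hx, hx'⟩
    exact ⟨z, hz, y', h4, h7.trans h5, h8.trans h6⟩

theorem LInv.childB (h : LInv P phi now P.n i l) (hi : i < P.m)
    (hl : Good P.n l' {y | ∃ x ∈ l, y ∈ P.childB now i x}) : LInv P phi now P.n (i + 1) l' := by
  refine ⟨fun y hy => ?_, hl.pw, fun pl hpl => ?_⟩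
  · obtain ⟨x, hx, hy⟩ := hl.mem y hy
    exact (h.sound x hx).childB hi hy
  · obtain ⟨x, hx, y, h1, h2, h3⟩ := h.plan pl hpl
    obtain ⟨x', hx', y', h4, h5, h6⟩ := h1.childB hpl h2 h3 hi
    obtain ⟨z, hz, h7, h8⟩ := hl.dom x' ⟨x, hx, hx'⟩
    exact ⟨z, hz, y', h4, h7.trans h5, h8.trans h6⟩

theorem LInv.next (h : LInv P phi now P.n P.m l) (hn : now < P.H) : LInv P phi (now + 1) 0 0 l :=
  ⟨fun x hx => (h.sound x hx).next, h.pw, fun pl hpl => by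
    obtain ⟨x, hx, y, h1, h2⟩ := h.plan pl hpl
    exact ⟨x, hx, y, h1.next hn, h2⟩⟩

end

/-! ### The number of equivalence classes -/

/-- The due slots that are relevant in slot `now`, indexed by a scale and a position. -/
def Par.act (P : Par) (now k a : ℕ) : ℕ := ((now - P.R) / (P.R * 2 ^ k) + a) * (P.R * 2 ^ k) + P.R

theorem Sound.exists_act {P : Par} {phi : ℝ → ℝ} {now jj i : ℕ} {x : Rec}
    (h : Sound P phi now jj i x) (hR : 1 ≤ P.R) {j : ℕ} (hj : j < P.n)
    (hRj : x.R j ≠ 0) :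
    ∃ k < Nat.log 2 P.N + 1, ∃ a < 2 * P.E + 4, x.D j = P.act now k a := by
  have hD : x.D j ≠ 0 := fun h0 => hRj (h.unrel j hj h0).1
  have hrs := (h.rel j hj).1 hD
  have hnow := h.now_le j hj hRj
  obtain ⟨k, a, hk, ha, hdue, -⟩ := h.due j hj hD
  have hk2 : 2 ^ k ≤ P.N := by
    rw [mul_comm P.N] at hk
    exact Nat.le_of_mul_le_mul_left hk hR
  refine ⟨k, by have := Nat.le_log_of_pow_le (by norm_num) hk2; omega, ?_⟩
  set g := P.R * 2 ^ k with hg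
  have hgR : P.R ≤ g := le_mul_of_pos_right _ (by positivity)
  have h1 := cdiv_mul_lt (P.rs j) (v := g) (by omega)
  have h2 : P.rs j ≤ cdiv (P.rs j) g * g := le_cdiv_mul _ (by omega)
  rw [hdue] at hnow
  unfold Par.due at hnow hdue
  rw [← hg] at hnow hdue
  set b := (now - P.R) / g with hb
  have h3 := Nat.div_add_mod (now - P.R) g
  have h4 := Nat.mod_lt (now - P.R) (show g > 0 by omega)
  rw [← hb] at h3
  set c := cdiv (P.rs j) g with hcd
  have e1 : b ≤ c + a := by
    have : g * b ≤ (c + a) * g := by rw [Nat.add_mul]; omega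
    rw [mul_comm] at this
    exact Nat.le_of_mul_le_mul_right this (by omega)
  have e2 : c + a < b + 2 * P.E + 3 := by
    have h5 : a * g ≤ 2 * P.E * g := Nat.mul_le_mul_right _ ha
    have : (c + a) * g < (b + 2 * P.E + 3) * g := by
      rw [mul_comm g b] at h3
      simp only [Nat.add_mul] at *
      omega
    exact Nat.lt_of_mul_lt_mul_right this
  refine ⟨c + a - b, by omega, ?_⟩
  rw [hdue, Par.act, ← hg, ← hb]
  have : b + (c + a - b) = c + a := by omega
  rw [this, Nat.add_mul]

theorem exists_encode (T : Type*) [DecidableEq T] (c : ℕ) :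
    ∃ f : Finset T → (Fin c → Option T), ∀ s s' : Finset T, s.card ≤ c → s'.card ≤ c →
      f s = f s' → s = s' := by
  refine ⟨fun s q => s.toList[(q : ℕ)]?, fun s s' hs hs' h => ?_⟩
  have : s.toList = s'.toList := by
    refine List.ext_getElem? fun q => ?_
    by_cases hq : q < c
    · exact congrFun h ⟨q, hq⟩
    · rw [List.getElem?_eq_none (by rw [Finset.length_toList]; omega),
        List.getElem?_eq_none (by rw [Finset.length_toList]; omega)]
  rw [← Finset.toList_toFinset s, ← Finset.toList_toFinset s', this]

/-- A bound on the number of partial schedules in a layer. -/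
def Par.X (P : Par) : ℕ :=
  ((P.n * P.V + 1) ^ P.m * (P.n * ((P.V + 1) * (P.H + 2)) + 1) ^ P.cap) ^
    ((Nat.log 2 P.N + 1) * (2 * P.E + 4))

theorem load_le {n V : ℕ} {x : Rec} (h : ∀ j < n, x.R j ≤ V) (d i : ℕ) : x.load n d i ≤ n * V := by
  unfold Rec.load
  refine (Finset.sum_le_card_nsmul (range n) _ V fun k hk => ?_).trans (by simp)
  split_ifs
  · exact h k (mem_range.1 hk)
  · exact Nat.zero_le _

/-- The unfinished unsettled jobs with due slot `d`, with their remaining work and the last slots in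
which they ran. -/
def Rec.uset (x : Rec) (n V H d : ℕ) : Finset (Fin n × Fin V × Fin H) :=
  univ.filter fun t => x.D t.1 = d ∧ x.M t.1 = 0 ∧ 1 ≤ x.R t.1 ∧ x.R t.1 = t.2.1 ∧
    x.L t.1 = t.2.2

theorem uset_card_le (x : Rec) (n V H d : ℕ) : (x.uset n V H d).card ≤
    ((range n).filter fun q => x.D q = d ∧ x.M q = 0 ∧ 1 ≤ x.R q).card := by
  refine Finset.card_le_card_of_injOn (fun t => (t.1 : ℕ)) (fun t ht => ?_) fun t ht t' ht' h => ?_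
  · have := (mem_filter.1 ht).2
    exact Finset.mem_coe.2 (mem_filter.2
      ⟨mem_range.2 t.1.2, this.1, this.2.1, this.2.2.1⟩)
  · have h1 := (mem_filter.1 ht).2
    have h2 := (mem_filter.1 ht').2
    have h : (t.1 : ℕ) = t'.1 := h
    rw [← h] at h2
    refine Prod.ext (Fin.ext h) (Prod.ext (Fin.ext ?_) (Fin.ext ?_)) <;> omega

theorem length_le_X {P : Par} {phi : ℝ → ℝ} {now jj i : ℕ} {l : List Rec} (hR : 1 ≤ P.R)
    (hn : now ≤ P.H) (hs : ∀ x ∈ l, Sound P phi now jj i x)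
    (hpw : l.Pairwise fun y z => ¬ EqRec P.n y z) : l.length ≤ P.X := by
  classical
  obtain ⟨f, hf⟩ := exists_encode (Fin P.n × Fin (P.V + 1) × Fin (P.H + 2)) P.cap
  set K := Nat.log 2 P.N + 1 with hK
  let key : Rec → (Fin K × Fin (2 * P.E + 4)) →
      ((Fin P.m → Fin (P.n * P.V + 1)) ×
        (Fin P.cap → Option (Fin P.n × Fin (P.V + 1) × Fin (P.H + 2)))) :=
    fun x δ => (fun i => Fin.ofNat _ (x.load P.n (P.act now δ.1 δ.2) (i + 1)),
      f (x.uset P.n (P.V + 1) (P.H + 2) (P.act now δ.1 δ.2)))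
  have half : ∀ x y, Sound P phi now jj i x → Sound P phi now jj i y → key x = key y →
      ∀ j < P.n, 0 < x.uR j → x.uR j = y.uR j ∧ x.D j = y.D j ∧ x.L j = y.L j := by
    intro x y hx hy hxy j hj hu
    have hM : x.M j = 0 := by
      by_contra h0
      simp [Rec.uR, h0] at hu
    rw [Rec.uR, if_pos hM] at hu
    obtain ⟨k, hk, a, ha, hD⟩ := hx.exists_act hR hj (by omega)
    have h1 := congrArg Prod.snd (congrFun hxy (⟨k, hk⟩, ⟨a, ha⟩))
    have h2 := hf _ _ ((uset_card_le _ _ _ _ _).trans (hx.cap _))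
      ((uset_card_le _ _ _ _ _).trans (hy.cap _)) h1
    have hVj := hx.le_V j hj
    have hLj := hx.le_L j hj
    have h3 : ((⟨j, hj⟩, ⟨x.R j, by omega⟩, ⟨x.L j, by omega⟩) :
        Fin P.n × Fin (P.V + 1) × Fin (P.H + 2)) ∈
        x.uset P.n (P.V + 1) (P.H + 2) (P.act now k a) :=
      mem_filter.2 ⟨mem_univ _, hD, hM, hu, rfl, rfl⟩
    simp only at h2
    rw [h2] at h3
    obtain ⟨-, e1, e2, e3, e4, e5⟩ := mem_filter.1 h3
    simp only at e1 e2 e4 e5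
    exact ⟨by rw [Rec.uR, Rec.uR, if_pos hM, if_pos e2, e4], by rw [hD, e1], e5.symm⟩
  have zero : ∀ x, Sound P phi now jj i x → ∀ d i', (P.m < i' ∨
      ∀ k < K, ∀ a < 2 * P.E + 4, d ≠ P.act now k a) → x.load P.n d i' = 0 := by
    intro x hx d i' h
    refine sum_eq_zero fun q hq => ?_
    have hq := mem_range.1 hq
    split_ifs with h1
    · by_contra h0
      obtain ⟨k, hk, a, ha, hD⟩ := hx.exists_act hR hq h0
      have := hx.le_m q hq
      rcases h with h | h
      · omega
      · exact h k hk a ha (by rw [← h1.1, hD])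
    · rfl
  have hkey : ∀ x y, Sound P phi now jj i x → Sound P phi now jj i y → key x = key y →
      EqRec P.n x y := by
    intro x y hx hy hxy
    refine ⟨fun j hj => ⟨?_, fun h => (half x y hx hy hxy j hj h).2⟩, fun d i' hi' => ?_⟩
    · rcases Nat.eq_zero_or_pos (x.uR j) with h0 | h0
      · rcases Nat.eq_zero_or_pos (y.uR j) with h1 | h1
        · rw [h0, h1]
        · exact (half y x hy hx hxy.symm j hj h1).1.symm
      · exact (half x y hx hy hxy j hj h0).1
    · by_cases hcase : P.m < i' ∨ ∀ k < K, ∀ a < 2 * P.E + 4, d ≠ P.act now k a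
      · rw [zero x hx d i' hcase, zero y hy d i' hcase]
      · push Not at hcase
        obtain ⟨hi'm, k, hk, a, ha, rfl⟩ := hcase
        have h1 := congrFun (congrArg Prod.fst (congrFun hxy (⟨k, hk⟩, ⟨a, ha⟩)))
          ⟨i' - 1, by omega⟩
        have h2 := congrArg Fin.val h1
        simp only [key, Fin.ofNat, Nat.sub_add_cancel hi'] at h2
        rwa [Nat.mod_eq_of_lt (Nat.lt_succ_of_le (load_le hx.le_V _ _)),
          Nat.mod_eq_of_lt (Nat.lt_succ_of_le (load_le hy.le_V _ _))] at h2
  have hnd : (l.map key).Nodup := by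
    unfold List.Nodup
    rw [List.pairwise_map]
    refine List.Pairwise.imp_of_mem (fun {a b} ha hb hab hk => ?_) hpw
    exact hab (hkey a b (hs a ha) (hs b hb) hk)
  have := hnd.length_le_card
  rw [List.length_map] at this
  refine this.trans (le_of_eq ?_)
  simp only [Par.X, Fintype.card_fun, Fintype.card_prod, Fintype.card_fin, Fintype.card_option, hK]

/-! ### The program -/

section rules

variable {Z : ℕ} {P P' : Prog} {s : Memory} {Q Q' : Memory → Prop}

theorem wp_cons_nat {a : ℕ} {i e : NExpr} {l : List Prog}
    (h : Wp Z (block l) (s.setNat a (i.eval s) (e.eval s)) Q) :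
    Wp Z (block (.setNat a i e :: l)) s Q := wp_cons (wp_setNat h)

theorem wp_cons_real {a : ℕ} {i : NExpr} {e : RExpr} {l : List Prog}
    (h : Wp Z (block l) (s.setReal a (i.eval s) (e.eval s)) Q) :
    Wp Z (block (.setReal a i e :: l)) s Q := wp_cons (wp_setReal h)

/-- `if e ≤ f then P`. -/
def ifLe (e f : NExpr) (P : Prog) : Prog := .ite (.natLe e f) P .skip

/-- `if e = f then P`. -/
def ifEq (e f : NExpr) (P : Prog) : Prog := ifLe e f (ifLe f e P)

/-- `if e ≠ f then P`. -/
def ifNe (e f : NExpr) (P : Prog) : Prog := .ite (.natLe e f) (.ite (.natLe f e) .skip P) P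

theorem wp_ifLe {e f : NExpr} (h1 : e.eval s ≤ f.eval s → Wp Z P s Q)
    (h2 : ¬ e.eval s ≤ f.eval s → Q s) : Wp Z (ifLe e f P) s Q :=
  wp_ite h1 fun h => wp_skip (h2 h)

theorem wp_ifEq {e f : NExpr} (h1 : e.eval s = f.eval s → Wp Z P s Q)
    (h2 : e.eval s ≠ f.eval s → Q s) : Wp Z (ifEq e f P) s Q :=
  wp_ifLe (fun h => wp_ifLe (fun h' => h1 (le_antisymm h h')) fun h' => h2 fun h3 => h' h3.ge)
    fun h => h2 fun h3 => h h3.le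

theorem wp_ifNe {e f : NExpr} (h1 : e.eval s ≠ f.eval s → Wp Z P s Q)
    (h2 : e.eval s = f.eval s → Q s) : Wp Z (ifNe e f P) s Q :=
  wp_ite (fun h => wp_ite (fun h' => wp_skip (h2 (le_antisymm h h'))) fun h' =>
    h1 fun h3 => h' h3.ge) fun h => h1 fun h3 => h h3.le

end rules

/-!
The integer variables and arrays of the program have the following numbers.
* Parameters: `10` `n`, `11` `m`, `13` `N`, `15` `KH`, `16` `R`, `17` the slots per time unit,
  `19` `V`, `20` `H + 1`, `21` `cap`, `23` `N * R`; arrays: `30` the multiples of `n`, `31` the speeds,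
  `33` the release slots. The real array `41` holds the constants `kap`.
* Records: array `40` gives for each record the start of its data in the arrays `41` to `44` (due slot,
  machine, remaining work, last slot); array `45` refers to the parent, the arrays `46` to `48`
  hold the last decision, and the real array `40` holds the cost.
* The current layer is in the records from `50` on to `51` (exclusive), the next layer from there
  to `52` (exclusive); `53` is the start of the free part of the data arrays.
* `54` is the current slot, `55` a job, `56` a machine, `57` a record, and `58` to `63` as well as the
  real variable `42` hold the data of a new record.
-/

/-- Compare the loads of the new record and of the record whose data start at `85`, for the due slot
and the machine of job `86` in the record whose data start at the value of variable `bs`. -/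
def cmpSide (bs : ℕ) : Prog := block [
  sv 87 (.get 41 (.add (nv bs) (nv 86))),
  sv 88 (.get 42 (.add (nv bs) (nv 86))),
  sv 89 (.lit 0),
  sv 90 (.lit 0),
  forN 91 (nv 10) (block [
    ifEq (.get 41 (.add (nv 85) (nv 91))) (nv 87) (ifEq (.get 42 (.add (nv 85) (nv 91))) (nv 88)
      (sv 89 (.add (nv 89) (.get 43 (.add (nv 85) (nv 91)))))),
    ifEq (.get 41 (.add (nv 53) (nv 91))) (nv 87) (ifEq (.get 42 (.add (nv 53) (nv 91))) (nv 88)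
      (sv 90 (.add (nv 90) (.get 43 (.add (nv 53) (nv 91))))))]),
  ifLe (.lit 1) (nv 88) (ifNe (nv 89) (nv 90) (sv 84 (.lit 0)))]

/-- Set `84` to `1` or `0` depending on whether record `83` and the new record are equivalent. -/
def cmp : Prog := block [
  sv 84 (.lit 1),
  sv 85 (.get 40 (nv 83)),
  forN 86 (nv 10) (block [
    sv 93 (.lit 0),
    ifEq (.get 42 (.add (nv 85) (nv 86))) (.lit 0) (sv 93 (.get 43 (.add (nv 85) (nv 86)))),
    sv 95 (.lit 0),
    ifEq (.get 42 (.add (nv 53) (nv 86))) (.lit 0) (sv 95 (.get 43 (.add (nv 53) (nv 86)))),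
    ifNe (nv 93) (nv 95) (sv 84 (.lit 0)),
    ifLe (.lit 1) (nv 93) (block [
      ifNe (.get 41 (.add (nv 85) (nv 86))) (.get 41 (.add (nv 53) (nv 86))) (sv 84 (.lit 0)),
      ifNe (.get 44 (.add (nv 85) (nv 86))) (.get 44 (.add (nv 53) (nv 86))) (sv 84 (.lit 0))]),
    cmpSide 85,
    cmpSide 53])]

/-- Copy the data of a record from the start `src` to the start `dst`. -/
def copyData (dst src : NExpr) : Prog := forN 80 (nv 10) (block [
  .setNat 41 (.add dst (nv 80)) (.get 41 (.add src (nv 80))),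
  .setNat 42 (.add dst (nv 80)) (.get 42 (.add src (nv 80))),
  .setNat 43 (.add dst (nv 80)) (.get 43 (.add src (nv 80))),
  .setNat 44 (.add dst (nv 80)) (.get 44 (.add src (nv 80)))])

/-- Write the new record, which arises from record `57` by changing the data of job `55`. -/
def write : Prog := block [
  sv 64 (.get 40 (nv 57)),
  copyData (nv 53) (nv 64),
  .setNat 41 (.add (nv 53) (nv 55)) (nv 58),
  .setNat 42 (.add (nv 53) (nv 55)) (nv 59),
  .setNat 43 (.add (nv 53) (nv 55)) (nv 60),
  .setNat 44 (.add (nv 53) (nv 55)) (nv 61),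
  .setReal 40 (nv 52) (.get 42 (.lit 0)),
  .setNat 40 (nv 52) (nv 53),
  .setNat 45 (nv 52) (nv 57),
  .setNat 46 (nv 52) (nv 62),
  .setNat 47 (nv 52) (nv 63),
  .setNat 48 (nv 52) (nv 54)]

/-- Search the next layer for a record that is equivalent to the new one. -/
def search : Prog := block [
  sv 81 (.lit 0),
  forN 82 (.sub (nv 52) (nv 51)) (block [
    sv 83 (.add (nv 51) (nv 82)),
    cmp,
    ifEq (nv 84) (.lit 1) (block [sv 81 (.lit 1), sv 92 (nv 83)])])]

/-- Overwrite record `92` with the new record. -/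
def overwrite : Prog := block [
  sv 64 (.get 40 (nv 92)),
  copyData (nv 64) (nv 53),
  .setReal 40 (nv 92) (.get 40 (nv 52)),
  .setNat 45 (nv 92) (.get 45 (nv 52)),
  .setNat 46 (nv 92) (.get 46 (nv 52)),
  .setNat 47 (nv 92) (.get 47 (nv 52)),
  .setNat 48 (nv 92) (.get 48 (nv 52))]

/-- Insert a new record into the next layer. -/
def emit : Prog := block [
  write,
  search,
  .ite (.natLe (.lit 1) (nv 81))
    (.ite (.realLe (.get 40 (nv 92)) (.get 40 (nv 52))) .skip overwrite)
    (block [sv 52 (.add (nv 52) (.lit 1)), sv 53 (.add (nv 53) (nv 10))])]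

/-- Load the data of job `55` in record `57`. -/
def loadFields : List Prog := [
  sv 76 (.get 40 (nv 57)),
  sv 58 (.get 41 (.add (nv 76) (nv 55))),
  sv 59 (.get 42 (.add (nv 76) (nv 55))),
  sv 60 (.get 43 (.add (nv 76) (nv 55))),
  sv 61 (.get 44 (.add (nv 76) (nv 55))),
  .setReal 42 (.lit 0) (.get 40 (nv 57))]

/-- Count the unfinished unsettled jobs other than `55` with due slot `58`. -/
def countOthers : Prog := block [
  sv 72 (.lit 0),
  forN 73 (nv 10) (ifNe (nv 73) (nv 55) (ifEq (.get 41 (.add (nv 76) (nv 73))) (nv 58)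
    (ifEq (.get 42 (.add (nv 76) (nv 73))) (.lit 0)
      (ifLe (.lit 1) (.get 43 (.add (nv 76) (nv 73))) (sv 72 (.add (nv 72) (.lit 1)))))))]

/-- Set `60` to `65` divided by `74`, rounded up. -/
def divide : Prog := block [
  sv 60 (.lit 0),
  sv 75 (.lit 0),
  forN 77 (nv 19) (ifLe (.add (nv 75) (.lit 1)) (nv 65)
    (block [sv 60 (.add (nv 60) (.lit 1)), sv 75 (.add (nv 75) (nv 74))]))]

/-- Insert the record in which job `55` is unsettled (if `71` is zero) or settled on a machine. -/
def tryEmit : Prog := .ite (.natLe (nv 71) (.lit 0))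
  (block [countOthers, ifLe (.add (nv 72) (.lit 1)) (nv 21)
    (block [sv 59 (.lit 0), sv 60 (nv 65), emit])])
  (block [sv 74 (.get 31 (.add (.get 30 (.sub (nv 71) (.lit 1))) (nv 55))),
    ifLe (.lit 1) (nv 74) (block [divide, sv 59 (nv 71), emit])])

/-- Insert the records for all choices of a machine. -/
def settleAll : Prog := forN 71 (.add (nv 11) (.lit 1)) tryEmit

/-- Set `68` to the least multiple of `66` that is at least the release slot of job `55`. -/
def roundUp : Prog := block [
  sv 68 (.lit 0),
  forN 69 (nv 15) (ifLe (.add (nv 68) (.lit 1)) (.get 33 (nv 55)) (sv 68 (.add (nv 68) (nv 66))))]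

/-- Insert the records for the release of job `55` with a deadline of the current scale, and pass
on to the next scale. -/
def scaleBody (E : ℕ) (tp : ℝ) : Prog := ifLe (nv 66) (nv 23) (block [
  roundUp,
  forN 70 (.lit (2 * E + 1)) (block [
    sv 58 (.add (nv 68) (nv 16)),
    .setReal 42 (.lit 0) (.add (.get 40 (nv 57)) (.mul (.cast (.get 2 (nv 55)))
      (.mul (.get 41 (nv 70)) (.get 43 (.lit 0))))),
    settleAll,
    sv 68 (.add (nv 68) (nv 66))]),
  sv 66 (.add (nv 66) (nv 66)),
  .setReal 43 (.lit 0) (.mul (.get 43 (.lit 0)) (.lit tp))])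

/-- Insert all successors of record `57` when job `55` is considered. -/
def opA (E : ℕ) (tp : ℝ) : Prog := block (loadFields ++ [
  sv 62 (.lit 0),
  sv 63 (.lit 0),
  .ite (.natLe (.lit 1) (nv 58))
    (.ite (.natLe (nv 60) (.lit 0)) emit
      (ifLe (.add (nv 54) (.lit 1)) (nv 58)
        (.ite (.natLe (.lit 1) (nv 59)) emit (block [sv 65 (nv 60), settleAll]))))
    (.ite (.natLe (.get 33 (nv 55)) (nv 54))
      (block [sv 61 (.lit 0), sv 65 (nv 19), sv 66 (nv 16), .setReal 43 (.lit 0) (.lit 1),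
        forN 67 (nv 13) (scaleBody E tp)])
      emit)])

/-- Insert the record in which job `55` runs on machine `56`, if that is possible. -/
def runJob : Prog := block (loadFields ++ [
  sv 62 (.add (nv 55) (.lit 1)),
  ifLe (.lit 1) (nv 60)
    (.ite (.natLe (.lit 1) (nv 59))
      (ifEq (nv 59) (.add (nv 56) (.lit 1)) (block [sv 60 (.sub (nv 60) (.lit 1)), emit]))
      (ifLe (nv 61) (nv 54) (block [
        sv 74 (.get 31 (.add (.get 30 (nv 56)) (nv 55))),
        ifLe (.lit 1) (nv 74) (block [
          sv 60 (.sub (nv 60) (nv 74)),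
          sv 61 (.add (nv 54) (.lit 1)),
          emit])])))])

/-- Insert all successors of record `57` when machine `56` is considered. -/
def opB : Prog := block [
  sv 63 (nv 56),
  forN 55 (nv 10) runJob,
  sv 55 (.lit 0),
  block (loadFields ++ [sv 62 (.lit 0), emit])]

/-- Compute the next layer. -/
def layerStep (op : Prog) : Prog := block [
  forN 94 (.sub (nv 51) (nv 50)) (block [sv 57 (.add (nv 50) (nv 94)), op]),
  sv 50 (nv 51),
  sv 51 (nv 52)]

/-- The dynamic program. -/
def mainLoop (E : ℕ) (tp : ℝ) : Prog := forN 54 (nv 20) (block [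
  forN 55 (nv 10) (layerStep (opA E tp)),
  forN 56 (nv 11) (layerStep opB)])

/-! ### The representation of layers in memory -/

/-- The memory holds the history `h` as the chain of decisions that leads to record `id`. -/
def Chain (s : Memory) : ℕ → List (ℕ × ℕ × ℕ) → Prop
  | id, [] => id = 0
  | id, a :: h => id ≠ 0 ∧ s.nat 46 id = a.1 ∧ s.nat 47 id = a.2.1 ∧ s.nat 48 id = a.2.2 ∧
      s.nat 45 id < id ∧ Chain s (s.nat 45 id) h

/-- The memory holds `x` as the data of record `id`. -/
structure RepData (s : Memory) (n id : ℕ) (x : Rec) : Prop where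
  base : s.nat 40 id = id * n
  D : ∀ k < n, s.nat 41 (id * n + k) = x.D k
  M : ∀ k < n, s.nat 42 (id * n + k) = x.M k
  R : ∀ k < n, s.nat 43 (id * n + k) = x.R k
  L : ∀ k < n, s.nat 44 (id * n + k) = x.L k
  cost : s.real 40 id = x.cost

/-- The memory holds the parameters. -/
structure Const (P : Par) (s : Memory) : Prop where
  n : s.nat 10 0 = P.n
  m : s.nat 11 0 = P.m
  N : s.nat 13 0 = P.N
  KH : s.nat 15 0 = P.KH
  R : s.nat 16 0 = P.R
  V : s.nat 19 0 = P.V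
  H : s.nat 20 0 = P.H + 1
  cap : s.nat 21 0 = P.cap
  NR : s.nat 23 0 = P.N * P.R
  row : ∀ i < P.m, s.nat 30 i = i * P.n
  v : ∀ i < P.m, ∀ j < P.n, s.nat 31 (i * P.n + j) = P.v i j
  rs : ∀ j < P.n, s.nat 33 j = P.rs j
  w : ∀ j < P.n, s.nat 2 j = P.w j
  kap : ∀ a ≤ 2 * P.E, s.real 41 a = P.kap a

/-- The memory holds the current layer `l`, starting with record `lo`, and the part `acc` of the next
layer that has been computed so far. -/
structure St (P : Par) (now lo : ℕ) (l acc : List Rec) (s : Memory) : Prop where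
  const : Const P s
  lo_eq : s.nat 50 0 = lo
  hi : s.nat 51 0 = lo + l.length
  nh : s.nat 52 0 = lo + l.length + acc.length
  nb : s.nat 53 0 = (lo + l.length + acc.length) * P.n
  now : s.nat 54 0 = now
  cur : ∀ q, (h : q < l.length) → RepData s P.n (lo + q) l[q] ∧ Chain s (lo + q) l[q].hist
  new : ∀ q, (h : q < acc.length) → RepData s P.n (lo + l.length + q) acc[q] ∧
    Chain s (lo + l.length + q) acc[q].hist ∧ s.nat 45 (lo + l.length + q) < lo + l.length

/-- The integer arrays on which `St` depends. -/
def stArr : List ℕ := [2, 10, 11, 13, 15, 16, 19, 20, 21, 23, 30, 31, 33, 40, 41, 42, 43, 44, 45, 46,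
  47, 48, 50, 51, 52, 53, 54]

theorem Chain.congr {s s' : Memory} {id : ℕ} {h : List (ℕ × ℕ × ℕ)} (hc : Chain s id h)
    (B : ℕ) (hB : id < B ∨ s.nat 45 id < B)
    (e : ∀ id', (id' = id ∨ id' < B) → s'.nat 45 id' = s.nat 45 id' ∧
      s'.nat 46 id' = s.nat 46 id' ∧ s'.nat 47 id' = s.nat 47 id' ∧ s'.nat 48 id' = s.nat 48 id') :
    Chain s' id h := by
  induction h generalizing id with
  | nil => exact hc
  | cons a h ih =>
    obtain ⟨h1, h2, h3, h4, h5, h6⟩ := hc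
    obtain ⟨e1, e2, e3, e4⟩ := e id (.inl rfl)
    refine ⟨h1, by rw [e2, h2], by rw [e3, h3], by rw [e4, h4], by rwa [e1], ?_⟩
    rw [e1]
    exact ih h6 (.inl (by omega)) fun id' hid' => e id' (by omega)

theorem RepData.congr {s s' : Memory} {n id : ℕ} {x : Rec} (h : RepData s n id x)
    (e0 : s'.nat 40 id = s.nat 40 id) (e1 : ∀ k < n, s'.nat 41 (id * n + k) = s.nat 41 (id * n + k))
    (e2 : ∀ k < n, s'.nat 42 (id * n + k) = s.nat 42 (id * n + k))
    (e3 : ∀ k < n, s'.nat 43 (id * n + k) = s.nat 43 (id * n + k))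
    (e4 : ∀ k < n, s'.nat 44 (id * n + k) = s.nat 44 (id * n + k))
    (e5 : s'.real 40 id = s.real 40 id) : RepData s' n id x where
  base := e0.trans h.base
  D k hk := (e1 k hk).trans (h.D k hk)
  M k hk := (e2 k hk).trans (h.M k hk)
  R k hk := (e3 k hk).trans (h.R k hk)
  L k hk := (e4 k hk).trans (h.L k hk)
  cost := e5.trans h.cost

theorem Const.congr {P : Par} {s s' : Memory} (h : Const P s)
    (e : ∀ a ∈ [2, 10, 11, 13, 15, 16, 19, 20, 21, 23, 30, 31, 33], s'.nat a = s.nat a)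
    (e' : s'.real 41 = s.real 41) : Const P s' := by
  simp only [forall_mem_cons, not_mem_nil, false_imp_iff, implies_true, and_true] at e
  obtain ⟨h1, h2, h3, h4, h5, h6, h7, h8, h9, h10, h11, h12, h13⟩ := e
  exact ⟨by rw [h2, h.n], by rw [h3, h.m], by rw [h4, h.N], by rw [h5, h.KH], by rw [h6, h.R],
    by rw [h7, h.V], by rw [h8, h.H], by rw [h9, h.cap], by rw [h10, h.NR],
    by rw [h11]; exact h.row, by rw [h12]; exact h.v, by rw [h13]; exact h.rs,
    by rw [h1]; exact h.w, by rw [e']; exact h.kap⟩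

theorem St.congr {P : Par} {now lo : ℕ} {l acc : List Rec} {s s' : Memory}
    (h : St P now lo l acc s) (e : ∀ a ∈ stArr, s'.nat a = s.nat a)
    (e40 : s'.real 40 = s.real 40) (e41 : s'.real 41 = s.real 41) : St P now lo l acc s' := by
  have hd : ∀ id x, RepData s P.n id x → RepData s' P.n id x := fun id x hx =>
    hx.congr (by rw [e 40 (by decide)]) (by simp [e 41 (by decide)]) (by simp [e 42 (by decide)])
      (by simp [e 43 (by decide)]) (by simp [e 44 (by decide)]) (by rw [e40])
  have hc : ∀ id h, Chain s id h → Chain s' id h := fun id h hx =>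
    hx.congr (id + 1) (.inl (by omega)) fun id' _ => by
      simp [e 45 (by decide), e 46 (by decide), e 47 (by decide), e 48 (by decide)]
  refine ⟨h.const.congr (fun a ha => e a ?_) e41, by rw [e 50 (by decide), h.lo_eq],
    by rw [e 51 (by decide), h.hi], by rw [e 52 (by decide), h.nh], by rw [e 53 (by decide), h.nb],
    by rw [e 54 (by decide), h.now], fun q hq => ⟨hd _ _ (h.cur q hq).1, hc _ _ (h.cur q hq).2⟩,
    fun q hq => ⟨hd _ _ (h.new q hq).1, hc _ _ (h.new q hq).2.1, ?_⟩⟩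
  · simp only [stArr, mem_cons, not_mem_nil, or_false] at ha ⊢
    tauto
  · rw [e 45 (by decide)]
    exact (h.new q hq).2.2

theorem St.setNat {P : Par} {now lo : ℕ} {l acc : List Rec} {s : Memory}
    (h : St P now lo l acc s) {a : ℕ} (ha : a ∉ stArr) (i v : ℕ) :
    St P now lo l acc (s.setNat a i v) :=
  h.congr (fun b hb => setNat_nat_of_ne _ _ _ (by rintro rfl; exact ha hb)) rfl rfl

theorem St.setReal {P : Par} {now lo : ℕ} {l acc : List Rec} {s : Memory}
    (h : St P now lo l acc s) {a : ℕ} (ha : a ≠ 40 ∧ a ≠ 41) (i : ℕ) (v : ℝ) :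
    St P now lo l acc (s.setReal a i v) :=
  h.congr (fun _ _ => rfl) (setReal_real_of_ne _ _ _ (by omega)) (setReal_real_of_ne _ _ _ (by omega))

/-! ### Verification: inserting a record -/

/-- The memories agree except on the integer arrays in `A` and the real arrays in `B`. -/
def Ag (A B : List ℕ) (s s' : Memory) : Prop :=
  (∀ a, a ∉ A → s'.nat a = s.nat a) ∧ ∀ a, a ∉ B → s'.real a = s.real a

theorem Ag.refl (A B : List ℕ) (s : Memory) : Ag A B s s := ⟨fun _ _ => rfl, fun _ _ => rfl⟩

theorem Ag.nat {A B : List ℕ} {s s' : Memory} (h : Ag A B s s') (a : ℕ) (ha : a ∉ A := by decide) :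
    s'.nat a = s.nat a := h.1 a ha

theorem Ag.real {A B : List ℕ} {s s' : Memory} (h : Ag A B s s') (a : ℕ)
    (ha : a ∉ B := by decide) : s'.real a = s.real a := h.2 a ha

theorem Ag.setNat {A B : List ℕ} {s s' : Memory} (h : Ag A B s s') {a i v : ℕ}
    (ha : a ∈ A := by first | decide | simp) : Ag A B s (s'.setNat a i v) :=
  ⟨fun b hb => (setNat_nat_of_ne _ _ _ (by rintro rfl; exact hb ha)).trans (h.1 b hb), h.2⟩

theorem Ag.setReal {A B : List ℕ} {s s' : Memory} (h : Ag A B s s') {a i : ℕ} {v : ℝ}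
    (ha : a ∈ B := by first | decide | simp) : Ag A B s (s'.setReal a i v) :=
  ⟨h.1, fun b hb => (setReal_real_of_ne _ _ _ (by rintro rfl; exact hb ha)).trans (h.2 b hb)⟩

theorem Ag.trans {A B A' B' : List ℕ} {s s' s'' : Memory} (h : Ag A B s s') (h' : Ag A' B' s' s'')
    (hA : ∀ a ∈ A', a ∈ A := by first | decide | simp +contextual)
    (hB : ∀ a ∈ B', a ∈ B := by first | decide | simp +contextual) : Ag A B s s'' :=
  ⟨fun a ha => (h'.1 a fun h => ha (hA a h)).trans (h.1 a ha),
    fun a ha => (h'.2 a fun h => ha (hB a h)).trans (h.2 a ha)⟩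

theorem Ag.weaken {A B A' B' : List ℕ} {s s' : Memory} (h : Ag A B s s')
    (hA : ∀ a ∈ A, a ∈ A' := by first | decide | simp +contextual)
    (hB : ∀ a ∈ B, a ∈ B' := by first | decide | simp +contextual) : Ag A' B' s s' :=
  ⟨fun a ha => h.1 a fun h => ha (hA a h), fun a ha => h.2 a fun h => ha (hB a h)⟩

theorem Frame.ag {P : Prog} {s s' : Memory} (h : Frame P s s') : Ag P.mods P.rmods s s' := h

theorem RepData.ag {A B : List ℕ} {s s' : Memory} {n id : ℕ} {x : Rec} (h : RepData s n id x)
    (hs : Ag A B s s') (hA : ∀ a ∈ [40, 41, 42, 43, 44], a ∉ A := by decide)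
    (hB : 40 ∉ B := by decide) : RepData s' n id x := by
  simp only [forall_mem_cons, not_mem_nil, false_imp_iff, implies_true, and_true] at hA
  obtain ⟨h0, h1, h2, h3, h4⟩ := hA
  exact h.congr (by rw [hs.1 _ h0]) (fun _ _ => by rw [hs.1 _ h1]) (fun _ _ => by rw [hs.1 _ h2])
    (fun _ _ => by rw [hs.1 _ h3]) (fun _ _ => by rw [hs.1 _ h4]) (by rw [hs.2 _ hB])

theorem St.ag {P : Par} {now lo : ℕ} {l acc : List Rec} {s s' : Memory} {A B : List ℕ}
    (h : St P now lo l acc s) (hs : Ag A B s s') (hA : ∀ a ∈ stArr, a ∉ A := by decide)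
    (hB : 40 ∉ B ∧ 41 ∉ B := by decide) : St P now lo l acc s' :=
  h.congr (fun a ha => hs.1 a (hA a ha)) (hs.2 _ hB.1) (hs.2 _ hB.2)

theorem setNat_self (s : Memory) (a i : ℕ) : s.setNat a i (s.nat a i) = s := by
  simp [Memory.setNat]

theorem wp_accum {Z a : ℕ} {e f e' f' g : NExpr} {s : Memory} {Q : Memory → Prop}
    (h : Q (s.setNat a 0 (s.nat a 0 +
      if e.eval s = f.eval s ∧ e'.eval s = f'.eval s then g.eval s else 0))) :
    Wp Z (ifEq e f (ifEq e' f' (sv a (.add (nv a) g)))) s Q := by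
  refine wp_ifEq (fun h1 => wp_ifEq (fun h2 => wp_setNat ?_) fun h2 => ?_) fun h1 => ?_
  · simpa [h1, h2, eval] using h
  · simpa [h1, h2, setNat_self] using h
  · simpa [h1, setNat_self] using h

theorem wp_ifEq_set {Z a : ℕ} {e f g : NExpr} {s : Memory} {Q : Memory → Prop}
    (h : Q (s.setNat a 0 (if e.eval s = f.eval s then g.eval s else s.nat a 0))) :
    Wp Z (ifEq e f (sv a g)) s Q := by
  refine wp_ifEq (fun h1 => wp_setNat ?_) fun h1 => ?_
  · simpa [h1, eval] using h
  · simpa [h1, setNat_self] using h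

theorem wp_ifNe_zero {Z a : ℕ} {e f : NExpr} {s : Memory} {Q : Memory → Prop}
    (h : Q (s.setNat a 0 (if e.eval s = f.eval s then s.nat a 0 else 0))) :
    Wp Z (ifNe e f (sv a (.lit 0))) s Q := by
  refine wp_ifNe (fun h1 => wp_setNat ?_) fun h1 => ?_
  · simpa [h1, eval] using h
  · simpa [h1, setNat_self] using h

theorem cmpSide_spec {Z n idx idy : ℕ} {x y : Rec} {s : Memory} (hZ : n ≤ Z) {bs b : ℕ}
    {z : Rec} (hn : s.nat 10 0 = n) (hx : RepData s n idx x) (hy : RepData s n idy y)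
    (h85 : s.nat 85 0 = idx * n) (h53 : s.nat 53 0 = idy * n) {j : ℕ} (hj : j < n)
    (h86 : s.nat 86 0 = j) (hbs : s.nat bs 0 = b * n) (hbs' : bs < 87) (hz : RepData s n b z) :
    Wp Z (cmpSide bs) s fun s' => Ag [84, 87, 88, 89, 90, 91] [] s s' ∧ s'.nat 84 0 =
      if 1 ≤ z.M j → x.load n (z.D j) (z.M j) = y.load n (z.D j) (z.M j) then s.nat 84 0 else 0 := by
  have e1 := hz.D j hj
  have e2 := hz.M j hj
  iterate 4 apply wp_cons_nat
  have hbs1 : bs ≠ 87 := by omega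
  simp only [eval, setNat_nat, h86, hbs, e1, e2, hbs1, reduceEqDiff, false_and,
    if_false]
  set s2 := (((s.setNat 87 0 (z.D j)).setNat 88 0 (z.M j)).setNat 89 0 0).setNat 90 0 0 with hs2
  have hag : Ag [84, 87, 88, 89, 90, 91] [] s s2 :=
    (Ag.refl _ _ s).setNat.setNat.setNat.setNat
  have f87 : s2.nat 87 0 = z.D j := by simp [hs2]
  have f88 : s2.nat 88 0 = z.M j := by simp [hs2]
  have f84 : s2.nat 84 0 = s.nat 84 0 := by simp [hs2]
  have f10 : s2.nat 10 0 = n := by simp [hs2, hn]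
  have f85 : s2.nat 85 0 = idx * n := by simp [hs2, h85]
  have f53 : s2.nat 53 0 = idy * n := by simp [hs2, h53]
  have f89 : s2.nat 89 0 = 0 := by simp [hs2]
  have f90 : s2.nat 90 0 = 0 := by simp [hs2]
  have hx2 : RepData s2 n idx x := hx.ag hag
  have hy2 : RepData s2 n idy y := hy.ag hag
  clear_value s2
  apply wp_cons
  refine wp_for n hZ (fun k s' => Ag [89, 90, 91] [] s2 s' ∧
    s'.nat 89 0 = ∑ q ∈ range k, (if x.D q = z.D j ∧ x.M q = z.M j then x.R q else 0) ∧
    s'.nat 90 0 = ∑ q ∈ range k, (if y.D q = z.D j ∧ y.M q = z.M j then y.R q else 0))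
    (by decide) ⟨Ag.refl _ _ _, by simp [f89], by simp [f90]⟩ ?_ ?_ ?_ ?_
  · rintro k s' v ⟨h1, h2, h3⟩
    exact ⟨h1.setNat, by simp [h2], by simp [h3]⟩
  · rintro k s' ⟨h1, h2, h3⟩
    simp [eval, h1.nat 10, f10]
  · rintro k s' hk h91 ⟨h1, h2, h3⟩
    have g85 : s'.nat 85 0 = idx * n := by rw [h1.nat 85, f85]
    have g53 : s'.nat 53 0 = idy * n := by rw [h1.nat 53, f53]
    have g87 : s'.nat 87 0 = z.D j := by rw [h1.nat 87, f87]
    have g88 : s'.nat 88 0 = z.M j := by rw [h1.nat 88, f88]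
    have hx' := hx2.ag h1
    have hy' := hy2.ag h1
    apply wp_cons
    apply wp_accum
    apply wp_cons
    apply wp_accum
    apply wp_nil
    simp only [eval, setNat_nat, g85, g53, g87, g88, h91, hx'.D k hk, hx'.M k hk, hx'.R k hk,
      hy'.D k hk, hy'.M k hk, hy'.R k hk, reduceEqDiff, false_and, if_false, and_self, if_true]
    refine ⟨h1.setNat.setNat, ?_, ?_⟩
    · rw [sum_range_succ, h2]
    · rw [sum_range_succ, h3]
  · rintro s' ⟨h1, h2, h3⟩
    apply wp_cons
    have g84 : s'.nat 84 0 = s.nat 84 0 := by rw [h1.nat 84, f84]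
    have i1 : Ag [84, 87, 88, 89, 90, 91] [] s s' := hag.trans h1
    have g88 : s'.nat 88 0 = z.M j := by rw [h1.nat 88, f88]
    have hload : (∑ q ∈ range n, (if x.D q = z.D j ∧ x.M q = z.M j then x.R q else 0) =
      ∑ q ∈ range n, (if y.D q = z.D j ∧ y.M q = z.M j then y.R q else 0)) ↔
      x.load n (z.D j) (z.M j) = y.load n (z.D j) (z.M j) := Iff.rfl
    refine wp_ifLe (fun h => wp_ifNe (fun h' => wp_setNat (wp_nil ?_))
      (fun h' => wp_nil ?_)) (fun h => wp_nil ?_)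
    all_goals simp only [eval, g88] at h
    · simp only [eval, h2, h3, ne_eq, hload] at h'
      refine ⟨i1.setNat, ?_⟩
      rw [if_neg fun hcon => h' (hcon h)]
      simp [eval]
    · simp only [eval, h2, h3, hload] at h'
      exact ⟨i1, by rw [g84, if_pos fun _ => h']⟩
    · exact ⟨i1, by rw [g84, if_pos fun hcon => absurd hcon h]⟩

/-- The condition on job `j` for the equivalence of two records, in a form that is easy to test. -/
def chk (n : ℕ) (x y : Rec) (j : ℕ) : Prop :=
  x.uR j = y.uR j ∧ (1 ≤ x.uR j → x.D j = y.D j ∧ x.L j = y.L j) ∧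
    (1 ≤ x.M j → x.load n (x.D j) (x.M j) = y.load n (x.D j) (x.M j)) ∧
    (1 ≤ y.M j → x.load n (y.D j) (y.M j) = y.load n (y.D j) (y.M j))

theorem eqRec_iff_chk {n : ℕ} {x y : Rec} : EqRec n x y ↔ ∀ j < n, chk n x y j := by
  constructor
  · exact fun h j hj => ⟨(h.1 j hj).1, (h.1 j hj).2, fun h' => h.2 _ _ h', fun h' => h.2 _ _ h'⟩
  · refine fun h => ⟨fun j hj => ⟨(h j hj).1, (h j hj).2.1⟩, fun d i hi => ?_⟩
    by_cases h1 : ∃ j < n, x.D j = d ∧ x.M j = i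
    · obtain ⟨j, hj, rfl, rfl⟩ := h1
      exact (h j hj).2.2.1 hi
    · by_cases h2 : ∃ j < n, y.D j = d ∧ y.M j = i
      · obtain ⟨j, hj, rfl, rfl⟩ := h2
        exact (h j hj).2.2.2 hi
      · push Not at h1 h2
        have hz : ∀ z : Rec, (∀ j < n, z.D j = d → z.M j ≠ i) → z.load n d i = 0 := fun z hz =>
          sum_eq_zero fun j hj =>
            if_neg fun hc => hz j (mem_range.1 hj) hc.1 hc.2
        rw [hz x h1, hz y h2]

theorem ite_and4 {p q r t : Prop} [Decidable p] [Decidable q] [Decidable r] [Decidable t]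
    [Decidable (p ∧ q ∧ r ∧ t)] :
    (if t then if r then if q then if p then 1 else 0 else 0 else 0 else 0) =
      if p ∧ q ∧ r ∧ t then 1 else 0 := by
  by_cases p <;> by_cases q <;> by_cases r <;> by_cases t <;> simp [*]

open Classical in
theorem cmp_spec {Z n idx idy : ℕ} {x y : Rec} {s : Memory} (hZ : n ≤ Z)
    (hn : s.nat 10 0 = n) (hx : RepData s n idx x) (hy : RepData s n idy y)
    (h83 : s.nat 83 0 = idx) (h53 : s.nat 53 0 = idy * n) :
    Wp Z cmp s fun s' => Ag [84, 85, 86, 87, 88, 89, 90, 91, 93, 95] [] s s' ∧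
      s'.nat 84 0 = if EqRec n x y then 1 else 0 := by
  iterate 2 apply wp_cons_nat
  simp only [eval, setNat_nat, h83, hx.base, reduceEqDiff, false_and, if_false]
  set s2 := (s.setNat 84 0 1).setNat 85 0 (idx * n) with hs2
  have hag : Ag [84, 85, 86, 87, 88, 89, 90, 91, 93, 95] [] s s2 :=
    (Ag.refl _ _ s).setNat.setNat
  have f84 : s2.nat 84 0 = 1 := by simp [hs2]
  have f10 : s2.nat 10 0 = n := by simp [hs2, hn]
  have f85 : s2.nat 85 0 = idx * n := by simp [hs2]
  have f53 : s2.nat 53 0 = idy * n := by simp [hs2, h53]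
  have hx2 : RepData s2 n idx x := hx.ag hag
  have hy2 : RepData s2 n idy y := hy.ag hag
  clear_value s2
  apply wp_cons
  refine wp_for n hZ (fun k s' => Ag [84, 86, 87, 88, 89, 90, 91, 93, 95] [] s2 s' ∧
    s'.nat 84 0 = if ∀ j < k, chk n x y j then 1 else 0)
    (by decide) ⟨Ag.refl _ _ _, by simp [f84]⟩ ?_ ?_ ?_ ?_
  · rintro k s' v ⟨h1, h2⟩
    exact ⟨h1.setNat, by simp [h2]⟩
  · rintro k s' ⟨h1, h2⟩
    simp [eval, h1.nat 10, f10]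
  · rintro k s' hk h86 ⟨h1, h2⟩
    have g85 : s'.nat 85 0 = idx * n := by rw [h1.nat 85, f85]
    have g53 : s'.nat 53 0 = idy * n := by rw [h1.nat 53, f53]
    have g10 : s'.nat 10 0 = n := by rw [h1.nat 10, f10]
    have hx' := hx2.ag h1
    have hy' := hy2.ag h1
    -- the last two tests, after the first ones have left the value `c` in `84`
    have key : ∀ (s'' : Memory) (q : Prop), Ag [84, 93, 95] [] s' s'' →
        s''.nat 84 0 = (if q then s'.nat 84 0 else 0) →
        (q ↔ x.uR k = y.uR k ∧ (1 ≤ x.uR k → x.D k = y.D k ∧ x.L k = y.L k)) →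
        Wp Z (block [cmpSide 85, cmpSide 53]) s'' fun s' =>
          Ag [84, 86, 87, 88, 89, 90, 91, 93, 95] [] s2 s' ∧
          s'.nat 84 0 = if ∀ j < k + 1, chk n x y j then 1 else 0 := by
      intro s'' q i1 i2 i3
      have hx'' := hx'.ag i1
      have hy'' := hy'.ag i1
      refine wp_cons ((cmpSide_spec hZ (by rw [i1.nat 10, g10]) hx'' hy''
        (by rw [i1.nat 85, g85]) (by rw [i1.nat 53, g53]) hk
        (by rw [i1.nat 86, h86]) (by rw [i1.nat 85, g85]) (by decide)
        hx'').mono ?_)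
      rintro s3 ⟨j1, j2⟩
      have j1 : Ag [84, 87, 88, 89, 90, 91, 93, 95] [] s' s3 :=
        i1.weaken.trans j1
      refine wp_cons ((cmpSide_spec hZ (by rw [j1.nat 10, g10])
        (hx'.ag j1) (hy'.ag j1)
        (by rw [j1.nat 85, g85]) (by rw [j1.nat 53, g53]) hk
        (by rw [j1.nat 86, h86]) (by rw [j1.nat 53, g53]) (by decide)
        (hy'.ag j1)).mono ?_)
      rintro s4 ⟨l1, l2⟩
      refine wp_nil ⟨h1.trans (j1.trans l1 (by simp) (by simp)), ?_⟩
      rw [l2, j2, i2, h2]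
      have hlast : (∀ j < k + 1, chk n x y j) ↔ (∀ j < k, chk n x y j) ∧ chk n x y k :=
        ⟨fun h => ⟨fun j hj => h j (by omega), h k (by omega)⟩, fun h j hj => by
          rcases lt_succ_iff_lt_or_eq.1 hj with h' | rfl
          exacts [h.1 j h', h.2]⟩
      have hc : chk n x y k ↔ q ∧
        (1 ≤ x.M k → x.load n (x.D k) (x.M k) = y.load n (x.D k) (x.M k)) ∧
        (1 ≤ y.M k → x.load n (y.D k) (y.M k) = y.load n (y.D k) (y.M k)) := by
        rw [i3, chk, and_assoc]
      simp only [hlast, hc]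
      exact ite_and4
    apply wp_cons_nat
    apply wp_cons
    apply wp_ifEq_set
    apply wp_cons_nat
    apply wp_cons
    apply wp_ifEq_set
    apply wp_cons
    apply wp_ifNe_zero
    simp only [eval, setNat_nat, g85, g53, h86, hx'.M k hk, hx'.R k hk,
      hy'.M k hk, hy'.R k hk, reduceEqDiff, false_and, if_false, and_self, if_true]
    have ux : (if x.M k = 0 then x.R k else 0) = x.uR k := rfl
    have uy : (if y.M k = 0 then y.R k else 0) = y.uR k := rfl
    simp only [ux, uy]
    set s4 := ((((s'.setNat 93 0 0).setNat 93 0 (x.uR k)).setNat 95 0 0).setNat 95 0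
      (y.uR k)).setNat 84 0 (if x.uR k = y.uR k then s'.nat 84 0 else 0) with hs4
    have hag4 : Ag [84, 93, 95] [] s' s4 :=
      (Ag.refl _ _ _).setNat.setNat.setNat.setNat.setNat
    have e93 : s4.nat 93 0 = x.uR k := by simp [hs4]
    have e84 : s4.nat 84 0 = if x.uR k = y.uR k then s'.nat 84 0 else 0 := by simp [hs4]
    clear_value s4
    have hx4 := hx'.ag hag4
    have hy4 := hy'.ag hag4
    have e85 : s4.nat 85 0 = idx * n := by rw [hag4.nat 85, g85]
    have e53 : s4.nat 53 0 = idy * n := by rw [hag4.nat 53, g53]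
    have e86 : s4.nat 86 0 = k := by rw [hag4.nat 86, h86]
    apply wp_cons
    refine wp_ifLe (fun hc => ?_) fun hc => ?_
    · simp only [eval, e93] at hc
      apply wp_cons
      apply wp_ifNe_zero
      apply wp_cons
      apply wp_ifNe_zero
      apply wp_nil
      refine key _ (x.uR k = y.uR k ∧ x.D k = y.D k ∧ x.L k = y.L k)
        (hag4.setNat.setNat) ?_ ?_
      · simp only [eval, setNat_nat, e85, e53, e86, e84, hx4.D k hk, hx4.L k hk,
          hy4.D k hk, hy4.L k hk, reduceEqDiff, false_and, if_false, and_self, if_true]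
        by_cases a1 : x.uR k = y.uR k <;> by_cases a2 : x.D k = y.D k <;>
          by_cases a3 : x.L k = y.L k <;>
          simp only [a1, a2, a3, if_true, if_false, and_true, and_false, and_self]
      · exact ⟨fun h => ⟨h.1, fun _ => h.2⟩, fun h => ⟨h.1, h.2 hc⟩⟩
    · simp only [eval, e93] at hc
      exact key _ (x.uR k = y.uR k) hag4 (by rw [e84]; congr) ⟨fun h => ⟨h, fun h' => absurd h' hc⟩, fun h => h.1⟩
  · rintro s' ⟨h1, h2⟩
    refine wp_nil ⟨hag.trans h1, ?_⟩
    rw [h2]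
    simp only [eqRec_iff_chk]

theorem not_mem_block {n A B k : ℕ} (hAB : A ≠ B) (hk : k < n) :
    ¬ (B * n ≤ A * n + k ∧ A * n + k < B * n + n) := by
  intro h
  rcases lt_or_gt_of_ne hAB with h1 | h1
  · have := Nat.mul_le_mul_right n (show A + 1 ≤ B from h1)
    rw [Nat.add_mul] at this; omega
  · have := Nat.mul_le_mul_right n (show B + 1 ≤ A from h1)
    rw [Nat.add_mul] at this; omega

theorem copyData_spec {Z n A B a b : ℕ} {s : Memory} (hZ : n ≤ Z) (hn : s.nat 10 0 = n)
    (ha : s.nat a 0 = A * n) (hb : s.nat b 0 = B * n) (hAB : A ≠ B)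
    (ha' : a ∉ [41, 42, 43, 44, 80]) (hb' : b ∉ [41, 42, 43, 44, 80]) :
    Wp Z (copyData (nv b) (nv a)) s fun s' => Ag [41, 42, 43, 44, 80] [] s s' ∧
      ∀ c ∈ [41, 42, 43, 44], ∀ p, s'.nat c p =
        if B * n ≤ p ∧ p < B * n + n then s.nat c (A * n + (p - B * n)) else s.nat c p := by
  refine wp_for n hZ (fun k s' => Ag [41, 42, 43, 44, 80] [] s s' ∧
      ∀ c ∈ [41, 42, 43, 44], ∀ p, s'.nat c p =
        if B * n ≤ p ∧ p < B * n + k then s.nat c (A * n + (p - B * n)) else s.nat c p)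
    (by simp [block, Prog.mods]) ⟨Ag.refl _ _ _, fun c _ p => ?_⟩ ?_ ?_ ?_ fun _ h => h
  · rw [if_neg (by omega)]
  · rintro k s' v ⟨h1, h2⟩
    refine ⟨h1.setNat, fun c hc p => ?_⟩
    rw [setNat_nat_of_ne _ _ _ (by rintro rfl; simp at hc)]
    exact h2 c hc p
  · rintro k s' ⟨h1, h2⟩
    simp [eval, h1.nat 10, hn]
  · rintro k s' hk h80 ⟨h1, h2⟩
    have ga : s'.nat a 0 = A * n := by rw [h1.1 a ha', ha]
    have gb : s'.nat b 0 = B * n := by rw [h1.1 b hb', hb]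
    have hk' := not_mem_block hAB hk
    have hr : ∀ c ∈ [41, 42, 43, 44], s'.nat c (A * n + k) = s.nat c (A * n + k) := by
      intro c hc
      rw [h2 c hc, if_neg (by omega)]
    simp only [mem_cons, not_mem_nil, or_false, not_or] at ha' hb'
    obtain ⟨a1, a2, a3, a4, a5⟩ := ha'
    obtain ⟨b1, b2, b3, b4, b5⟩ := hb'
    iterate 4 apply wp_cons_nat
    apply wp_nil
    simp only [eval, setNat_nat, ga, gb, h80, a1, a2, a3, b1, b2, b3, reduceEqDiff,
      false_and, if_false, hr 41 (by simp), hr 42 (by simp), hr 43 (by simp), hr 44 (by simp)]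
    refine ⟨h1.setNat.setNat.setNat.setNat, fun c hc p => ?_⟩
    have h3 := h2 c hc p
    by_cases hp : p = B * n + k
    · have hcond : B * n ≤ p ∧ p < B * n + (k + 1) := by omega
      have : p - B * n = k := by omega
      rw [if_pos hcond, this]
      simp only [mem_cons, not_mem_nil, or_false] at hc
      rcases hc with rfl | rfl | rfl | rfl <;> simp [hp]
    · have : (B * n ≤ p ∧ p < B * n + (k + 1)) ↔ (B * n ≤ p ∧ p < B * n + k) := by omega
      simp only [hp, and_false, if_false, h3, this]

/-- The memories `s` and `s'` agree on record `id`. -/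
structure SameRec (n : ℕ) (s s' : Memory) (id : ℕ) : Prop where
  ptr : ∀ c ∈ [40, 45, 46, 47, 48], s'.nat c id = s.nat c id
  data : ∀ c ∈ [41, 42, 43, 44], ∀ k < n, s'.nat c (id * n + k) = s.nat c (id * n + k)
  cost : s'.real 40 id = s.real 40 id

theorem SameRec.repData {n id : ℕ} {s s' : Memory} {x : Rec} (h : SameRec n s s' id)
    (hx : RepData s n id x) : RepData s' n id x :=
  hx.congr (h.ptr 40 (by simp)) (h.data 41 (by simp)) (h.data 42 (by simp)) (h.data 43 (by simp))
    (h.data 44 (by simp)) h.cost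

theorem chain_same {n B id : ℕ} {s s' : Memory} {h : List (ℕ × ℕ × ℕ)} (hc : Chain s id h)
    (hB : s.nat 45 id < B) (h0 : SameRec n s s' id) (e : ∀ id' < B, SameRec n s s' id') :
    Chain s' id h :=
  hc.congr B (.inr hB) fun id' hid' => by
    have : SameRec n s s' id' := by
      rcases hid' with rfl | hid'
      exacts [h0, e _ hid']
    exact ⟨this.ptr 45 (by simp), this.ptr 46 (by simp), this.ptr 47 (by simp),
      this.ptr 48 (by simp)⟩

/-- Changing record `g` of the next layer. -/
theorem St.modify {P : Par} {now lo g : ℕ} {l acc acc' : List Rec} {s s' : Memory}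
    (h : St P now lo l acc s) (hg : lo + l.length ≤ g)
    (e : ∀ a ∈ [2, 10, 11, 13, 15, 16, 19, 20, 21, 23, 30, 31, 33, 50, 51, 54], s'.nat a = s.nat a)
    (e41 : s'.real 41 = s.real 41)
    (same : ∀ id < lo + l.length + acc.length, id ≠ g → SameRec P.n s s' id)
    (nh : s'.nat 52 0 = lo + l.length + acc'.length)
    (nb : s'.nat 53 0 = (lo + l.length + acc'.length) * P.n)
    (old : ∀ q, (hq : q < acc'.length) → lo + l.length + q ≠ g →
      ∃ hq' : q < acc.length, acc'[q] = acc[q])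
    (new : ∀ q, (hq : q < acc'.length) → lo + l.length + q = g → RepData s' P.n g acc'[q] ∧
      Chain s' g acc'[q].hist ∧ s'.nat 45 g < lo + l.length) :
    St P now lo l acc' s' := by
  have hlow : ∀ id' < lo + l.length, SameRec P.n s s' id' := fun id' h' =>
    same id' (by omega) (by omega)
  refine ⟨h.const.congr (fun a ha => e a ?_) e41, by rw [e 50 (by decide), h.lo_eq],
    by rw [e 51 (by decide), h.hi], nh, nb, by rw [e 54 (by decide), h.now], fun q hq => ?_,
    fun q hq => ?_⟩
  · simp at ha ⊢
    tauto
  · have h1 := hlow (lo + q) (by omega)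
    exact ⟨h1.repData (h.cur q hq).1, (h.cur q hq).2.congr (lo + l.length) (.inl (by omega))
      fun id' hid' => by
        have := hlow id' (by omega)
        exact ⟨this.ptr 45 (by simp), this.ptr 46 (by simp), this.ptr 47 (by simp),
          this.ptr 48 (by simp)⟩⟩
  · by_cases hqg : lo + l.length + q = g
    · have := new q hq hqg
      rwa [← hqg] at this
    · obtain ⟨hq', hqe⟩ := old q hq hqg
      have h1 := same _ (show lo + l.length + q < _ by omega) hqg
      obtain ⟨n1, n2, n3⟩ := h.new q hq'
      rw [hqe]
      exact ⟨h1.repData n1, chain_same n2 n3 h1 hlow, by rwa [h1.ptr 45 (by simp)]⟩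

/-- The variables describe the new record that arises from record `q` of the current layer by changing
the data of job `j`. -/
structure Fields (lo q j d i r e : ℕ) (c : ℝ) (act : ℕ × ℕ × ℕ) (s : Memory) : Prop where
  src : s.nat 57 0 = lo + q
  job : s.nat 55 0 = j
  d : s.nat 58 0 = d
  i : s.nat 59 0 = i
  r : s.nat 60 0 = r
  e : s.nat 61 0 = e
  c : s.real 42 0 = c
  aj : s.nat 62 0 = act.1
  am : s.nat 63 0 = act.2.1
  now : s.nat 54 0 = act.2.2

/-- The record with number `g` is the new record. -/
structure Pending (n B g : ℕ) (y : Rec) (s : Memory) : Prop where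
  data : RepData s n g y
  chain : Chain s g y.hist
  par : s.nat 45 g < B

theorem write_spec {P : Par} {Z now lo q j d i r e : ℕ} {l acc : List Rec} {c f : ℝ}
    {act : ℕ × ℕ × ℕ} {s : Memory} (hZ : P.n ≤ Z) (h : St P now lo l acc s) (hq : q < l.length)
    (hj : j < P.n) (hf : Fields lo q j d i r e c act s) :
    Wp Z write s fun s' => St P now lo l acc s' ∧
      Pending P.n (lo + l.length) (lo + l.length + acc.length) (l[q].upd j d i r e c f act) s' ∧
      Ag [40, 41, 42, 43, 44, 45, 46, 47, 48, 64, 80] [40] s s' := by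
  obtain ⟨g, hg⟩ : ∃ g, g = lo + l.length + acc.length := ⟨_, rfl⟩
  have hc := (h.cur q hq).1
  have hn := h.const.n
  have hnb : s.nat 53 0 = g * P.n := by rw [h.nb, hg]
  have hnh : s.nat 52 0 = g := by rw [h.nh, hg]
  rw [← hg]
  apply wp_cons_nat
  simp only [eval, hf.src, hc.base]
  apply wp_cons
  refine (copyData_spec (A := lo + q) (B := g) hZ (by simp [hn]) (by simp) (by simp [hnb])
    (by omega) (by decide) (by decide)).mono ?_
  rintro s1 ⟨h1, h2⟩
  have h3 : Ag [41, 42, 43, 44, 64, 80] [] s s1 :=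
    (Ag.refl [41, 42, 43, 44, 64, 80] [] s).setNat.trans h1
  have h4 : ∀ c ∈ [41, 42, 43, 44], ∀ p, s1.nat c p = if g * P.n ≤ p ∧ p < g * P.n + P.n then
      s.nat c ((lo + q) * P.n + (p - g * P.n)) else s.nat c p := by
    intro c hc p
    rw [h2 c hc p, setNat_nat_of_ne _ _ _ (by rintro rfl; simp at hc)]
  clear h1 h2
  have g53 : s1.nat 53 0 = g * P.n := by rw [h3.nat 53, hnb]
  have g52 : s1.nat 52 0 = g := by rw [h3.nat 52, hnh]
  have g57 : s1.nat 57 0 = lo + q := by rw [h3.nat 57, hf.src]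
  have g55 : s1.nat 55 0 = j := by rw [h3.nat 55, hf.job]
  have g58 : s1.nat 58 0 = d := by rw [h3.nat 58, hf.d]
  have g59 : s1.nat 59 0 = i := by rw [h3.nat 59, hf.i]
  have g60 : s1.nat 60 0 = r := by rw [h3.nat 60, hf.r]
  have g61 : s1.nat 61 0 = e := by rw [h3.nat 61, hf.e]
  have g62 : s1.nat 62 0 = act.1 := by rw [h3.nat 62, hf.aj]
  have g63 : s1.nat 63 0 = act.2.1 := by rw [h3.nat 63, hf.am]
  have g54 : s1.nat 54 0 = act.2.2 := by rw [h3.nat 54, hf.now]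
  have gc : s1.real 42 0 = c := by rw [h3.real 42, hf.c]
  iterate 4 apply wp_cons_nat
  apply wp_cons_real
  iterate 5 apply wp_cons_nat
  apply wp_nil
  simp only [eval, RExpr.eval, setNat_nat, setReal_nat, setNat_real, g53, g52,
    g57, g55, g58, g59, g60, g61, g62, g63, g54, gc, reduceEqDiff, false_and, if_false]
  set s2 := ((((((((((s1.setNat 41 (g * P.n + j) d).setNat 42 (g * P.n + j) i).setNat 43
    (g * P.n + j) r).setNat 44 (g * P.n + j) e).setReal 40 g c).setNat 40 g (g * P.n)).setNat 45 g
    (lo + q)).setNat 46 g act.1).setNat 47 g act.2.1).setNat 48 g act.2.2) with hs2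
  have h5 : Ag [40, 41, 42, 43, 44, 45, 46, 47, 48, 64, 80] [40] s s2 :=
    (h3.weaken.setNat.setNat.setNat.setNat.setReal.setNat.setNat.setNat.setNat.setNat)
  have e40 (p : ℕ) : s2.nat 40 p = if p = g then g * P.n else s.nat 40 p := by
    simp [hs2, h3.nat 40]
  have e41 (p : ℕ) : s2.nat 41 p = if p = g * P.n + j then d else s1.nat 41 p := by simp [hs2]
  have e42 (p : ℕ) : s2.nat 42 p = if p = g * P.n + j then i else s1.nat 42 p := by simp [hs2]
  have e43 (p : ℕ) : s2.nat 43 p = if p = g * P.n + j then r else s1.nat 43 p := by simp [hs2]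
  have e44 (p : ℕ) : s2.nat 44 p = if p = g * P.n + j then e else s1.nat 44 p := by simp [hs2]
  have e45 (p : ℕ) : s2.nat 45 p = if p = g then lo + q else s.nat 45 p := by simp [hs2, h3.nat 45]
  have e46 (p : ℕ) : s2.nat 46 p = if p = g then act.1 else s.nat 46 p := by simp [hs2, h3.nat 46]
  have e47 (p : ℕ) : s2.nat 47 p = if p = g then act.2.1 else s.nat 47 p := by
    simp [hs2, h3.nat 47]
  have e48 (p : ℕ) : s2.nat 48 p = if p = g then act.2.2 else s.nat 48 p := by
    simp [hs2, h3.nat 48]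
  have ec (p : ℕ) : s2.real 40 p = if p = g then c else s.real 40 p := by simp [hs2, h3.real 40]
  clear_value s2
  have same : ∀ id, id ≠ g → SameRec P.n s s2 id := by
    intro id hid
    refine ⟨?_, ?_, by rw [ec, if_neg hid]⟩
    · simp only [forall_mem_cons, not_mem_nil, false_imp_iff, implies_true, and_true,
        e40, e45, e46, e47, e48, if_neg hid]
    · intro c hc k hk
      have h6 := not_mem_block hid hk
      have h7 : id * P.n + k ≠ g * P.n + j := by omega
      have h8 := h4 c hc (id * P.n + k)
      rw [if_neg h6] at h8
      rw [← h8]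
      simp only [mem_cons, not_mem_nil, or_false] at hc
      rcases hc with rfl | rfl | rfl | rfl
      · rw [e41, if_neg h7]
      · rw [e42, if_neg h7]
      · rw [e43, if_neg h7]
      · rw [e44, if_neg h7]
  have new : ∀ c ∈ [41, 42, 43, 44], ∀ k < P.n, s1.nat c (g * P.n + k) =
      s.nat c ((lo + q) * P.n + k) := by
    intro c hc k hk
    rw [h4 c hc, if_pos (by omega), Nat.add_sub_cancel_left]
  refine ⟨h.modify (g := g) (by omega) (fun a ha => h5.1 a ?_) (h5.real 41)
    (fun id _ hid => same id hid) (by rw [h5.nat 52, h.nh])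
    (by rw [h5.nat 53, h.nb]) (fun q hq _ => ⟨hq, rfl⟩) (fun q hq hqg => by omega),
    ⟨?_, ?_, ?_⟩, h5⟩
  · simp at ha ⊢
    omega
  · have hupd : ∀ (u : ℕ → ℕ) (v k : ℕ), update u j v k = if k = j then v else u k :=
      fun u v k => by simp [Function.update_apply]
    refine ⟨by rw [e40, if_pos rfl], ?_, ?_, ?_, ?_, by rw [ec, if_pos rfl]; rfl⟩
    · intro k hk
      simp only [Rec.upd, hupd, e41, Nat.add_left_cancel_iff, new 41 (by simp) k hk, hc.D k hk]
    · intro k hk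
      simp only [Rec.upd, hupd, e42, Nat.add_left_cancel_iff, new 42 (by simp) k hk, hc.M k hk]
    · intro k hk
      simp only [Rec.upd, hupd, e43, Nat.add_left_cancel_iff, new 43 (by simp) k hk, hc.R k hk]
    · intro k hk
      simp only [Rec.upd, hupd, e44, Nat.add_left_cancel_iff, new 44 (by simp) k hk, hc.L k hk]
  · refine ⟨by omega, by rw [e46, if_pos rfl], by rw [e47, if_pos rfl], by rw [e48, if_pos rfl],
      by rw [e45, if_pos rfl]; omega, ?_⟩
    rw [e45, if_pos rfl]
    refine (h.cur q hq).2.congr (lo + l.length) (.inl (by omega)) fun id' hid' => ?_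
    have := same id' (by omega)
    exact ⟨this.ptr 45 (by simp), this.ptr 46 (by simp), this.ptr 47 (by simp),
      this.ptr 48 (by simp)⟩
  · rw [e45, if_pos rfl]; omega

theorem Pending.ag {n B g : ℕ} {y : Rec} {s s' : Memory} (h : Pending n B g y s)
    {A C : List ℕ} (hs : Ag A C s s') (hA : ∀ a ∈ [40, 41, 42, 43, 44, 45, 46, 47, 48], a ∉ A := by decide)
    (hC : 40 ∉ C := by decide) : Pending n B g y s' := by
  refine ⟨h.data.ag hs (fun a ha => hA a ?_) hC, h.chain.congr (g + 1) (.inl (by omega))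
    fun id' _ => ?_, by rw [hs.1 45 (hA 45 (by simp))]; exact h.par⟩
  · simp at ha ⊢
    omega
  · rw [hs.1 45 (hA 45 (by simp)), hs.1 46 (hA 46 (by simp)), hs.1 47 (hA 47 (by simp)),
      hs.1 48 (hA 48 (by simp))]
    simp

theorem search_spec {P : Par} {Z now lo : ℕ} {l acc : List Rec} {y : Rec} {s : Memory}
    (hZ : P.n ≤ Z) (hZ' : acc.length ≤ Z) (h : St P now lo l acc s)
    (hy : RepData s P.n (lo + l.length + acc.length) y) :
    Wp Z search s fun s' => Ag [81, 82, 83, 84, 85, 86, 87, 88, 89, 90, 91, 92, 93, 95] [] s s' ∧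
      ((s'.nat 81 0 = 0 ∧ ∀ z ∈ acc, ¬ EqRec P.n z y) ∨
        (s'.nat 81 0 = 1 ∧ ∃ f, ∃ h : f < acc.length, s'.nat 92 0 = lo + l.length + f ∧
          EqRec P.n acc[f] y)) := by
  apply wp_cons_nat
  simp only [eval]
  apply wp_cons
  refine wp_for acc.length hZ' (fun k s' =>
    Ag [81, 82, 83, 84, 85, 86, 87, 88, 89, 90, 91, 92, 93, 95] [] s s' ∧
      ((s'.nat 81 0 = 0 ∧ ∀ f, (hf : f < acc.length) → f < k → ¬ EqRec P.n acc[f] y) ∨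
        (s'.nat 81 0 = 1 ∧ ∃ f, ∃ h : f < acc.length, s'.nat 92 0 = lo + l.length + f ∧
          EqRec P.n acc[f] y)))
    (by decide) ⟨(Ag.refl _ _ s).setNat, .inl (by simp)⟩ ?_ ?_ ?_ ?_
  · rintro k s' v ⟨h1, h2⟩
    exact ⟨h1.setNat, by simpa using h2⟩
  · rintro k s' ⟨h1, -⟩
    simp only [eval, h1.nat 52, h1.nat 51, h.nh, h.hi]
    omega
  · rintro k s' hk h82 ⟨h1, h2⟩
    apply wp_cons_nat
    simp only [eval, h82, h1.nat 51, h.hi]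
    have h3 : Ag [81, 82, 83, 84, 85, 86, 87, 88, 89, 90, 91, 92, 93, 95] [] s
      (s'.setNat 83 0 (lo + l.length + k)) := h1.setNat
    apply wp_cons
    refine (cmp_spec (x := acc[k]) (y := y) (idx := lo + l.length + k)
      (idy := lo + l.length + acc.length) hZ (by rw [h3.nat 10, h.const.n])
      ((h.new k hk).1.ag h3) (hy.ag h3)
      (by simp) (by rw [h3.nat 53, h.nb])).mono ?_
    rintro s2 ⟨h4, h5⟩
    have h6 := h3.trans h4
    have e81 : s2.nat 81 0 = s'.nat 81 0 := by rw [h4.nat 81]; simp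
    have e92 : s2.nat 92 0 = s'.nat 92 0 := by rw [h4.nat 92]; simp
    have e83 : s2.nat 83 0 = lo + l.length + k := by rw [h4.nat 83]; simp
    apply wp_cons
    refine wp_ifEq (fun hc => ?_) fun hc => wp_nil ?_
    · simp only [eval, h5] at hc
      have hc' : EqRec P.n acc[k] y := by
        by_contra h0
        simp [h0] at hc
      iterate 2 apply wp_cons_nat
      apply wp_nil
      apply wp_nil
      refine ⟨h6.setNat.setNat, .inr ⟨by simp [eval], k, hk,
        by simp [eval, e83], hc'⟩⟩
    · simp only [eval, h5] at hc
      have hc' : ¬ EqRec P.n acc[k] y := by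
        intro h0
        simp [h0] at hc
      refine ⟨h6, ?_⟩
      rw [e81, e92]
      rcases h2 with h2 | h2
      · refine .inl ⟨h2.1, fun f hf hfk => ?_⟩
        rcases lt_succ_iff_lt_or_eq.1 hfk with h7 | rfl
        exacts [h2.2 f hf h7, hc']
      · exact .inr h2
  · rintro s' ⟨h1, h2⟩
    refine wp_nil ⟨h1, h2.imp (fun h3 => ⟨h3.1, fun z hz => ?_⟩) id⟩
    obtain ⟨f, hf, rfl⟩ := List.mem_iff_getElem.1 hz
    exact h3.2 f hf hf

theorem overwrite_spec {P : Par} {Z now lo f : ℕ} {l acc : List Rec} {y : Rec} {s : Memory}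
    (hZ : P.n ≤ Z) (h : St P now lo l acc s)
    (hy : Pending P.n (lo + l.length) (lo + l.length + acc.length) y s) (hyh : y.hist ≠ [])
    (hf : f < acc.length) (h92 : s.nat 92 0 = lo + l.length + f) :
    Wp Z overwrite s fun s' => St P now lo l (acc.set f y) s' := by
  obtain ⟨G, hG⟩ : ∃ G, G = lo + l.length + acc.length := ⟨_, rfl⟩
  obtain ⟨g, hg⟩ : ∃ g, g = lo + l.length + f := ⟨_, rfl⟩
  rw [← hG] at hy
  rw [← hg] at h92
  have hn := h.const.n
  have hnb : s.nat 53 0 = G * P.n := by rw [h.nb, hG]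
  have hnh : s.nat 52 0 = G := by rw [h.nh, hG]
  have hb := (h.new f hf).1.base
  rw [← hg] at hb
  apply wp_cons_nat
  simp only [eval, h92, hb]
  apply wp_cons
  refine (copyData_spec (A := G) (B := g) hZ (by simp [hn]) (by simp [hnb]) (by simp)
    (by omega) (by decide) (by decide)).mono ?_
  rintro s1 ⟨h1, h2⟩
  have h3 : Ag [41, 42, 43, 44, 64, 80] [] s s1 :=
    (Ag.refl [41, 42, 43, 44, 64, 80] [] s).setNat.trans h1
  have h4 : ∀ c ∈ [41, 42, 43, 44], ∀ p, s1.nat c p = if g * P.n ≤ p ∧ p < g * P.n + P.n then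
      s.nat c (G * P.n + (p - g * P.n)) else s.nat c p := by
    intro c hc p
    rw [h2 c hc p, setNat_nat_of_ne _ _ _ (by rintro rfl; simp at hc)]
  clear h1 h2
  have g92 : s1.nat 92 0 = g := by rw [h3.nat 92, h92]
  have g52 : s1.nat 52 0 = G := by rw [h3.nat 52, hnh]
  have g45 := h3.nat 45
  have g46 := h3.nat 46
  have g47 := h3.nat 47
  have g48 := h3.nat 48
  have gc := h3.real 40
  apply wp_cons_real
  iterate 4 apply wp_cons_nat
  apply wp_nil
  simp only [eval, RExpr.eval, setNat_nat, setReal_nat, g92, g52, g45, g46, g47, g48, gc,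
    reduceEqDiff, false_and, if_false]
  set s2 := (((((s1.setReal 40 g (s.real 40 G)).setNat 45 g (s.nat 45 G)).setNat 46 g
    (s.nat 46 G)).setNat 47 g (s.nat 47 G)).setNat 48 g (s.nat 48 G)) with hs2
  have h5 : Ag [41, 42, 43, 44, 45, 46, 47, 48, 64, 80] [40] s s2 :=
    (h3.weaken.setReal.setNat.setNat.setNat.setNat)
  have e41 : ∀ c ∈ [41, 42, 43, 44], ∀ p, s2.nat c p = s1.nat c p := fun c hc p => by
    simp only [mem_cons, not_mem_nil, or_false] at hc
    rcases hc with rfl | rfl | rfl | rfl <;> simp [hs2]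
  have e45 (p : ℕ) : s2.nat 45 p = if p = g then s.nat 45 G else s.nat 45 p := by simp [hs2, g45]
  have e46 (p : ℕ) : s2.nat 46 p = if p = g then s.nat 46 G else s.nat 46 p := by simp [hs2, g46]
  have e47 (p : ℕ) : s2.nat 47 p = if p = g then s.nat 47 G else s.nat 47 p := by simp [hs2, g47]
  have e48 (p : ℕ) : s2.nat 48 p = if p = g then s.nat 48 G else s.nat 48 p := by simp [hs2, g48]
  have ec (p : ℕ) : s2.real 40 p = if p = g then s.real 40 G else s.real 40 p := by simp [hs2, gc]
  have e40 := h5.nat 40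
  clear_value s2
  have same : ∀ id, id ≠ g → SameRec P.n s s2 id := by
    intro id hid
    refine ⟨?_, ?_, by rw [ec, if_neg hid]⟩
    · simp only [forall_mem_cons, not_mem_nil, false_imp_iff, implies_true, and_true,
        e40, e45, e46, e47, e48, if_neg hid]
    · intro c hc k hk
      rw [e41 c hc, h4 c hc, if_neg (not_mem_block hid hk)]
  have new : ∀ c ∈ [41, 42, 43, 44], ∀ k < P.n, s2.nat c (g * P.n + k) =
      s.nat c (G * P.n + k) := by
    intro c hc k hk
    rw [e41 c hc, h4 c hc, if_pos (by omega), Nat.add_sub_cancel_left]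
  refine h.modify (g := g) (by omega) (fun a ha => h5.1 a ?_) (h5.real 41)
    (fun id _ hid => same id hid) (by rw [h5.nat 52, h.nh, length_set])
    (by rw [h5.nat 53, h.nb, length_set]) (fun q hq hqg => ?_) (fun q hq hqg => ?_)
  · simp at ha ⊢
    omega
  · rw [length_set] at hq
    exact ⟨hq, List.getElem_set_ne (by omega) _⟩
  · obtain rfl : q = f := by omega
    rw [List.getElem_set_self]
    have hp := hy.par
    refine ⟨⟨by rw [e40, hb], fun k hk => ?_, fun k hk => ?_, fun k hk => ?_, fun k hk => ?_, ?_⟩,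
      ?_, by rw [e45, if_pos rfl]; exact hp⟩
    · rw [new 41 (by simp) k hk, hy.data.D k hk]
    · rw [new 42 (by simp) k hk, hy.data.M k hk]
    · rw [new 43 (by simp) k hk, hy.data.R k hk]
    · rw [new 44 (by simp) k hk, hy.data.L k hk]
    · rw [ec, if_pos rfl, hy.data.cost]
    · have hch := hy.chain
      cases hh : y.hist with
      | nil => exact absurd hh hyh
      | cons a t =>
        rw [hh] at hch
        obtain ⟨c1, c2, c3, c4, c5, c6⟩ := hch
        refine ⟨by omega, by rw [e46, if_pos rfl, c2], by rw [e47, if_pos rfl, c3],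
          by rw [e48, if_pos rfl, c4], by rw [e45, if_pos rfl]; omega, ?_⟩
        rw [e45, if_pos rfl]
        refine c6.congr (lo + l.length) (.inl hp) fun id' hid' => ?_
        have := same id' (by omega)
        exact ⟨this.ptr 45 (by simp), this.ptr 46 (by simp), this.ptr 47 (by simp),
          this.ptr 48 (by simp)⟩

theorem emit_spec {P : Par} {Z now lo q j d i r e : ℕ} {l acc : List Rec} {c : ℝ} (f : ℝ)
    {act : ℕ × ℕ × ℕ} {s : Memory} (hZ : P.n ≤ Z) (hZ' : acc.length ≤ Z) (h : St P now lo l acc s)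
    (hq : q < l.length) (hj : j < P.n) (hf : Fields lo q j d i r e c act s) :
    Wp Z emit s fun s' => ∃ acc', St P now lo l acc' s' ∧
      Ins P.n acc (l[q].upd j d i r e c f act) acc' := by
  apply wp_cons
  refine (write_spec (f := f) hZ h hq hj hf).mono ?_
  rintro s1 ⟨h1, h2, -⟩
  set y := l[q].upd j d i r e c f act with hy
  apply wp_cons
  refine (search_spec hZ hZ' h1 h2.data).mono ?_
  rintro s2 ⟨h3, h4⟩
  have h5 := h1.ag h3
  have h6 := h2.ag h3
  apply wp_cons
  refine wp_ite (fun hc => ?_) fun hc => ?_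
  · simp only [Cond.eval, eval] at hc
    rcases h4 with h4 | ⟨-, k, hk, h7, h8⟩
    · omega
    refine wp_ite (fun hc' => wp_skip (wp_nil ?_)) fun hc' => ?_
    · simp only [Cond.eval, RExpr.eval, eval, h7, h5.nh, (h5.new k hk).1.cost,
        h6.data.cost] at hc'
      exact ⟨acc, h5, .inr ⟨k, hk, h8, .inl ⟨hc', rfl⟩⟩⟩
    · simp only [Cond.eval, RExpr.eval, eval, h7, h5.nh, (h5.new k hk).1.cost,
        h6.data.cost, not_le] at hc'
      exact (overwrite_spec hZ h5 h6 (by simp [hy, Rec.upd]) hk h7).mono fun s' h9 =>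
        wp_nil ⟨_, h9, .inr ⟨k, hk, h8, .inr ⟨hc', rfl⟩⟩⟩
  · simp only [Cond.eval, eval] at hc
    rcases h4 with ⟨-, h4⟩ | ⟨h4, -⟩
    · apply wp_cons_nat
      apply wp_cons_nat
      apply wp_nil
      apply wp_nil
      simp only [eval, setNat_nat, h5.nh, h5.nb, h5.const.n, reduceEqDiff, false_and,
        if_false]
      set s3 := (s2.setNat 52 0 (lo + l.length + acc.length + 1)).setNat 53 0
        ((lo + l.length + acc.length) * P.n + P.n) with hs3
      have h7 : Ag [52, 53] [] s2 s3 :=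
        (Ag.refl _ _ s2).setNat.setNat
      have h8 := h6.ag h7
      refine ⟨acc ++ [y], h5.modify (g := lo + l.length + acc.length) (by omega)
        (fun a ha => h7.1 a ?_) (h7.real 41)
        (fun id _ _ => ⟨fun c hc => ?_, fun c hc k _ => ?_, by rw [h7.real 40]⟩)
        (by simp [hs3]; omega) (by simp [hs3]; ring) (fun q hq hqg => ?_) (fun q hq hqg => ?_),
        .inl ⟨h4, rfl⟩⟩
      · simp at ha ⊢
        omega
      · rw [h7.1 c (by simp only [mem_cons, not_mem_nil, or_false] at hc ⊢; omega)]
      · rw [h7.1 c (by simp only [mem_cons, not_mem_nil, or_false] at hc ⊢; omega)]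
      · rw [length_append, List.length_singleton] at hq
        exact ⟨by omega, List.getElem_append_left (by omega)⟩
      · obtain rfl : q = acc.length := by omega
        rw [List.getElem_concat_length rfl]
        exact ⟨h8.data, h8.chain, h8.par⟩
    · omega

/-! ### Verification: computing the successors of a partial schedule -/

/-- The arrays which are changed when records are inserted. -/
def emArr : List ℕ := [40, 41, 42, 43, 44, 45, 46, 47, 48, 52, 53, 59, 60, 64, 72, 73, 74, 75, 77, 80,
  81, 82, 83, 84, 85, 86, 87, 88, 89, 90, 91, 92, 93, 95]

/-- The next layer represents the set `S`. -/
def EmSt (P : Par) (now lo : ℕ) (l : List Rec) (S : Set Rec) (s : Memory) : Prop :=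
  ∃ acc, St P now lo l acc s ∧ Good P.n acc S

/-- The set `S` is so small that its representations have length at most `Z`. -/
def Small (n Z : ℕ) (S : Set Rec) : Prop :=
  ∀ acc : List Rec, (∀ y ∈ acc, y ∈ S) → (acc.Pairwise fun y z => ¬ EqRec n y z) → acc.length ≤ Z

theorem Small.mono {n Z : ℕ} {S T : Set Rec} (h : Small n Z T) (hS : S ⊆ T) : Small n Z S :=
  fun acc h1 h2 => h acc (fun y hy => hS (h1 y hy)) h2

/-- The step bound admits all loops of the dynamic program. -/
structure Fits (P : Par) (Z : ℕ) : Prop where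
  n : P.n ≤ Z
  m : P.m + 1 ≤ Z
  E : 2 * P.E + 1 ≤ Z
  N : P.N ≤ Z
  KH : P.KH ≤ Z
  V : P.V ≤ Z
  H : P.H + 1 ≤ Z

section

variable {P : Par} {Z now lo : ℕ} {l : List Rec} {S S' T : Set Rec} {s s' : Memory}

theorem EmSt.setNat (h : EmSt P now lo l S s) {a i v : ℕ} (ha : a ∉ stArr := by decide) :
    EmSt P now lo l S (s.setNat a i v) := by
  obtain ⟨acc, h1, h2⟩ := h
  exact ⟨acc, h1.setNat ha _ _, h2⟩

theorem EmSt.setReal (h : EmSt P now lo l S s) {a i : ℕ} {v : ℝ}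
    (ha : a ≠ 40 ∧ a ≠ 41 := by decide) : EmSt P now lo l S (s.setReal a i v) := by
  obtain ⟨acc, h1, h2⟩ := h
  exact ⟨acc, h1.setReal ha _ _, h2⟩

theorem EmSt.ag {A B : List ℕ} (h : EmSt P now lo l S s) (hs : Ag A B s s')
    (hA : ∀ a ∈ stArr, a ∉ A := by decide) (hB : 40 ∉ B ∧ 41 ∉ B := by decide) :
    EmSt P now lo l S s' := by
  obtain ⟨acc, h1, h2⟩ := h
  exact ⟨acc, h1.ag hs hA hB, h2⟩

theorem EmSt.congr (h : EmSt P now lo l S s) (e : ∀ y, y ∈ S ↔ y ∈ S') : EmSt P now lo l S' s := by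
  rwa [← Set.ext e]

theorem EmSt.const (h : EmSt P now lo l S s) : Const P s := by
  obtain ⟨acc, h1, -⟩ := h
  exact h1.const

theorem EmSt.slot (h : EmSt P now lo l S s) : s.nat 54 0 = now := by
  obtain ⟨acc, h1, -⟩ := h
  exact h1.now

theorem EmSt.data (h : EmSt P now lo l S s) {q : ℕ} (hq : q < l.length) :
    RepData s P.n (lo + q) l[q] := by
  obtain ⟨acc, h1, -⟩ := h
  exact (h1.cur q hq).1

theorem emit_em {q j d i r e : ℕ} {c : ℝ} (f : ℝ) {act : ℕ × ℕ × ℕ} (hZ : P.n ≤ Z)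
    (h : EmSt P now lo l S s) (hsm : Small P.n Z S) (hq : q < l.length) (hj : j < P.n)
    (hf : Fields lo q j d i r e c act s) :
    Wp Z emit s fun s' => Ag emArr [40] s s' ∧
      EmSt P now lo l (S ∪ {l[q].upd j d i r e c f act}) s' := by
  obtain ⟨acc, h1, h2⟩ := h
  refine (emit_spec f hZ (hsm acc h2.mem h2.pw) h1 hq hj hf).mono_frame ?_
  rintro s' hs ⟨acc', h3, h4⟩
  exact ⟨hs.ag.weaken, acc', h3, h2.ins h4⟩

/-- The data that stay the same while records for different deadlines and types of job `j` are
inserted: the job has `r` units of work left, and `e` will be its last slot. -/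
structure Ctx (P : Par) (lo q j r e : ℕ) (act : ℕ × ℕ × ℕ) (s : Memory) : Prop where
  src : s.nat 57 0 = lo + q
  base : s.nat 76 0 = (lo + q) * P.n
  job : s.nat 55 0 = j
  e : s.nat 61 0 = e
  aj : s.nat 62 0 = act.1
  am : s.nat 63 0 = act.2.1
  r : s.nat 65 0 = r

theorem Ctx.ag {q j r e : ℕ} {act : ℕ × ℕ × ℕ} {A B : List ℕ} (h : Ctx P lo q j r e act s)
    (hs : Ag A B s s') (hA : ∀ a ∈ [57, 76, 55, 61, 62, 63, 65], a ∉ A := by decide) :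
    Ctx P lo q j r e act s' := by
  simp only [forall_mem_cons, not_mem_nil, false_imp_iff, implies_true, and_true] at hA
  obtain ⟨h1, h2, h3, h4, h5, h6, h7⟩ := hA
  exact ⟨by rw [hs.1 _ h1, h.src], by rw [hs.1 _ h2, h.base], by rw [hs.1 _ h3, h.job],
    by rw [hs.1 _ h4, h.e], by rw [hs.1 _ h5, h.aj], by rw [hs.1 _ h6, h.am],
    by rw [hs.1 _ h7, h.r]⟩

theorem countOthers_spec {q j d : ℕ} {x : Rec} (hZ : P.n ≤ Z) (hn : s.nat 10 0 = P.n)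
    (hx : RepData s P.n (lo + q) x) (h76 : s.nat 76 0 = (lo + q) * P.n) (h55 : s.nat 55 0 = j)
    (h58 : s.nat 58 0 = d) :
    Wp Z countOthers s fun s' => Ag [72, 73] [] s s' ∧ s'.nat 72 0 = x.others P.n j d := by
  apply wp_cons_nat
  apply wp_cons
  refine wp_for P.n hZ (fun k s' => Ag [72, 73] [] s s' ∧ s'.nat 72 0 = x.others k j d)
    (by decide) ⟨(Ag.refl _ _ s).setNat, by simp [eval, Rec.others]⟩ ?_ ?_ ?_
    fun s' h => wp_nil h
  · rintro k s' v ⟨h1, h2⟩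
    exact ⟨h1.setNat, by simpa using h2⟩
  · rintro k s' ⟨h1, -⟩
    simp [eval, h1.nat 10, hn]
  · rintro k s' hk h73 ⟨h1, h2⟩
    have hx' := hx.ag h1
    have g76 : s'.nat 76 0 = (lo + q) * P.n := by rw [h1.nat 76, h76]
    have g55 : s'.nat 55 0 = j := by rw [h1.nat 55, h55]
    have g58 : s'.nat 58 0 = d := by rw [h1.nat 58, h58]
    have hno : ¬ (k ≠ j ∧ x.D k = d ∧ x.M k = 0 ∧ 1 ≤ x.R k) → x.others (k + 1) j d =
        x.others k j d := fun hc => by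
      rw [Rec.others, Finset.range_add_one, Finset.filter_insert, if_neg hc, Rec.others]
    have hyes : (k ≠ j ∧ x.D k = d ∧ x.M k = 0 ∧ 1 ≤ x.R k) → x.others (k + 1) j d =
        x.others k j d + 1 := fun hc => by
      rw [Rec.others, Finset.range_add_one, Finset.filter_insert, if_pos hc,
        Finset.card_insert_of_notMem (by simp), Rec.others]
    have e : ∀ P : Prop, (P → x.others (k + 1) j d = x.others k j d) → P →
        Ag [72, 73] [] s s' ∧ s'.nat 72 0 = x.others (k + 1) j d := fun P hP h =>
      ⟨h1, by rw [h2, hP h]⟩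
    refine wp_ifNe (fun c1 => wp_ifEq (fun c2 => wp_ifEq (fun c3 => wp_ifLe (fun c4 =>
      wp_setNat ?_) fun c4 => ?_) fun c3 => ?_) fun c2 => ?_) fun c1 => ?_
    all_goals simp only [eval, h73, g55, g76, g58, hx'.D k hk, hx'.M k hk, hx'.R k hk] at *
    · exact ⟨h1.setNat, by simp [h2, hyes ⟨c1, c2, c3, c4⟩]⟩
    · exact ⟨h1, by rw [h2, hno fun hc => c4 hc.2.2.2]⟩
    · exact ⟨h1, by rw [h2, hno fun hc => c3 hc.2.2.1]⟩
    · exact ⟨h1, by rw [h2, hno fun hc => c2 hc.2.1]⟩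
    · exact ⟨h1, by rw [h2, hno fun hc => hc.1 c1]⟩

theorem mul_lt_iff_lt_cdiv {r v c : ℕ} (hv : 1 ≤ v) : c * v < r ↔ c < cdiv r v := by
  constructor
  · intro h
    have := h.trans_le (le_cdiv_mul r hv)
    exact Nat.lt_of_mul_lt_mul_right this
  · intro h
    by_contra h'
    exact absurd (cdiv_le (not_lt.1 h')) (by omega)

theorem divide_spec {r v : ℕ} (hV : s.nat 19 0 = P.V) (hZ : P.V ≤ Z) (hr : r ≤ P.V) (hv : 1 ≤ v)
    (h65 : s.nat 65 0 = r) (h74 : s.nat 74 0 = v) :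
    Wp Z divide s fun s' => Ag [60, 75, 77] [] s s' ∧ s'.nat 60 0 = cdiv r v := by
  iterate 2 apply wp_cons_nat
  apply wp_cons
  refine wp_for P.V hZ (fun k s' => Ag [60, 75, 77] [] s s' ∧ s'.nat 60 0 = min k (cdiv r v) ∧
    s'.nat 75 0 = min k (cdiv r v) * v) (by decide)
    ⟨(Ag.refl _ _ s).setNat.setNat, by simp [eval],
      by simp [eval]⟩ ?_ ?_ ?_ ?_
  · rintro k s' v ⟨h1, h2⟩
    exact ⟨h1.setNat, by simpa using h2⟩
  · rintro k s' ⟨h1, -⟩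
    simp [eval, h1.nat 19, hV]
  · rintro k s' hk h77 ⟨h1, h2, h3⟩
    have g65 : s'.nat 65 0 = r := by rw [h1.nat 65, h65]
    have g74 : s'.nat 74 0 = v := by rw [h1.nat 74, h74]
    have hlt := mul_lt_iff_lt_cdiv (r := r) (c := min k (cdiv r v)) hv
    refine wp_ifLe (fun hc => ?_) fun hc => ?_
    all_goals simp only [eval, h3, g65] at hc
    · have hkc : k < cdiv r v := by have := hlt.1 hc; omega
      iterate 2 apply wp_cons_nat
      apply wp_nil
      refine ⟨h1.setNat.setNat, ?_, ?_⟩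
      · simp [eval, h2]; omega
      · simp only [eval, setNat_nat, h3, g74, reduceEqDiff, false_and, if_false,
          and_self, if_true]
        rw [min_eq_left hkc.le, min_eq_left (by omega), Nat.add_mul, one_mul]
    · have hkc : ¬ k < cdiv r v := fun h => hc (hlt.2 (by omega))
      exact ⟨h1, by rw [h2]; omega, by rw [h3, min_eq_right (by omega), min_eq_right (by omega)]⟩
  · rintro s' ⟨h1, h2, -⟩
    refine wp_nil ⟨h1, ?_⟩
    rw [h2, min_eq_right ((cdiv_le_self r v hv).trans hr)]

theorem roundUp_spec {j g : ℕ} (hK : s.nat 15 0 = P.KH) (hZ : P.KH ≤ Z) (hg : 1 ≤ g)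
    (h66 : s.nat 66 0 = g) (h55 : s.nat 55 0 = j) (hrs : s.nat 33 j = P.rs j)
    (hr : P.rs j ≤ P.KH * g) :
    Wp Z roundUp s fun s' => Ag [68, 69] [] s s' ∧ s'.nat 68 0 = cdiv (P.rs j) g * g := by
  apply wp_cons_nat
  apply wp_cons
  refine wp_for P.KH hZ (fun k s' => Ag [68, 69] [] s s' ∧
    s'.nat 68 0 = min k (cdiv (P.rs j) g) * g) (by decide)
    ⟨(Ag.refl _ _ s).setNat, by simp [eval]⟩ ?_ ?_ ?_ ?_
  · rintro k s' v ⟨h1, h2⟩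
    exact ⟨h1.setNat, by simpa using h2⟩
  · rintro k s' ⟨h1, -⟩
    simp [eval, h1.nat 15, hK]
  · rintro k s' hk h77 ⟨h1, h3⟩
    have g66 : s'.nat 66 0 = g := by rw [h1.nat 66, h66]
    have g55 : s'.nat 55 0 = j := by rw [h1.nat 55, h55]
    have g33 : s'.nat 33 j = P.rs j := by rw [h1.nat 33, hrs]
    have hlt := mul_lt_iff_lt_cdiv (r := P.rs j) (c := min k (cdiv (P.rs j) g)) hg
    refine wp_ifLe (fun hc => wp_setNat ?_) fun hc => ?_
    all_goals simp only [eval, h3, g55, g33] at hc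
    · have hkc : k < cdiv (P.rs j) g := by have := hlt.1 hc; omega
      refine ⟨h1.setNat, ?_⟩
      simp only [eval, setNat_nat, h3, g66, and_self, if_true]
      rw [min_eq_left hkc.le, min_eq_left (by omega), Nat.add_mul, one_mul]
    · have hkc : ¬ k < cdiv (P.rs j) g := fun h => hc (hlt.2 (by omega))
      exact ⟨h1, by rw [h3, min_eq_right (by omega), min_eq_right (by omega)]⟩
  · rintro s' ⟨h1, h2⟩
    refine wp_nil ⟨h1, ?_⟩
    rw [h2, min_eq_right (cdiv_le hr)]

theorem tryEmit_spec {q j d r e τ : ℕ} {c f : ℝ} {act : ℕ × ℕ × ℕ} (hF : Fits P Z)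
    (h : EmSt P now lo l S s) (hsm : Small P.n Z S) (hq : q < l.length) (hj : j < P.n)
    (hx : Ctx P lo q j r e act s) (hd : s.nat 58 0 = d) (hc : s.real 42 0 = c) (hr : r ≤ P.V)
    (hact : act.2.2 = now) (hτ : τ < P.m + 1) (h71 : s.nat 71 0 = τ) :
    Wp Z tryEmit s fun s' => Ag emArr [40] s s' ∧
      EmSt P now lo l (S ∪ P.typeAt l[q] j d r e c f act τ) s' := by
  refine wp_ite (fun h0 => ?_) fun h0 => ?_
  · simp only [Cond.eval, eval, h71] at h0
    have h0 : τ = 0 := by omega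
    apply wp_cons
    refine (countOthers_spec hF.n h.const.n (h.data hq) hx.base hx.job hd).mono ?_
    rintro s1 ⟨h1, h2⟩
    have h3 := h.ag h1
    have hx3 := hx.ag h1
    have h4 : Ag emArr [40] s s1 := h1.weaken
    apply wp_cons
    refine wp_ifLe (fun hcap => ?_) fun hcap => wp_nil ⟨h4, h3.congr fun y => ?_⟩
    all_goals simp only [eval, h2, h3.const.cap] at hcap
    · apply wp_cons_nat
      apply wp_cons_nat
      simp only [eval, setNat_nat, hx3.r, reduceEqDiff, false_and, if_false]
      set s2 := (s1.setNat 59 0 0).setNat 60 0 r with hs2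
      have h5 : Ag [59, 60] [] s1 s2 :=
        (Ag.refl _ _ s1).setNat.setNat
      have e59 : s2.nat 59 0 = 0 := by simp [hs2]
      have e60 : s2.nat 60 0 = r := by simp [hs2]
      clear_value s2
      have h6 := h3.ag h5
      have hx6 := hx3.ag h5
      apply wp_cons
      refine (emit_em f (act := act) hF.n h6 hsm hq hj ⟨hx6.src, hx6.job,
        by rw [h5.nat 58, h1.nat 58, hd], e59, e60, hx6.e,
        by rw [h5.real 42, h1.real 42, hc], hx6.aj, hx6.am,
        by rw [h6.slot, hact]⟩).mono ?_
      rintro s3 ⟨h7, h8⟩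
      refine wp_nil (wp_nil ⟨(h4.trans h5).trans h7, h8.congr fun y => ?_⟩)
      simp only [Par.typeAt, mem_union, mem_ofPred_eq, mem_singleton_iff, h0]
      constructor
      · rintro (h9 | h9)
        exacts [.inl h9, .inr (.inl ⟨trivial, by omega, h9⟩)]
      · rintro (h9 | ⟨-, -, h9⟩ | ⟨h9, -⟩)
        exacts [.inl h9, .inr h9, absurd h9 (by omega)]
    · simp only [Par.typeAt, mem_union, mem_ofPred_eq, h0]
      constructor
      · exact .inl
      · rintro (h9 | ⟨-, h9, -⟩ | ⟨h9, -⟩)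
        exacts [h9, absurd h9 (by omega), absurd h9 (by omega)]
  · simp only [Cond.eval, eval, h71, nonpos_iff_eq_zero] at h0
    have hτm : τ - 1 < P.m := by omega
    apply wp_cons_nat
    simp only [eval, h71, hx.job, h.const.row _ hτm, h.const.v _ hτm _ hj]
    set s1 := s.setNat 74 0 (P.v (τ - 1) j) with hs1
    have h1 : Ag [74] [] s s1 := (Ag.refl _ _ s).setNat
    have e74 : s1.nat 74 0 = P.v (τ - 1) j := by simp [hs1]
    clear_value s1
    have h2 := h.ag h1
    have hx2 := hx.ag h1
    have h4 : Ag emArr [40] s s1 := h1.weaken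
    apply wp_cons
    refine wp_ifLe (fun hv => ?_) fun hv => wp_nil ⟨h4, h2.congr fun y => ?_⟩
    all_goals simp only [eval, e74] at hv
    · apply wp_cons
      refine (divide_spec h2.const.V hF.V hr hv hx2.r e74).mono ?_
      rintro s2 ⟨h5, h6⟩
      apply wp_cons_nat
      simp only [eval, h5.nat 71, h1.nat 71, h71]
      set s3 := s2.setNat 59 0 τ with hs3
      have h7 : Ag [59] [] s2 s3 := (Ag.refl _ _ s2).setNat
      have e59 : s3.nat 59 0 = τ := by simp [hs3]
      clear_value s3
      have h8 := (h2.ag h5).ag h7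
      have hx8 := (hx2.ag h5).ag h7
      apply wp_cons
      refine (emit_em f (act := act) hF.n h8 hsm hq hj ⟨hx8.src, hx8.job,
        by rw [h7.nat 58, h5.nat 58, h1.nat 58, hd], e59,
        by rw [h7.nat 60, h6], hx8.e,
        by rw [h7.real 42, h5.real 42, h1.real 42, hc], hx8.aj, hx8.am,
        by rw [h8.slot, hact]⟩).mono ?_
      rintro s4 ⟨h9, h10⟩
      refine wp_nil (wp_nil ⟨((h4.trans h5).trans h7).trans h9, h10.congr fun y => ?_⟩)
      simp only [Par.typeAt, mem_union, mem_ofPred_eq, mem_singleton_iff]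
      constructor
      · rintro (h9 | h9)
        exacts [.inl h9, .inr (.inr ⟨by omega, hv, h9⟩)]
      · rintro (h9 | ⟨h9, -⟩ | ⟨-, -, h9⟩)
        exacts [.inl h9, absurd h9 h0, .inr h9]
    · simp only [Par.typeAt, mem_union, mem_ofPred_eq]
      constructor
      · exact .inl
      · rintro (h9 | ⟨h9, -⟩ | ⟨-, h9, -⟩)
        exacts [h9, absurd h9 h0, absurd h9 hv]

theorem settleAll_spec {q j d r e : ℕ} {c f : ℝ} {act : ℕ × ℕ × ℕ} (hF : Fits P Z)
    (h : EmSt P now lo l S s) (hsm : Small P.n Z T) (hS : S ⊆ T)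
    (hq : q < l.length) (hT : ∀ τ < P.m + 1, P.typeAt l[q] j d r e c f act τ ⊆ T) (hj : j < P.n)
    (hx : Ctx P lo q j r e act s) (hd : s.nat 58 0 = d) (hc : s.real 42 0 = c) (hr : r ≤ P.V)
    (hact : act.2.2 = now) :
    Wp Z settleAll s fun s' => Ag (71 :: emArr) [40] s s' ∧
      EmSt P now lo l (S ∪ {y | ∃ τ < P.m + 1, y ∈ P.typeAt l[q] j d r e c f act τ}) s' := by
  refine wp_for (P.m + 1) hF.m (fun k s' => Ag (71 :: emArr) [40] s s' ∧
    EmSt P now lo l (S ∪ {y | ∃ τ < k, y ∈ P.typeAt l[q] j d r e c f act τ}) s') (by decide)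
    ⟨Ag.refl _ _ _, by simpa using h⟩ ?_ ?_ ?_ fun s' h => h
  · rintro k s' v ⟨h1, h2⟩
    exact ⟨h1.setNat, h2.setNat⟩
  · rintro k s' ⟨h1, h2⟩
    simp [eval, h2.const.m]
  · rintro k s' hk h71 ⟨h1, h2⟩
    refine (tryEmit_spec (f := f) hF h2 (hsm.mono ?_) hq hj (hx.ag h1)
      (by rw [h1.nat 58, hd]) (by rw [h1.real 42, hc]) hr hact hk h71).mono ?_
    · rintro y (hy | ⟨τ, hτ, hy⟩)
      exacts [hS hy, hT τ (by omega) hy]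
    · rintro s2 ⟨h3, h4⟩
      refine ⟨h1.trans h3, h4.congr fun y => ?_⟩
      simp only [mem_union, mem_ofPred_eq, lt_succ_iff_lt_or_eq]
      constructor
      · rintro ((h5 | ⟨τ, hτ, h5⟩) | h5)
        exacts [.inl h5, .inr ⟨τ, .inl hτ, h5⟩, .inr ⟨k, .inr rfl, h5⟩]
      · rintro (h5 | ⟨τ, hτ | rfl, h5⟩)
        exacts [.inl (.inl h5), .inl (.inr ⟨τ, hτ, h5⟩), .inr h5]

/-- The partial schedules that arise by releasing job `j` with a due slot of scale `k`. -/
def Par.relAt (P : Par) (now j : ℕ) (x : Rec) (k : ℕ) : Set Rec :=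
  {y | ∃ a < 2 * P.E + 1, ∃ τ < P.m + 1, y ∈ P.typeAt x j (P.due j k a) P.V 0
    (x.cost + P.w j * (P.kap a * P.tp ^ k)) (P.flow k a) (0, 0, now) τ}

theorem scaleBody_spec {q j k : ℕ} (hF : Fits P Z) (h : EmSt P now lo l S s)
    (hsm : Small P.n Z T) (hS : S ⊆ T) (hq : q < l.length)
    (hT : P.R * 2 ^ k ≤ P.N * P.R → P.relAt now j l[q] k ⊆ T) (hj : j < P.n) (hR : 1 ≤ P.R)
    (hrs : P.rs j ≤ P.KH * P.R) (hx : Ctx P lo q j P.V 0 (0, 0, now) s)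
    (h66 : s.nat 66 0 = P.R * 2 ^ k) (h43 : s.real 43 0 = P.tp ^ k) :
    Wp Z (scaleBody P.E P.tp) s fun s' =>
      Ag (58 :: 66 :: 68 :: 69 :: 70 :: 71 :: emArr) [40, 42, 43] s s' ∧
      ((P.R * 2 ^ k ≤ P.N * P.R ∧ s'.nat 66 0 = P.R * 2 ^ (k + 1) ∧ s'.real 43 0 = P.tp ^ (k + 1) ∧
        EmSt P now lo l (S ∪ P.relAt now j l[q] k) s') ∨
      (¬ P.R * 2 ^ k ≤ P.N * P.R ∧ s' = s)) := by
  obtain ⟨g, hg⟩ : ∃ g, g = P.R * 2 ^ k := ⟨_, rfl⟩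
  have hgR : P.R ≤ g := by rw [hg]; exact le_mul_of_pos_right _ (by positivity)
  rw [← hg] at h66 hT ⊢
  refine wp_ifLe (fun hc => ?_) fun hc => ⟨Ag.refl _ _ _, .inr ⟨?_, rfl⟩⟩
  all_goals simp only [eval, h66, h.const.NR] at hc
  swap
  · exact hc
  apply wp_cons
  refine (roundUp_spec h.const.KH hF.KH (by omega) h66 hx.job (h.const.rs j hj)
    (hrs.trans (Nat.mul_le_mul_left _ hgR))).mono ?_
  rintro s1 ⟨h1, h2⟩
  have hx1 := hx.ag h1
  have h3 := h.ag h1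
  have g66 : s1.nat 66 0 = g := by rw [h1.nat 66, h66]
  have g43 : s1.real 43 0 = P.tp ^ k := by rw [h1.real 43, h43]
  apply wp_cons
  refine wp_for (2 * P.E + 1) hF.E (fun b s' =>
    Ag (58 :: 68 :: 69 :: 70 :: 71 :: emArr) [40, 42] s1 s' ∧
    s'.nat 68 0 = cdiv (P.rs j) g * g + b * g ∧
    EmSt P now lo l (S ∪ {y | ∃ a < b, ∃ τ < P.m + 1, y ∈ P.typeAt l[q] j (P.due j k a) P.V 0
    (l[q].cost + P.w j * (P.kap a * P.tp ^ k)) (P.flow k a) (0, 0, now) τ}) s')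
    (by simp only [block, Prog.mods, settleAll, forN]; decide) ⟨Ag.refl _ _ _, by simpa using h2, by simpa using h3⟩ ?_ ?_ ?_ ?_
  · rintro b s' v ⟨h4, h5, h6⟩
    exact ⟨h4.setNat, by simpa using h5, h6.setNat⟩
  · rintro b s' ⟨h4, h5, h6⟩
    rfl
  · rintro b s' hb h70 ⟨h4, h5, h6⟩
    have hx4 := hx1.ag h4
    apply wp_cons_nat
    apply wp_cons_real
    simp only [eval, RExpr.eval, setNat_nat, setNat_real, h5, h6.const.R, hx4.src, hx4.job,
      h6.const.w j hj, (h6.data hq).cost, h70, h6.const.kap b (by omega),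
      h4.real 43, g43, reduceEqDiff, false_and, if_false]
    set d := cdiv (P.rs j) g * g + b * g + P.R with hd
    set c := l[q].cost + (P.w j : ℝ) * (P.kap b * P.tp ^ k) with hcost
    have hdue : P.due j k b = d := by rw [Par.due, hd, hg]
    set s2 := (s'.setNat 58 0 d).setReal 42 0 c with hs2
    have h7 : Ag [58] [42] s' s2 :=
      (Ag.refl _ _ s').setNat.setReal
    have e58 : s2.nat 58 0 = d := by simp [hs2]
    have e42 : s2.real 42 0 = c := by simp [hs2]
    have e68 : s2.nat 68 0 = cdiv (P.rs j) g * g + b * g := by rw [h7.nat 68, h5]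
    clear_value s2
    have h8 := h6.ag h7
    have hx8 := hx4.ag h7
    apply wp_cons
    have hT' := hT hc
    refine (settleAll_spec (f := P.flow k b) hF h8 hsm ?_ hq ?_ hj hx8 e58 e42 le_rfl rfl).mono ?_
    · rintro y (hy | ⟨a, ha, hy⟩)
      exacts [hS hy, hT' ⟨a, by omega, hy⟩]
    · intro τ hτ y hy
      exact hT' ⟨b, hb, τ, hτ, by rwa [hdue]⟩
    rintro s3 ⟨h9, h10⟩
    have h11 : Ag (58 :: 68 :: 69 :: 70 :: 71 :: emArr) [40, 42] s1 s3 :=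
      (h4.trans h7).trans h9
    apply wp_cons_nat
    apply wp_nil
    have f68 : s3.nat 68 0 = cdiv (P.rs j) g * g + b * g := by rw [h9.nat 68, e68]
    have f66 : s3.nat 66 0 = g := by rw [h11.nat 66, g66]
    simp only [eval, f68, f66]
    refine ⟨h11.setNat, by simp [Nat.add_mul, add_assoc],
      h10.setNat.congr fun y => ?_⟩
    simp only [mem_union, mem_ofPred_eq, lt_succ_iff_lt_or_eq (n := b)]
    constructor
    · rintro ((h5 | ⟨a, ha, h5⟩) | h5)
      exacts [.inl h5, .inr ⟨a, .inl ha, h5⟩, .inr ⟨b, .inr rfl, by rwa [hdue]⟩]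
    · rintro (h12 | ⟨a, ha | rfl, h12⟩)
      exacts [.inl (.inl h12), .inl (.inr ⟨a, ha, h12⟩), .inr (by rwa [hdue] at h12)]
  · rintro s2 ⟨h4, h5, h6⟩
    apply wp_cons_nat
    apply wp_cons_real
    apply wp_nil
    simp only [eval, RExpr.eval, setNat_real, h4.nat 66, g66, h4.real 43,
      g43]
    have h7 : Ag (58 :: 66 :: 68 :: 69 :: 70 :: 71 :: emArr) [40, 42, 43] s s2 :=
      h1.weaken.trans h4
    refine ⟨h7.setNat.setReal, .inl ⟨hc, ?_, ?_,
      h6.setNat.setReal⟩⟩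
    · simp [hg, pow_succ]; ring
    · simp [pow_succ]

theorem releaseLoop_spec {q j : ℕ} (hF : Fits P Z) (h : EmSt P now lo l S s)
    (hsm : Small P.n Z T) (hS : S ⊆ T) (hq : q < l.length)
    (hT : {y | ∃ k < P.N, P.R * 2 ^ k ≤ P.N * P.R ∧ y ∈ P.relAt now j l[q] k} ⊆ T) (hj : j < P.n)
    (hR : 1 ≤ P.R) (hrs : P.rs j ≤ P.KH * P.R) (hx : Ctx P lo q j P.V 0 (0, 0, now) s)
    (h66 : s.nat 66 0 = P.R) (h43 : s.real 43 0 = 1) :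
    Wp Z (forN 67 (nv 13) (scaleBody P.E P.tp)) s fun s' => EmSt P now lo l
      (S ∪ {y | ∃ k < P.N, P.R * 2 ^ k ≤ P.N * P.R ∧ y ∈ P.relAt now j l[q] k}) s' := by
  refine wp_for P.N hF.N (fun k s' => ∃ k' ≤ k, (k' = k ∨ P.N * P.R < P.R * 2 ^ k') ∧
    s'.nat 66 0 = P.R * 2 ^ k' ∧ s'.real 43 0 = P.tp ^ k' ∧
    Ag (58 :: 66 :: 67 :: 68 :: 69 :: 70 :: 71 :: emArr) [40, 42, 43] s s' ∧
    EmSt P now lo l (S ∪ {y | ∃ κ < k, P.R * 2 ^ κ ≤ P.N * P.R ∧ y ∈ P.relAt now j l[q] κ}) s')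
    (by simp only [block, Prog.mods, settleAll, forN, scaleBody, ifLe]; decide)
    ⟨0, le_rfl, .inl rfl, by simp [h66], by simp [h43], Ag.refl _ _ _, by simpa using h⟩
    ?_ ?_ ?_ fun s' ⟨k', _, _, _, _, _, h10⟩ => h10
  · rintro k s' v ⟨k', h5, h6, h7, h8, h9, h10⟩
    exact ⟨k', h5, h6, by simpa using h7, h8, h9.setNat,
      h10.setNat⟩
  · rintro k s' ⟨k', h5, h6, h7, h8, h9, h10⟩
    simp [eval, h10.const.N]
  · rintro k s' hk - ⟨k', h5, h6, h7, h8, h9, h10⟩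
    have hsplit : ∀ y, (∃ κ < k + 1, P.R * 2 ^ κ ≤ P.N * P.R ∧ y ∈ P.relAt now j l[q] κ) ↔
        (∃ κ < k, P.R * 2 ^ κ ≤ P.N * P.R ∧ y ∈ P.relAt now j l[q] κ) ∨
        (P.R * 2 ^ k ≤ P.N * P.R ∧ y ∈ P.relAt now j l[q] k) := by
      intro y
      simp only [lt_succ_iff_lt_or_eq (n := k)]
      constructor
      · rintro ⟨κ, h11 | rfl, h12⟩
        exacts [.inl ⟨κ, h11, h12⟩, .inr h12]
      · rintro (⟨κ, h11, h12⟩ | h12)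
        exacts [⟨κ, .inl h11, h12⟩, ⟨k, .inr rfl, h12⟩]
    have hmono : P.R * 2 ^ k' ≤ P.R * 2 ^ k :=
      Nat.mul_le_mul_left _ (Nat.pow_le_pow_right (by norm_num) h5)
    refine (scaleBody_spec hF h10 hsm ?_ hq (fun h11 => ?_) hj hR hrs
      (hx.ag h9) h7 h8).mono ?_
    · rintro y (hy | ⟨κ, hκ, h11, hy⟩)
      exacts [hS hy, hT ⟨κ, by omega, h11, hy⟩]
    · rintro y hy
      exact hT ⟨k', by omega, h11, hy⟩
    · rintro s3 ⟨h11, ⟨h12, h13, h14, h15⟩ | ⟨h12, rfl⟩⟩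
      · obtain rfl : k' = k := by omega
        refine ⟨k' + 1, le_rfl, .inl rfl, h13, h14, h9.trans h11,
          h15.congr fun y => ?_⟩
        simp only [mem_union, mem_ofPred_eq, hsplit, h12, true_and, or_assoc]
      · refine ⟨k', by omega, .inr (by omega), h7, h8, h9, h10.congr fun y => ?_⟩
        simp only [mem_union, mem_ofPred_eq, hsplit,
          show ¬ P.R * 2 ^ k ≤ P.N * P.R by omega, false_and, or_false]

theorem opA_spec {q j : ℕ} (hF : Fits P Z) (h : EmSt P now lo l S s)
    (hsm : Small P.n Z T) (hS : S ⊆ T) (hq : q < l.length)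
    (hT : P.childA now j l[q] ⊆ T) (hj : j < P.n) (hR : 1 ≤ P.R)
    (hrs : P.rs j ≤ P.KH * P.R) (hV : ∀ j < P.n, l[q].R j ≤ P.V)
    (h57 : s.nat 57 0 = lo + q) (h55 : s.nat 55 0 = j) :
    Wp Z (opA P.E P.tp) s fun s' => EmSt P now lo l (S ∪ P.childA now j l[q]) s' := by
  have hx := h.data hq
  rw [opA, loadFields]
  simp only [cons_append, nil_append]
  iterate 5 apply wp_cons_nat
  apply wp_cons_real
  iterate 2 apply wp_cons_nat
  simp only [eval, RExpr.eval, setNat_nat, setNat_real, h57, h55, hx.base,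
    hx.D j hj, hx.M j hj, hx.R j hj, hx.L j hj, hx.cost, reduceEqDiff, false_and, if_false,
    and_self, if_true]
  set s1 := (((((((s.setNat 76 0 ((lo + q) * P.n)).setNat 58 0 (l[q].D j)).setNat 59 0
    (l[q].M j)).setNat 60 0 (l[q].R j)).setNat 61 0 (l[q].L j)).setReal 42 0 l[q].cost).setNat
    62 0 0).setNat 63 0 0 with hs1
  have h1 : Ag [76, 58, 59, 60, 61, 62, 63] [42] s s1 :=
    (Ag.refl _ _ s).setNat.setNat.setNat.setNat.setNat.setReal.setNat.setNat
  have e76 : s1.nat 76 0 = (lo + q) * P.n := by simp [hs1]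
  have e58 : s1.nat 58 0 = l[q].D j := by simp [hs1]
  have e59 : s1.nat 59 0 = l[q].M j := by simp [hs1]
  have e60 : s1.nat 60 0 = l[q].R j := by simp [hs1]
  have e61 : s1.nat 61 0 = l[q].L j := by simp [hs1]
  have e62 : s1.nat 62 0 = 0 := by simp [hs1]
  have e63 : s1.nat 63 0 = 0 := by simp [hs1]
  have e42 : s1.real 42 0 = l[q].cost := by simp [hs1]
  clear_value s1
  have h2 := h.ag h1
  have e55 : s1.nat 55 0 = j := by rw [h1.nat 55, h55]
  have e57 : s1.nat 57 0 = lo + q := by rw [h1.nat 57, h57]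
  have hsm' := hsm.mono hS
  have hkeep : ((l[q].D j = 0 ∧ now < P.rs j) ∨ (l[q].D j ≠ 0 ∧ (l[q].R j = 0 ∨
      (now < l[q].D j ∧ l[q].M j ≠ 0)))) → Wp Z emit s1 fun s' =>
      Wp Z (block []) s' fun s' => EmSt P now lo l (S ∪ P.childA now j l[q]) s' := fun hcase =>
    (emit_em (l[q].fh j) (act := (0, 0, now)) hF.n h2 hsm' hq hj ⟨e57, e55, e58, e59, e60, e61,
      e42, e62, e63, h2.slot⟩).mono fun s' h3 => wp_nil (h3.2.congr fun y => by
        rw [Rec.upd_self]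
        simp only [Par.childA, mem_union, mem_ofPred_eq, mem_singleton_iff]
        constructor
        · rintro (h4 | h4)
          exacts [.inl h4, .inr (.inl ⟨hcase, h4⟩)]
        · rintro (h4 | ⟨-, h4⟩ | ⟨h4, h5, -⟩ | ⟨h4, h5, h6, h7, -⟩)
          · exact .inl h4
          · exact .inr h4
          · exfalso; omega
          · exfalso; omega)
  apply wp_cons
  refine wp_ite (fun c1 => wp_ite (fun c2 => ?_) fun c2 => wp_ifLe (fun c3 => wp_ite (fun c4 => ?_)
    fun c4 => ?_) fun c3 => ?_) fun c1 => wp_ite (fun c2 => ?_) fun c2 => ?_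
  all_goals simp only [Cond.eval, eval, e58] at c1
  all_goals try simp only [Cond.eval, eval, e60, e55, h2.slot, h2.const.rs j hj] at c2
  all_goals try simp only [eval, e58, h2.slot] at c3
  all_goals try simp only [Cond.eval, eval, e59] at c4
  · exact hkeep (.inr ⟨by omega, .inl (by omega)⟩)
  · exact hkeep (.inr ⟨by omega, .inr ⟨by omega, by omega⟩⟩)
  · apply wp_cons_nat
    simp only [eval, e60]
    set s2 := s1.setNat 65 0 (l[q].R j) with hs2
    have h3 : Ag [65] [] s1 s2 := (Ag.refl _ _ s1).setNat
    have e65 : s2.nat 65 0 = l[q].R j := by simp [hs2]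
    clear_value s2
    have hmem : ∀ y, y ∈ P.childA now j l[q] ↔ ∃ τ < P.m + 1,
        y ∈ P.typeAt l[q] j (l[q].D j) (l[q].R j) (l[q].L j) l[q].cost (l[q].fh j) (0, 0, now) τ := by
      intro y
      simp only [Par.childA, mem_ofPred_eq]
      constructor
      · rintro (⟨h4, -⟩ | ⟨h4, -⟩ | ⟨-, -, -, -, h4⟩)
        · exfalso; omega
        · exfalso; omega
        · exact h4
      · exact fun h4 => .inr (.inr ⟨by omega, by omega, by omega, by omega, h4⟩)
    apply wp_cons
    refine (settleAll_spec (f := l[q].fh j) (act := (0, 0, now)) hF (h2.ag h3) hsm hS hq (fun τ hτ y hy => hT ((hmem y).2 ⟨τ, hτ, hy⟩)) hj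
      ⟨by rw [h3.nat 57, e57], by rw [h3.nat 76, e76],
      by rw [h3.nat 55, e55], by rw [h3.nat 61, e61],
      by rw [h3.nat 62, e62], by rw [h3.nat 63, e63], e65⟩
      (by rw [h3.nat 58, e58]) (by rw [h3.real 42, e42]) (hV j hj) rfl).mono ?_
    rintro s3 ⟨-, h4⟩
    refine wp_nil (wp_nil (h4.congr fun y => ?_))
    simp only [mem_union, hmem, mem_ofPred_eq]
  · refine wp_nil (h2.congr fun y => ⟨.inl, ?_⟩)
    simp only [Par.childA, mem_union, mem_ofPred_eq]
    rintro (h4 | ⟨h4, -⟩ | ⟨h4, -⟩ | ⟨h4, h5, h6, h7, -⟩)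
    · exact h4
    · exfalso; omega
    · exfalso; omega
    · exfalso; omega
  · have hD : l[q].D j = 0 := by omega
    iterate 3 apply wp_cons_nat
    apply wp_cons_real
    simp only [eval, RExpr.eval, setNat_nat, h2.const.V, h2.const.R, reduceEqDiff,
      false_and, if_false]
    set s2 := (((s1.setNat 61 0 0).setNat 65 0 P.V).setNat 66 0 P.R).setReal 43 0 1 with hs2
    have h3 : Ag [61, 65, 66] [43] s1 s2 :=
      (Ag.refl _ _ s1).setNat.setNat.setNat.setReal
    have e61 : s2.nat 61 0 = 0 := by simp [hs2]
    have e65 : s2.nat 65 0 = P.V := by simp [hs2]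
    have e66 : s2.nat 66 0 = P.R := by simp [hs2]
    have e43 : s2.real 43 0 = 1 := by simp [hs2]
    clear_value s2
    have hx3 : Ctx P lo q j P.V 0 (0, 0, now) s2 :=
      ⟨by rw [h3.nat 57, e57], by rw [h3.nat 76, e76],
      by rw [h3.nat 55, e55], e61,
      by rw [h3.nat 62, e62], by rw [h3.nat 63, e63], e65⟩
    have h4 := h2.ag h3
    have hmem : ∀ y, y ∈ P.childA now j l[q] ↔ ∃ k < P.N, P.R * 2 ^ k ≤ P.N * P.R ∧
        y ∈ P.relAt now j l[q] k := by
      intro y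
      simp only [Par.childA, Par.relAt, mem_ofPred_eq]
      constructor
      · rintro (⟨h5, -⟩ | ⟨-, -, k, a, τ, h5, h6, h7, h8, h9⟩ | ⟨h5, -⟩)
        · exfalso; omega
        · exact ⟨k, h5, h6, a, h7, τ, h8, h9⟩
        · exfalso; omega
      · rintro ⟨k, h5, h6, a, h7, τ, h8, h9⟩
        exact .inr (.inl ⟨hD, c2, k, a, τ, h5, h6, h7, h8, h9⟩)
    apply wp_cons
    refine (releaseLoop_spec hF h4 hsm hS hq (fun y hy => hT ((hmem y).2 hy)) hj hR hrs hx3 e66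
      e43).mono fun s3 h5 => wp_nil (wp_nil (h5.congr fun y => ?_))
    simp only [mem_union, mem_ofPred_eq, hmem]
  · exact hkeep (.inl ⟨by omega, by omega⟩)

end

/-! ### Verification: the layers -/

section

variable {P : Par} {Z now lo : ℕ} {l : List Rec} {S T : Set Rec} {s s' : Memory}

/-- The partial schedules that arise by running job `j` on machine `i`. -/
def Par.runSet (P : Par) (now i j : ℕ) (x : Rec) : Set Rec :=
  {y | 1 ≤ x.R j ∧ ((x.M j = i + 1 ∧
        y = x.upd j (x.D j) (x.M j) (x.R j - 1) (x.L j) x.cost (x.fh j) (j + 1, i, now)) ∨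
      (x.M j = 0 ∧ x.L j ≤ now ∧ 1 ≤ P.v i j ∧
        y = x.upd j (x.D j) (x.M j) (x.R j - P.v i j) (now + 1) x.cost (x.fh j)
          (j + 1, i, now)))}

theorem mem_childB {i : ℕ} {x y : Rec} : y ∈ P.childB now i x ↔
    (∃ j < P.n, y ∈ P.runSet now i j x) ∨ y = x.keep (0, i, now) := Iff.rfl

theorem runJob_spec {q i j : ℕ} (hF : Fits P Z) (h : EmSt P now lo l S s) (hsm : Small P.n Z S)
    (hq : q < l.length) (hj : j < P.n) (hi : i < P.m)
    (h57 : s.nat 57 0 = lo + q) (h55 : s.nat 55 0 = j) (h56 : s.nat 56 0 = i)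
    (h63 : s.nat 63 0 = i) :
    Wp Z runJob s fun s' => Ag (58 :: 61 :: 62 :: 76 :: emArr) [40, 42] s s' ∧
      EmSt P now lo l (S ∪ P.runSet now i j l[q]) s' := by
  have hx := h.data hq
  rw [runJob, loadFields]
  simp only [cons_append, nil_append]
  iterate 5 apply wp_cons_nat
  apply wp_cons_real
  apply wp_cons_nat
  simp only [eval, RExpr.eval, setNat_nat, setNat_real, setReal_nat, h57, h55, hx.base,
    hx.D j hj, hx.M j hj, hx.R j hj, hx.L j hj, hx.cost, reduceEqDiff, false_and, if_false,
    and_self, if_true]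
  set s1 := ((((((s.setNat 76 0 ((lo + q) * P.n)).setNat 58 0 (l[q].D j)).setNat 59 0
    (l[q].M j)).setNat 60 0 (l[q].R j)).setNat 61 0 (l[q].L j)).setReal 42 0 l[q].cost).setNat
    62 0 (j + 1) with hs1
  have h1 : Ag (58 :: 61 :: 62 :: 76 :: emArr) [40, 42] s s1 :=
    (Ag.refl _ _ s).setNat.setNat.setNat.setNat.setNat.setReal.setNat
  have h1' : Ag [76, 58, 59, 60, 61, 62] [42] s s1 :=
    (Ag.refl _ _ s).setNat.setNat.setNat.setNat.setNat.setReal.setNat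
  have e58 : s1.nat 58 0 = l[q].D j := by simp [hs1]
  have e59 : s1.nat 59 0 = l[q].M j := by simp [hs1]
  have e60 : s1.nat 60 0 = l[q].R j := by simp [hs1]
  have e61 : s1.nat 61 0 = l[q].L j := by simp [hs1]
  have e62 : s1.nat 62 0 = j + 1 := by simp [hs1]
  have e42 : s1.real 42 0 = l[q].cost := by simp [hs1]
  clear_value s1
  have h2 := h.ag h1'
  have e55 : s1.nat 55 0 = j := by rw [h1.nat 55, h55]
  have e56 : s1.nat 56 0 = i := by rw [h1.nat 56, h56]
  have e57 : s1.nat 57 0 = lo + q := by rw [h1.nat 57, h57]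
  have e63 : s1.nat 63 0 = i := by rw [h1.nat 63, h63]
  have hno : (¬ (1 ≤ l[q].R j ∧ (l[q].M j = i + 1 ∨ (l[q].M j = 0 ∧ l[q].L j ≤ now ∧
      1 ≤ P.v i j)))) → Wp Z (block []) s1 fun s' => Ag (58 :: 61 :: 62 :: 76 :: emArr) [40, 42] s s' ∧
      EmSt P now lo l (S ∪ P.runSet now i j l[q]) s' := fun hcase =>
    wp_nil ⟨h1, h2.congr fun y => ⟨.inl, by
      simp only [Par.runSet, mem_union, mem_ofPred_eq]
      tauto⟩⟩
  apply wp_cons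
  refine wp_ifLe (fun c1 => wp_ite (fun c2 => wp_ifEq (fun c3 => ?_) fun c3 => ?_) fun c2 =>
    wp_ifLe (fun c3 => ?_) fun c3 => ?_) fun c1 => ?_
  all_goals simp only [eval, e60] at c1
  all_goals try simp only [Cond.eval, eval, e59] at c2
  all_goals try simp only [eval, e59, e56, e61, h2.slot] at c3
  · apply wp_cons_nat
    simp only [eval, e60]
    have h3 : Ag [60] [] s1 (s1.setNat 60 0 (l[q].R j - 1)) :=
      (Ag.refl _ _ s1).setNat
    apply wp_cons
    refine (emit_em (d := l[q].D j) (i := l[q].M j) (r := l[q].R j - 1) (e := l[q].L j)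
      (c := l[q].cost) (l[q].fh j) (act := (j + 1, i, now)) hF.n (h2.setNat) hsm hq hj
      ⟨by simp [e57], by simp [e55], by simp [e58], by simp [e59], by simp, by simp [e61],
      by simp [e42], by simp [e62], by simp [e63], by simp [h2.slot]⟩).mono fun s' h4 =>
      wp_nil (wp_nil ⟨(h1.trans h3).trans h4.1, h4.2.congr fun y => ?_⟩)
    simp only [Par.runSet, mem_union, mem_ofPred_eq, mem_singleton_iff]
    constructor
    · rintro (h5 | h5)
      exacts [.inl h5, .inr ⟨c1, .inl ⟨c3, h5⟩⟩]
    · rintro (h5 | ⟨-, ⟨-, h5⟩ | ⟨h5, -⟩⟩)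
      exacts [.inl h5, .inr h5, absurd h5 (by omega)]
  · exact hno (by omega)
  · apply wp_cons_nat
    simp only [eval, e56, e55, h2.const.row i hi, h2.const.v i hi j hj]
    set s2 := s1.setNat 74 0 (P.v i j) with hs2
    have h3 : Ag [74] [] s1 s2 := (Ag.refl _ _ s1).setNat
    have e74 : s2.nat 74 0 = P.v i j := by simp [hs2]
    clear_value s2
    have h4 := h2.ag h3
    apply wp_cons
    refine wp_ifLe (fun c4 => ?_) fun c4 => wp_nil (wp_nil
      ⟨h1.trans h3, h4.congr fun y => ⟨.inl, ?_⟩⟩)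
    all_goals simp only [eval, e74] at c4
    · apply wp_cons_nat
      apply wp_cons_nat
      simp only [eval, setNat_nat, e74, h4.slot, h3.nat 60, e60, reduceEqDiff,
        false_and, if_false]
      set s3 := (s2.setNat 60 0 (l[q].R j - P.v i j)).setNat 61 0 (now + 1) with hs3
      have h5 : Ag [60, 61] [] s2 s3 :=
        (Ag.refl _ _ s2).setNat.setNat
      have f60 : s3.nat 60 0 = l[q].R j - P.v i j := by simp [hs3]
      have f61 : s3.nat 61 0 = now + 1 := by simp [hs3]
      clear_value s3
      have h6 := h4.ag h5
      have h7 : Ag [60, 61, 74] [] s1 s3 := h3.weaken.trans h5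
      apply wp_cons
      refine (emit_em (l[q].fh j) (act := (j + 1, i, now)) hF.n h6 hsm hq hj
        ⟨by rw [h7.nat 57, e57], by rw [h7.nat 55, e55],
        by rw [h7.nat 58, e58], by rw [h7.nat 59, e59], f60, f61,
        by rw [h7.real 42, e42], by rw [h7.nat 62, e62],
        by rw [h7.nat 63, e63], h6.slot⟩).mono fun s' h8 => wp_nil (wp_nil
        (wp_nil ⟨(h1.trans h7).trans h8.1, h8.2.congr fun y => ?_⟩))
      simp only [Par.runSet, mem_union, mem_ofPred_eq, mem_singleton_iff]
      constructor
      · rintro (h5 | h5)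
        exacts [.inl h5, .inr ⟨c1, .inr ⟨by omega, c3, c4, h5⟩⟩]
      · rintro (h5 | ⟨-, ⟨h5, -⟩ | ⟨-, -, -, h5⟩⟩)
        exacts [.inl h5, absurd h5 (by omega), .inr h5]
    · simp only [Par.runSet, mem_union, mem_ofPred_eq]
      rintro (h5 | ⟨-, ⟨h5, -⟩ | ⟨-, -, h5, -⟩⟩)
      exacts [h5, absurd h5 (by omega), absurd h5 c4]
  · exact hno (by omega)
  · exact hno (by omega)

theorem opB_spec {q i : ℕ} (hF : Fits P Z) (h : EmSt P now lo l S s) (hsm : Small P.n Z T)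
    (hS : S ⊆ T) (hq : q < l.length) (hT : P.childB now i l[q] ⊆ T) (hn : 0 < P.n) (hi : i < P.m)
    (h57 : s.nat 57 0 = lo + q) (h56 : s.nat 56 0 = i) :
    Wp Z opB s fun s' => EmSt P now lo l (S ∪ P.childB now i l[q]) s' := by
  apply wp_cons_nat
  simp only [eval, h56]
  set s1 := s.setNat 63 0 i with hs1
  have h1 : Ag [63] [] s s1 := (Ag.refl _ _ s).setNat
  have e63 : s1.nat 63 0 = i := by simp [hs1]
  clear_value s1
  have e57 : s1.nat 57 0 = lo + q := by rw [h1.nat 57, h57]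
  have e56 : s1.nat 56 0 = i := by rw [h1.nat 56, h56]
  apply wp_cons
  refine wp_for P.n hF.n (fun k s' => Ag (55 :: 58 :: 61 :: 62 :: 76 :: emArr) [40, 42] s1 s' ∧
      EmSt P now lo l (S ∪ {y | ∃ j < k, y ∈ P.runSet now i j l[q]}) s') (by decide)
    ⟨Ag.refl _ _ _, by simpa using h.ag h1⟩ ?_ ?_ ?_ ?_
  · rintro k s' v ⟨h2, h3⟩
    exact ⟨h2.setNat, h3.setNat⟩
  · rintro k s' ⟨h2, h3⟩
    simp [eval, h3.const.n]
  · rintro k s' hk h55 ⟨h2, h3⟩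
    refine (runJob_spec hF h3 (hsm.mono ?_) hq hk hi (by rw [h2.nat 57, e57]) h55
      (by rw [h2.nat 56, e56]) (by rw [h2.nat 63, e63])).mono ?_
    · rintro y (hy | ⟨j, hj, hy⟩)
      exacts [hS hy, hT (.inl ⟨j, by omega, hy⟩)]
    · rintro s2 ⟨h4, h5⟩
      refine ⟨h2.trans h4, h5.congr fun y => ?_⟩
      simp only [mem_union, mem_ofPred_eq, lt_succ_iff_lt_or_eq (n := k)]
      constructor
      · rintro ((h6 | ⟨j, hj, h6⟩) | h6)
        exacts [.inl h6, .inr ⟨j, .inl hj, h6⟩, .inr ⟨k, .inr rfl, h6⟩]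
      · rintro (h6 | ⟨j, hj | rfl, h6⟩)
        exacts [.inl (.inl h6), .inl (.inr ⟨j, hj, h6⟩), .inr h6]
  · rintro s2 ⟨h2, h3⟩
    have hx := h3.data hq
    have f57 : s2.nat 57 0 = lo + q := by rw [h2.nat 57, e57]
    have f63 : s2.nat 63 0 = i := by rw [h2.nat 63, e63]
    rw [loadFields]
    apply wp_cons_nat
    apply wp_cons
    simp only [cons_append, nil_append]
    iterate 5 apply wp_cons_nat
    apply wp_cons_real
    apply wp_cons_nat
    simp only [eval, RExpr.eval, setNat_nat, setNat_real, f57, hx.base,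
      hx.D 0 hn, hx.M 0 hn, hx.R 0 hn, hx.L 0 hn, hx.cost, reduceEqDiff, false_and, if_false,
      and_self, if_true]
    set s3 := (((((((s2.setNat 55 0 0).setNat 76 0 ((lo + q) * P.n)).setNat 58 0
      (l[q].D 0)).setNat 59 0 (l[q].M 0)).setNat 60 0 (l[q].R 0)).setNat 61 0
      (l[q].L 0)).setReal 42 0 l[q].cost).setNat 62 0 0 with hs3
    have h4 : Ag [55, 76, 58, 59, 60, 61, 62] [42] s2 s3 :=
      (Ag.refl _ _ s2).setNat.setNat.setNat.setNat.setNat.setNat.setReal.setNat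
    have g55 : s3.nat 55 0 = 0 := by simp [hs3]
    have g58 : s3.nat 58 0 = l[q].D 0 := by simp [hs3]
    have g59 : s3.nat 59 0 = l[q].M 0 := by simp [hs3]
    have g60 : s3.nat 60 0 = l[q].R 0 := by simp [hs3]
    have g61 : s3.nat 61 0 = l[q].L 0 := by simp [hs3]
    have g62 : s3.nat 62 0 = 0 := by simp [hs3]
    have g42 : s3.real 42 0 = l[q].cost := by simp [hs3]
    clear_value s3
    have h5 := h3.ag h4
    apply wp_cons
    refine (emit_em (l[q].fh 0) (act := (0, i, now)) hF.n h5 (hsm.mono ?_) hq hn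
      ⟨by rw [h4.nat 57, f57], g55, g58, g59, g60, g61, g42, g62,
      by rw [h4.nat 63, f63], h5.slot⟩).mono ?_
    · rintro y (hy | ⟨j, hj, hy⟩)
      exacts [hS hy, hT (.inl ⟨j, by omega, hy⟩)]
    · rintro s4 ⟨-, h6⟩
      refine wp_nil (wp_nil (h6.congr fun y => ?_))
      rw [Rec.upd_self]
      simp only [mem_union, mem_childB, mem_ofPred_eq, mem_singleton_iff, or_assoc]

/-- Processing a layer: if `op` inserts the successors of a record, then `layerStep op` computes the
next layer. -/
theorem layerStep_spec {op : Prog} {child : Rec → Set Rec} {K : Memory → Prop}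
    (hop : ∀ q, (hq : q < l.length) → ∀ S s, S ⊆ {y | ∃ x ∈ l, y ∈ child x} → EmSt P now lo l S s →
      s.nat 57 0 = lo + q → K s → Wp Z op s fun s' => K s' ∧ EmSt P now lo l (S ∪ child l[q]) s')
    (hK : ∀ a ∈ [50, 51, 57, 94], ∀ v s, K s → K (s.setNat a 0 v)) (h94 : 94 ∉ op.mods)
    (hl : l.length ≤ Z) (h : St P now lo l [] s) (hs : K s) :
    Wp Z (layerStep op) s fun s' => K s' ∧ ∃ l', St P now (lo + l.length) l' [] s' ∧
      Good P.n l' {y | ∃ x ∈ l, y ∈ child x} := by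
  apply wp_cons
  refine wp_for l.length hl (fun k s' => K s' ∧
    EmSt P now lo l {y | ∃ q, ∃ hq : q < l.length, q < k ∧ y ∈ child l[q]} s')
    (by simpa [block, Prog.mods] using h94)
    ⟨hs, [], h, by simpa using good_nil P.n⟩ ?_ ?_ ?_ ?_
  · rintro k s' v ⟨h1, h2⟩
    exact ⟨hK 94 (by simp) _ _ h1, h2.setNat⟩
  · rintro k s' ⟨-, acc, h1, -⟩
    simp [eval, h1.hi, h1.lo_eq]
  · rintro k s' hk hk' ⟨h1, h2⟩
    have h50 : s'.nat 50 0 = lo := by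
      obtain ⟨acc, h3, -⟩ := h2
      exact h3.lo_eq
    apply wp_cons_nat
    simp only [eval, h50, hk']
    apply wp_cons
    refine (hop k hk _ _ ?_ (h2.setNat) (by simp) (hK 57 (by simp) _ _ h1)).mono ?_
    · rintro y ⟨q, hq, -, hy⟩
      exact ⟨_, getElem_mem hq, hy⟩
    · rintro s2 ⟨h3, h4⟩
      refine wp_nil ⟨h3, h4.congr fun y => ?_⟩
      simp only [mem_union, mem_ofPred_eq]
      constructor
      · rintro (⟨q, hq, hqk, h5⟩ | h5)
        exacts [⟨q, hq, by omega, h5⟩, ⟨k, hk, by omega, h5⟩]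
      · rintro ⟨q, hq, hqk, h5⟩
        rcases lt_succ_iff_lt_or_eq.1 hqk with h6 | rfl
        exacts [.inl ⟨q, hq, h6, h5⟩, .inr h5]
  · rintro s1 ⟨h1, acc, h2, h3⟩
    iterate 2 apply wp_cons_nat
    apply wp_nil
    simp only [eval, setNat_nat, h2.hi, h2.nh, reduceEqDiff, false_and, if_false]
    have h4 : Ag [50, 51] [] s1 ((s1.setNat 50 0 (lo + l.length)).setNat 51 0
        (lo + l.length + acc.length)) :=
      (Ag.refl _ _ s1).setNat.setNat
    refine ⟨hK 51 (by simp) _ _ (hK 50 (by simp) _ _ h1), acc, ?_, ?_⟩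
    · refine ⟨h2.const.congr (fun a ha => h4.1 a ?_) (h4.2 _ (by simp)), by simp, by simp,
        by simp [h2.nh], by simp [h2.nb], by simp [h2.now], fun q hq => ⟨(h2.new q hq).1.ag h4, (h2.new q hq).2.1.congr (lo + l.length)
        (.inr (h2.new q hq).2.2) fun id' _ => ?_⟩, by simp⟩
      · simp at ha ⊢
        omega
      · simp
    · convert h3 using 1
      ext y
      constructor
      · rintro ⟨x, hx, hy⟩
        obtain ⟨q, hq, rfl⟩ := List.mem_iff_getElem.1 hx
        exact ⟨q, hq, hq, hy⟩
      · rintro ⟨q, hq, -, hy⟩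
        exact ⟨_, getElem_mem hq, hy⟩

theorem St.setSlot {acc : List Rec} (h : St P now lo l acc s) (x : ℕ) :
    St P x lo l acc (s.setNat 54 0 x) := by
  have h4 : Ag [54] [] s (s.setNat 54 0 x) := (Ag.refl _ _ s).setNat
  have hd : ∀ id x, RepData s P.n id x → RepData (s.setNat 54 0 _) P.n id x := fun id x hx =>
    hx.ag h4
  have hc : ∀ id h, Chain s id h → Chain (s.setNat 54 0 x) id h := fun id h hx =>
    hx.congr (id + 1) (.inl (by omega)) fun id' _ => by simp
  refine ⟨h.const.congr (fun a ha => h4.1 a ?_) rfl, by simp [h.lo_eq], by simp [h.hi],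
    by simp [h.nh], by simp [h.nb], by simp, fun q hq => ⟨hd _ _ (h.cur q hq).1, hc _ _
    (h.cur q hq).2⟩, fun q hq => ⟨hd _ _ (h.new q hq).1, hc _ _ (h.new q hq).2.1, ?_⟩⟩
  · simp at ha ⊢
    omega
  · simpa using (h.new q hq).2.2

theorem setNat_setNat (s : Memory) (a i v w : ℕ) : (s.setNat a i v).setNat a i w = s.setNat a i w := by
  simp [Memory.setNat]

set_option maxRecDepth 5000 in
theorem notMem_opA (E : ℕ) (tp : ℝ) : ∀ a ∈ [54, 55, 94], a ∉ (opA E tp).mods :=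
  of_decide_eq_true rfl

theorem notMem_opB : ∀ a ∈ [54, 56, 94], a ∉ opB.mods := of_decide_eq_true rfl

theorem length_childA {now j : ℕ} {x y : Rec} (h : y ∈ P.childA now j x) :
    y.hist.length = x.hist.length + 1 := by
  have ht : ∀ {d r l' τ c f act}, y ∈ P.typeAt x j d r l' c f act τ →
      y.hist.length = x.hist.length + 1 := by
    rintro d r l' τ c f act (⟨-, -, rfl⟩ | ⟨-, -, rfl⟩) <;> rfl
  rcases h with ⟨-, rfl⟩ | ⟨-, -, k, a, τ, -, -, -, -, h⟩ | ⟨-, -, -, -, τ, -, h⟩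
  exacts [rfl, ht h, ht h]

theorem length_childB {now i : ℕ} {x y : Rec} (h : y ∈ P.childB now i x) :
    y.hist.length = x.hist.length + 1 := by
  rcases h with ⟨j, -, -, ⟨-, rfl⟩ | ⟨-, -, -, rfl⟩⟩ | rfl <;> rfl

/-- The dynamic program computes a layer that satisfies the invariant for the last slot. -/
theorem mainLoop_spec {phi : ℝ → ℝ} (hF : Fits P Z) (hX : P.X ≤ Z) (hn : 0 < P.n) (hR : 1 ≤ P.R)
    (hV : 1 ≤ P.V) (hphi : ∀ k a, P.kap a * P.tp ^ k = phi (P.flow k a))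
    (hrs : ∀ j < P.n, P.rs j ≤ P.KH * P.R) (h : St P 0 lo [Rec.root] [] s) :
    Wp Z (mainLoop P.E P.tp) s fun s' => ∃ now lo l, St P now lo l [] s' ∧
      LInv P phi P.H P.n P.m l ∧ ∀ x ∈ l, x.hist.length ≤ (P.H + 1) * (P.n + P.m) := by
  have len : ∀ {now jj i l}, now ≤ P.H → LInv P phi now jj i l → l.length ≤ Z := fun h1 h2 =>
    (length_le_X hR h1 h2.sound h2.pw).trans hX
  refine wp_for (P.H + 1) hF.H (fun k s' => ∃ lo l, (∀ x, St P x lo l [] (s'.setNat 54 0 x)) ∧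
    (∀ x ∈ l, x.hist.length ≤ k * (P.n + P.m)) ∧
    (k ≤ P.H → LInv P phi k 0 0 l) ∧ (k = P.H + 1 → LInv P phi P.H P.n P.m l))
    (by
      have h1 := notMem_opA P.E P.tp 54 (by simp)
      have h2 := notMem_opB 54 (by simp)
      simp only [block, Prog.mods, layerStep, forN, mem_append, h1, h2]
      decide)
    ⟨lo, _, h.setSlot, by simp [Rec.root], fun _ => linv_root P phi, by omega⟩ ?_ ?_ ?_ ?_
  · rintro k s' v ⟨lo, l, h1, h2⟩
    exact ⟨lo, l, by simpa only [setNat_setNat] using h1, h2⟩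
  · rintro k s' ⟨lo, l, h1, h2⟩
    simpa [eval] using (h1 0).const.H
  · rintro k s' hk h54 ⟨lo, l, h1, hlen, h2, -⟩
    have h1 := h1 k
    rw [← h54, setNat_self, h54] at h1
    apply wp_cons
    refine wp_for P.n hF.n (fun jj s' => ∃ lo l, St P k lo l [] s' ∧ LInv P phi k jj 0 l ∧
      ∀ x ∈ l, x.hist.length ≤ k * (P.n + P.m) + jj)
      (by
        have h1 := notMem_opA P.E P.tp 55 (by simp)
        simp only [block, Prog.mods, layerStep, forN, mem_append, h1]
        decide)
      ⟨lo, l, h1, h2 (by omega), hlen⟩ ?_ ?_ ?_ ?_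
    · rintro jj s' v ⟨lo, l, h3, h4⟩
      exact ⟨lo, l, h3.setNat (by decide) _ _, h4⟩
    · rintro jj s' ⟨lo, l, h3, h4⟩
      simp [eval, h3.const.n]
    · rintro jj s' hjj h55 ⟨lo, l, h3, h4, hlen⟩
      have hsm : Small P.n Z {y | ∃ x ∈ l, y ∈ P.childA k jj x} := fun acc h5 h6 =>
        (length_le_X (phi := phi) (now := k) (jj := jj + 1) (i := 0) hR (by omega) (fun y hy => by
          obtain ⟨x, hx, hy⟩ := h5 y hy
          exact (h4.sound x hx).childA hjj hR hphi hy) h6).trans hX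
      refine (layerStep_spec (child := P.childA k jj) (K := fun s => s.nat 55 0 = jj) ?_ ?_ ?_
        (len (by omega) h4) h3 h55).mono ?_
      · intro q hq S s hS h5 h57 h55
        refine (opA_spec hF h5 hsm hS hq (fun y hy => ⟨_, getElem_mem hq, hy⟩) hjj hR
          (hrs jj hjj) (fun j hj => (h4.sound _ (getElem_mem hq)).le_V j hj) h57
          h55).mono_frame fun s' hs h6 => ⟨?_, h6⟩
        rw [hs.1 55 (notMem_opA _ _ 55 (by simp)), h55]
      · intro a ha v s hs
        rw [setNat_nat_of_ne _ _ _ (by rintro rfl; simp at ha), hs]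
      · exact notMem_opA _ _ 94 (by simp)
      · rintro s2 ⟨-, l', h5, h6⟩
        refine ⟨_, l', h5, h4.childA hjj hR hV hphi h6, fun y hy => ?_⟩
        obtain ⟨x, hx, hy⟩ := h6.mem y hy
        have := hlen x hx
        have := length_childA hy
        omega
    · rintro s1 ⟨lo, l, h3, h4, hlen⟩
      apply wp_cons
      refine wp_for P.m (by have := hF.m; omega) (fun i s' => ∃ lo l, St P k lo l [] s' ∧
        LInv P phi k P.n i l ∧ ∀ x ∈ l, x.hist.length ≤ k * (P.n + P.m) + P.n + i)
        (by
          have h1 := notMem_opB 56 (by simp)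
          simp only [block, Prog.mods, layerStep, forN, mem_append, h1]
          decide)
        ⟨lo, l, h3, h4, hlen⟩ ?_ ?_ ?_ ?_
      · rintro jj s' v ⟨lo, l, h3, h4⟩
        exact ⟨lo, l, h3.setNat (by decide) _ _, h4⟩
      · rintro jj s' ⟨lo, l, h3, h4⟩
        simp [eval, h3.const.m]
      · rintro i s' hi h56 ⟨lo, l, h3, h4, hlen⟩
        have hsm : Small P.n Z {y | ∃ x ∈ l, y ∈ P.childB k i x} := fun acc h5 h6 =>
          (length_le_X (phi := phi) (now := k) (jj := P.n) (i := i + 1) hR (by omega) (fun y hy => by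
            obtain ⟨x, hx, hy⟩ := h5 y hy
            exact (h4.sound x hx).childB hi hy) h6).trans hX
        refine (layerStep_spec (child := P.childB k i) (K := fun s => s.nat 56 0 = i) ?_ ?_ ?_
          (len (by omega) h4) h3 h56).mono ?_
        · intro q hq S s hS h5 h57 h56
          refine (opB_spec hF h5 hsm hS hq (fun y hy => ⟨_, getElem_mem hq, hy⟩) hn hi h57
            h56).mono_frame fun s' hs h6 => ⟨?_, h6⟩
          rw [hs.1 56 (notMem_opB 56 (by simp)), h56]
        · intro a ha v s hs
          rw [setNat_nat_of_ne _ _ _ (by rintro rfl; simp at ha), hs]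
        · exact notMem_opB 94 (by simp)
        · rintro s2 ⟨-, l', h5, h6⟩
          refine ⟨_, l', h5, h4.childB hi h6, fun y hy => ?_⟩
          obtain ⟨x, hx, hy⟩ := h6.mem y hy
          have := hlen x hx
          have := length_childB hy
          omega
      · rintro s2 ⟨lo, l, h5, h6, hlen⟩
        refine wp_nil ⟨lo, l, h5.setSlot, fun x hx => (hlen x hx).trans_eq (by ring),
          fun hk => h6.next (by omega), fun hk => ?_⟩
        obtain rfl : k = P.H := by omega
        exact h6
  · rintro s' ⟨lo, l, h1, hlen, -, h2⟩
    have h3 := h1 (s'.nat 54 0)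
    rw [setNat_self] at h3
    exact ⟨_, lo, l, h3, h2 rfl, hlen⟩

end

/-! ### Sparse solutions of linear systems and the Birkhoff-von Neumann theorem -/

/-- A nonnegative combination of vectors can be replaced by one with at most as many terms as the
vectors have coordinates, all of which occur in the given combination. -/
theorem exists_sparse {ι ρ : Type*} [Fintype ι] [Fintype ρ] (v : ι → ρ → ℝ) (x : ι → ℝ)
    (hx : ∀ i, 0 ≤ x i) : ∃ y : ι → ℝ, (∀ i, 0 ≤ y i) ∧ (∀ i, x i = 0 → y i = 0) ∧
      (∀ r, ∑ i, y i * v i r = ∑ i, x i * v i r) ∧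
      (univ.filter fun i => y i ≠ 0).card ≤ Fintype.card ρ := by
  classical
  induction hk : (univ.filter fun i => x i ≠ 0).card using Nat.strong_induction_on
    generalizing x with
  | _ k ih =>
    by_cases hcard : k ≤ Fintype.card ρ
    · exact ⟨x, hx, fun _ h => h, fun _ => rfl, by omega⟩
    -- there are more terms than coordinates, so that the vectors satisfy a linear relation `c`
    obtain ⟨c, hc0, hcv, i1, hi1⟩ : ∃ c : ι → ℝ, (∀ i, x i = 0 → c i = 0) ∧
        (∀ r, ∑ i, c i * v i r = 0) ∧ ∃ i, 0 < c i := by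
      let f : (ι → ℝ) →ₗ[ℝ] (ρ ⊕ {i // x i = 0} → ℝ) :=
        { toFun := fun a => Sum.elim (fun r => ∑ i, a i * v i r) fun i => a i
          map_add' := fun a b => by
            ext (r | i) <;> simp [add_mul, sum_add_distrib]
          map_smul' := fun t a => by ext (r | i) <;> simp [mul_sum, mul_assoc] }
      have hf : LinearMap.ker f ≠ ⊥ := by
        refine f.ker_ne_bot_of_finrank_lt ?_
        rw [Module.finrank_fintype_fun_eq_card, Module.finrank_fintype_fun_eq_card,
          Fintype.card_sum, Fintype.card_subtype]
        have := card_filter_add_card_filter_not (s := (univ : Finset ι))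
          (fun i => x i = 0)
        rw [Finset.card_univ] at this
        simp only [ne_eq] at hk
        omega
      obtain ⟨a, ha, ha0⟩ := (Submodule.ne_bot_iff _).1 hf
      have ha : f a = 0 := ha
      obtain ⟨i0, hi0⟩ : ∃ i, a i ≠ 0 := by
        by_contra! h
        exact ha0 (funext h)
      have h1 : ∀ r, ∑ i, a i * v i r = 0 := fun r => congrFun ha (.inl r)
      have h2 : ∀ i, x i = 0 → a i = 0 := fun i hi => congrFun ha (.inr ⟨i, hi⟩)
      rcases lt_or_gt_of_ne hi0 with h | h
      · exact ⟨fun i => -a i, fun i hi => by simp [h2 i hi], fun r => by simp [h1 r], i0,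
          by linarith⟩
      · exact ⟨a, h2, h1, i0, h⟩
    obtain ⟨i2, hi2, hmin⟩ := Finset.exists_min_image (univ.filter fun i => 0 < c i)
      (fun i => x i / c i) ⟨i1, by simpa using hi1⟩
    have hi2 : 0 < c i2 := by simpa using hi2
    set t := x i2 / c i2 with ht
    have ht0 : 0 ≤ t := div_nonneg (hx _) hi2.le
    have hy0 : ∀ i, 0 ≤ x i - t * c i := by
      intro i
      by_cases hci : 0 < c i
      · have := hmin i (by simpa using hci)
        rw [le_div_iff₀ hci] at this
        linarith
      · have := mul_nonneg ht0 (neg_nonneg.2 (not_lt.1 hci))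
        linarith [hx i]
    have hsupp : ∀ i, x i = 0 → x i - t * c i = 0 := fun i hi => by simp [hi, hc0 i hi]
    have hlt : (univ.filter fun i => x i - t * c i ≠ 0).card < k := by
      rw [← hk]
      refine Finset.card_lt_card ⟨fun i hi => ?_, fun h => ?_⟩
      · simp only [mem_filter, mem_univ, true_and] at hi ⊢
        exact fun h => hi (hsupp i h)
      · have h3 : x i2 ≠ 0 := fun h => hi2.ne' (hc0 i2 h)
        have h4 := (mem_filter.1 (h (mem_filter.2 ⟨mem_univ i2, h3⟩))).2
        exact h4 (by rw [ht, div_mul_cancel₀ _ hi2.ne', sub_self])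
    obtain ⟨y, h3, h4, h5, h6⟩ := ih _ hlt _ hy0 rfl
    refine ⟨y, h3, fun i hi => h4 i (hsupp i hi), fun r => ?_, h6⟩
    rw [h5 r]
    simp only [sub_mul, Finset.sum_sub_distrib, mul_assoc, ← mul_sum, hcv r]
    simp

/-- A matrix with row and column sums at most one is a convex combination of partial matchings,
which are given by permutations of the disjoint union of the rows and the columns. -/
theorem exists_matchings {R C : Type*} [Fintype R] [Fintype C] [DecidableEq R] [DecidableEq C]
    (X : R → C → ℝ) (h0 : ∀ i j, 0 ≤ X i j) (hr : ∀ i, ∑ j, X i j ≤ 1) (hc : ∀ j, ∑ i, X i j ≤ 1) :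
    ∃ w : Equiv.Perm (R ⊕ C) → ℝ, (∀ σ, 0 ≤ w σ) ∧ ∑ σ, w σ = 1 ∧
      ∀ i j, (∑ σ, if σ (.inl i) = .inr j then w σ else 0) = X i j := by
  -- the matrix is extended to a doubly stochastic one by means of its transpose
  let M : Matrix (R ⊕ C) (R ⊕ C) ℝ := Matrix.fromBlocks (Matrix.diagonal fun i => 1 - ∑ j, X i j)
    (Matrix.of X) (Matrix.of X).transpose (Matrix.diagonal fun j => 1 - ∑ i, X i j)
  have hM : M ∈ doublyStochastic ℝ (R ⊕ C) := by
    rw [mem_doublyStochastic_iff_sum]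
    refine ⟨?_, ?_, ?_⟩
    · rintro (i | j) (i' | j')
      · simp only [M, Matrix.fromBlocks_apply₁₁, Matrix.diagonal_apply]
        split_ifs
        · linarith [hr i]
        · exact le_rfl
      · exact h0 _ _
      · exact h0 _ _
      · simp only [M, Matrix.fromBlocks_apply₂₂, Matrix.diagonal_apply]
        split_ifs
        · linarith [hc j]
        · exact le_rfl
    · rintro (i | j) <;> simp [M, Matrix.diagonal_apply]
    · rintro (i | j) <;> simp [M, Matrix.diagonal_apply]
  obtain ⟨w, hw0, hw1, hw⟩ := exists_eq_sum_perm_of_mem_doublyStochastic hM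
  refine ⟨w, hw0, hw1, fun i j => ?_⟩
  have h := congrFun (congrFun hw (.inl i)) (.inr j)
  simp only [Matrix.sum_apply, Matrix.smul_apply] at h
  rw [show M (.inl i) (.inr j) = X i j from rfl] at h
  rw [← h]
  refine sum_congr rfl fun σ _ => ?_
  simp [Equiv.toPEquiv_apply]

theorem exists_few_split_of_pos {m : ℕ} {U Φ : Type*} [Fintype U] [Fintype Φ]
    (y : Φ → ℝ) (hy : ∀ S, 0 < y S) (c : Fin m → U → ℝ) (x : Fin m → U → Φ → ℝ)
    (hx : ∀ i j S, 0 ≤ x i j S) (hm : ∀ i S, ∑ j, x i j S ≤ y S) (hj : ∀ j S, ∑ i, x i j S ≤ y S)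
    (hpos : ∀ j, 0 < ∑ S, ∑ i, x i j S * c i j) :
    ∃ x' : Fin m → U → Φ → ℝ, (∀ i j S, 0 ≤ x' i j S) ∧ (∀ i j S, x i j S = 0 → x' i j S = 0) ∧
      (∀ i S, ∑ j, x' i j S ≤ y S) ∧ (∀ j S, ∑ i, x' i j S ≤ y S) ∧
      (∀ j, ∑ S, ∑ i, x' i j S * c i j = ∑ S, ∑ i, x i j S * c i j) ∧
      ∀ B : Finset U, (∀ j ∈ B, ∃ i i', i ≠ i' ∧ (∃ S, x' i j S ≠ 0) ∧ ∃ S, x' i' j S ≠ 0) →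
        B.card ≤ 2 * (m * Fintype.card Φ) := by
  classical
  -- the variables are the times and the slacks of the constraints for the jobs
  let v : (Fin m × U × Φ) ⊕ (U × Φ) → U ⊕ (Fin m × Φ) ⊕ (U × Φ) → ℝ := fun t r => match t, r with
    | .inl t, .inl j => if t.2.1 = j then c t.1 j else 0
    | .inl t, .inr (.inl r) => if t.1 = r.1 ∧ t.2.2 = r.2 then 1 else 0
    | .inl t, .inr (.inr r) => if t.2.1 = r.1 ∧ t.2.2 = r.2 then 1 else 0
    | .inr _, .inl _ => 0
    | .inr _, .inr (.inl _) => 0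
    | .inr t, .inr (.inr r) => if t = r then 1 else 0
  have v1 : ∀ (z : (Fin m × U × Φ) ⊕ (U × Φ) → ℝ) j, ∑ t, z t * v t (.inl j) =
      ∑ S, ∑ i, z (.inl (i, j, S)) * c i j := by
    intro z j
    have h : ∀ i : Fin m, ∑ S, z (.inl (i, j, S)) * c i j =
        ∑ j', ∑ S, z (.inl (i, j', S)) * v (.inl (i, j', S)) (.inl j) := by
      intro i
      rw [sum_comm]
      refine sum_congr rfl fun S _ => ?_
      simp [v]
    rw [sum_comm, sum_congr rfl fun i _ => h i, Fintype.sum_sum_type,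
      Fintype.sum_prod_type]
    simp only [Fintype.sum_prod_type, v, mul_zero, Finset.sum_const_zero, add_zero]
  have v2 : ∀ (z : (Fin m × U × Φ) ⊕ (U × Φ) → ℝ) i S, ∑ t, z t * v t (.inr (.inl (i, S))) =
      ∑ j, z (.inl (i, j, S)) := by
    intro z i S
    simp [v, Fintype.sum_sum_type, Fintype.sum_prod_type, ite_and]
  have v3 : ∀ (z : (Fin m × U × Φ) ⊕ (U × Φ) → ℝ) j S, ∑ t, z t * v t (.inr (.inr (j, S))) =
      ∑ i, z (.inl (i, j, S)) + z (.inr (j, S)) := by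
    intro z j S
    simp [v, Fintype.sum_sum_type, Fintype.sum_prod_type, ite_and]
  obtain ⟨z, z0, zs, zv, zc⟩ := exists_sparse v
    (Sum.elim (fun t => x t.1 t.2.1 t.2.2) fun t => y t.2 - ∑ i, x i t.1 t.2)
    (by rintro (t | t); exacts [hx _ _ _, sub_nonneg.2 (hj _ _)])
  have e1 := fun j => zv (.inl j)
  have e2 := fun i S => zv (.inr (.inl (i, S)))
  have e3 := fun j S => zv (.inr (.inr (j, S)))
  simp only [v1, v2, v3, Sum.elim_inl, Sum.elim_inr] at e1 e2 e3
  have e3' : ∀ j S, ∑ i, z (.inl (i, j, S)) + z (.inr (j, S)) = y S := fun j S => by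
    rw [e3]; ring
  refine ⟨fun i j S => z (.inl (i, j, S)), fun i j S => z0 _, fun i j S h => zs _ h,
    fun i S => (e2 i S).trans_le (hm i S), fun j S => by linarith [e3' j S, z0 (.inr (j, S))],
    e1, fun B hB => ?_⟩
  -- the pairs of a job and a phase in which the job is never idle
  set T := univ.filter fun t : U × Φ => z (.inr t) = 0 with hT
  have hTc : T.card ≤ m * Fintype.card Φ := by
    have h1 : ∀ S, (T.filter fun t => t.2 = S).card ≤ m := by
      intro S
      have h2 : ((T.filter fun t => t.2 = S).card : ℝ) * y S ≤ m * y S := by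
        calc ((T.filter fun t => t.2 = S).card : ℝ) * y S
            = ∑ t ∈ T.filter fun t => t.2 = S, ∑ i, z (.inl (i, t.1, S)) := by
              rw [← nsmul_eq_mul, ← sum_const]
              refine sum_congr rfl fun t ht => ?_
              obtain ⟨h3, rfl⟩ := mem_filter.1 ht
              have h4 := e3' t.1 t.2
              rw [(mem_filter.1 h3).2] at h4
              linarith
          _ = ∑ j ∈ (T.filter fun t => t.2 = S).image Prod.fst, ∑ i, z (.inl (i, j, S)) := by
              rw [Finset.sum_image]
              intro t ht t' ht' h
              have h5 := (mem_filter.1 ht).2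
              have h6 := (mem_filter.1 ht').2
              exact Prod.ext h (h5.trans h6.symm)
          _ ≤ ∑ j, ∑ i, z (.inl (i, j, S)) :=
              Finset.sum_le_univ_sum_of_nonneg fun j => sum_nonneg fun i _ => z0 _
          _ = ∑ i, ∑ j, x i j S := by
              rw [sum_comm]
              exact sum_congr rfl fun i _ => e2 i S
          _ ≤ ∑ _i : Fin m, y S := sum_le_sum fun i _ => hm i S
          _ = m * y S := by simp
      exact_mod_cast le_of_mul_le_mul_right h2 (hy S)
    rw [Finset.card_eq_sum_card_fiberwise (f := Prod.snd) (t := univ) (by simp)]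
    refine (sum_le_sum fun S _ => h1 S).trans ?_
    simp [mul_comm]
  -- each job occurs in the support of the solution, the jobs in `B` at least twice
  set X := univ.filter fun t : Fin m × U × Φ => z (.inl t) ≠ 0 with hX
  have hXc : Fintype.card U + B.card ≤ X.card := by
    have h1 : ∀ j, (1 + if j ∈ B then 1 else 0) ≤ (X.filter fun t => t.2.1 = j).card := by
      intro j
      split_ifs with hjB
      · obtain ⟨i, i', hii, ⟨S, hS⟩, ⟨S', hS'⟩⟩ := hB j hjB
        refine Finset.one_lt_card.2 ⟨(i, j, S), by simpa [hX] using hS, (i', j, S'),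
          by simpa [hX] using hS', fun h => hii (congrArg Prod.fst h)⟩
      · refine Finset.card_pos.2 ?_
        by_contra h
        rw [Finset.not_nonempty_iff_eq_empty, Finset.filter_eq_empty_iff] at h
        have h2 := hpos j
        rw [← e1 j, sum_eq_zero] at h2
        · exact lt_irrefl _ h2
        · refine fun S _ => sum_eq_zero fun i _ => ?_
          have h3 : z (.inl (i, j, S)) = 0 := by
            by_contra h3
            exact h (x := (i, j, S)) (by simpa [hX] using h3) rfl
          rw [h3, zero_mul]
    rw [Finset.card_eq_sum_card_fiberwise (s := X) (f := fun t => t.2.1) (t := univ) (by simp)]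
    refine le_trans (le_of_eq ?_) (sum_le_sum fun j _ => h1 j)
    simp [sum_add_distrib]
  have hcount : (univ.filter fun t => z t ≠ 0).card =
      X.card + (univ.filter fun t : U × Φ => z (.inr t) ≠ 0).card := by
    simp only [Finset.card_filter, Fintype.sum_sum_type, hX]
  have hneg : T.card + (univ.filter fun t : U × Φ => z (.inr t) ≠ 0).card =
      Fintype.card U * Fintype.card Φ := by
    rw [hT, card_filter_add_card_filter_not, Finset.card_univ, Fintype.card_prod]
  rw [hcount, Fintype.card_sum, Fintype.card_sum, Fintype.card_prod, Fintype.card_prod,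
    Fintype.card_fin] at zc
  omega

/-- Let `x i j S` be the time that machine `i` gives to job `j` in phase `S`. If the durations of
the phases and the total times of the machines in each phase are kept fixed, then the times may be
chosen such that almost all jobs run on a single machine only. -/
theorem exists_few_split {m : ℕ} {J Φ : Type*} [Fintype J] [Fintype Φ]
    (y : Φ → ℝ) (c : Fin m → J → ℝ) (x : Fin m → J → Φ → ℝ)
    (hx : ∀ i j S, 0 ≤ x i j S) (hm : ∀ i S, ∑ j, x i j S ≤ y S) (hj : ∀ j S, ∑ i, x i j S ≤ y S)
    (hy : ∀ S, 0 ≤ y S) (hc : ∀ i j S, x i j S ≠ 0 → 0 < c i j) :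
    ∃ x' : Fin m → J → Φ → ℝ, (∀ i j S, 0 ≤ x' i j S) ∧
      (∀ i j S, x i j S = 0 → x' i j S = 0) ∧ (∀ i S, ∑ j, x' i j S ≤ y S) ∧
      (∀ j S, ∑ i, x' i j S ≤ y S) ∧
      (∀ j, ∑ S, ∑ i, x' i j S * c i j = ∑ S, ∑ i, x i j S * c i j) ∧
      ∀ B : Finset J, (∀ j ∈ B, ∃ i i', i ≠ i' ∧ (∃ S, x' i j S ≠ 0) ∧ ∃ S, x' i' j S ≠ 0) →
        B.card ≤ 2 * (m * Fintype.card Φ) := by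
  classical
  -- phases of duration zero and jobs that do not run are left out
  have hxy : ∀ i j S, ¬ 0 < y S → x i j S = 0 := fun i j S h => le_antisymm
    ((single_le_sum (f := fun j => x i j S) (fun j _ => hx i j S)
      (mem_univ j)).trans ((hm i S).trans (not_lt.1 h))) (hx i j S)
  let U := {j : J // ∃ i S, x i j S ≠ 0}
  let Ψ := {S : Φ // 0 < y S}
  have sU : ∀ f : J → ℝ, (∀ j, (¬ ∃ i S, x i j S ≠ 0) → f j = 0) → ∑ j, f j = ∑ j : U, f j :=
    fun f h => by
      rw [← Fintype.sum_subtype_add_sum_subtype (fun j => ∃ i S, x i j S ≠ 0) f,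
        sum_eq_zero (s := (univ : Finset {j // ¬ ∃ i S, x i j S ≠ 0}))
          fun j _ => h j j.2, add_zero]
  have sΨ : ∀ f : Φ → ℝ, (∀ S, ¬ 0 < y S → f S = 0) → ∑ S, f S = ∑ S : Ψ, f S :=
    fun f h => by
      rw [← Fintype.sum_subtype_add_sum_subtype (fun S => 0 < y S) f,
        sum_eq_zero (s := (univ : Finset {S // ¬ 0 < y S}))
          fun j _ => h j j.2, add_zero]
  have hx0 : ∀ i j S, (¬ ∃ i S, x i j S ≠ 0) → x i j S = 0 := fun i j S h => by
    by_contra h'; exact h ⟨i, S, h'⟩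
  obtain ⟨z, z0, zx, zm, zj, zc, zB⟩ := exists_few_split_of_pos (U := U) (Φ := Ψ)
    (fun S => y S) (fun S => S.2) (fun i j => c i j) (fun i j S => x i j S)
    (fun i j S => hx i j S) (fun i S => (sU (fun j => x i j S) fun j h => hx0 i j S h) ▸ hm i S)
    (fun j S => hj j S) (by
      rintro ⟨j, i, S, h⟩
      have hS : 0 < y S := by by_contra hS; exact h (hxy i j S hS)
      refine Finset.sum_pos' (fun S _ => sum_nonneg fun i _ => ?_)
        ⟨⟨S, hS⟩, mem_univ _, Finset.sum_pos' (fun i _ => ?_) ⟨i, mem_univ _,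
          mul_pos (lt_of_le_of_ne (hx i j S) h.symm) (hc i j S h)⟩⟩
      all_goals
        by_cases h0 : x i j S = 0
        · simp [h0]
        · exact mul_nonneg (hx _ _ _) (hc i j S h0).le)
  let x' : Fin m → J → Φ → ℝ := fun i j S =>
    if h : (∃ i S, x i j S ≠ 0) ∧ 0 < y S then z i ⟨j, h.1⟩ ⟨S, h.2⟩ else 0
  have e : ∀ i (j : U) (S : Ψ), x' i j S = z i j S := fun i j S => dif_pos ⟨j.2, S.2⟩
  have e0 : ∀ i j S, (¬ ∃ i S, x i j S ≠ 0) → x' i j S = 0 := fun i j S h =>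
    dif_neg fun h' => h h'.1
  have e1 : ∀ i j S, ¬ 0 < y S → x' i j S = 0 := fun i j S h => dif_neg fun h' => h h'.2
  have hz : ∀ i j S, x i j S = 0 → x' i j S = 0 := fun i j S h => by
    by_cases h' : (∃ i S, x i j S ≠ 0) ∧ 0 < y S
    · rw [show x' i j S = _ from dif_pos h']
      exact zx i ⟨j, h'.1⟩ ⟨S, h'.2⟩ h
    · exact dif_neg h'
  refine ⟨x', fun i j S => ?_, hz, fun i S => ?_, fun j S => ?_,
    fun j => ?_, fun B hB => ?_⟩
  · by_cases h' : (∃ i S, x i j S ≠ 0) ∧ 0 < y S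
    · rw [show x' i j S = _ from dif_pos h']
      exact z0 _ _ _
    · exact (show x' i j S = 0 from dif_neg h').ge
  · by_cases hS : 0 < y S
    · rw [sU _ fun j h => e0 i j S h]
      exact (sum_congr rfl fun j _ => e i j ⟨S, hS⟩).trans_le (zm i ⟨S, hS⟩)
    · rw [sum_eq_zero fun j _ => e1 i j S hS]
      exact hy S
  · by_cases h' : (∃ i S, x i j S ≠ 0) ∧ 0 < y S
    · exact (sum_congr rfl fun i _ => e i ⟨j, h'.1⟩ ⟨S, h'.2⟩).trans_le (zj _ _)
    · rw [sum_eq_zero fun i _ => dif_neg h']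
      exact hy S
  · by_cases hjU : ∃ i S, x i j S ≠ 0
    · rw [sΨ _ fun S h => sum_eq_zero fun i _ => by rw [e1 i j S h, zero_mul],
        sΨ _ fun S h => sum_eq_zero fun i _ => by rw [hxy i j S h, zero_mul],
        ← zc ⟨j, hjU⟩]
      exact sum_congr rfl fun S _ => sum_congr rfl fun i _ => by
        rw [e i ⟨j, hjU⟩ S]
    · exact sum_congr rfl fun S _ => sum_congr rfl fun i _ => by
        rw [e0 i j S hjU, hx0 i j S hjU]
  · have hU : ∀ i j S, x' i j S ≠ 0 → (∃ i S, x i j S ≠ 0) ∧ 0 < y S := fun i j S h => by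
      by_contra h'; exact h (dif_neg h')
    have h1 : B.card = (B.subtype fun j => ∃ i S, x i j S ≠ 0).card := by
      rw [Finset.card_subtype, Finset.filter_true_of_mem]
      intro j hj
      obtain ⟨i, i', -, ⟨S, hS⟩, -⟩ := hB j hj
      exact (hU i j S hS).1
    rw [h1]
    refine (zB (B.subtype fun j => ∃ i S, x i j S ≠ 0) fun j hj => ?_).trans ?_
    · obtain ⟨i, i', hii, ⟨S, hS⟩, S', hS'⟩ := hB j (Finset.mem_subtype.1 hj)
      exact ⟨i, i', hii, ⟨⟨S, (hU _ _ _ hS).2⟩, by rwa [← e]⟩,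
        ⟨⟨S', (hU _ _ _ hS').2⟩, by rwa [← e]⟩⟩
    · gcongr
      exact Fintype.card_subtype_le _

/-! ### Fractional schedules -/

/-- A configuration: machine `i` runs job `j` if `.inl i` is mapped to `.inr j`, and it is idle if
`.inl i` is mapped to some `.inl i'`. Working with permutations makes configurations injective. -/
abbrev Conf (m n : ℕ) := Equiv.Perm (Fin m ⊕ Fin n)

/-- The fraction of tick `k` in which machine `i` runs job `j`. -/
noncomputable def busy {m n : ℕ} (z : ℕ → Conf m n → ℝ) (k : ℕ) (i : Fin m) (j : Fin n) : ℝ :=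
  ∑ σ, if σ (.inl i) = .inr j then z k σ else 0

/-- A fractional schedule assigns to each tick `k` and each configuration `σ` the fraction `z k σ` of
the tick in which the configuration is used. Job `j` runs only on machines with `ok i j`, only
in ticks from `rel j` on and before `dl j`, and receives the work `W`, where machine `i` processes
it with speed `c i j`. -/
structure FSched {m n : ℕ} (K : ℕ) (W : ℝ) (c : Fin m → Fin n → ℝ) (ok : Fin m → Fin n → Prop)
    (rel dl : Fin n → ℕ) (z : ℕ → Conf m n → ℝ) : Prop where
  nonneg : ∀ k σ, 0 ≤ z k σ
  total : ∀ k, ∑ σ, z k σ = 1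
  supp : ∀ k i j, busy z k i j ≠ 0 → ok i j ∧ rel j ≤ k ∧ k < dl j
  work : ∀ j, W ≤ ∑ k ∈ range K, ∑ i, busy z k i j * c i j

/-- Job `j` runs on machine `i` in some tick from `k` on. -/
def Uses {m n : ℕ} (z : ℕ → Conf m n → ℝ) (k : ℕ) (i : Fin m) (j : Fin n) : Prop :=
  ∃ κ ≥ k, busy z κ i j ≠ 0

/-- Job `j` runs on more than one machine in the ticks from `k` on. -/
def Uns {m n : ℕ} (z : ℕ → Conf m n → ℝ) (k : ℕ) (j : Fin n) : Prop :=
  ∃ i i', i ≠ i' ∧ Uses z k i j ∧ Uses z k i' j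

theorem Uns.mono {m n : ℕ} {z z' : ℕ → Conf m n → ℝ} {k k' : ℕ} {j : Fin n} (h : Uns z' k j)
    (hu : ∀ i, Uses z' k i j → Uses z k' i j) : Uns z k' j := by
  obtain ⟨i, i', hi, h1, h2⟩ := h
  exact ⟨i, i', hi, hu i h1, hu i' h2⟩

theorem busy_ne_zero {m n : ℕ} {z : ℕ → Conf m n → ℝ} {k : ℕ} (h : ∀ σ, 0 ≤ z k σ)
    {i : Fin m} {j : Fin n} : busy z k i j ≠ 0 ↔ ∃ σ : Conf m n, σ (.inl i) = .inr j ∧ z k σ ≠ 0 := by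
  unfold busy
  rw [Ne, Finset.sum_eq_zero_iff_of_nonneg fun σ _ => by split_ifs <;> simp [h]]
  simp

/-- A machine runs at most one job in a configuration. -/
theorem Conf.sum_job_le {m n : ℕ} (σ : Conf m n) (i : Fin m) (p : Fin n → Prop) [DecidablePred p]
    {a : ℝ} (ha : 0 ≤ a) : (∑ j, if p j ∧ σ (.inl i) = .inr j then a else 0) ≤ a := by
  rcases hσ : σ (.inl i) with i' | j
  · simpa using ha
  · rw [sum_eq_single j]
    · split_ifs <;> simp [ha]
    · intro j' _ hj'
      rw [if_neg]
      rintro ⟨-, h3⟩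
      exact hj' (Sum.inr_injective h3).symm
    · simp

/-- A job runs on at most one machine in a configuration. -/
theorem Conf.sum_machine_le {m n : ℕ} (σ : Conf m n) (j : Fin n) (p : Prop) [Decidable p]
    {a : ℝ} (ha : 0 ≤ a) : (∑ i, if p ∧ σ (.inl i) = .inr j then a else 0) ≤ a := by
  rcases hσ : σ.symm (.inr j) with i | j'
  · have hi : σ (.inl i) = .inr j := by rw [← hσ, Equiv.apply_symm_apply]
    rw [sum_eq_single i]
    · split_ifs <;> simp [ha]
    · intro i' _ hi'
      rw [if_neg]
      rintro ⟨-, h3⟩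
      exact hi' (Sum.inl_injective (σ.injective (h3.trans hi.symm)))
    · simp
  · rw [sum_eq_zero]
    · exact ha
    · intro i _
      rw [if_neg]
      rintro ⟨-, h3⟩
      rw [← h3, Equiv.symm_apply_apply] at hσ
      simp at hσ

section Step

variable {m n K : ℕ} {W : ℝ} {c : Fin m → Fin n → ℝ} {ok : Fin m → Fin n → Prop}
  {rel dl : Fin n → ℕ} {z : ℕ → Conf m n → ℝ}

open Classical in
/-- The jobs with deadline `d` that are unsettled in tick `k` can be rescheduled from this tick on
such that only few of them remain unsettled. The rescheduling uses, for each set `S` of machines,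
the time during which exactly the machines in `S` run such jobs. -/
theorem FSched.exists_few_unsettled (h : FSched K W c ok rel dl z)
    (hc : ∀ i j, ok i j → 0 < c i j) (k d : ℕ) :
    ∃ z', FSched K W c ok rel dl z' ∧ (∀ κ ≤ k, ∀ i j, Uses z' κ i j → Uses z κ i j) ∧
      (univ.filter fun j => dl j = d ∧ rel j ≤ k ∧ Uns z' k j).card ≤ 2 * (m * 2 ^ m) := by
  set U : Finset (Fin n) := univ.filter fun j => dl j = d ∧ rel j ≤ k ∧ Uns z k j with hU
  set T := (range K).filter fun κ => k ≤ κ with hT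
  let S : Conf m n → Finset (Fin m) := fun σ =>
    univ.filter fun i => ∃ j ∈ U, σ (.inl i) = .inr j
  -- the duration of the phases, and the time which each machine gives to each job of `U`
  let y : Finset (Fin m) → ℝ := fun s => ∑ κ ∈ T, ∑ σ, if S σ = s then z κ σ else 0
  let x : Fin m → Fin n → Finset (Fin m) → ℝ := fun i j s =>
    ∑ κ ∈ T, ∑ σ, if S σ = s ∧ j ∈ U ∧ σ (.inl i) = .inr j then z κ σ else 0
  have hy0 : ∀ s, 0 ≤ y s := fun s => sum_nonneg fun κ _ => sum_nonneg fun σ _ => by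
    split_ifs <;> simp [h.nonneg]
  have hx0 : ∀ i j s, 0 ≤ x i j s := fun i j s =>
    sum_nonneg fun κ _ => sum_nonneg fun σ _ => by split_ifs <;> simp [h.nonneg]
  have hm : ∀ i s, ∑ j, x i j s ≤ y s := by
    intro i s
    simp only [x, y]
    rw [sum_comm]
    refine sum_le_sum fun κ _ => ?_
    rw [sum_comm]
    refine sum_le_sum fun σ _ => ?_
    by_cases hs : S σ = s
    · simpa [hs] using σ.sum_job_le i (· ∈ U) (h.nonneg κ σ)
    · simp [hs]
  have hj : ∀ j s, ∑ i, x i j s ≤ y s := by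
    intro j s
    simp only [x, y]
    rw [sum_comm]
    refine sum_le_sum fun κ _ => ?_
    rw [sum_comm]
    refine sum_le_sum fun σ _ => ?_
    by_cases hs : S σ = s
    · simpa [hs] using σ.sum_machine_le j (j ∈ U) (h.nonneg κ σ)
    · simp [hs]
  have hxz : ∀ i j s, x i j s ≠ 0 → j ∈ U ∧ i ∈ s ∧ Uses z k i j := by
    intro i j s hne
    obtain ⟨κ, hκ, h1⟩ := exists_ne_zero_of_sum_ne_zero hne
    obtain ⟨σ, -, h2⟩ := exists_ne_zero_of_sum_ne_zero h1
    obtain ⟨⟨h3, h4, h5⟩, h6⟩ := ite_ne_right_iff.1 h2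
    refine ⟨h4, h3 ▸ mem_filter.2 ⟨mem_univ _, j, h4, h5⟩, κ,
      (mem_filter.1 hκ).2, (busy_ne_zero (h.nonneg κ)).2 ⟨σ, h5, h6⟩⟩
  obtain ⟨x', x0, xx, xm, xj, xc, xB⟩ := exists_few_split y c x hx0 hm hj hy0
    fun i j s hne => by
      obtain ⟨κ, -, hκ⟩ := (hxz i j s hne).2.2
      exact hc i j (h.supp κ i j hκ).1
  have hxz' : ∀ i j s, x' i j s ≠ 0 → j ∈ U ∧ i ∈ s ∧ Uses z k i j := fun i j s hne =>
    hxz i j s fun h0 => hne (xx i j s h0)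
  -- in a configuration `σ`, the machines in `S σ` work on the jobs of `U` as `x'` prescribes
  let M : Conf m n → Fin m → Fin n → ℝ := fun σ i j =>
    x' i j (S σ) / y (S σ) + if j ∉ U ∧ σ (.inl i) = .inr j then 1 else 0
  have hM0 : ∀ σ i j, 0 ≤ M σ i j := fun σ i j =>
    add_nonneg (div_nonneg (x0 _ _ _) (hy0 _)) (by split_ifs <;> simp)
  have hMi : ∀ σ i, ∑ j, M σ i j ≤ 1 := by
    intro σ i
    simp only [M]
    rw [sum_add_distrib, ← sum_div]
    by_cases hi : i ∈ S σ
    · obtain ⟨j, hjU, hj⟩ := (mem_filter.1 hi).2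
      rw [sum_eq_zero (f := fun j => if j ∉ U ∧ σ (.inl i) = .inr j then (1 : ℝ) else 0),
        add_zero]
      · exact div_le_one_of_le₀ (xm i _) (hy0 _)
      · intro j' _
        rw [if_neg]
        rintro ⟨h1, h2⟩
        rw [hj] at h2
        exact h1 (Sum.inr_injective h2 ▸ hjU)
    · rw [sum_eq_zero fun j _ => by_contra fun hne => hi (hxz' i j _ hne).2.1, zero_div,
        zero_add]
      exact σ.sum_job_le i (· ∉ U) zero_le_one
  have hMj : ∀ σ j, ∑ i, M σ i j ≤ 1 := by
    intro σ j
    simp only [M]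
    rw [sum_add_distrib, ← sum_div]
    by_cases hjU : j ∈ U
    · simpa [hjU] using div_le_one_of_le₀ (xj j (S σ)) (hy0 _)
    · rw [sum_eq_zero fun i _ => by_contra fun hne => hjU (hxz' i j _ hne).1, zero_div,
        zero_add]
      exact σ.sum_machine_le j (j ∉ U) zero_le_one
  choose w w0 w1 ww using fun σ => exists_matchings (M σ) (hM0 σ) (hMi σ) (hMj σ)
  let z' : ℕ → Conf m n → ℝ := fun κ τ => if k ≤ κ then ∑ σ, z κ σ * w σ τ else z κ τ
  have hz0 : ∀ κ τ, 0 ≤ z' κ τ := fun κ τ => by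
    simp only [z']
    split_ifs
    · exact sum_nonneg fun σ _ => mul_nonneg (h.nonneg _ _) (w0 _ _)
    · exact h.nonneg _ _
  have hb1 : ∀ κ i j, ¬ k ≤ κ → busy z' κ i j = busy z κ i j := fun κ i j hκ => by
    simp only [busy, z', if_neg hκ]
  have hb2 : ∀ κ i j, k ≤ κ → busy z' κ i j = ∑ σ, z κ σ * M σ i j := by
    intro κ i j hκ
    simp only [busy, z', if_pos hκ, ← ww, mul_sum]
    rw [sum_comm]
    refine sum_congr rfl fun τ _ => ?_
    split_ifs <;> simp
  have hb3 : ∀ κ i j, k ≤ κ → j ∉ U → busy z' κ i j = busy z κ i j := by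
    intro κ i j hκ hjU
    rw [hb2 κ i j hκ]
    refine sum_congr rfl fun σ _ => ?_
    have : x' i j (S σ) = 0 := by_contra fun hne => hjU (hxz' i j _ hne).1
    simp [M, this, hjU]
  have hb4 : ∀ κ i j, k ≤ κ → j ∈ U → busy z' κ i j = ∑ σ, z κ σ * (x' i j (S σ) / y (S σ)) := by
    intro κ i j hκ hjU
    rw [hb2 κ i j hκ]
    refine sum_congr rfl fun σ _ => ?_
    simp [M, hjU]
  have hbU : ∀ κ i j, k ≤ κ → j ∈ U → busy z' κ i j ≠ 0 →
      κ < d ∧ ∃ s, x' i j s ≠ 0 := by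
    intro κ i j hκ hjU hne
    rw [hb4 κ i j hκ hjU] at hne
    obtain ⟨σ, -, h1⟩ := exists_ne_zero_of_sum_ne_zero hne
    have h2 : x' i j (S σ) ≠ 0 := fun h0 => h1 (by simp [h0])
    obtain ⟨j', hj', h3⟩ := (mem_filter.1 (hxz' i j _ h2).2.1).2
    have h4 := h.supp κ i j' ((busy_ne_zero (h.nonneg κ)).2 ⟨σ, h3, fun h0 => h1 (by simp [h0])⟩)
    rw [(mem_filter.1 hj').2.1] at h4
    exact ⟨h4.2.2, _, h2⟩
  have huse : ∀ κ ≤ k, ∀ i j, Uses z' κ i j → Uses z κ i j := by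
    rintro κ hκ i j ⟨κ', hκ', hne⟩
    by_cases hk : k ≤ κ'
    · by_cases hjU : j ∈ U
      · obtain ⟨-, s, hs⟩ := hbU κ' i j hk hjU hne
        obtain ⟨κ'', h1, h2⟩ := (hxz' i j s hs).2.2
        exact ⟨κ'', hκ.trans h1, h2⟩
      · exact ⟨κ', hκ', hb3 κ' i j hk hjU ▸ hne⟩
    · exact ⟨κ', hκ', hb1 κ' i j hk ▸ hne⟩
  refine ⟨z', ⟨hz0, fun κ => ?_, fun κ i j hne => ?_, fun j => ?_⟩, huse, ?_⟩
  · simp only [z']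
    split_ifs
    · rw [sum_comm]
      simp only [← mul_sum, w1, mul_one, h.total]
    · exact h.total κ
  · by_cases hk : k ≤ κ
    · by_cases hjU : j ∈ U
      · obtain ⟨h1, s, hs⟩ := hbU κ i j hk hjU hne
        obtain ⟨κ', -, h2⟩ := (hxz' i j s hs).2.2
        obtain ⟨h3, h4, -⟩ := (mem_filter.1 hjU).2
        exact ⟨(h.supp κ' i j h2).1, h4.trans hk, h3 ▸ h1⟩
      · exact h.supp κ i j (hb3 κ i j hk hjU ▸ hne)
    · exact h.supp κ i j (hb1 κ i j hk ▸ hne)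
  · refine (h.work j).trans (le_of_eq ?_)
    rw [← Finset.sum_filter_add_sum_filter_not (range K) (fun κ => k ≤ κ),
      ← Finset.sum_filter_add_sum_filter_not (range K) (fun κ => k ≤ κ)
        fun κ => ∑ i, busy z' κ i j * c i j]
    congr 1
    · by_cases hjU : j ∈ U
      · have e1 : ∀ i, ∑ κ ∈ T, busy z κ i j = ∑ s, x i j s := by
          intro i
          simp only [x]
          rw [sum_comm]
          refine sum_congr rfl fun κ _ => ?_
          rw [sum_comm]
          refine sum_congr rfl fun σ _ => ?_
          simp [hjU, ite_and]
        have e2 : ∀ i, ∑ κ ∈ T, busy z' κ i j = ∑ s, x' i j s := by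
          intro i
          rw [sum_congr rfl fun κ hκ => hb4 κ i j (mem_filter.1 hκ).2 hjU]
          calc ∑ κ ∈ T, ∑ σ, z κ σ * (x' i j (S σ) / y (S σ))
              = ∑ κ ∈ T, ∑ σ, ∑ s, (if S σ = s then z κ σ else 0) * (x' i j s / y s) := by
                refine sum_congr rfl fun κ _ => sum_congr rfl fun σ _ => ?_
                simp
            _ = ∑ s, y s * (x' i j s / y s) := by
                simp only [y, sum_mul]
                rw [sum_congr rfl fun κ _ => sum_comm, sum_comm]
            _ = ∑ s, x' i j s := by
                refine sum_congr rfl fun s _ => ?_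
                rcases eq_or_ne (y s) 0 with h0 | h0
                · have := single_le_sum (f := fun i => x' i j s) (fun i _ => x0 i j s)
                    (mem_univ i)
                  have := this.trans (xj j s)
                  rw [h0] at this ⊢
                  rw [le_antisymm this (x0 i j s), zero_mul]
                · field_simp
        have e3 : ∀ (b : ℕ → Fin m → ℝ) (g : Fin m → Finset (Fin m) → ℝ),
            (∀ i, ∑ κ ∈ T, b κ i = ∑ s, g i s) →
            ∑ κ ∈ T, ∑ i, b κ i * c i j = ∑ s, ∑ i, g i s * c i j := by
          intro b g hbg
          rw [sum_comm]
          simp only [← sum_mul, hbg]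
          simp only [sum_mul]
          exact sum_comm
        rw [e3 _ (fun i s => x i j s) e1, e3 _ (fun i s => x' i j s) e2, xc j]
      · exact sum_congr rfl fun κ hκ => sum_congr rfl fun i _ => by
          rw [hb3 κ i j (mem_filter.1 hκ).2 hjU]
    · exact sum_congr rfl fun κ hκ => sum_congr rfl fun i _ => by
        rw [hb1 κ i j (mem_filter.1 hκ).2]
  · refine (xB _ fun j hj => ?_).trans (by simp)
    obtain ⟨h1, h2, h3⟩ := (mem_filter.1 hj).2
    have hjU : j ∈ U := mem_filter.2 ⟨mem_univ _, h1, h2, h3.mono (huse k le_rfl · j)⟩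
    obtain ⟨i, i', hii, ⟨κ, hκ, hb⟩, κ', hκ', hb'⟩ := h3
    exact ⟨i, i', hii, (hbU κ i j hκ hjU hb).2, (hbU κ' i' j hκ' hjU hb').2⟩

end Step

/-- In a suitable fractional schedule, few jobs with the same deadline are unsettled at any time. -/
theorem FSched.exists_all_few_unsettled {m n K : ℕ} {W : ℝ} {c : Fin m → Fin n → ℝ}
    {ok : Fin m → Fin n → Prop} {rel dl : Fin n → ℕ} {z : ℕ → Conf m n → ℝ}
    (h : FSched K W c ok rel dl z) (hK : ∀ j, dl j ≤ K) (hc : ∀ i j, ok i j → 0 < c i j) :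
    ∃ z', FSched K W c ok rel dl z' ∧ ∀ k d, ∀ B : Finset (Fin n),
      (∀ j ∈ B, dl j = d ∧ rel j ≤ k ∧ Uns z' k j) → B.card ≤ 2 * (m * 2 ^ m) := by
  classical
  let F := fun (z' : ℕ → Conf m n → ℝ) (k d : ℕ) => ∀ B : Finset (Fin n),
    (∀ j ∈ B, dl j = d ∧ rel j ≤ k ∧ Uns z' k j) → B.card ≤ 2 * (m * 2 ^ m)
  -- the ticks are treated in increasing order, such that what has been achieved is preserved
  have key : ∀ k, ∃ z', FSched K W c ok rel dl z' ∧ ∀ k' < k, ∀ d ≤ K, F z' k' d := by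
    intro k
    induction k with
    | zero => exact ⟨z, h, by simp⟩
    | succ k ih =>
      obtain ⟨z1, h1, f1⟩ := ih
      have key2 : ∀ D, ∃ z', FSched K W c ok rel dl z' ∧ (∀ k' < k, ∀ d ≤ K, F z' k' d) ∧
          ∀ d < D, F z' k d := by
        intro D
        induction D with
        | zero => exact ⟨z1, h1, f1, by simp⟩
        | succ D ih =>
          obtain ⟨z2, h2, f2, g2⟩ := ih
          obtain ⟨z3, h3, u3, c3⟩ := h2.exists_few_unsettled hc k D
          refine ⟨z3, h3, fun k' hk' d hd B hB => f2 k' hk' d hd B fun j hj => ?_,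
            fun d hd B hB => ?_⟩
          · obtain ⟨b1, b2, b3⟩ := hB j hj
            exact ⟨b1, b2, b3.mono fun i => u3 k' hk'.le i j⟩
          · rcases lt_succ_iff_lt_or_eq.1 hd with hd | rfl
            · refine g2 d hd B fun j hj => ?_
              obtain ⟨b1, b2, b3⟩ := hB j hj
              exact ⟨b1, b2, b3.mono fun i => u3 k le_rfl i j⟩
            · exact (card_le_card fun j hj => mem_filter.2
                ⟨mem_univ _, hB j hj⟩).trans c3
      obtain ⟨z2, h2, f2, g2⟩ := key2 (K + 1)
      refine ⟨z2, h2, fun k' hk' d hd => ?_⟩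
      rcases lt_succ_iff_lt_or_eq.1 hk' with hk' | rfl
      · exact f2 k' hk' d hd
      · exact g2 d (by omega)
  obtain ⟨z', h', f'⟩ := key K
  refine ⟨z', h', fun k d B hB => ?_⟩
  rcases B.eq_empty_or_nonempty with rfl | ⟨j, hj⟩
  · simp
  · obtain ⟨b1, -, i, -, -, ⟨κ, hκ, b2⟩, -⟩ := hB j hj
    have := (h'.supp κ _ j b2).2.2
    have := hK j
    exact f' k (by omega) d (by omega) B hB

/-- Each tick of a fractional schedule can be made to use at most `n + 1` configurations. -/
theorem FSched.exists_few_confs {m n K : ℕ} {W : ℝ} {c : Fin m → Fin n → ℝ}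
    {ok : Fin m → Fin n → Prop} {rel dl : Fin n → ℕ} {z : ℕ → Conf m n → ℝ}
    (h : FSched K W c ok rel dl z) :
    ∃ z', FSched K W c ok rel dl z' ∧ (∀ k i j, Uses z' k i j → Uses z k i j) ∧
      ∀ k, (univ.filter fun σ => z' k σ ≠ 0).card ≤ n + 1 := by
  classical
  let v : Conf m n → Option (Fin n) → ℝ := fun σ r =>
    r.elim 1 fun j => ∑ i, if σ (.inl i) = .inr j then c i j else 0
  choose y y0 ys yv yc using fun k => exists_sparse v (z k) (h.nonneg k)
  have hb : ∀ k i j, busy y k i j ≠ 0 → busy z k i j ≠ 0 := by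
    intro k i j hne
    rw [busy_ne_zero (y0 k)] at hne
    rw [busy_ne_zero (h.nonneg k)]
    obtain ⟨σ, h1, h2⟩ := hne
    exact ⟨σ, h1, fun h3 => h2 (ys k σ h3)⟩
  have hrate : ∀ (x : ℕ → Conf m n → ℝ) k j,
      ∑ i, busy x k i j * c i j = ∑ σ, x k σ * v σ (some j) := by
    intro x k j
    simp only [busy, sum_mul, v, Option.elim, mul_sum]
    rw [sum_comm]
    refine sum_congr rfl fun σ _ => sum_congr rfl fun i _ => ?_
    split_ifs <;> simp
  refine ⟨y, ⟨y0, fun k => ?_, fun k i j hne => h.supp k i j (hb k i j hne), fun j => ?_⟩, ?_,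
    fun k => (yc k).trans (by simp)⟩
  · have := yv k none
    simpa [v, h.total] using this
  · refine (h.work j).trans (le_of_eq (sum_congr rfl fun k _ => ?_))
    rw [hrate, hrate, yv]
  · rintro k i j ⟨κ, hκ, hne⟩
    exact ⟨κ, hκ, hb κ i j hne⟩

/-! ### From fractional schedules to slots -/

/-- The sum over the slots of a plan, grouped into `K` ticks of `L` slots. -/
theorem sum_range_mul_add {M : Type*} [AddCommMonoid M] (f : ℕ → M) (K L : ℕ) :
    ∑ u ∈ range (K * L), f u = ∑ k ∈ range K, ∑ o ∈ range L, f (k * L + o) := by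
  induction K with
  | zero => simp
  | succ K ih => rw [succ_mul, Finset.sum_range_add, ih, sum_range_succ]

theorem Par.fut_zero (P : Par) (f : ℕ → ℕ → ℕ) :
    P.fut f 0 0 = ∑ u ∈ range (P.H + 1), ∑ i ∈ range P.m, f u i := by
  have h1 : ∀ k, range k = Finset.Ico 0 k := Finset.range_eq_Ico
  rw [h1, sum_eq_sum_Ico_succ_bot (succ_pos _), h1]
  simp only [Par.fut, h1]

/-- If `R + 2 * (n + 1)` slots are available, at most `n + 1` configurations with total weight one
can be given more than `R` times their weights. -/
theorem exists_slots {α : Type*} [Fintype α] [DecidableEq α] {n R : ℕ} {z : α → ℝ}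
    (h0 : ∀ σ, 0 ≤ z σ) (h1 : ∑ σ, z σ = 1)
    (hn : (univ.filter fun σ => z σ ≠ 0).card ≤ n + 1) :
    ∃ g : ℕ → Option α, (∀ o σ, g o = some σ → z σ ≠ 0) ∧ ∀ σ, z σ ≠ 0 →
      (R * z σ + 1 : ℝ) ≤ ((range (R + 2 * (n + 1))).filter fun o => g o = some σ).card := by
  classical
  let X := Σ σ : {σ // z σ ≠ 0}, Fin (⌈R * z σ⌉₊ + 1)
  have hX : Fintype.card X ≤ Fintype.card (Fin (R + 2 * (n + 1))) := by
    rw [Fintype.card_sigma, Fintype.card_fin]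
    simp only [Fintype.card_fin]
    have e : ∑ σ : {σ // z σ ≠ 0}, (R * z σ + 2 : ℝ) ≤ R + 2 * (n + 1) := by
      rw [sum_add_distrib, ← mul_sum]
      have e1 : ∑ σ : {σ // z σ ≠ 0}, z σ ≤ 1 := by
        rw [← h1, ← Fintype.sum_subtype_add_sum_subtype (fun σ => z σ ≠ 0) z]
        exact le_add_of_nonneg_right (sum_nonneg fun σ _ => h0 _)
      have e2 : (Fintype.card {σ // z σ ≠ 0} : ℝ) ≤ n + 1 := by
        rw [Fintype.card_subtype]
        exact_mod_cast hn
      simp only [sum_const, Finset.card_univ, nsmul_eq_mul]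
      have : (R : ℝ) * ∑ σ : {σ // z σ ≠ 0}, z σ ≤ R := mul_le_of_le_one_right (by positivity) e1
      linarith
    have e3 : ((∑ σ : {σ // z σ ≠ 0}, (⌈R * z σ⌉₊ + 1) : ℕ) : ℝ) ≤ R + 2 * (n + 1) := by
      refine le_trans ?_ e
      push_cast
      refine sum_le_sum fun σ _ => ?_
      have := Nat.ceil_lt_add_one (mul_nonneg (cast_nonneg R) (h0 σ))
      linarith
    exact_mod_cast e3
  obtain ⟨e⟩ := Function.Embedding.nonempty_of_card_le hX
  let g : ℕ → Option α := fun o => if h : ∃ x : X, (e x : ℕ) = o then some (h.choose.1 : α) else none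
  have hg : ∀ x : X, g (e x) = some (x.1 : α) := by
    intro x
    have h : ∃ x' : X, (e x' : ℕ) = e x := ⟨x, rfl⟩
    have : h.choose = x := e.injective (Fin.ext h.choose_spec)
    rw [show g (e x) = some (h.choose.1 : α) from dif_pos h, this]
  refine ⟨g, fun o σ ho => ?_, fun σ hσ => ?_⟩
  · simp only [g] at ho
    split_ifs at ho with h
    rw [← Option.some_injective _ ho]
    exact h.choose.1.2
  · have : ⌈R * z σ⌉₊ + 1 ≤
        ((range (R + 2 * (n + 1))).filter fun o => g o = some σ).card := by
      rw [← Fintype.card_fin (⌈R * z σ⌉₊ + 1), ← Finset.card_univ]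
      refine Finset.card_le_card_of_injOn (fun t => (e ⟨⟨σ, hσ⟩, t⟩ : ℕ)) (fun t _ => ?_) ?_
      · exact Finset.mem_coe.2 (mem_filter.2 ⟨mem_range.2 (Fin.isLt _), hg _⟩)
      · intro t _ t' _ htt
        exact eq_of_heq (Sigma.mk.inj (e.injective (Fin.ext htt))).2
    have h2 := Nat.le_ceil (R * z σ)
    have h3 : ((⌈R * z σ⌉₊ + 1 : ℕ) : ℝ) ≤ _ := cast_le.2 this
    push_cast at h3
    linarith

open Classical in
/-- A fractional schedule in which each tick uses at most `n + 1` configurations yields a plan: tick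
`k` is replaced by `R + 2 * (n + 1)` slots, such that each configuration may be rounded up. The delay
is at most `R` slots. -/
theorem FSched.exists_plan {m n : ℕ} {c : Fin m → Fin n → ℝ} {ok : Fin m → Fin n → Prop}
    {rel dl : Fin n → ℕ} {z : ℕ → Conf m n → ℝ} {P : Par} {W E : ℝ} {kk aa : ℕ → ℕ}
    (h : FSched P.KH E c ok rel dl z) (hPn : P.n = n) (hPm : P.m = m)
    (hR : P.R = 2 * (n + 1) * P.KH) (hrs : ∀ j : Fin n, P.rs j = P.R * rel j)
    (hrel : ∀ j, rel j ≤ P.KH) (hdl : ∀ j, dl j ≤ P.KH)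
    (hdue : ∀ j : Fin n, P.due j (kk j) (aa j) = P.R * dl j + P.R)
    (hkk : ∀ j < n, 2 ^ kk j ≤ P.N) (haa : ∀ j < n, aa j ≤ 2 * P.E)
    (hv : ∀ i j, ok i j → 1 ≤ P.v i j ∧ W * c i j ≤ P.v i j + 1) (hW : 0 ≤ W)
    (hc : ∀ i j, ok i j → P.R + 1 ≤ W * c i j) (hV : P.V ≤ P.R * W * E)
    (hfew : ∀ k, (univ.filter fun σ => z k σ ≠ 0).card ≤ n + 1)
    (huns : ∀ k d, ∀ B : Finset (Fin n), (∀ j ∈ B, dl j = d ∧ rel j ≤ k ∧ Uns z k j) →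
      4 * B.card ≤ P.cap) :
    ∃ pl : Plan, pl.OK P ∧ pl.kk = kk ∧ pl.aa = aa := by
  rcases Nat.eq_zero_or_pos P.KH with hK0 | hK
  · refine ⟨⟨fun _ _ => 0, kk, aa⟩, ⟨?_, ?_, fun j hj => ?_, fun j hj => ?_, fun u d => ?_,
      hPn ▸ hkk, hPn ▸ haa⟩, rfl, rfl⟩
    · simp
    · simp
    · have : (P.V : ℝ) ≤ 0 := by simpa [hR, hK0] using hV
      simp [show P.V = 0 by exact_mod_cast this.antisymm (cast_nonneg _)]
    · have := hrs ⟨j, hPn ▸ hj⟩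
      simp only at this
      simp [this, hR, hK0]
    · simp [Plan.unsettled, Plan.settled]
  set L := P.R + 2 * (n + 1) with hL
  have hL0 : 0 < L := by omega
  have hKL : P.KH * L = P.H := by
    rw [Par.H, hL, Nat.mul_add, mul_comm P.KH (2 * (n + 1)), ← hR, mul_comm P.KH]
  choose g gz gc using fun k => exists_slots (R := P.R) (h.nonneg k) (h.total k) (hfew k)
  let job : Option (Conf m n) → ℕ → ℕ := fun o i =>
    o.elim 0 fun σ => if hi : i < m then (σ (.inl ⟨i, hi⟩)).elim (fun _ => 0) (fun j : Fin n => (j : ℕ) + 1)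
      else 0
  have hjob : ∀ o i j, job o i = j + 1 ↔ ∃ (hi : i < m) (hj : j < n), ∃ σ, o = some σ ∧
      σ (.inl ⟨i, hi⟩) = .inr ⟨j, hj⟩ := by
    intro o i j
    rcases o with _ | σ
    · simp [job]
    · by_cases hi : i < m
      · rcases hσ : σ (.inl ⟨i, hi⟩) with i' | j'
        · simp [job, hi, hσ]
        · have : (j' : ℕ) = j ↔ ∃ hj : j < n, j' = ⟨j, hj⟩ :=
            ⟨fun h => ⟨h ▸ j'.2, Fin.ext h⟩, fun ⟨_, h⟩ => by rw [h]⟩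
          simp [job, hi, hσ, this]
      · simp [job, hi]
  let pl : Plan := ⟨fun u i => job (g (u / L) (u % L)) i, kk, aa⟩
  have hsig : ∀ u i j, pl.sig u i = j + 1 → ∃ (hi : i < m) (hj : j < n),
      busy z (u / L) ⟨i, hi⟩ ⟨j, hj⟩ ≠ 0 := by
    intro u i j hs
    obtain ⟨hi, hj, σ, h1, h2⟩ := (hjob _ _ _).1 hs
    exact ⟨hi, hj, (busy_ne_zero (h.nonneg _)).2 ⟨σ, h2, gz _ _ _ h1⟩⟩
  have hLR : P.R ≤ L := by omega
  have hdelay : ∀ k ≤ P.KH, k * L ≤ k * P.R + P.R := by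
    intro k hk
    have := Nat.mul_le_mul_right (2 * (n + 1)) hk
    rw [hL, Nat.mul_add, hR] at *
    linarith [mul_comm P.KH (2 * (n + 1))]
  have hdueE : ∀ j : Fin n, pl.due P j = P.R * dl j + P.R := hdue
  refine ⟨pl, ⟨fun u i j _ hs => ?_, fun u i i' _ _ he h0 => ?_, fun j hj => ?_, fun j hj => ?_,
    fun u d => ?_, hPn ▸ hkk, hPn ▸ haa⟩, rfl, rfl⟩
  · obtain ⟨hi, hj, hb⟩ := hsig u i j hs
    obtain ⟨h1, h2, h3⟩ := h.supp _ _ _ hb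
    refine ⟨hPn ▸ hj, ?_, ?_, (hv _ _ h1).1⟩
    · rw [show P.rs j = _ from hrs ⟨j, hj⟩]
      calc P.R * rel ⟨j, hj⟩ ≤ L * (u / L) := Nat.mul_le_mul hLR h2
        _ ≤ u := Nat.mul_div_le u L
    · rw [show pl.due P j = _ from hdueE ⟨j, hj⟩]
      calc u < (u / L + 1) * L := by
            rw [← Nat.div_lt_iff_lt_mul hL0]; omega
        _ ≤ dl ⟨j, hj⟩ * L := Nat.mul_le_mul_right _ h3
        _ ≤ _ := by rw [mul_comm P.R]; exact hdelay _ (hdl _)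
  · obtain ⟨j, hj⟩ := Nat.exists_eq_succ_of_ne_zero h0
    obtain ⟨hi, hjn, σ, h1, h2⟩ := (hjob _ _ _).1 hj
    obtain ⟨hi', hjn', σ', h1', h2'⟩ := (hjob _ _ _).1 (he.symm.trans hj)
    rw [h1] at h1'
    rw [← Option.some_injective _ h1', ← h2] at h2'
    exact (Fin.mk.inj (Sum.inl_injective (σ.injective h2'))).symm
  · rw [hPn] at hj
    -- the work that a configuration performs per slot
    let rv : Conf m n → ℕ := fun σ => ∑ i : Fin m, if σ (.inl i) = .inr ⟨j, hj⟩ then P.v i j else 0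
    have h1 : ∀ u, ∑ i ∈ range P.m, pl.fW P j u i =
        ∑ σ, if g (u / L) (u % L) = some σ then rv σ else 0 := by
      intro u
      rw [hPm, sum_range]
      simp only [Plan.fW]
      rcases hg : g (u / L) (u % L) with _ | σ
      · simp [pl, hg, job]
      · simp only [Option.some.injEq, Finset.sum_ite_eq, mem_univ, if_true, rv]
        refine sum_congr rfl fun i _ => ?_
        have := hjob (some σ) i j
        simp only [pl, hg, this]
        simp [hj]
    have h2 : ∀ k, (P.R * W * ∑ i, busy z k i ⟨j, hj⟩ * c i ⟨j, hj⟩ : ℝ) ≤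
        ((∑ o ∈ range L, ∑ i ∈ range P.m, pl.fW P j (k * L + o) i : ℕ) : ℝ) := by
      intro k
      have e1 : ∀ o ∈ range L, ∑ i ∈ range P.m, pl.fW P j (k * L + o) i =
          ∑ σ, if g k o = some σ then rv σ else 0 := by
        intro o ho
        have ho := mem_range.1 ho
        rw [h1, mul_comm k, Nat.mul_add_div hL0, Nat.mul_add_mod, Nat.mod_eq_of_lt ho,
          Nat.div_eq_of_lt ho, add_zero]
      rw [sum_congr rfl e1, sum_comm]
      simp only [busy, sum_mul, mul_sum]
      rw [sum_comm]
      push_cast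
      refine sum_le_sum fun σ _ => ?_
      rw [← sum_filter, sum_const, nsmul_eq_mul]
      simp only [rv]
      push_cast
      rw [mul_sum]
      refine sum_le_sum fun i _ => ?_
      split_ifs with hi
      · by_cases hz : z k σ = 0
        · simp only [hz, zero_mul, mul_zero]; positivity
        · obtain ⟨hok, -, -⟩ := h.supp k i ⟨j, hj⟩ ((busy_ne_zero (h.nonneg k)).2 ⟨σ, hi, hz⟩)
          have a1 := gc k σ hz
          have a2 := (hv _ _ hok).2
          have a3 := hc _ _ hok
          have a4 : z k σ ≤ 1 := h.total k ▸
            single_le_sum (fun σ _ => h.nonneg k σ) (mem_univ σ)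
          have a5 := h.nonneg k σ
          have a6 : (0 : ℝ) ≤ P.R := cast_nonneg _
          have a7 : (0 : ℝ) ≤ P.v i j := cast_nonneg _
          simp only at a2
          calc P.R * W * (z k σ * c i ⟨j, hj⟩) = P.R * z k σ * (W * c i ⟨j, hj⟩) := by ring
            _ ≤ (P.R * z k σ + 1) * P.v i j := by nlinarith [mul_nonneg a6 a5]
            _ ≤ _ := mul_le_mul_of_nonneg_right a1 a7
      · simp
    rw [Par.fut_zero, ← hKL]
    have h3 : (P.V : ℝ) ≤
        ((∑ u ∈ range (P.KH * L), ∑ i ∈ range P.m, pl.fW P j u i : ℕ) : ℝ) := by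
      rw [sum_range_mul_add]
      push_cast
      calc (P.V : ℝ) ≤ P.R * W * E := hV
        _ ≤ P.R * W * ∑ k ∈ range P.KH, ∑ i, busy z k i ⟨j, hj⟩ * c i ⟨j, hj⟩ :=
            mul_le_mul_of_nonneg_left (h.work _) (by positivity)
        _ ≤ _ := by
            rw [mul_sum]
            refine sum_le_sum fun k _ => (h2 k).trans (le_of_eq ?_)
            push_cast
            rfl
    refine (cast_le.1 h3).trans (Finset.sum_le_sum_of_subset ?_)
    exact Finset.range_subset_range.2 (by omega)
  · rw [show P.rs j = _ from hrs ⟨j, hPn ▸ hj⟩, ← hKL, mul_comm]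
    exact Nat.mul_le_mul (hrel _) hLR
  · set B := (range P.n).filter fun j => pl.due P j = d ∧ P.rs j ≤ u ∧ pl.unsettled P u j
      with hB
    have hBn : ∀ j ∈ B, j < n := fun j hj => hPn ▸ mem_range.1 (mem_filter.1 hj).1
    have hRpos : 0 < P.R := by rw [hR]; positivity
    have hprop : ∀ j ∈ B.attachFin hBn, dl j = (d - P.R) / P.R ∧ rel j ≤ u / L + 1 ∧
        Uns z (u / L) j := by
      intro j hj
      obtain ⟨-, h1, h2, h3⟩ := mem_filter.1 ((Finset.mem_attachFin hBn).1 hj)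
      have huse : ∀ u' ≥ u, ∀ i', pl.sig u' i' = j + 1 → ∃ hi, Uses z (u / L) ⟨i', hi⟩ j := by
        intro u' hu' i' hs
        obtain ⟨hi, _, hb⟩ := hsig u' i' j hs
        exact ⟨hi, u' / L, Nat.div_le_div_right hu', hb⟩
      obtain ⟨u1, hu1, i1, hi1, hs1, -⟩ : ∃ u1 ≥ u, ∃ i1 < P.m, pl.sig u1 i1 = j + 1 ∧ i1 ≠ P.m := by
        have := h3 P.m
        simp only [Plan.settled] at this
        push Not at this
        exact this
      obtain ⟨u2, hu2, i2, hi2, hs2, hne⟩ : ∃ u2 ≥ u, ∃ i2 < P.m, pl.sig u2 i2 = j + 1 ∧ i2 ≠ i1 := by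
        have := h3 i1
        simp only [Plan.settled] at this
        push Not at this
        exact this
      obtain ⟨ha1, hb1⟩ := huse u1 hu1 i1 hs1
      obtain ⟨ha2, hb2⟩ := huse u2 hu2 i2 hs2
      refine ⟨?_, ?_, _, _, fun he => hne (Fin.mk.inj he), hb2, hb1⟩
      · rw [← h1, hdueE, Nat.add_sub_cancel, Nat.mul_div_cancel_left _ hRpos]
      · obtain ⟨κ, hκ, hb⟩ := hb1
        have h4 := (h.supp _ _ _ hb).2.2
        have h5 : u / L + 1 ≤ P.KH := by have := hdl j; omega
        have h6 := hdelay _ h5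
        have h7 : u < (u / L + 1) * L := by rw [← Nat.div_lt_iff_lt_mul hL0]; omega
        rw [hrs] at h2
        have h8 : P.R * rel j < P.R * (u / L + 2) := by
          calc P.R * rel j ≤ u := h2
            _ < _ := h7
            _ ≤ (u / L + 1) * P.R + P.R := h6
            _ = _ := by ring
        have := Nat.lt_of_mul_lt_mul_left h8
        omega
    have hcard := card_filter_add_card_filter_not (s := B.attachFin hBn)
      (fun j => rel j ≤ u / L)
    have c1 := huns (u / L) ((d - P.R) / P.R) ((B.attachFin hBn).filter fun j => rel j ≤ u / L)
      fun j hj => by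
        obtain ⟨h1, h2⟩ := mem_filter.1 hj
        exact ⟨(hprop j h1).1, h2, (hprop j h1).2.2⟩
    have c2 := huns (u / L + 1) ((d - P.R) / P.R)
      ((B.attachFin hBn).filter fun j => ¬ rel j ≤ u / L) fun j hj => by
        obtain ⟨h1, h2⟩ := mem_filter.1 hj
        obtain ⟨h3, h4, h5⟩ := hprop j h1
        -- the job is released in the next tick only, so it does not run in the present one
        have hnext : ∀ i, Uses z (u / L) i j → Uses z (u / L + 1) i j := by
          rintro i ⟨κ, hκ, hb⟩
          have := (h.supp _ _ _ hb).2.1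
          exact ⟨κ, by omega, hb⟩
        obtain ⟨i, i', hi, h6, h7⟩ := h5
        exact ⟨h3, h4, i, i', hi, hnext i h6, hnext i' h7⟩
    rw [Finset.card_attachFin] at hcard
    omega

/-! ### Lengths of pieces -/

open MeasureTheory in
/-- The time that a piece spends in the interval `[u, v)`. -/
noncomputable def Piece.lap {n m : ℕ} (a : Piece n m) (u v : ℝ) : ℝ :=
  volume.real (Set.Ico a.start a.finish ∩ Set.Ico u v)

/-- The relation between two pieces that feasibility asks for. -/
def Piece.Compat {n m : ℕ} (a b : Piece n m) : Prop :=
  a.machine = b.machine ∨ a.job = b.job → a.finish ≤ b.start ∨ b.finish ≤ a.start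

theorem Piece.Compat.symm {n m : ℕ} {a b : Piece n m} (h : a.Compat b) : b.Compat a :=
  fun h' => (h (h'.imp Eq.symm Eq.symm)).symm

section Lap

variable {n m : ℕ} (a : Piece n m)

theorem Piece.lap_nonneg (u v : ℝ) : 0 ≤ a.lap u v := MeasureTheory.measureReal_nonneg

theorem Piece.lap_ne_zero {u v : ℝ} (h : a.lap u v ≠ 0) : a.start < v ∧ u < a.finish := by
  unfold Piece.lap at h
  rw [Set.Ico_inter_Ico] at h
  simp only [Real.volume_real_Ico, ne_eq] at h
  constructor
  · by_contra h'
    refine h (max_eq_right ?_)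
    have := le_max_left a.start u
    have := min_le_right a.finish v
    linarith
  · by_contra h'
    refine h (max_eq_right ?_)
    have := le_max_right a.start u
    have := min_le_left a.finish v
    linarith

theorem Piece.lap_ne_top (u v : ℝ) :
    MeasureTheory.volume (Set.Ico a.start a.finish ∩ Set.Ico u v) ≠ ⊤ :=
  ne_top_of_le_ne_top (by simp) (MeasureTheory.measure_mono inter_subset_right)

theorem Piece.lap_add {u v w : ℝ} (h : u ≤ v) (h' : v ≤ w) :
    a.lap u v + a.lap v w = a.lap u w := by
  unfold Piece.lap
  rw [← Set.Ico_union_Ico_eq_Ico h h', Set.inter_union_distrib_left,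
    MeasureTheory.measureReal_union (h₁ := a.lap_ne_top u v) (h₂ := a.lap_ne_top v w)]
  · exact Disjoint.mono inter_subset_right inter_subset_right Set.Ico_disjoint_Ico_same
  · exact measurableSet_Ico.inter measurableSet_Ico

theorem Piece.lap_le (u v : ℝ) (h : a.start ≤ a.finish) : a.lap u v ≤ a.finish - a.start := by
  rw [← Real.volume_real_Ico_of_le h]
  exact MeasureTheory.measureReal_mono inter_subset_left (by simp)

theorem Piece.lap_eq {u v : ℝ} (h : a.start ≤ a.finish) (hu : u ≤ a.start) (hv : a.finish ≤ v) :
    a.lap u v = a.finish - a.start := by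
  rw [← Real.volume_real_Ico_of_le h, Piece.lap, Set.inter_eq_left.2 (Set.Ico_subset_Ico hu hv)]

/-- The laps of a piece with the ticks of length `1 / E`. -/
theorem Piece.sum_lap {E : ℕ} (K : ℕ) :
    ∑ k ∈ range K, a.lap (k / E) ((k + 1) / E) = a.lap 0 (K / E) := by
  induction K with
  | zero => simp [Piece.lap]
  | succ K ih =>
    rw [sum_range_succ, ih, a.lap_add (by positivity) (by gcongr; simp)]
    push_cast
    rfl

end Lap

/-- Disjoint pieces do not spend more time in an interval than its length. -/
theorem sum_lap_le {ι : Type*} {n m : ℕ} (a : ι → Piece n m) (s : Finset ι)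
    (h : ∀ q ∈ s, ∀ q' ∈ s, q ≠ q' →
      (a q).finish ≤ (a q').start ∨ (a q').finish ≤ (a q).start) {u v : ℝ} (huv : u ≤ v) :
    ∑ q ∈ s, (a q).lap u v ≤ v - u := by
  unfold Piece.lap
  rw [← MeasureTheory.measureReal_biUnion_finset (h := fun q _ => (a q).lap_ne_top u v),
    ← Real.volume_real_Ico_of_le huv]
  · exact MeasureTheory.measureReal_mono (Set.iUnion₂_subset fun _ _ => inter_subset_right)
      (by simp)
  · intro q hq q' hq' hne
    refine Disjoint.mono inter_subset_left inter_subset_left ?_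
    rw [Set.Ico_disjoint_Ico]
    rcases h q hq q' hq' hne with h | h
    · exact (min_le_left _ _).trans (h.trans (le_max_right _ _))
    · exact (min_le_right _ _).trans (h.trans (le_max_left _ _))
  · exact fun q _ => measurableSet_Ico.inter measurableSet_Ico

/-- A sum over a filtered list as a sum over the positions of the list. -/
theorem sum_map_filter_get {α : Type*} (l : List α) (p : α → Prop) [DecidablePred p] (f : α → ℝ) :
    ((l.filter fun a => p a).map f).sum = ∑ q : Fin l.length, if p (l.get q) then f (l.get q) else 0 := by
  induction l with
  | nil => simp
  | cons a l ih =>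
    rw [show (∑ q : Fin (a :: l).length, if p ((a :: l).get q) then f ((a :: l).get q) else 0) =
      (if p a then f a else 0) + ∑ q : Fin l.length, if p (l.get q) then f (l.get q) else 0 from
        Fin.sum_univ_succ _, ← ih]
    by_cases h : p a <;> simp [h]

/-! ### Shifting the jobs in time -/

/-- If each job `j` runs within `[r j, r j + G]` only, then it makes no difference whether its release
time is `r j` or `ρ j`: two jobs are moved by the same distance, or their time windows are disjoint
before and after the movement. -/
def ShiftEquiv {n : ℕ} (r ρ : Fin n → ℕ) (G : ℕ) : Prop :=
  ∀ j j', r j + ρ j' = r j' + ρ j ∨ (r j + G ≤ r j' ∧ ρ j + G ≤ ρ j') ∨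
    (r j' + G ≤ r j ∧ ρ j' + G ≤ ρ j)

theorem ShiftEquiv.symm {n : ℕ} {r ρ : Fin n → ℕ} {G : ℕ} (h : ShiftEquiv r ρ G) :
    ShiftEquiv ρ r G := fun j j' => by
  rcases h j j' with h | h | h <;> omega

/-- The piece that starts `ρ j - r j` time units later, where `j` is its job. -/
def Piece.shift {n m : ℕ} (a : Piece n m) (r ρ : Fin n → ℕ) : Piece n m :=
  { a with start := a.start - r a.job + ρ a.job, finish := a.finish - r a.job + ρ a.job }

theorem Piece.Compat.shift {n m : ℕ} {a b : Piece n m} {r ρ : Fin n → ℕ} {G : ℕ} (h : a.Compat b)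
    (hs : ShiftEquiv r ρ G) (ha : (r a.job : ℝ) ≤ a.start) (ha' : a.finish ≤ r a.job + G)
    (hb : (r b.job : ℝ) ≤ b.start) (hb' : b.finish ≤ r b.job + G) :
    (a.shift r ρ).Compat (b.shift r ρ) := by
  intro hab
  have h1 := h hab
  simp only [Piece.shift]
  rcases hs a.job b.job with h2 | ⟨-, h2⟩ | ⟨-, h2⟩
  · have h3 : (r a.job : ℝ) + ρ b.job = r b.job + ρ a.job := by exact_mod_cast h2
    rcases h1 with h1 | h1
    · left; linarith
    · right; linarith
  · have h3 : (ρ a.job : ℝ) + G ≤ ρ b.job := by exact_mod_cast h2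
    left; linarith
  · have h3 : (ρ b.job : ℝ) + G ≤ ρ a.job := by exact_mod_cast h2
    right; linarith

/-! ### Properties of feasible schedules -/

section Feasible

variable {n m : ℕ} {I : SchedInstance n m} {mode : Setting} {S : Schedule n m}

theorem le_completion {a : Piece n m} (ha : a ∈ S) : a.finish ≤ completion S a.job := by
  unfold completion
  have : ∀ (l : List ℝ) (x : ℝ), x ∈ l → x ≤ l.foldr max 0 := by
    intro l
    induction l with
    | nil => simp
    | cons y l ih =>
      intro x hx
      rcases mem_cons.1 hx with rfl | hx
      · exact le_max_left _ _
      · exact (ih x hx).trans (le_max_right _ _)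
  exact this _ _ (List.mem_map.2 ⟨a, List.mem_filter.2 ⟨ha, by simp⟩, rfl⟩)

theorem completion_le {j : Fin n} {x : ℝ} (hx : 0 ≤ x) (h : ∀ a ∈ S, a.job = j → a.finish ≤ x) :
    completion S j ≤ x := by
  unfold completion
  have : ∀ l : List ℝ, (∀ y ∈ l, y ≤ x) → l.foldr max 0 ≤ x := by
    intro l
    induction l with
    | nil => simpa
    | cons y l ih =>
      intro hl
      exact max_le (hl y (by simp)) (ih fun z hz => hl z (by simp [hz]))
  refine this _ fun y hy => ?_
  obtain ⟨a, ha, rfl⟩ := List.mem_map.1 hy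
  obtain ⟨h1, h2⟩ := List.mem_filter.1 ha
  exact h a h1 (by simpa using h2)

theorem SchedInstance.le_pmax (I : SchedInstance n m) (i : Fin m) (j : Fin n) :
    (I.proc i j).toNat ≤ I.pmax :=
  (Finset.le_sup (f := fun j => (I.proc i j).toNat) (mem_univ j)).trans
    (Finset.le_sup (f := fun i => Finset.univ.sup fun j => (I.proc i j).toNat) (mem_univ i))

theorem SchedInstance.one_le_toNat (I : SchedInstance n m) {i : Fin m} {j : Fin n}
    (h : I.proc i j ≠ ⊤) : 1 ≤ (I.proc i j).toNat := by
  have h1 := I.proc_pos i j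
  rw [← ENat.natCast_toNat h] at h1
  exact_mod_cast h1

theorem SchedInstance.one_le_pmax (I : SchedInstance n m) (j : Fin n) : 1 ≤ I.pmax := by
  obtain ⟨i, hi⟩ := I.runnable j
  exact (I.one_le_toNat hi).trans (I.le_pmax i j)

theorem Feasible.completed_get (h : Feasible I mode S) (j : Fin n) :
    (∑ q : Fin S.length, if (S.get q).job = j then
      ((S.get q).finish - (S.get q).start) / ((I.proc (S.get q).machine j).toNat : ℝ) else 0) = 1 := by
  rw [← h.completed j]
  exact (sum_map_filter_get S (fun a => a.job = j) fun a =>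
    (a.finish - a.start) / ((I.proc a.machine j).toNat : ℝ)).symm

theorem Feasible.compat (h : Feasible I mode S) {q q' : Fin S.length} (hq : q ≠ q') :
    (S.get q).Compat (S.get q') := by
  rcases lt_or_gt_of_ne hq with hlt | hlt
  · exact List.pairwise_iff_get.1 h.disjoint q q' hlt
  · exact Piece.Compat.symm (List.pairwise_iff_get.1 h.disjoint q' q hlt)

/-- The total length of the pieces of a job lies between `1` and `pmax`. -/
theorem Feasible.length_bounds (h : Feasible I mode S) (j : Fin n) :
    (1 ≤ ∑ q : Fin S.length, if (S.get q).job = j then (S.get q).finish - (S.get q).start else 0) ∧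
    (∑ q : Fin S.length, if (S.get q).job = j then (S.get q).finish - (S.get q).start else 0) ≤
      I.pmax := by
  have hp : ∀ q, (S.get q).job = j → 0 < (S.get q).finish - (S.get q).start ∧
      (1 : ℝ) ≤ (I.proc (S.get q).machine j).toNat ∧
      ((I.proc (S.get q).machine j).toNat : ℝ) ≤ I.pmax := fun q hq => by
    refine ⟨sub_pos.2 (h.start_lt_finish _ (S.get_mem q)), ?_, cast_le.2 (I.le_pmax _ _)⟩
    exact_mod_cast I.one_le_toNat (hq ▸ h.finite_proc _ (S.get_mem q))
  have hc := h.completed_get j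
  constructor
  · rw [← hc]
    refine sum_le_sum fun q _ => ?_
    split_ifs with hq
    · obtain ⟨h1, h2, -⟩ := hp q hq
      exact div_le_self h1.le h2
    · exact le_rfl
  · rw [← mul_one (I.pmax : ℝ), ← hc, mul_sum]
    refine sum_le_sum fun q _ => ?_
    split_ifs with hq
    · obtain ⟨h1, h2, h3⟩ := hp q hq
      rw [mul_div_assoc', le_div_iff₀ (by linarith), mul_comm]
      exact mul_le_mul_of_nonneg_right h3 h1.le
    · simp

theorem Feasible.one_le_flow (h : Feasible I mode S) (j : Fin n) :
    (1 : ℝ) ≤ completion S j - I.release j := by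
  have h1 := (h.length_bounds j).1
  rw [← sum_filter] at h1
  have h2 : (I.release j : ℝ) ≤ completion S j := by
    by_contra hlt
    have : ∀ q : Fin S.length, (S.get q).job ≠ j := by
      rintro q rfl
      have a1 := h.start_lt_finish _ (S.get_mem q)
      have a2 := h.release_le _ (S.get_mem q)
      have a3 := le_completion (S.get_mem q)
      linarith
    rw [sum_filter, sum_eq_zero fun q _ => if_neg (this q)] at h1
    linarith
  refine h1.trans ?_
  refine le_trans (le_of_eq (sum_congr rfl fun q hq => ?_))
    (sum_lap_le (fun q => S.get q) (univ.filter fun q => (S.get q).job = j) ?_ h2)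
  · have hj := (mem_filter.1 hq).2
    refine ((S.get q).lap_eq (h.start_lt_finish _ (S.get_mem q)).le ?_ ?_).symm
    · exact hj ▸ h.release_le _ (S.get_mem q)
    · exact hj ▸ le_completion (S.get_mem q)
  · intro q hq q' hq' hne
    exact h.compat hne (.inr ((mem_filter.1 hq).2.trans (mem_filter.1 hq').2.symm))

theorem Feasible.exists_piece (h : Feasible I mode S) (j : Fin n) : ∃ a ∈ S, a.job = j := by
  by_contra hno
  have h1 := h.completed_get j
  rw [sum_eq_zero fun q _ => if_neg fun hq => hno ⟨_, S.get_mem q, hq⟩] at h1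
  exact zero_ne_one h1

end Feasible

/-! ### From schedules to fractional schedules -/

open Classical in
/-- A feasible schedule yields a fractional schedule in which the flow time of a job is at most as
large as before, but also at most `N = 2 * n * pmax`. The jobs with a larger flow time are removed and
inserted again: the other jobs keep a machine busy for at most `n * pmax` time units, and each of the
removed jobs can get the fraction `1 / n` of the idle time of a machine. -/
theorem Feasible.exists_fsched {n m : ℕ} {I : SchedInstance n m} {mode : Setting}
    {S : Schedule n m} (h : Feasible I mode S) {E N G K : ℕ} (hE : 1 ≤ E)
    (hN : N = 2 * n * I.pmax) (hNG : N ≤ G) {ρ : Fin n → ℕ} (hρ : ShiftEquiv I.release ρ G)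
    {f dl : Fin n → ℕ}
    (hf : ∀ j, E * min (completion S j - I.release j) (N : ℝ) ≤ f j)
    (hdl : ∀ j, E * ρ j + f j ≤ dl j) (hK : ∀ j, dl j ≤ K) :
    ∃ z ok, FSched K E (fun i j => 1 / ((I.proc i j).toNat : ℝ)) ok (fun j => E * ρ j) dl z ∧
      (∀ i j, ok i j → I.proc i j ≠ ⊤) ∧
      (mode = .noMigration → ∀ i i' j, ok i j → ok i' j → i = i') := by
  have hE0 : (0 : ℝ) < E := by exact_mod_cast hE
  -- each job gets a machine to be used if it is removed, or if there is no migration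
  choose pc hpc hpcj using h.exists_piece
  let M : Fin n → Fin m := fun j => (pc j).machine
  let ok : Fin m → Fin n → Prop := fun i j =>
    I.proc i j ≠ ⊤ ∧ (mode = .noMigration → i = M j)
  have hokM : ∀ j, ok (M j) j := fun j =>
    ⟨by have := h.finite_proc _ (hpc j); rwa [hpcj] at this, fun _ => rfl⟩
  have hokS : ∀ q, ok (S.get q).machine (S.get q).job := fun q =>
    ⟨h.finite_proc _ (S.get_mem q), fun hs =>
      h.one_machine hs _ (S.get_mem q) _ (hpc _) (hpcj _).symm⟩
  let kept : Fin n → Prop := fun j => completion S j - I.release j ≤ N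
  let a : Fin S.length → Piece n m := fun q => (S.get q).shift I.release ρ
  let lap : Fin S.length → ℕ → ℝ := fun q k => E * (a q).lap (k / E) ((k + 1) / E)
  have hlap0 : ∀ q k, 0 ≤ lap q k := fun q k => mul_nonneg hE0.le ((a q).lap_nonneg _ _)
  have hpos : ∀ q, (S.get q).start < (S.get q).finish := fun q => h.start_lt_finish _ (S.get_mem q)
  have hrel : ∀ q, (I.release (S.get q).job : ℝ) ≤ (S.get q).start :=
    fun q => h.release_le _ (S.get_mem q)
  have hfin : ∀ q, kept (S.get q).job → (S.get q).finish ≤ I.release (S.get q).job + N := by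
    intro q hq
    have h1 := le_completion (S.get_mem q)
    have h2 : completion S (S.get q).job - I.release (S.get q).job ≤ N := hq
    linarith
  have hNG' : (N : ℝ) ≤ G := cast_le.2 hNG
  have hcomp : ∀ q q', q ≠ q' → kept (S.get q).job → kept (S.get q').job → (a q).Compat (a q') :=
    fun q q' hne hq hq' => (h.compat hne).shift hρ (hrel q) ((hfin q hq).trans (by gcongr))
      (hrel q') ((hfin q' hq').trans (by gcongr))
  have htick : ∀ (k : ℕ) (s : Finset (Fin S.length)), (∀ q ∈ s, ∀ q' ∈ s, q ≠ q' →
      (a q).finish ≤ (a q').start ∨ (a q').finish ≤ (a q).start) → ∑ q ∈ s, lap q k ≤ 1 := by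
    intro k s hs
    rw [← mul_sum]
    have := sum_lap_le a s hs (u := k / E) (v := (k + 1) / E) (by gcongr; simp)
    calc (E : ℝ) * ∑ q ∈ s, (a q).lap (k / E) ((k + 1) / E)
        ≤ E * ((k + 1) / E - k / E) := by gcongr
      _ = 1 := by field_simp; ring
  have hsum : ∀ q, ∑ k ∈ range K, lap q k ≤ E * ((S.get q).finish - (S.get q).start) := by
    intro q
    rw [← mul_sum, (a q).sum_lap]
    gcongr
    refine ((a q).lap_le _ _ ?_).trans (le_of_eq ?_)
    · simp only [a, Piece.shift]; linarith [hpos q]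
    · simp only [a, Piece.shift]; ring
  -- the time a machine is busy with jobs that are kept
  let B : ℕ → Fin m → ℝ := fun k i =>
    ∑ q, if kept (S.get q).job ∧ (S.get q).machine = i then lap q k else 0
  have hB1 : ∀ k i, B k i ≤ 1 := by
    intro k i
    simp only [B]
    rw [← sum_filter]
    refine htick k _ fun q hq q' hq' hne => ?_
    obtain ⟨h1, h2⟩ := (mem_filter.1 hq).2
    obtain ⟨h3, h4⟩ := (mem_filter.1 hq').2
    exact hcomp q q' hne h1 h3 (.inl (h2.trans h4.symm))
  have hB0 : ∀ k i, 0 ≤ B k i := fun k i => sum_nonneg fun q _ => by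
    split_ifs <;> simp [hlap0]
  have hBsum : ∀ i, ∑ k ∈ range K, B k i ≤ E * (n * I.pmax) := by
    intro i
    simp only [B]
    rw [sum_comm]
    calc ∑ q, ∑ k ∈ range K,
          (if kept (S.get q).job ∧ (S.get q).machine = i then lap q k else 0)
        ≤ ∑ q, E * ((S.get q).finish - (S.get q).start) := by
          refine sum_le_sum fun q _ => le_trans (sum_le_sum fun k _ => ?_) (hsum q)
          split_ifs <;> simp [hlap0]
      _ = E * ∑ j, ∑ q, if (S.get q).job = j then (S.get q).finish - (S.get q).start else 0 := by
          rw [sum_comm, mul_sum]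
          simp
      _ ≤ E * ∑ _j : Fin n, (I.pmax : ℝ) := by
          gcongr with j
          exact (h.length_bounds j).2
      _ = _ := by simp
  let X1 : ℕ → Fin m → Fin n → ℝ := fun k i j =>
    ∑ q, if kept j ∧ (S.get q).machine = i ∧ (S.get q).job = j then lap q k else 0
  let X2 : ℕ → Fin m → Fin n → ℝ := fun k i j =>
    if ¬ kept j ∧ i = M j ∧ E * ρ j ≤ k ∧ k < E * ρ j + E * N then (1 - B k i) / n else 0
  let X : ℕ → Fin m → Fin n → ℝ := fun k i j => X1 k i j + X2 k i j
  have hX1 : ∀ k i j, 0 ≤ X1 k i j := fun k i j => sum_nonneg fun q _ => by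
    split_ifs <;> simp [hlap0]
  have hX2 : ∀ k i j, 0 ≤ X2 k i j := fun k i j => by
    simp only [X2]
    split_ifs
    · exact div_nonneg (sub_nonneg.2 (hB1 k i)) (cast_nonneg n)
    · exact le_rfl
  have hX20 : ∀ k i j, kept j → X2 k i j = 0 := fun k i j hj => if_neg fun h' => h'.1 hj
  have hX10 : ∀ k i j, ¬ kept j → X1 k i j = 0 := fun k i j hj =>
    sum_eq_zero fun q _ => if_neg fun h' => hj h'.1
  have hrow : ∀ k i, ∑ j, X k i j ≤ 1 := by
    intro k i
    simp only [X]
    rw [sum_add_distrib]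
    have e1 : ∑ j, X1 k i j = B k i := by
      simp only [X1, B]
      rw [sum_comm]
      refine sum_congr rfl fun q _ => ?_
      rw [sum_eq_single (S.get q).job]
      · simp
      · exact fun j _ hj => if_neg fun h' => hj h'.2.2.symm
      · simp
    have e2 : ∑ j, X2 k i j ≤ 1 - B k i := by
      calc ∑ j, X2 k i j ≤ ∑ _j : Fin n, (1 - B k i) / n := by
            refine sum_le_sum fun j _ => ?_
            simp only [X2]
            split_ifs
            · exact le_rfl
            · exact div_nonneg (sub_nonneg.2 (hB1 k i)) (cast_nonneg n)
        _ = n * ((1 - B k i) / n) := by simp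
        _ ≤ 1 - B k i := by
            rcases Nat.eq_zero_or_pos n with h0 | h0
            · rw [h0, Nat.cast_zero, zero_mul]
              exact sub_nonneg.2 (hB1 k i)
            · rw [mul_div_cancel₀ _ (by positivity)]
    linarith
  have hcol : ∀ k j, ∑ i, X k i j ≤ 1 := by
    intro k j
    simp only [X]
    by_cases hj : kept j
    · simp only [hX20 _ _ _ hj, add_zero, X1]
      rw [sum_comm]
      calc ∑ q, ∑ i, (if kept j ∧ (S.get q).machine = i ∧ (S.get q).job = j then lap q k else 0)
          = ∑ q, if (S.get q).job = j then lap q k else 0 := by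
            refine sum_congr rfl fun q _ => ?_
            rw [sum_eq_single (S.get q).machine]
            · simp [hj]
            · exact fun i _ hi => if_neg fun h' => hi h'.2.1.symm
            · simp
        _ ≤ 1 := by
            rw [← sum_filter]
            refine htick k _ fun q hq q' hq' hne => ?_
            have h1 := (mem_filter.1 hq).2
            have h2 := (mem_filter.1 hq').2
            exact hcomp q q' hne (h1 ▸ hj) (h2 ▸ hj) (.inr (h1.trans h2.symm))
    · simp only [hX10 _ _ _ hj, zero_add, X2]
      rw [sum_eq_single (M j)]
      · split_ifs
        · refine div_le_one_of_le₀ ?_ (cast_nonneg n)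
          have : (1 : ℝ) ≤ n := by exact_mod_cast Fin.pos j
          linarith [hB0 k (M j)]
        · exact zero_le_one
      · exact fun i _ hi => if_neg fun h' => hi h'.2.1
      · simp
  choose w w0 w1 ww using fun k => exists_matchings (X k)
    (fun i j => add_nonneg (hX1 k i j) (hX2 k i j)) (hrow k) (hcol k)
  have hbusy : ∀ k i j, busy w k i j = X k i j := fun k i j => by rw [← ww k i j]; rfl
  have hfR : ∀ j, (E * ρ j + f j : ℝ) ≤ dl j := fun j => by exact_mod_cast hdl j
  refine ⟨w, ok, ⟨w0, w1, fun k i j hne => ?_, fun j => ?_⟩, fun i j hok => hok.1,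
    fun hs i i' j hi hi' => (hi.2 hs).trans (hi'.2 hs).symm⟩
  · rw [hbusy] at hne
    by_cases hj : kept j
    · simp only [X, hX20 k i j hj, add_zero, X1] at hne
      obtain ⟨q, -, hq⟩ := exists_ne_zero_of_sum_ne_zero hne
      obtain ⟨⟨-, rfl, rfl⟩, h2⟩ := ite_ne_right_iff.1 hq
      obtain ⟨h3, h4⟩ := (a q).lap_ne_zero (right_ne_zero_of_mul h2)
      refine ⟨hokS q, ?_, ?_⟩
      · simp only [a, Piece.shift] at h3
        rw [lt_div_iff₀ hE0] at h3
        have h5 : ((E * ρ (S.get q).job : ℕ) : ℝ) < ((k + 1 : ℕ) : ℝ) := by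
          push_cast
          nlinarith [hrel q]
        have := Nat.cast_lt.1 h5
        omega
      · simp only [a, Piece.shift] at h4
        rw [div_lt_iff₀ hE0] at h4
        have h5 : completion S (S.get q).job - I.release (S.get q).job ≤ N := hj
        have h6 := hf (S.get q).job
        rw [min_eq_left h5] at h6
        have h7 := le_completion (S.get_mem q)
        have h8 := hfR (S.get q).job
        have h9 : ((k : ℕ) : ℝ) < (dl (S.get q).job : ℝ) := by nlinarith
        exact Nat.cast_lt.1 h9
    · simp only [X, hX10 k i j hj, zero_add, X2] at hne
      obtain ⟨⟨-, rfl, h2, h3⟩, -⟩ := ite_ne_right_iff.1 hne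
      refine ⟨hokM j, h2, h3.trans_le ?_⟩
      have h6 := hf j
      rw [min_eq_right (not_le.1 hj).le] at h6
      have h7 : E * N ≤ f j := by exact_mod_cast h6
      have := hdl j
      omega
  · simp only [hbusy]
    by_cases hj : kept j
    · simp only [X, hX20 _ _ j hj, add_zero, X1, sum_mul]
      have hend : ∀ q, (S.get q).job = j →
          ∑ k ∈ range K, lap q k = E * ((S.get q).finish - (S.get q).start) := by
        rintro q rfl
        rw [← mul_sum, (a q).sum_lap, (a q).lap_eq]
        · simp only [a, Piece.shift]; ring
        · simp only [a, Piece.shift]; linarith [hpos q]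
        · simp only [a, Piece.shift]
          have : (0 : ℝ) ≤ ρ (S.get q).job := cast_nonneg _
          linarith [hrel q]
        · simp only [a, Piece.shift]
          rw [le_div_iff₀ hE0]
          have h5 : completion S (S.get q).job - I.release (S.get q).job ≤ N := hj
          have h6 := hf (S.get q).job
          rw [min_eq_left h5] at h6
          have h7 := le_completion (S.get_mem q)
          have h8 := hfR (S.get q).job
          have h9 : (dl (S.get q).job : ℝ) ≤ K := cast_le.2 (hK _)
          nlinarith
      calc (E : ℝ) = E * ∑ q : Fin S.length, (if (S.get q).job = j then
            ((S.get q).finish - (S.get q).start) / ((I.proc (S.get q).machine j).toNat : ℝ) else 0) := by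
            rw [h.completed_get j, mul_one]
        _ = ∑ q, ∑ k ∈ range K, ∑ i, (if kept j ∧ (S.get q).machine = i ∧
              (S.get q).job = j then lap q k else 0) * (1 / ((I.proc i j).toNat : ℝ)) := by
            rw [mul_sum]
            refine sum_congr rfl fun q _ => ?_
            split_ifs with hq
            · rw [mul_div_assoc', ← hend q hq, sum_div]
              refine sum_congr rfl fun k _ => ?_
              rw [sum_eq_single (S.get q).machine]
              · rw [if_pos ⟨hj, rfl, hq⟩, mul_one_div]
              · exact fun i _ hi => by rw [if_neg fun h' => hi h'.2.1.symm, zero_mul]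
              · simp
            · rw [mul_zero]
              exact (sum_eq_zero fun k _ => sum_eq_zero fun i _ => by
                rw [if_neg fun h' => hq h'.2.2, zero_mul]).symm
        _ ≤ _ := by
            rw [sum_comm]
            refine sum_le_sum fun k _ => ?_
            rw [sum_comm]
    · simp only [X, hX10 _ _ j hj, zero_add]
      have hn : (0 : ℝ) < n := by exact_mod_cast Fin.pos j
      have hpm : ((I.proc (M j) j).toNat : ℝ) ≤ I.pmax := cast_le.2 (I.le_pmax _ _)
      have hp0 : (1 : ℝ) ≤ (I.proc (M j) j).toNat := by exact_mod_cast I.one_le_toNat (hokM j).1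
      have hwin : Finset.Ico (E * ρ j) (E * ρ j + E * N) ⊆ range K := by
        intro k hk
        have h6 := hf j
        rw [min_eq_right (not_le.1 hj).le] at h6
        have h7 : E * N ≤ f j := by exact_mod_cast h6
        have := hdl j
        have := hK j
        have := (Finset.mem_Ico.1 hk).2
        exact mem_range.2 (by omega)
      have h1 : (E * (n * I.pmax) : ℝ) ≤
          ∑ k ∈ Finset.Ico (E * ρ j) (E * ρ j + E * N), (1 - B k (M j)) := by
        rw [Finset.sum_sub_distrib]
        have h2 := (Finset.sum_le_sum_of_subset_of_nonneg hwin
          fun k _ _ => hB0 k (M j)).trans (hBsum (M j))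
        simp only [sum_const, Nat.card_Ico, Nat.add_sub_cancel_left, nsmul_eq_mul, mul_one]
        have h3 : ((E * N : ℕ) : ℝ) = 2 * (E * (n * I.pmax)) := by
          rw [hN]; push_cast; ring
        linarith
      calc (E : ℝ) ≤ (E * (n * I.pmax)) / n / (I.proc (M j) j).toNat := by
            rw [le_div_iff₀ (by linarith), le_div_iff₀ hn]
            nlinarith [mul_nonneg hE0.le hn.le]
        _ ≤ (∑ k ∈ Finset.Ico (E * ρ j) (E * ρ j + E * N), (1 - B k (M j))) / n /
              (I.proc (M j) j).toNat := by gcongr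
        _ ≤ _ := by
            rw [sum_div, sum_div]
            refine le_trans (sum_le_sum fun k hk => ?_)
              (Finset.sum_le_sum_of_subset_of_nonneg hwin fun k _ _ =>
                sum_nonneg fun i _ => mul_nonneg (hX2 k i j) (by positivity))
            refine le_trans (le_of_eq ?_) (single_le_sum (fun i _ =>
              mul_nonneg (hX2 k i j) (by positivity)) (mem_univ (M j)))
            obtain ⟨hk1, hk2⟩ := Finset.mem_Ico.1 hk
            have e : X2 k (M j) j = (1 - B k (M j)) / n := if_pos ⟨hj, rfl, hk1, hk2⟩
            rw [e, mul_one_div]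

/-! ### The parameters of the dynamic program for an instance -/

/-- The bound `2 * n * pmax` on the flow times that are considered. -/
def SchedInstance.flowBound {n m : ℕ} (I : SchedInstance n m) : ℕ := 2 * n * I.pmax

/-- The number of ticks before the last deadline. There are `E` ticks per unit of time. -/
def SchedInstance.ticks {n m : ℕ} (I : SchedInstance n m) (E : ℕ) : ℕ :=
  E * ((n + 1) * (4 * I.flowBound))

/-- The number of slots per tick. -/
def SchedInstance.slots {n m : ℕ} (I : SchedInstance n m) (E : ℕ) : ℕ :=
  2 * (n + 1) * I.ticks E

/-- The number of work units which correspond to one slot of a job with processing time one. -/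
def SchedInstance.units {n m : ℕ} (I : SchedInstance n m) (E : ℕ) : ℕ :=
  I.pmax * (E * I.slots E + 1)

/-- The processing times as numbers, with `0` in place of `⊤`. -/
def SchedInstance.ptime {n m : ℕ} (I : SchedInstance n m) (i j : ℕ) : ℕ :=
  if h : i < m ∧ j < n then (I.proc ⟨i, h.1⟩ ⟨j, h.2⟩).toNat else 0

open Classical in
/-- The parameters of the dynamic program; `E * slots` slots correspond to one unit of time, and job
`j` is released at time `ρ j`. -/
noncomputable def SchedInstance.par {n m : ℕ} (I : SchedInstance n m) (mode : Setting) (E : ℕ)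
    (p : ℝ) (ρ : Fin n → ℕ) : Par where
  n := n
  m := m
  E := E
  N := I.flowBound
  KH := I.ticks E
  R := I.slots E
  V := E * I.slots E * I.units E
  cap := if mode = .migration then 8 * (m * 2 ^ m) else 0
  v := fun i j => I.units E / I.ptime i j
  rs := fun j => if h : j < n then E * I.slots E * ρ ⟨j, h⟩ else 0
  w := fun j => if h : j < n then I.weight ⟨j, h⟩ else 0
  kap := fun a => (((a : ℝ) + 2) / E) ^ p
  tp := 2 ^ p

section

variable {n m : ℕ} {I : SchedInstance n m} {mode : Setting} {E : ℕ} {p : ℝ} {ρ : Fin n → ℕ}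

theorem SchedInstance.ptime_eq (I : SchedInstance n m) (i : Fin m) (j : Fin n) :
    I.ptime i j = (I.proc i j).toNat := dif_pos ⟨i.2, j.2⟩

theorem SchedInstance.par_v (i : Fin m) (j : Fin n) :
    (I.par mode E p ρ).v i j = I.units E / (I.proc i j).toNat :=
  congrArg _ (I.ptime_eq i j)

theorem SchedInstance.par_rs (j : Fin n) :
    (I.par mode E p ρ).rs j = E * I.slots E * ρ j := dif_pos j.2

theorem SchedInstance.par_w (j : Fin n) : (I.par mode E p ρ).w j = I.weight j := dif_pos j.2

theorem SchedInstance.par_kap (hE : 1 ≤ E) (k a : ℕ) :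
    (I.par mode E p ρ).kap a * (I.par mode E p ρ).tp ^ k =
      (I.par mode E p ρ).flow k a ^ p := by
  have h : (0 : ℝ) < E := by exact_mod_cast hE
  change (((a : ℝ) + 2) / E) ^ p * ((2 : ℝ) ^ p) ^ k = (((a : ℝ) + 2) * 2 ^ k / E) ^ p
  rw [← Real.rpow_natCast ((2 : ℝ) ^ p) k, ← Real.rpow_mul (by positivity), mul_comm p,
    Real.rpow_mul (by positivity), Real.rpow_natCast, ← Real.mul_rpow (by positivity) (by positivity)]
  congr 1
  ring

theorem cdiv_mul_mul {R b : ℕ} (a : ℕ) (hR : 1 ≤ R) (hb : 1 ≤ b) :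
    cdiv (R * a) (R * b) = cdiv a b := by
  refine cdiv_eq (Nat.mul_pos hR hb) ?_ ?_
  · calc R * a ≤ R * (cdiv a b * b) := Nat.mul_le_mul_left _ (le_cdiv_mul a hb)
      _ = _ := by ring
  · rcases Nat.eq_zero_or_pos (cdiv a b) with h | h
    · exact .inl h
    · refine .inr ?_
      have h1 := cdiv_mul_lt a hb
      have h2 : (cdiv a b - 1) * b < a := by
        rw [Nat.sub_mul, one_mul]
        have := Nat.le_mul_of_pos_left b h
        omega
      calc (cdiv a b - 1) * (R * b) = R * ((cdiv a b - 1) * b) := by ring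
        _ < R * a := Nat.mul_lt_mul_of_pos_left h2 hR

theorem SchedInstance.par_due (hR : 1 ≤ I.slots E) (j : Fin n) (k a : ℕ) :
    (I.par mode E p ρ).due j k a =
      I.slots E * (cdiv (E * ρ j) (2 ^ k) * 2 ^ k + a * 2 ^ k) + I.slots E := by
  unfold Par.due
  rw [SchedInstance.par_rs]
  change cdiv _ (I.slots E * 2 ^ k) * (I.slots E * 2 ^ k) + a * (I.slots E * 2 ^ k) + I.slots E = _
  rw [mul_comm E, mul_assoc, cdiv_mul_mul _ hR one_le_two_pow]
  ring

theorem SchedInstance.one_le_slots (I : SchedInstance n m) (hE : 1 ≤ E) (hn : 0 < n) :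
    1 ≤ I.slots E := by
  have := I.one_le_pmax ⟨0, hn⟩
  have : 0 < I.pmax := this
  simp only [slots, ticks, flowBound]
  exact Nat.succ_le_of_lt (by positivity)

/-- Rounding a flow time `F` up to `(a + 2) * 2 ^ k / E` increases it by a factor close to one. -/
theorem exists_rounding {E N : ℕ} (hE : 1 ≤ E) {F : ℝ} (hF : 1 ≤ F) (hFN : F ≤ N) :
    ∃ k a : ℕ, 2 ^ k ≤ N ∧ a ≤ 2 * E ∧ ⌈E * F⌉₊ ≤ a * 2 ^ k ∧ a * 2 ^ k ≤ ⌈E * F⌉₊ + 2 ^ k ∧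
      ⌈E * F⌉₊ ≤ E * N ∧ ((a : ℝ) + 2) * 2 ^ k / E ≤ (1 + 1 / E) * (1 + 3 / E) * F := by
  have hE0 : (0 : ℝ) < E := by exact_mod_cast hE
  set f := ⌈E * F⌉₊ with hf
  have h1 : E * F ≤ f := Nat.le_ceil _
  have h2 : (f : ℝ) < E * F + 1 := Nat.ceil_lt_add_one (by positivity)
  have h3 : E ≤ f := by
    have : (E : ℝ) ≤ f := by nlinarith
    exact_mod_cast this
  have h4 : f ≤ E * N := Nat.ceil_le.2 (by push_cast; gcongr)
  set k := Nat.log 2 (f / E) with hk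
  have hfE : f / E ≠ 0 := (Nat.div_pos h3 hE).ne'
  have h5 : 2 ^ k * E ≤ f := (Nat.le_div_iff_mul_le hE).1 (Nat.pow_log_le_self 2 hfE)
  have h6 : f < 2 ^ (k + 1) * E := (Nat.div_lt_iff_lt_mul hE).1 (Nat.lt_pow_succ_log_self (by simp) _)
  have h7 : 1 ≤ 2 ^ k := one_le_two_pow
  have h8 := le_cdiv_mul f h7
  have h9 := cdiv_mul_lt f h7
  refine ⟨k, cdiv f (2 ^ k), ?_, cdiv_le ?_, h8, h9.le, h4, ?_⟩
  · exact Nat.le_of_mul_le_mul_right (h5.trans (h4.trans_eq (mul_comm _ _))) hE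
  · calc f ≤ 2 ^ (k + 1) * E := h6.le
      _ = _ := by ring
  · have a1 : ((cdiv f (2 ^ k) : ℕ) : ℝ) * 2 ^ k < f + 2 ^ k := by exact_mod_cast h9
    have a2 : (2 : ℝ) ^ k * E ≤ f := by exact_mod_cast h5
    have a3 : (f : ℝ) ≤ (1 + 1 / E) * (E * F) := by
      have : (1 + 1 / E) * (E * F) = E * F + F := by field_simp
      linarith
    calc ((cdiv f (2 ^ k) : ℕ) + 2 : ℝ) * 2 ^ k / E ≤ (f + 3 * 2 ^ k) / E := by gcongr; linarith
      _ ≤ (f + 3 * (f / E)) / E := by gcongr; rwa [le_div_iff₀ hE0]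
      _ = (1 + 3 / E) * f / E := by field_simp
      _ ≤ (1 + 3 / E) * ((1 + 1 / E) * (E * F)) / E := by gcongr
      _ = _ := by field_simp

/-- A feasible schedule can be turned into an admissible plan with almost the same flow times. -/
theorem Feasible.exists_plan {S : Schedule n m} (h : Feasible I mode S) (hE : 1 ≤ E) (hn : 0 < n)
    (hρ : ShiftEquiv I.release ρ (4 * I.flowBound)) (hρn : ∀ j, ρ j ≤ n * (4 * I.flowBound)) :
    ∃ pl : Plan, pl.OK (I.par mode E p ρ) ∧ ∀ j : Fin n,
      (I.par mode E p ρ).flow (pl.kk j) (pl.aa j) ≤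
        (1 + 1 / E) * (1 + 3 / E) * (completion S j - I.release j) := by
  classical
  have hE0 : (0 : ℝ) < E := by exact_mod_cast hE
  have hpm := I.one_le_pmax ⟨0, hn⟩
  have hN1 : 1 ≤ I.flowBound := Nat.succ_le_of_lt (by
    have : 0 < I.pmax := hpm
    simp only [SchedInstance.flowBound]; positivity)
  have hN1' : (1 : ℝ) ≤ I.flowBound := by exact_mod_cast hN1
  have hR1 := I.one_le_slots hE hn
  let F : Fin n → ℝ := fun j => min (completion S j - I.release j) I.flowBound
  have hF1 : ∀ j, 1 ≤ F j := fun j => le_min (h.one_le_flow j) hN1'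
  choose kk aa hkk haa hfa haf hfN hflow using fun j =>
    exists_rounding hE (hF1 j) (min_le_right (completion S j - I.release j) (I.flowBound : ℝ))
  let dl : Fin n → ℕ := fun j => cdiv (E * ρ j) (2 ^ kk j) * 2 ^ kk j + aa j * 2 ^ kk j
  have hdl1 : ∀ j, E * ρ j + ⌈E * F j⌉₊ ≤ dl j := fun j =>
    Nat.add_le_add (le_cdiv_mul _ one_le_two_pow) (hfa j)
  have hrelK : ∀ j, E * ρ j + E * (4 * I.flowBound) ≤ I.ticks E := by
    intro j
    calc E * ρ j + E * (4 * I.flowBound) = E * (ρ j + 4 * I.flowBound) := by ring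
      _ ≤ E * (n * (4 * I.flowBound) + 4 * I.flowBound) := by gcongr; exact hρn j
      _ = _ := by simp only [SchedInstance.ticks]; ring
  have hdl2 : ∀ j, dl j ≤ I.ticks E := by
    intro j
    have h1 := cdiv_mul_lt (E * ρ j) (one_le_two_pow (n := kk j))
    have h2 := haf j
    have h3 := hfN j
    have h4 := hkk j
    have h5 := hrelK j
    have h6 := Nat.mul_le_mul hE (le_refl I.flowBound)
    have h7 : E * (4 * I.flowBound) = 4 * (E * I.flowBound) := by ring
    simp only [dl]
    simp only [F] at h2 h3
    omega
  obtain ⟨z, ok, hz, hok, hmig⟩ := h.exists_fsched hE (rfl : I.flowBound = _)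
    (show I.flowBound ≤ 4 * I.flowBound by omega) hρ (f := fun j => ⌈E * F j⌉₊)
    (fun j => Nat.le_ceil _) hdl1 hdl2
  have hc : ∀ i j, ok i j → (1 : ℝ) ≤ (I.proc i j).toNat ∧ ((I.proc i j).toNat : ℝ) ≤ I.pmax :=
    fun i j hij => ⟨by exact_mod_cast I.one_le_toNat (hok i j hij), cast_le.2 (I.le_pmax i j)⟩
  have hc0 : ∀ i j, ok i j → 0 < 1 / ((I.proc i j).toNat : ℝ) := fun i j hij =>
    one_div_pos.2 (by linarith [(hc i j hij).1])
  -- without migration, no job is ever unsettled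
  obtain ⟨z1, hz1, hu1⟩ : ∃ z1, FSched (I.ticks E) E (fun i j => 1 / ((I.proc i j).toNat : ℝ)) ok
      (fun j => E * ρ j) dl z1 ∧ ∀ k d, ∀ B : Finset (Fin n),
        (∀ j ∈ B, dl j = d ∧ E * ρ j ≤ k ∧ Uns z1 k j) →
          4 * B.card ≤ (I.par mode E p ρ).cap := by
    cases mode with
    | migration =>
      obtain ⟨z1, hz1, hu1⟩ := hz.exists_all_few_unsettled hdl2 hc0
      refine ⟨z1, hz1, fun k d B hB => ?_⟩
      have := hu1 k d B hB
      change _ ≤ if Setting.migration = .migration then 8 * (m * 2 ^ m) else 0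
      rw [if_pos rfl]
      omega
    | noMigration =>
      refine ⟨z, hz, fun k d B hB => ?_⟩
      rw [Finset.eq_empty_of_forall_notMem (s := B) fun j hj => ?_]
      · simp
      · obtain ⟨-, -, i, i', hne, ⟨κ, -, h1⟩, κ', -, h2⟩ := hB j hj
        exact hne (hmig rfl i i' j (hz.supp _ _ _ h1).1 (hz.supp _ _ _ h2).1)
  obtain ⟨z2, hz2, hu2, hf2⟩ := hz1.exists_few_confs
  have hW : ∀ i j, ok i j → (I.slots E : ℝ) + 1 ≤ I.units E * (1 / ((I.proc i j).toNat : ℝ)) := by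
    intro i j hij
    obtain ⟨h1, h2⟩ := hc i j hij
    have hE1 : (1 : ℝ) ≤ E := by exact_mod_cast hE
    rw [mul_one_div, le_div_iff₀ (by linarith), SchedInstance.units]
    push_cast
    have h3 : (I.slots E : ℝ) + 1 ≤ E * I.slots E + 1 := by
      have : (0 : ℝ) ≤ I.slots E := cast_nonneg _
      nlinarith
    calc ((I.slots E : ℝ) + 1) * (I.proc i j).toNat ≤ (E * I.slots E + 1) * I.pmax := by gcongr
      _ = _ := mul_comm _ _
  let ext : (Fin n → ℕ) → ℕ → ℕ := fun g j => if hj : j < n then g ⟨j, hj⟩ else 0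
  have hext : ∀ (g : Fin n → ℕ) (j : Fin n), ext g j = g j := fun g j => dif_pos j.2
  obtain ⟨pl, hpl, hkk', haa'⟩ := hz2.exists_plan (P := I.par mode E p ρ) (W := I.units E)
    (kk := ext kk) (aa := ext aa) rfl rfl rfl
    (fun j => by
      rw [SchedInstance.par_rs]
      change _ = I.slots E * (E * ρ j)
      ring)
    (fun j => (Nat.le_add_right _ _).trans (hrelK j)) hdl2
    (fun j => by rw [hext, hext]; exact SchedInstance.par_due hR1 j _ _)
    (fun j hj => by rw [show ext kk j = _ from hext kk ⟨j, hj⟩]; exact hkk _)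
    (fun j hj => by rw [show ext aa j = _ from hext aa ⟨j, hj⟩]; exact haa _)
    (fun i j hij => by
      rw [SchedInstance.par_v]
      obtain ⟨h1, h2⟩ := hc i j hij
      have h3 := hW i j hij
      rw [mul_one_div] at h3 ⊢
      have h4 := Nat.lt_floor_add_one ((I.units E : ℝ) / (I.proc i j).toNat)
      rw [Nat.floor_div_natCast, Nat.floor_natCast] at h4
      refine ⟨?_, h4.le⟩
      have h5 : (0 : ℝ) < ((I.units E / (I.proc i j).toNat : ℕ) : ℝ) := by
        have : (1 : ℝ) ≤ I.slots E := by exact_mod_cast hR1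
        linarith
      exact_mod_cast h5)
    (cast_nonneg _) (fun i j hij => hW i j hij)
    (le_of_eq (by
      change ((E * I.slots E * I.units E : ℕ) : ℝ) = I.slots E * I.units E * E
      push_cast; ring))
    hf2
    (fun k d B hB => hu1 k d B fun j hj =>
      ⟨(hB j hj).1, (hB j hj).2.1, (hB j hj).2.2.mono fun i => hu2 k i j⟩)
  refine ⟨pl, hpl, fun j => ?_⟩
  rw [hkk', haa', hext, hext]
  refine (hflow j).trans ?_
  gcongr
  exact min_le_left _ _

end

/-! ### From partial schedules to schedules -/

section Emitted

variable {n m : ℕ}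

/-- The fraction of job `j` that is processed by a schedule. -/
noncomputable def fracOf (I : SchedInstance n m) (S : Schedule n m) (j : Fin n) : ℝ :=
  ((S.filter fun a => a.job = j).map fun a =>
    (a.finish - a.start) / ((I.proc a.machine j).toNat : ℝ)).sum

theorem fracOf_append (I : SchedInstance n m) (S : Schedule n m) (a : Piece n m) (j : Fin n) :
    fracOf I (S ++ [a]) j = fracOf I S j +
      if a.job = j then (a.finish - a.start) / ((I.proc a.machine j).toNat : ℝ) else 0 := by
  unfold fracOf
  by_cases h : a.job = j <;> simp [h]

/-- The fraction of job `j` that is processed by a list of decisions, with `Q` slots per time unit. -/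
noncomputable def fracDec (I : SchedInstance n m) (Q : ℕ) (l : List (ℕ × ℕ × ℕ)) (j : ℕ) : ℝ :=
  (l.map fun e => if e.1 = j + 1 then 1 / ((Q : ℝ) * I.ptime e.2.1 j) else 0).sum

/-- A decision to run a job respects release time and machine, and lies less than `G` time units after
the release. -/
def ValidDec (I : SchedInstance n m) (ρ : Fin n → ℕ) (Q G : ℕ) (e : ℕ × ℕ × ℕ) : Prop :=
  ∀ j, e.1 = j + 1 → ∃ (hj : j < n) (hi : e.2.1 < m), I.proc ⟨e.2.1, hi⟩ ⟨j, hj⟩ ≠ ⊤ ∧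
    Q * ρ ⟨j, hj⟩ ≤ e.2.2 ∧ e.2.2 + 1 ≤ Q * (ρ ⟨j, hj⟩ + G)

/-- The schedule `S` results from a list of decisions: each decision to run a job results in a
piece, which is truncated or omitted if otherwise the job would be processed by more than once. -/
structure Emitted (I : SchedInstance n m) (ρ : Fin n → ℕ) (Q : ℕ) (l : List (ℕ × ℕ × ℕ))
    (S : Schedule n m) : Prop where
  mem : ∀ a ∈ S, ∃ t : ℕ, ((a.job : ℕ) + 1, (a.machine : ℕ), t) ∈ l ∧
    a.start = t / Q + I.release a.job - ρ a.job ∧ a.start < a.finish ∧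
    a.finish ≤ (t + 1) / Q + I.release a.job - ρ a.job
  disj : S.Pairwise Piece.Compat
  frac : ∀ j, fracOf I S j = min 1 (fracDec I Q l j)

variable {I : SchedInstance n m} {ρ : Fin n → ℕ} {Q G : ℕ} {l : List (ℕ × ℕ × ℕ)}
  {S : Schedule n m}

theorem emitted_nil : Emitted I ρ Q [] ([] : Schedule n m) :=
  ⟨by simp, List.Pairwise.nil, fun j => by simp [fracOf, fracDec]⟩

theorem fracDec_append (e : ℕ × ℕ × ℕ) (j : ℕ) : fracDec I Q (l ++ [e]) j = fracDec I Q l j +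
    if e.1 = j + 1 then 1 / ((Q : ℝ) * I.ptime e.2.1 j) else 0 := by
  simp [fracDec]

/-- A decision that concerns no job, or a job that is completed already, has no effect. -/
theorem Emitted.skip (h : Emitted I ρ Q l S) (e : ℕ × ℕ × ℕ)
    (he : ∀ j : Fin n, e.1 = j + 1 → 1 ≤ fracOf I S j) : Emitted I ρ Q (l ++ [e]) S where
  mem a ha := by
    obtain ⟨t, h1, h2⟩ := h.mem a ha
    exact ⟨t, mem_append_left _ h1, h2⟩
  disj := h.disj
  frac j := by
    rw [fracDec_append, h.frac]
    split_ifs with hj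
    · have h1 := he j hj
      rw [h.frac] at h1
      have h2 := h1.trans (min_le_right _ _)
      rw [min_eq_left h2, min_eq_left (h2.trans (le_add_of_nonneg_right (by positivity)))]
    · rw [add_zero]

/-- The piece that results from a decision. -/
noncomputable def nextPiece (I : SchedInstance n m) (ρ : Fin n → ℕ) (Q : ℕ) (S : Schedule n m)
    (j : Fin n) (i : Fin m) (t : ℕ) : Piece n m where
  job := j
  machine := i
  start := t / Q + I.release j - ρ j
  finish := t / Q + I.release j - ρ j + min (1 / (Q : ℝ)) ((1 - fracOf I S j) * (I.proc i j).toNat)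

theorem Emitted.append (h : Emitted I ρ Q l S) (hQ : 1 ≤ Q) (hρ : ShiftEquiv I.release ρ G)
    (hl : ∀ e ∈ l, ValidDec I ρ Q G e) {j : Fin n} {i : Fin m} {t : ℕ}
    (he : ValidDec I ρ Q G ((j : ℕ) + 1, (i : ℕ), t))
    (hd : ∀ e ∈ l, e.1 ≠ 0 → (e.2.1 = i ∨ e.1 = (j : ℕ) + 1) → e.2.2 ≠ t) (hj : fracOf I S j < 1) :
    Emitted I ρ Q (l ++ [((j : ℕ) + 1, (i : ℕ), t)]) (S ++ [nextPiece I ρ Q S j i t]) := by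
  have hQ0 : (0 : ℝ) < Q := by exact_mod_cast hQ
  obtain ⟨_, _, hp, -⟩ := he j rfl
  have hp1 : (1 : ℝ) ≤ (I.proc i j).toNat := by exact_mod_cast I.one_le_toNat hp
  set p : ℝ := ((I.proc i j).toNat : ℝ) with hpdef
  set δ := min (1 / (Q : ℝ)) ((1 - fracOf I S j) * p) with hδ
  have hδ0 : 0 < δ := lt_min (by positivity) (mul_pos (by linarith) (by linarith))
  have hδQ : δ ≤ 1 / Q := min_le_left _ _
  -- the piece of a decision before the shift from the times `ρ` to the release times
  have key : ∀ a : Piece n m, ∀ t : ℕ, ValidDec I ρ Q G ((a.job : ℕ) + 1, (a.machine : ℕ), t) →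
      a.start = t / Q + I.release a.job - ρ a.job →
      a.finish ≤ (t + 1) / Q + I.release a.job - ρ a.job →
      ∃ b : Piece n m, b.shift ρ I.release = a ∧ (ρ b.job : ℝ) ≤ b.start ∧
        b.finish ≤ ρ b.job + G ∧ b.start = t / Q ∧ b.finish ≤ (t + 1) / Q ∧ b.job = a.job ∧
        b.machine = a.machine := by
    intro a t ha h1 h2
    obtain ⟨_, _, -, h3, h4⟩ := ha a.job rfl
    have h3' : ((Q : ℝ) * ρ a.job) ≤ t := by exact_mod_cast h3
    have h4' : ((t : ℝ) + 1) ≤ Q * (ρ a.job + G) := by exact_mod_cast h4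
    refine ⟨a.shift I.release ρ, ?_, ?_, ?_, ?_, ?_, rfl, rfl⟩
    · simp [Piece.shift]
    · change (ρ a.job : ℝ) ≤ a.start - I.release a.job + ρ a.job
      have : (ρ a.job : ℝ) ≤ t / Q := by rw [le_div_iff₀ hQ0]; linarith
      linarith
    · change a.finish - I.release a.job + ρ a.job ≤ ρ a.job + G
      have : ((t : ℝ) + 1) / Q ≤ ρ a.job + G := by rw [div_le_iff₀ hQ0]; linarith
      linarith
    · change a.start - I.release a.job + ρ a.job = _
      linarith
    · change a.finish - I.release a.job + ρ a.job ≤ _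
      linarith
  have hfin : (nextPiece I ρ Q S j i t).finish ≤ (t + 1) / Q + I.release j - ρ j := by
    change t / Q + I.release j - ρ j + δ ≤ _
    rw [add_div]
    linarith
  refine ⟨fun a ha => ?_, ?_, fun j' => ?_⟩
  · rcases mem_append.1 ha with ha | ha
    · obtain ⟨t', h1, h2⟩ := h.mem a ha
      exact ⟨t', mem_append_left _ h1, h2⟩
    · obtain rfl := List.mem_singleton.1 ha
      exact ⟨t, by simp [nextPiece], rfl, lt_add_of_pos_right _ hδ0, hfin⟩
  · refine List.pairwise_append.2 ⟨h.disj, List.pairwise_singleton _ _, fun a ha b hb => ?_⟩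
    obtain rfl := List.mem_singleton.1 hb
    obtain ⟨t', h1, h2, -, h4⟩ := h.mem a ha
    obtain ⟨a', rfl, a1, a2, a3, a4, a5, a6⟩ := key a t' (hl _ h1) h2 h4
    obtain ⟨b', hb', b1, b2, b3, b4, b5, b6⟩ := key (nextPiece I ρ Q S j i t) t he rfl hfin
    rw [← hb']
    refine Piece.Compat.shift (fun hab => ?_) hρ.symm a1 a2 b1 b2
    rw [a5, a6] at *
    have hne := hd _ h1 (Nat.succ_ne_zero _) (by
      rw [b5, b6] at hab
      exact hab.imp (fun h => congrArg Fin.val h) fun h => congrArg (fun j : Fin n => (j : ℕ) + 1) h)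
    rw [a3, b3]
    rcases lt_or_gt_of_ne hne with hlt | hlt
    · left
      have h5 : ((t' : ℝ) + 1) / Q ≤ t / Q := by gcongr; exact_mod_cast hlt
      linarith
    · right
      have h5 : ((t : ℝ) + 1) / Q ≤ t' / Q := by gcongr; exact_mod_cast hlt
      linarith
  · rw [fracOf_append, fracDec_append]
    by_cases hjj : j = j'
    · subst hjj
      rw [if_pos (show (nextPiece I ρ Q S j i t).job = j from rfl), if_pos rfl,
        show I.ptime ((j : ℕ) + 1, (i : ℕ), t).2.1 j = _ from I.ptime_eq i j]
      have e1 : (nextPiece I ρ Q S j i t).finish - (nextPiece I ρ Q S j i t).start = δ := by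
        simp [nextPiece, hδ, hpdef]
      have e2 : (I.proc (nextPiece I ρ Q S j i t).machine j).toNat = (I.proc i j).toNat := rfl
      rw [e1, e2, ← hpdef]
      have hF := h.frac j
      have hF1 : fracOf I S j = fracDec I Q l j := by
        rw [hF] at hj ⊢
        exact min_eq_right (by by_contra h'; rw [min_eq_left (not_le.1 h').le] at hj; linarith)
      rw [← hF1, hδ, ← min_div_div_right (by linarith), mul_div_cancel_right₀ _ (by linarith),
        ← min_add_add_left, min_comm]
      congr 1
      · ring
      · rw [div_div]
    · have hne : (nextPiece I ρ Q S j i t).job ≠ j' := hjj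
      rw [if_neg hne, if_neg (fun h' => hjj (Fin.ext (Nat.succ_injective h'))), add_zero, add_zero,
        h.frac]

end Emitted

section Final

variable {n m : ℕ} {I : SchedInstance n m} {mode : Setting} {E : ℕ} {p : ℝ} {ρ : Fin n → ℕ}

/-- The due slots and the flow time bounds of the dynamic program. -/
theorem SchedInstance.par_due_le (hE : 1 ≤ E) (hn : 0 < n) (j : Fin n) {k a : ℕ}
    (hk : I.slots E * 2 ^ k ≤ I.flowBound * I.slots E) (ha : a ≤ 2 * E)
    (hρn : ρ j ≤ n * (4 * I.flowBound)) :
    (I.par mode E p ρ).due j k a ≤ (I.par mode E p ρ).H ∧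
    (I.par mode E p ρ).due j k a ≤ E * I.slots E * (ρ j + 4 * I.flowBound) ∧
    ((I.par mode E p ρ).due j k a : ℝ) ≤
      E * I.slots E * (ρ j + (I.par mode E p ρ).flow k a) := by
  have hR := I.one_le_slots hE hn
  have hk' : 2 ^ k ≤ I.flowBound :=
    Nat.le_of_mul_le_mul_left (hk.trans_eq (mul_comm _ _)) hR
  have h1 := cdiv_mul_lt (E * ρ j) (one_le_two_pow (n := k))
  have h2 : (1 : ℕ) ≤ 2 ^ k := one_le_two_pow
  set d := cdiv (E * ρ j) (2 ^ k) * 2 ^ k + a * 2 ^ k with hd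
  have h3 : d + 1 ≤ E * ρ j + (a + 2) * 2 ^ k := by
    have : (a + 2) * 2 ^ k = a * 2 ^ k + 2 * 2 ^ k := by ring
    omega
  have h4 : (a + 2) * 2 ^ k ≤ E * (4 * I.flowBound) := by
    calc (a + 2) * 2 ^ k ≤ (4 * E) * I.flowBound := Nat.mul_le_mul (by omega) hk'
      _ = _ := by ring
  rw [I.par_due hR]
  refine ⟨?_, ?_, ?_⟩
  · change _ ≤ I.slots E * I.ticks E + I.slots E
    have h5 : E * ρ j ≤ E * (n * (4 * I.flowBound)) := Nat.mul_le_mul_left _ hρn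
    have h6 : d ≤ I.ticks E := by
      have : I.ticks E = E * (n * (4 * I.flowBound)) + E * (4 * I.flowBound) := by
        simp only [ticks]; ring
      omega
    gcongr
  · calc I.slots E * d + I.slots E = I.slots E * (d + 1) := by ring
      _ ≤ I.slots E * (E * ρ j + E * (4 * I.flowBound)) :=
          Nat.mul_le_mul_left _ (by omega)
      _ = _ := by ring
  · have hE0 : (0 : ℝ) < E := by exact_mod_cast hE
    have h7 : ((d : ℝ) + 1) ≤ E * ρ j + (a + 2) * 2 ^ k := by exact_mod_cast h3
    change ((I.slots E * d + I.slots E : ℕ) : ℝ) ≤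
      E * I.slots E * (ρ j + ((a : ℝ) + 2) * 2 ^ k / E)
    push_cast
    calc (I.slots E : ℝ) * d + I.slots E = I.slots E * (d + 1) := by ring
      _ ≤ I.slots E * (E * ρ j + (a + 2) * 2 ^ k) := by gcongr
      _ = _ := by field_simp

/-- The schedule that results from a complete partial schedule is feasible, and its objective value
is bounded by the cost of the partial schedule. -/
theorem Sound.feasible {x : Rec} (hx : Sound (I.par mode E p ρ) (fun F => F ^ p)
      (I.par mode E p ρ).H n m x) (hE : 1 ≤ E) (hp : 0 < p)
    (hρn : ∀ j, ρ j ≤ n * (4 * I.flowBound)) :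
    (∀ e ∈ x.hist, ValidDec I ρ (E * I.slots E) (4 * I.flowBound) e) ∧
    ∀ S, Emitted I ρ (E * I.slots E) x.hist S → Feasible I mode S ∧
      ∑ j, (I.weight j : ℝ) * (completion S j - I.release j) ^ p ≤ x.cost := by
  set P := I.par mode E p ρ with hP
  have hE0 : (0 : ℝ) < E := by exact_mod_cast hE
  have hR : ∀ j : Fin n, 1 ≤ I.slots E := fun j => I.one_le_slots hE (Fin.pos j)
  have hrsH : ∀ j : Fin n, P.rs j ≤ P.H := by
    intro j
    rw [SchedInstance.par_rs]
    change _ ≤ I.slots E * I.ticks E + I.slots E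
    have : E * ρ j ≤ I.ticks E := by
      calc E * ρ j ≤ E * (n * (4 * I.flowBound)) := Nat.mul_le_mul_left _ (hρn j)
        _ ≤ E * ((n + 1) * (4 * I.flowBound)) := by gcongr; omega
    calc E * I.slots E * ρ j = I.slots E * (E * ρ j) := by ring
      _ ≤ I.slots E * I.ticks E + 0 := Nat.mul_le_mul_left _ this
      _ ≤ _ := by gcongr; exact Nat.zero_le _
  have hD : ∀ j : Fin n, x.D j ≠ 0 := fun j => (hx.rel j j.2).2 (by
    have := hrsH j
    have := j.2
    omega)
  have hdue : ∀ j : Fin n, x.D j ≤ P.H ∧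
      x.D j ≤ E * I.slots E * (ρ j + 4 * I.flowBound) ∧
      (x.D j : ℝ) ≤ E * I.slots E * (ρ j + x.fh j) ∧ 0 ≤ x.fh j := by
    intro j
    obtain ⟨k, a, h1, h2, h3, h4⟩ := hx.due j j.2 (hD j)
    rw [h3, h4]
    obtain ⟨a1, a2, a3⟩ := I.par_due_le (mode := mode) (p := p) hE (Fin.pos j) j h1 h2 (hρn j)
    exact ⟨a1, a2, a3, div_nonneg (by positivity) (cast_nonneg _)⟩
  have hR0 : ∀ j : Fin n, x.R j = 0 := by
    intro j
    by_contra hne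
    have := hx.now_lt j j.2 j.2 hne
    have := (hdue j).1
    omega
  have hent : ∀ e ∈ x.hist, ∀ j, e.1 = j + 1 → ∃ (hj : j < n) (hi : e.2.1 < m),
      I.proc ⟨e.2.1, hi⟩ ⟨j, hj⟩ ≠ ⊤ ∧ E * I.slots E * ρ ⟨j, hj⟩ ≤ e.2.2 ∧ e.2.2 < x.D j := by
    intro e he j hj
    obtain ⟨h1, h2, h3, h4, h5, -⟩ := hx.entry e he j hj
    have h1 : j < n := h1
    have h2 : e.2.1 < m := h2
    refine ⟨h1, h2, fun htop => ?_, ?_, h5⟩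
    · rw [show P.v e.2.1 j = _ from SchedInstance.par_v ⟨_, h2⟩ ⟨_, h1⟩, htop] at h3
      simp at h3
    · rwa [show P.rs j = _ from SchedInstance.par_rs ⟨j, h1⟩] at h4
  refine ⟨fun e he j hj => ?_, fun S hS => ?_⟩
  · obtain ⟨h1, h2, h3, h4, h5⟩ := hent e he j hj
    exact ⟨h1, h2, h3, h4, (Nat.succ_le_of_lt h5).trans (hdue ⟨j, h1⟩).2.1⟩
  have hQ : ∀ j : Fin n, (0 : ℝ) < ((E * I.slots E : ℕ) : ℝ) := fun j => by
    exact_mod_cast Nat.mul_pos hE (hR j)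
  have hpiece : ∀ a ∈ S, I.proc a.machine a.job ≠ ⊤ ∧ (I.release a.job : ℝ) ≤ a.start ∧
      a.finish ≤ I.release a.job + x.fh a.job := by
    intro a ha
    obtain ⟨t, h1, h2, -, h4⟩ := hS.mem a ha
    obtain ⟨_, _, h5, h6, h7⟩ := hent _ h1 a.job rfl
    have hQ := hQ a.job
    refine ⟨h5, ?_, ?_⟩
    · have h6' : (((E * I.slots E : ℕ) : ℝ) * ρ a.job) ≤ t := by exact_mod_cast h6
      have : (ρ a.job : ℝ) ≤ t / ((E * I.slots E : ℕ) : ℝ) := by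
        rw [le_div_iff₀ hQ]; linarith
      linarith
    · have h8 : ((t : ℝ) + 1) ≤ x.D a.job := by exact_mod_cast h7
      have h9 := (hdue a.job).2.2.1
      have : ((t : ℝ) + 1) / ((E * I.slots E : ℕ) : ℝ) ≤ ρ a.job + x.fh a.job := by
        rw [div_le_iff₀ hQ]; push_cast; linarith
      linarith
  have hfeas : Feasible I mode S := by
    refine ⟨fun a ha => ?_, fun a ha => (hpiece a ha).2.1, fun a ha => (hpiece a ha).1, hS.disj,
      fun j => ?_, fun hset a ha b hb hab => ?_⟩
    · obtain ⟨t, -, -, h3, -⟩ := hS.mem a ha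
      exact h3
    · change fracOf I S j = 1
      rw [hS.frac]
      refine min_eq_left ?_
      -- the decisions provide enough work for each job
      have hw : P.V ≤ P.work j x.hist := by
        by_cases hM : x.M j = 0
        · simpa [hR0 j] using hx.work0 j j.2 (hD j) hM
        · simpa [hR0 j] using hx.work1 j j.2 hM
      have hU : (0 : ℝ) < I.units E := by
        have := I.one_le_pmax j
        have : 0 < I.units E := Nat.mul_pos this (succ_pos _)
        exact_mod_cast this
      have hw2 : ((P.work j x.hist : ℕ) : ℝ) ≤
          I.units E * (((E * I.slots E : ℕ) : ℝ) * fracDec I (E * I.slots E) x.hist j) := by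
        unfold Par.work fracDec
        rw [← List.sum_map_mul_left, ← List.sum_map_mul_left, Nat.cast_list_sum, List.map_map]
        refine List.sum_le_sum fun e _ => ?_
        simp only [Function.comp]
        split_ifs
        · have := Nat.cast_div_le (α := ℝ) (m := I.units E) (n := I.ptime e.2.1 j)
          refine this.trans (le_of_eq ?_)
          have := (hQ j).ne'
          rw [one_div, mul_inv, mul_inv_cancel_left₀ this]
          rfl
        · simp
      have hV : ((E * I.slots E : ℕ) : ℝ) * I.units E ≤ P.work j x.hist := by exact_mod_cast hw
      have h3 := hV.trans hw2
      have hQ := hQ j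
      have h4 : ((E * I.slots E : ℕ) : ℝ) * I.units E * 1 ≤
          ((E * I.slots E : ℕ) : ℝ) * I.units E * fracDec I (E * I.slots E) x.hist j := by linarith
      exact le_of_mul_le_mul_left h4 (by positivity)
    · have hcap : P.cap = 0 := by
        subst hset
        exact if_neg (by simp)
      obtain ⟨t, h1, -⟩ := hS.mem a ha
      obtain ⟨t', h1', -⟩ := hS.mem b hb
      have e1 := (hx.nomig hcap a.job a.job.2 (hD _)).2 _ h1 rfl
      have e2 := (hx.nomig hcap b.job b.job.2 (hD _)).2 _ h1' rfl
      rw [← hab] at e2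
      exact Fin.ext (Nat.succ_injective (e1.trans e2.symm))
  refine ⟨hfeas, ?_⟩
  rw [hx.cost, show P.n = n from rfl, sum_range]
  refine sum_le_sum fun j _ => ?_
  rw [if_pos (hD j), SchedInstance.par_w]
  gcongr
  · linarith [hfeas.one_le_flow j]
  · have h1 := (hdue j).2.2.2
    have : completion S j ≤ I.release j + x.fh j :=
      completion_le (by positivity) fun a ha haj => haj ▸ (hpiece a ha).2.2
    linarith

/-- There is a feasible schedule: the jobs run one after the other. -/
theorem SchedInstance.exists_feasible (I : SchedInstance n m) (mode : Setting) :
    ∃ S, Feasible I mode S := by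
  choose i hi using I.runnable
  have hp : ∀ j, (0 : ℝ) < (I.proc (i j) j).toNat ∧ ((I.proc (i j) j).toNat : ℝ) ≤ I.pmax :=
    fun j => ⟨by exact_mod_cast I.one_le_toNat (hi j), by exact_mod_cast I.le_pmax _ _⟩
  let T : ℕ := Finset.univ.sup I.release
  let f : Fin n → Piece n m := fun j => ⟨j, i j, T + j * I.pmax,
    T + j * I.pmax + (I.proc (i j) j).toNat⟩
  refine ⟨List.ofFn f, ⟨?_, ?_, ?_, ?_, fun j => ?_, ?_⟩⟩
  · simpa [List.mem_ofFn, f] using fun j => Nat.pos_of_ne_zero (Nat.one_le_iff_ne_zero.1 (I.one_le_toNat (hi j)))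
  · intro a ha
    obtain ⟨j, rfl⟩ := List.mem_ofFn.1 ha
    have : (I.release j : ℝ) ≤ T := by exact_mod_cast Finset.le_sup (f := I.release) (mem_univ j)
    simp only [f]
    have : (0 : ℝ) ≤ j * I.pmax := by positivity
    linarith
  · intro a ha
    obtain ⟨j, rfl⟩ := List.mem_ofFn.1 ha
    exact hi j
  · rw [List.pairwise_ofFn]
    intro j j' hjj _
    left
    simp only [f]
    have h1 : ((j : ℕ) : ℝ) + 1 ≤ (j' : ℕ) := by exact_mod_cast hjj
    nlinarith [hp j]
  · rw [sum_map_filter_get (List.ofFn f) (fun a => a.job = j)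
      fun a => (a.finish - a.start) / ((I.proc a.machine j).toNat : ℝ)]
    rw [← Equiv.sum_comp (finCongr (List.length_ofFn (f := f)).symm)]
    rw [sum_eq_single j]
    · simp [f, (hp j).1.ne']
    · intro j' _ hj'
      simp [f, hj']
    · simp
  · intro _ a ha b hb hab
    obtain ⟨j, rfl⟩ := List.mem_ofFn.1 ha
    obtain ⟨j', rfl⟩ := List.mem_ofFn.1 hb
    have : j = j' := hab
    rw [this]

end Final

/-! ### Arithmetic in programs -/

/-- Arithmetic terms. `rd e` is the value of an expression of the machine model. -/
inductive Term
  | rd (e : NExpr)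
  | add (a b : Term)
  | mul (a b : Term)
  | div (a b : Term)

/-- The value of a term. -/
def Term.val (s : Memory) : Term → ℕ
  | rd e => e.eval s
  | add a b => a.val s + b.val s
  | mul a b => a.val s * b.val s
  | div a b => a.val s / b.val s

/-- The integer arrays that occur in an expression. -/
def NExpr.reads : NExpr → List ℕ
  | lit _ => []
  | get a i => a :: i.reads
  | add e f => e.reads ++ f.reads
  | sub e f => e.reads ++ f.reads

/-- The integer arrays that occur in a term. -/
def Term.reads : Term → List ℕ
  | rd e => e.reads
  | add a b => a.reads ++ b.reads
  | mul a b => a.reads ++ b.reads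
  | div a b => a.reads ++ b.reads

/-- The loops that evaluate the term run for at most `Z` rounds. -/
def Term.Fits (Z : ℕ) (s : Memory) : Term → Prop
  | rd _ => True
  | add a b => a.Fits Z s ∧ b.Fits Z s
  | mul a b => a.Fits Z s ∧ b.Fits Z s ∧ a.val s ≤ Z
  | div a b => a.Fits Z s ∧ b.Fits Z s ∧ a.val s ≤ Z

/-- Evaluation of a term. The array `24` is used as a stack; the value is put into cell `d`. -/
def Term.comp : Term → ℕ → Prog
  | rd e, d => .setNat 24 (.lit d) e
  | add a b, d => block [a.comp d, b.comp (d + 1),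
      .setNat 24 (.lit d) (.add (.get 24 (.lit d)) (.get 24 (.lit (d + 1))))]
  | mul a b, d => block [a.comp d, b.comp (d + 1), .setNat 24 (.lit (d + 2)) (.lit 0),
      forN 25 (.get 24 (.lit d)) (.setNat 24 (.lit (d + 2))
        (.add (.get 24 (.lit (d + 2))) (.get 24 (.lit (d + 1))))),
      .setNat 24 (.lit d) (.get 24 (.lit (d + 2)))]
  | div a b, d => block [a.comp d, b.comp (d + 1), .setNat 24 (.lit (d + 2)) (.lit 0),
      .setNat 24 (.lit (d + 3)) (.get 24 (.lit (d + 1))),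
      forN 25 (.get 24 (.lit d)) (ifLe (.lit 1) (.get 24 (.lit (d + 1)))
        (ifLe (.get 24 (.lit (d + 3))) (.get 24 (.lit d)) (block [
          .setNat 24 (.lit (d + 2)) (.add (.get 24 (.lit (d + 2))) (.lit 1)),
          .setNat 24 (.lit (d + 3)) (.add (.get 24 (.lit (d + 3))) (.get 24 (.lit (d + 1))))]))),
      .setNat 24 (.lit d) (.get 24 (.lit (d + 2)))]

theorem NExpr.eval_congr {s s' : Memory} {e : NExpr} (h : ∀ a ∈ e.reads, s'.nat a = s.nat a) :
    e.eval s' = e.eval s := by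
  induction e with
  | lit k => rfl
  | get a i ih =>
    simp only [reads, mem_cons, forall_eq_or_imp] at h
    simp only [eval, ih h.2, h.1]
  | add e f ih ih' =>
    simp only [reads, mem_append] at h
    simp only [eval, ih fun a ha => h a (.inl ha), ih' fun a ha => h a (.inr ha)]
  | sub e f ih ih' =>
    simp only [reads, mem_append] at h
    simp only [eval, ih fun a ha => h a (.inl ha), ih' fun a ha => h a (.inr ha)]

theorem Term.val_congr {s s' : Memory} {e : Term} (h : ∀ a ∈ e.reads, s'.nat a = s.nat a) :
    e.val s' = e.val s := by
  induction e with
  | rd e => exact NExpr.eval_congr h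
  | add a b ih ih' | mul a b ih ih' | div a b ih ih' =>
    simp only [reads, mem_append] at h
    simp only [val, ih fun a ha => h a (.inl ha), ih' fun a ha => h a (.inr ha)]

theorem Term.fits_congr {Z : ℕ} {s s' : Memory} {e : Term}
    (h : ∀ a ∈ e.reads, s'.nat a = s.nat a) (hf : e.Fits Z s) : e.Fits Z s' := by
  induction e with
  | rd e => trivial
  | add a b ih ih' =>
    simp only [reads, mem_append] at h
    exact ⟨ih (fun a ha => h a (.inl ha)) hf.1, ih' (fun a ha => h a (.inr ha)) hf.2⟩
  | mul a b ih ih' | div a b ih ih' =>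
    simp only [reads, mem_append] at h
    exact ⟨ih (fun a ha => h a (.inl ha)) hf.1, ih' (fun a ha => h a (.inr ha)) hf.2.1,
      (val_congr fun a ha => h a (.inl ha)).trans_le hf.2.2⟩

/-- The memories agree except for variable `25` and the cells of array `24` from `d` on. -/
def AgStack (d : ℕ) (s s' : Memory) : Prop :=
  Ag [24, 25] [] s s' ∧ ∀ k < d, s'.nat 24 k = s.nat 24 k

theorem AgStack.trans {d d' : ℕ} {s s' s'' : Memory} (h : AgStack d s s') (h' : AgStack d' s' s'')
    (hd : d ≤ d') : AgStack d s s'' :=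
  ⟨h.1.trans h'.1 (fun _ => id) (fun _ => id), fun k hk => (h'.2 k (by omega)).trans (h.2 k hk)⟩

theorem AgStack.push {d : ℕ} {s s' : Memory} (h : AgStack d s s') {k : ℕ} (hk : d ≤ k) (v : ℕ) :
    AgStack d s (s'.setNat 24 k v) :=
  ⟨h.1.setNat, fun k' hk' => by simp [show k' ≠ k by omega, h.2 k' hk']⟩

theorem AgStack.count {d : ℕ} {s s' : Memory} (h : AgStack d s s') (v : ℕ) :
    AgStack d s (s'.setNat 25 0 v) :=
  ⟨h.1.setNat, fun k' hk' => by simp [h.2 k' hk']⟩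

theorem Term.comp_spec {Z : ℕ} {e : Term} (he : ∀ a ∈ e.reads, a ∉ [24, 25]) (d : ℕ) {s : Memory}
    (hf : e.Fits Z s) :
    Wp Z (e.comp d) s fun s' => AgStack d s s' ∧ s'.nat 24 d = e.val s := by
  have refl : ∀ d s, AgStack d s s := fun d s => ⟨Ag.refl _ _ _, fun _ _ => rfl⟩
  induction e generalizing d s
  case rd e => exact wp_setNat ⟨(refl d s).push (le_refl d) _, by simp [Term.val, eval]⟩
  all_goals
    rename_i a b ih ih'
    simp only [reads, mem_append] at he
    have ha := fun x hx => he x (.inl hx)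
    have hb := fun x hx => he x (.inr hx)
    apply wp_cons
    refine (ih ha d hf.1).mono fun s1 h1 => ?_
    have e1 : ∀ x ∈ b.reads, s1.nat x = s.nat x := fun x hx => h1.1.1.1 x (hb x hx)
    apply wp_cons
    refine (ih' hb (d + 1) (fits_congr e1 (by first | exact hf.2.1 | exact hf.2))).mono fun s2 h2 => ?_
  case add =>
    apply wp_cons_nat
    refine wp_nil ⟨(h1.1.trans h2.1 (by omega)).push le_rfl _, ?_⟩
    simp [eval, h2.1.2 d (by omega), h1.2, h2.2, Term.val, val_congr e1]
  case mul =>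
    apply wp_cons_nat
    apply wp_cons
    refine wp_for (a.val s) hf.2.2 (fun k s' => AgStack d s s' ∧ s'.nat 24 d = a.val s ∧
      s'.nat 24 (d + 1) = b.val s ∧ s'.nat 24 (d + 2) = k * b.val s) (by simp [Prog.mods])
      ⟨(h1.1.trans h2.1 (by omega)).push (by simp [eval]) _, ?_, ?_, ?_⟩ ?_ ?_ ?_ ?_
    · simp [eval, h2.1.2 d (by omega), h1.2]
    · simp [eval, h2.2, val_congr e1]
    · simp [eval]
    · rintro k s' x ⟨h3, h4⟩
      exact ⟨h3.count x, by simpa using h4⟩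
    · rintro k s' ⟨-, h4, -⟩
      exact h4
    · rintro k s' - - ⟨h3, h4, h5, h6⟩
      refine wp_setNat ⟨h3.push (by simp [eval]) _, ?_⟩
      simp [eval, h4, h5, h6, succ_mul]
    · rintro s' ⟨h3, h4, h5, h6⟩
      refine wp_cons_nat (wp_nil ⟨h3.push (by simp [eval]) _, ?_⟩)
      simp [eval, h6, Term.val]
  case div =>
    iterate 2 apply wp_cons_nat
    apply wp_cons
    refine wp_for (a.val s) hf.2.2 (fun k s' => AgStack d s s' ∧ s'.nat 24 d = a.val s ∧
      s'.nat 24 (d + 1) = b.val s ∧ s'.nat 24 (d + 2) = min k (a.val s / b.val s) ∧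
      s'.nat 24 (d + 3) = (min k (a.val s / b.val s) + 1) * b.val s)
      (by simp [Prog.mods, ifLe, block])
      ⟨((h1.1.trans h2.1 (by omega)).push (by simp [eval]) _).push (by simp [eval]) _,
        ?_, ?_, ?_, ?_⟩ ?_ ?_ ?_ ?_
    · simp [eval, h2.1.2 d (by omega), h1.2]
    · simp [eval, h2.2, val_congr e1]
    · simp [eval]
    · simp [eval, h2.2, val_congr e1]
    · rintro k s' x ⟨h3, h4⟩
      exact ⟨h3.count x, by simpa using h4⟩
    · rintro k s' ⟨-, h4, -⟩
      exact h4
    · rintro k s' - - ⟨h3, h4, h5, h6, h7⟩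
      refine wp_ifLe (fun hb => wp_ifLe (fun hle => ?_) fun hle => ?_) fun hb => ?_
      · simp only [eval, h4, h5, h7] at hb hle
        have h8 := (Nat.le_div_iff_mul_le hb).2 hle
        have h9 : min k (a.val s / b.val s) = k := by omega
        have h10 : min (k + 1) (a.val s / b.val s) = k + 1 := by omega
        refine wp_cons_nat (wp_cons_nat (wp_nil
          ⟨(h3.push (by simp [eval]) _).push (by simp [eval]) _, ?_⟩))
        simp [eval, h4, h5, h6, h7, h9, h10, succ_mul]
      · simp only [eval, h4, h5, h7] at hb hle
        have h8 : ¬ min k (a.val s / b.val s) + 1 ≤ a.val s / b.val s := fun h =>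
          hle ((Nat.le_div_iff_mul_le hb).1 h)
        rw [show min (k + 1) (a.val s / b.val s) = min k (a.val s / b.val s) by omega]
        exact ⟨h3, h4, h5, h6, h7⟩
      · simp only [eval, h5] at hb
        have h8 : b.val s = 0 := by omega
        simp only [h8, Nat.div_zero, Nat.min_zero, mul_zero] at h5 h6 h7 ⊢
        exact ⟨h3, h4, h5, h6, h7⟩
    · rintro s' ⟨h3, h4, h5, h6, -⟩
      refine wp_cons_nat (wp_nil ⟨h3.push (by simp [eval]) _, ?_⟩)
      simpa [eval, h6, Term.val] using Nat.div_le_self _ _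

/-- `a[i] := e` for a term `e`. -/
def assign (a : ℕ) (i : NExpr) (e : Term) : Prog := .seq (e.comp 0) (.setNat a i (.get 24 (.lit 0)))

theorem wp_assign {Z a : ℕ} {i : NExpr} {e : Term} {s : Memory} {Q : Memory → Prop}
    (he : ∀ x ∈ e.reads, x ∉ [24, 25]) (hi : ∀ x ∈ i.reads, x ∉ [24, 25]) (hf : e.Fits Z s)
    (h : ∀ s', Ag [24, 25] [] s s' → Q (s'.setNat a (i.eval s) (e.val s))) :
    Wp Z (assign a i e) s Q := by
  refine wp_seq ((e.comp_spec he 0 hf).mono fun s1 h1 => wp_setNat ?_)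
  have := h s1 h1.1.1
  rwa [← h1.2, ← NExpr.eval_congr fun x hx => h1.1.1.1 x (hi x hx)] at this

/-- A sequence of assignments to variables which the terms do not read. -/
theorem wp_assigns {Z : ℕ} {L : List (ℕ × Term)} {s : Memory} (hnd : (L.map Prod.fst).Nodup)
    (hL : ∀ p ∈ L, p.1 ∉ [24, 25]) (hr : ∀ p ∈ L, ∀ x ∈ p.2.reads, x ∉ 24 :: 25 :: L.map Prod.fst)
    (hf : ∀ p ∈ L, p.2.Fits Z s) :
    Wp Z (block (L.map fun p => assign p.1 (.lit 0) p.2)) s fun s' =>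
      Ag (24 :: 25 :: L.map Prod.fst) [] s s' ∧ ∀ p ∈ L, s'.nat p.1 0 = p.2.val s := by
  induction L generalizing s with
  | nil => exact wp_nil ⟨Ag.refl _ _ _, by simp⟩
  | cons p L ih =>
    have hr1 : ∀ q ∈ L, ∀ x ∈ q.2.reads, x ∉ 24 :: 25 :: p.1 :: L.map Prod.fst := fun q hq =>
      hr q (mem_cons_of_mem _ hq)
    have hp := hL p mem_cons_self
    rw [map_cons, List.nodup_cons] at hnd
    apply wp_cons
    refine wp_assign (fun x hx h' => hr p mem_cons_self x hx (by simp at h' ⊢; tauto))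
      (by simp [NExpr.reads]) (hf p mem_cons_self) fun s1 h1 => ?_
    have h2 : Ag [24, 25, p.1] [] s (s1.setNat p.1 0 (p.2.val s)) :=
      h1.weaken.setNat
    have h3 : ∀ q ∈ L, ∀ x ∈ q.2.reads, (s1.setNat p.1 0 (p.2.val s)).nat x = s.nat x :=
      fun q hq x hx => h2.1 x fun h' => hr1 q hq x hx (by simp at h' ⊢; tauto)
    refine (ih hnd.2 (fun q hq => hL q (mem_cons_of_mem _ hq))
      (fun q hq x hx h' => hr1 q hq x hx (by simp at h' ⊢; tauto))
      fun q hq => Term.fits_congr (h3 q hq) (hf q (mem_cons_of_mem _ hq))).mono ?_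
    rintro s2 ⟨h4, h5⟩
    refine ⟨h2.weaken.trans h4 (by simp; tauto) (by simp), ?_⟩
    rintro q hq
    rcases mem_cons.1 hq with rfl | hq
    · rw [h4.1 _ fun h' => ?_]
      · simp
      · simp only [mem_cons] at h' hp
        tauto
    · rw [h5 q hq, Term.val_congr (h3 q hq)]

/-- The program that fills the first cells of the array `a` with the values of a term. -/
theorem wp_table {Z a v B : ℕ} {b : NExpr} {e : Term} {s : Memory} (f : ℕ → ℕ)
    (hv : v ∉ [24, 25, a]) (ha : a ∉ [24, 25]) (hr : ∀ x ∈ e.reads, x ∉ [24, 25]) (hB : B ≤ Z)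
    (hb : ∀ s', Ag [24, 25, a, v] [] s s' → b.eval s' = B)
    (he : ∀ q < B, ∀ s', Ag [24, 25, a, v] [] s s' → s'.nat v 0 = q →
      e.val s' = f q ∧ e.Fits Z s') :
    Wp Z (forN v b (assign a (nv v) e)) s fun s' => Ag [24, 25, a, v] [] s s' ∧
      ∀ q < B, s'.nat a q = f q := by
  have hmods : ∀ (e : Term) d, ∀ x ∈ (e.comp d).mods, x ∈ [24, 25] := by
    intro e
    induction e with
    | rd e => intro d x hx; simp_all [Term.comp, Prog.mods]
    | add a b ih ih' | mul a b ih ih' | div a b ih ih' =>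
      intro d x hx
      have h1 := ih d x
      have h2 := ih' (d + 1) x
      simp [Term.comp, block, Prog.mods, forN, ifLe] at hx h1 h2 ⊢
      tauto
  refine wp_for B hB (fun k s' => Ag [24, 25, a, v] [] s s' ∧ ∀ q < k, s'.nat a q = f q) ?_
    ⟨Ag.refl _ _ _, by simp⟩ ?_ (fun k s' h => hb s' h.1) ?_ fun s' h => h
  · intro h'
    simp only [assign, Prog.mods, mem_append, List.mem_singleton] at h'
    rcases h' with h' | h'
    · have := hmods e 0 v h'
      simp at this hv
      tauto
    · simp [h'] at hv
  · rintro k s' x ⟨h1, h2⟩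
    refine ⟨h1.setNat, fun q hq => ?_⟩
    rw [setNat_nat_of_ne _ _ _ (by simp at hv; tauto), h2 q hq]
  · rintro k s' hk hkv ⟨h1, h2⟩
    obtain ⟨h3, h4⟩ := he k hk s' h1 hkv
    refine wp_assign hr (by simp at hv; simp [NExpr.reads]; tauto) h4 fun s2 h5 => ?_
    have h6 : Ag [24, 25, a, v] [] s s2 := h1.trans h5
    refine ⟨h6.setNat, fun q hq => ?_⟩
    simp only [eval, hkv, h3, setNat_nat]
    split_ifs with h7
    · rw [h7.2]
    · have : q ≠ k := fun h => h7 ⟨trivial, h⟩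
      rw [h5.1 a ha]
      exact h2 q (by omega)

/-! ### Cutting the gaps between the release times -/

/-- The releases up to time `cur` are considered, and `ρ` gives their times if each gap between
consecutive releases is cut to length at most `G`; the time `cur` becomes `crho`. -/
structure Scan {n : ℕ} (r : Fin n → ℕ) (G k cur crho : ℕ) (ρ : Fin n → ℕ) : Prop where
  le : ∀ j, r j ≤ cur → ρ j ≤ crho
  last : ∀ j, r j ≤ cur → ρ j + cur = crho + r j ∨ (r j + G ≤ cur ∧ ρ j + G ≤ crho)
  pair : ∀ j j', r j ≤ cur → r j' ≤ cur → r j + ρ j' = r j' + ρ j ∨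
    (r j + G ≤ r j' ∧ ρ j + G ≤ ρ j') ∨ (r j' + G ≤ r j ∧ ρ j' + G ≤ ρ j)
  crho_le : crho ≤ k * G
  prog : (∀ j, r j ≤ cur) ∨ k ≤ (univ.filter fun j => r j ≤ cur).card

theorem scan_zero {n : ℕ} (r : Fin n → ℕ) (G : ℕ) : Scan r G 0 0 0 fun _ => 0 := by
  constructor <;> simp +contextual

theorem Scan.next {n : ℕ} {r : Fin n → ℕ} {G k cur crho nxt : ℕ} {ρ : Fin n → ℕ}
    (h : Scan r G k cur crho ρ) (hle : cur ≤ nxt) (h1 : ∀ j, cur < r j → nxt ≤ r j)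
    (h2 : (∀ j, r j ≤ cur) ∨ ∃ j, r j = nxt ∧ cur < nxt) :
    Scan r G (k + 1) nxt (crho + min (nxt - cur) G)
      fun j => if r j = nxt then crho + min (nxt - cur) G else ρ j := by
  have hold : ∀ j, r j ≤ nxt → r j ≠ nxt → r j ≤ cur := fun j hj hne => by
    by_contra h'
    exact hne (hj.antisymm (h1 j (not_le.1 h')))
  refine ⟨fun j hj => ?_, fun j hj => ?_, fun j j' hj hj' => ?_, ?_, ?_⟩
  · split_ifs with h3
    · exact le_rfl
    · have := h.le j (hold j hj h3)
      omega
  · split_ifs with h3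
    · exact .inl (by omega)
    · have := h.le j (hold j hj h3)
      have := hold j hj h3
      have := h.last j (hold j hj h3)
      omega
  · by_cases h3 : r j = nxt <;> by_cases h4 : r j' = nxt
    · rw [if_pos h3, if_pos h4]
      omega
    · rw [if_pos h3, if_neg h4]
      have := h.le j' (hold j' hj' h4)
      have := hold j' hj' h4
      have := h.last j' (hold j' hj' h4)
      omega
    · rw [if_neg h3, if_pos h4]
      have := h.le j (hold j hj h3)
      have := hold j hj h3
      have := h.last j (hold j hj h3)
      omega
    · rw [if_neg h3, if_neg h4]
      exact h.pair j j' (hold j hj h3) (hold j' hj' h4)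
  · have := h.crho_le
    rw [succ_mul]
    omega
  · rcases h2 with h2 | ⟨j, h3, h4⟩
    · exact .inl fun j => (h2 j).trans hle
    · rcases h.prog with h5 | h5
      · have := h5 j
        omega
      · right
        have hlt : (univ.filter fun j => r j ≤ cur).card <
            (univ.filter fun j => r j ≤ nxt).card := by
          refine Finset.card_lt_card ⟨fun i hi => ?_, fun h' => ?_⟩
          · simp only [mem_filter, mem_univ, true_and] at hi ⊢
            exact hi.trans hle
          · have := (mem_filter.1 (h' (mem_filter.2 ⟨mem_univ j, h3.le⟩))).2
            omega
        omega

theorem Scan.final {n : ℕ} {r : Fin n → ℕ} {G cur crho : ℕ} {ρ : Fin n → ℕ}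
    (h : Scan r G n cur crho ρ) : ShiftEquiv r ρ G ∧ ∀ j, ρ j ≤ n * G := by
  have hall : ∀ j, r j ≤ cur := by
    rcases h.prog with h1 | h1
    · exact h1
    · have h2 : (univ.filter fun j => r j ≤ cur) = univ :=
        Finset.eq_univ_of_card _ (le_antisymm (Finset.card_le_univ _) (by simpa using h1))
      refine fun j => (mem_filter.1 (?_ : j ∈ univ.filter fun j => r j ≤ cur)).2
      rw [h2]
      exact mem_univ j
  exact ⟨fun j j' => h.pair j j' (hall j) (hall j'), fun j => (h.le j (hall j)).trans h.crho_le⟩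

/-- Compute the array `32` of the shifted release times. The variables `28` and `29` hold the
current release time and its new value, and `26` the next release time. -/
def scan : Prog := forN 34 (nv 10) (block [
  sv 26 (nv 28),
  forN 55 (nv 10) (ifLe (.add (nv 28) (.lit 1)) (.get 1 (nv 55))
    (.ite (.natLe (nv 26) (nv 28)) (sv 26 (.get 1 (nv 55)))
      (ifLe (.get 1 (nv 55)) (nv 26) (sv 26 (.get 1 (nv 55)))))),
  sv 29 (.add (nv 29) (.sub (.sub (nv 26) (nv 28)) (.sub (.sub (nv 26) (nv 28)) (nv 14)))),
  sv 28 (nv 26),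
  forN 55 (nv 10) (ifEq (.get 1 (nv 55)) (nv 28) (.setNat 32 (nv 55) (nv 29)))])

theorem scan_spec {Z n G : ℕ} {r : Fin n → ℕ} {s : Memory} (hZ : n ≤ Z) (h10 : s.nat 10 0 = n)
    (h14 : s.nat 14 0 = G) (h1 : ∀ j : Fin n, s.nat 1 j = r j) (h28 : s.nat 28 0 = 0)
    (h29 : s.nat 29 0 = 0) (h32 : ∀ j, s.nat 32 j = 0) :
    Wp Z scan s fun s' => Ag [26, 28, 29, 32, 34, 55] [] s s' ∧ ∃ ρ : Fin n → ℕ,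
      ShiftEquiv r ρ G ∧ (∀ j, ρ j ≤ n * G) ∧ ∀ j : Fin n, s'.nat 32 j = ρ j := by
  refine wp_for n hZ (fun k s' => Ag [26, 28, 29, 32, 34, 55] [] s s' ∧ ∃ ρ : Fin n → ℕ,
    Scan r G k (s'.nat 28 0) (s'.nat 29 0) ρ ∧ ∀ j : Fin n, s'.nat 32 j = ρ j)
    (by decide) ⟨Ag.refl _ _ _, _, by rw [h28, h29]; exact scan_zero r G, fun j => h32 j⟩ ?_ ?_ ?_ ?_
  · rintro k s' x ⟨h2, ρ, h3, h4⟩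
    exact ⟨h2.setNat, ρ, by simpa using h3, by simpa using h4⟩
  · rintro k s' ⟨h2, -⟩
    simp [eval, h2.nat 10, h10]
  · rintro k s' hk - ⟨h2, ρ, h3, h4⟩
    set cur := s'.nat 28 0 with hcur
    set crho := s'.nat 29 0 with hcrho
    have e10 := (h2.nat 10).symm ▸ h10
    apply wp_cons_nat
    apply wp_cons
    -- search the next release time
    refine wp_for n hZ (fun q s1 => Ag [26, 55] [] s' s1 ∧ cur ≤ s1.nat 26 0 ∧
      (∀ j : Fin n, (j : ℕ) < q → cur < r j → cur < s1.nat 26 0 ∧ s1.nat 26 0 ≤ r j) ∧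
      (cur < s1.nat 26 0 → ∃ j, r j = s1.nat 26 0)) (by decide)
      ⟨(Ag.refl _ _ _).setNat, by simp [eval, hcur], by simp,
        by simp [eval, hcur]⟩ ?_ ?_ ?_ ?_
    · rintro q s1 x ⟨h5, h6⟩
      exact ⟨h5.setNat, by simpa using h6⟩
    · rintro q s1 ⟨h5, -⟩
      simp [eval, h5.nat 10, e10]
    · rintro q s1 hq h55 ⟨h5, h6, h7, h8⟩
      have f28 : s1.nat 28 0 = cur := by rw [h5.nat 28]
      have f1 : s1.nat 1 q = r ⟨q, hq⟩ := by
        rw [h5.nat 1, h2.nat 1, ← h1]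
      have hcase : ∀ j : Fin n, (j : ℕ) < q + 1 → (j : ℕ) < q ∨ j = ⟨q, hq⟩ := fun j hj =>
        (lt_succ_iff_lt_or_eq.1 hj).imp id fun h => Fin.ext h
      have hset : cur < r ⟨q, hq⟩ → (∀ j : Fin n, (j : ℕ) < q → cur < r j → r ⟨q, hq⟩ ≤ r j) →
          Wp Z (sv 26 (.get 1 (nv 55))) s1 fun s1 => Ag [26, 55] [] s' s1 ∧ cur ≤ s1.nat 26 0 ∧
            (∀ j : Fin n, (j : ℕ) < q + 1 → cur < r j → cur < s1.nat 26 0 ∧ s1.nat 26 0 ≤ r j) ∧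
            (cur < s1.nat 26 0 → ∃ j, r j = s1.nat 26 0) := fun h9 h10 => by
        refine wp_setNat ⟨h5.setNat, ?_⟩
        simp only [eval, h55, f1, setNat_nat, and_self, if_true]
        refine ⟨h9.le, fun j hj hj' => ⟨h9, ?_⟩, fun _ => ⟨_, rfl⟩⟩
        rcases hcase j hj with h | rfl
        exacts [h10 j h hj', le_rfl]
      have hkeep : (cur < r ⟨q, hq⟩ → cur < s1.nat 26 0 ∧ s1.nat 26 0 ≤ r ⟨q, hq⟩) →
          Ag [26, 55] [] s' s1 ∧ cur ≤ s1.nat 26 0 ∧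
            (∀ j : Fin n, (j : ℕ) < q + 1 → cur < r j → cur < s1.nat 26 0 ∧ s1.nat 26 0 ≤ r j) ∧
            (cur < s1.nat 26 0 → ∃ j, r j = s1.nat 26 0) := fun h9 => by
        refine ⟨h5, h6, fun j hj hj' => ?_, h8⟩
        rcases hcase j hj with h | rfl
        exacts [h7 j h hj', h9 hj']
      refine wp_ifLe (fun h9 => wp_ite (fun h10 => ?_) fun h10 => wp_ifLe (fun h11 => ?_)
        fun h11 => ?_) fun h9 => ?_
      all_goals simp only [Cond.eval, eval, f28, h55, f1] at *
      · exact hset h9 fun j hj hj' => by have := h7 j hj hj'; omega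
      · exact hset h9 fun j hj hj' => by have := h7 j hj hj'; omega
      · exact hkeep fun _ => by omega
      · exact hkeep fun _ => by omega
    · rintro s1 ⟨h5, h6, h7, h8⟩
      have hnext := h3.next (nxt := s1.nat 26 0) h6 (fun j hj => (h7 j j.2 hj).2) (by
        by_cases h9 : cur < s1.nat 26 0
        · obtain ⟨j, hj⟩ := h8 h9
          exact .inr ⟨j, hj, h9⟩
        · exact .inl fun j => by
            by_contra h10
            exact h9 (h7 j j.2 (not_le.1 h10)).1)
      set nxt := s1.nat 26 0 with hnxt
      iterate 2 apply wp_cons_nat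
      have e29 : s1.nat 29 0 + (nxt - s1.nat 28 0 - (nxt - s1.nat 28 0 - s1.nat 14 0)) =
          crho + min (nxt - cur) G := by
        rw [h5.nat 29, h5.nat 28, h5.nat 14, h2.nat 14, h14]
        omega
      simp only [eval, setNat_nat, reduceEqDiff, false_and, if_false, ← hnxt, e29]
      set s2 := (s1.setNat 29 0 (crho + min (nxt - cur) G)).setNat 28 0 nxt with hs2
      have h9 : Ag [26, 28, 29, 55] [] s' s2 :=
        h5.weaken.setNat.setNat
      have f28 : s2.nat 28 0 = nxt := by simp [hs2]
      have f29 : s2.nat 29 0 = crho + min (nxt - cur) G := by simp [hs2]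
      clear_value s2
      apply wp_cons
      refine wp_for n hZ (fun q s3 => Ag [32, 55] [] s2 s3 ∧ ∀ j : Fin n, s3.nat 32 j =
        if (j : ℕ) < q ∧ r j = nxt then crho + min (nxt - cur) G else ρ j) (by decide)
        ⟨Ag.refl _ _ _, fun j => by simp [h9.nat 32, h4 j]⟩ ?_ ?_ ?_ ?_
      · rintro q s3 x ⟨h10, h11⟩
        exact ⟨h10.setNat, by simpa using h11⟩
      · rintro q s3 ⟨h10, -⟩
        simp [eval, h10.nat 10, h9.nat 10, e10]
      · rintro q s3 hq h55 ⟨h10, h11⟩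
        have f1 : s3.nat 1 q = r ⟨q, hq⟩ := by
          rw [h10.nat 1, h9.nat 1, h2.nat 1, ← h1]
        have g28 : s3.nat 28 0 = nxt := by rw [h10.nat 28, f28]
        have g29 : s3.nat 29 0 = crho + min (nxt - cur) G := by rw [h10.nat 29, f29]
        refine wp_ifEq (fun h12 => wp_setNat ⟨h10.setNat, fun j => ?_⟩)
          fun h12 => ⟨h10, fun j => ?_⟩
        all_goals
          simp only [eval, h55, f1, g28, g29, setNat_nat, true_and] at h12 ⊢
          rw [h11 j]
          by_cases hj : (j : ℕ) = q
          · have : j = ⟨q, hq⟩ := Fin.ext hj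
            subst this
            simp [h12]
          · have : ((j : ℕ) < q + 1) = ((j : ℕ) < q) := by
              simp only [eq_iff_iff]; omega
            simp [hj, this]
      · rintro s3 ⟨h10, h11⟩
        refine wp_nil ⟨(h2.trans h9).trans h10,
          _, ?_, h11⟩
        rw [h10.nat 28, h10.nat 29, f28, f29]
        simpa using hnext
  · rintro s' ⟨h2, ρ, h3, h4⟩
    obtain ⟨h5, h6⟩ := h3.final
    exact ⟨h2, ρ, h5, h6, h4⟩

/-! ### Preprocessing -/

/-- The number `N` of slots. The terms below compute the other entries of `Par`. -/
def termN : Term := .mul (.rd (nv 10)) (.mul (.rd (.lit 2)) (.rd (nv 12)))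

def termG : Term := .mul (.rd (.lit 4)) termN

def termKH (E : ℕ) : Term :=
  .mul (.rd (.lit E)) (.mul (.rd (.add (nv 10) (.lit 1))) termG)

def termR (E : ℕ) : Term :=
  .mul (.rd (.add (nv 10) (.lit 1))) (.mul (.rd (.lit 2)) (termKH E))

def termQ (E : ℕ) : Term := .mul (.rd (.lit E)) (termR E)

def termW (E : ℕ) : Term := .mul (.rd (nv 12)) (.add (termQ E) (.rd (.lit 1)))

def termCap : Setting → Term
  | .migration => .mul (.rd (.lit 8)) (.mul (.rd (nv 11)) (.rd (nv 22)))
  | .noMigration => .rd (.lit 0)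

/-- The variables for the parameters that are computed from `n`, `m`, `pmax` (variable `12`) and
`2 ^ m` (variable `22`). -/
def paramTerms (mode : Setting) (E : ℕ) : List (ℕ × Term) := [
  (13, termN), (14, termG), (15, termKH E), (16, termR E), (17, termQ E), (18, termW E),
  (19, .mul (termQ E) (termW E)),
  (20, .add (.mul (termKH E) (termR E)) (.add (termR E) (.rd (.lit 1)))),
  (21, termCap mode), (23, .mul termN (termR E))]

/-- Compute the integer tables and the first layer of the dynamic program. -/
def tables (mode : Setting) (E : ℕ) : Prog := block [
  sv 10 (.get 0 (.lit 0)),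
  sv 11 (.get 0 (.lit 1)),
  forN 55 (nv 11) (assign 30 (nv 55) (.mul (.rd (nv 55)) (.rd (nv 10)))),
  assign 35 (.lit 0) (.mul (.rd (nv 11)) (.rd (nv 10))),
  sv 22 (.lit 1),
  forN 55 (nv 11) (sv 22 (.add (nv 22) (nv 22))),
  forN 55 (nv 35) (ifLe (nv 12) (.get 3 (nv 55)) (sv 12 (.get 3 (nv 55)))),
  block ((paramTerms mode E).map fun p => assign p.1 (.lit 0) p.2),
  forN 55 (nv 35) (assign 31 (nv 55) (.div (.rd (nv 18)) (.rd (.get 3 (nv 55))))),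
  scan,
  forN 55 (nv 10) (assign 33 (nv 55) (.mul (.rd (.get 32 (nv 55))) (.rd (nv 17)))),
  sv 51 (.lit 1),
  sv 52 (.lit 1),
  sv 53 (nv 10)]

/-- Compute the shifted release times and all tables that the dynamic program reads. -/
noncomputable def preprocess (mode : Setting) (E : ℕ) (p : ℝ) : Prog := .seq (tables mode E)
  (block ((List.range (2 * E + 1)).map fun a : ℕ => .setReal 41 (.lit a) (.lit ((((a : ℝ) + 2) / E) ^ p))))

theorem wp_realTable {Z a : ℕ} (f : ℕ → ℝ) (B : ℕ) {s : Memory} :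
    Wp Z (block ((List.range B).map fun k => .setReal a (.lit k) (.lit (f k)))) s fun s' =>
      Ag [] [a] s s' ∧ ∀ k < B, s'.real a k = f k := by
  have h : ∀ (l : List ℕ) (s : Memory), Wp Z (block (l.map fun k =>
      .setReal a (.lit k) (.lit (f k)))) s fun s' =>
        Ag [] [a] s s' ∧ ∀ k, s'.real a k = if k ∈ l then f k else s.real a k := by
    intro l
    induction l with
    | nil => exact fun s => wp_nil ⟨Ag.refl _ _ _, by simp⟩
    | cons k l ih =>
      refine fun s => wp_cons_real ((ih _).mono fun s' h => ⟨?_, fun q => ?_⟩)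
      · exact (Ag.refl [] [a] s).setReal.trans h.1
      · rw [h.2 q]
        by_cases h1 : q = k <;> by_cases h2 : q ∈ l <;> simp [h1, h2, eval, RExpr.eval]
  exact (h _ s).mono fun s' h => ⟨h.1, fun k hk => by simp [h.2 k, hk]⟩

theorem inputMemory_proc {n m : ℕ} (I : SchedInstance n m) (i : Fin m) (j : Fin n) :
    (inputMemory I).nat 3 (i * n + j) = (I.proc i j).toNat := by
  have h : (i : ℕ) * n + j = (finProdFinEquiv (i, j) : ℕ) := by simp [mul_comm, add_comm]
  rw [h]
  change (if h : _ then _ else _) = _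
  rw [dif_pos (finProdFinEquiv (i, j)).2, Fin.eta, Equiv.symm_apply_apply]

theorem index_lt {i j m n : ℕ} (hi : i < m) (hj : j < n) : i * n + j < m * n := by
  have := Nat.mul_le_mul_right n hi
  rw [succ_mul] at this
  omega

section

variable {n m : ℕ} {I : SchedInstance n m} {mode : Setting} {E Z : ℕ} {p : ℝ} {s : Memory}

theorem inputMemory_le_pmax (k : ℕ) : (inputMemory I).nat 3 k ≤ I.pmax := by
  change (if h : _ then _ else _) ≤ _
  split_ifs
  exacts [I.le_pmax _ _, Nat.zero_le _]

theorem val_param (h10 : s.nat 10 0 = n) (h12 : s.nat 12 0 = I.pmax) :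
    termN.val s = I.flowBound ∧ termG.val s = 4 * I.flowBound ∧ (termKH E).val s = I.ticks E ∧
      (termR E).val s = I.slots E ∧ (termQ E).val s = E * I.slots E ∧
      (termW E).val s = I.units E := by
  have h1 : termN.val s = I.flowBound := by
    simp only [termN, Term.val, eval, h10, h12, SchedInstance.flowBound]; ring
  have h2 : termG.val s = 4 * I.flowBound := by simp only [termG, Term.val, eval, h1]
  have h3 : (termKH E).val s = I.ticks E := by
    simp only [termKH, Term.val, eval, h2, h10, SchedInstance.ticks]
  have h4 : (termR E).val s = I.slots E := by
    simp only [termR, Term.val, eval, h3, h10, SchedInstance.slots]; ring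
  have h5 : (termQ E).val s = E * I.slots E := by simp only [termQ, Term.val, eval, h4]
  exact ⟨h1, h2, h3, h4, h5, by simp only [termW, Term.val, eval, h5, h12, SchedInstance.units]⟩

set_option maxHeartbeats 1000000 in
theorem preprocess_spec (hE : 1 ≤ E) (hn : 0 < n) (hF : Fits (I.par mode E p fun _ => 0) Z)
    (hmn : m * n ≤ Z) :
    Wp Z (preprocess mode E p) (inputMemory I) fun s => ∃ ρ : Fin n → ℕ,
      ShiftEquiv I.release ρ (4 * I.flowBound) ∧ (∀ j, ρ j ≤ n * (4 * I.flowBound)) ∧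
      St (I.par mode E p ρ) 0 0 [Rec.root] [] s ∧ s.nat 17 0 = E * I.slots E ∧
      (∀ j : Fin n, s.nat 32 j = ρ j) ∧ s.nat 1 = (inputMemory I).nat 1 ∧
      s.nat 3 = (inputMemory I).nat 3 ∧ s.nat 4 = (inputMemory I).nat 4 ∧ s.real 44 = fun _ => 0 := by
  -- bounds for the numbers of rounds
  have hpm := I.one_le_pmax ⟨0, hn⟩
  have bn : n ≤ Z := hF.n
  have bm : m + 1 ≤ Z := hF.m
  have bE : 2 * E + 1 ≤ Z := hF.E
  have bN : I.flowBound ≤ Z := hF.N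
  have bKH : I.ticks E ≤ Z := hF.KH
  have bV : E * I.slots E * I.units E ≤ Z := hF.V
  have b1 : 2 ≤ I.flowBound := by
    simp only [SchedInstance.flowBound]; nlinarith [Nat.mul_le_mul hn hpm]
  have b2 : I.pmax ≤ I.flowBound := by
    simp only [SchedInstance.flowBound]; nlinarith [Nat.mul_le_mul_right I.pmax hn]
  have b3 : (n + 1) * (4 * I.flowBound) ≤ I.ticks E := Nat.le_mul_of_pos_left _ hE
  have b4 : 8 ≤ I.ticks E ∧ n + 1 ≤ I.ticks E ∧ n * (4 * I.flowBound) ≤ I.ticks E := by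
    refine ⟨?_, ?_, ?_⟩ <;> nlinarith
  have b5 : 1 ≤ E * I.slots E := Nat.mul_pos hE (I.one_le_slots hE hn)
  have b6 : E * I.slots E ≤ I.units E := by
    simp only [SchedInstance.units]; nlinarith [Nat.mul_le_mul_right (E * I.slots E + 1) hpm]
  have b7 : I.units E ≤ Z := (Nat.le_mul_of_pos_left _ b5).trans bV
  have b8 := b6.trans b7
  -- the tables
  apply wp_seq
  iterate 2 apply wp_cons_nat
  set s0 := inputMemory I with hs0
  set s1 := (s0.setNat 10 _ _).setNat 11 _ _ with hs1
  have a1 : Ag [10, 11] [] s0 s1 := (Ag.refl _ _ _).setNat.setNat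
  have c10 : s1.nat 10 0 = n := by simp [hs1, eval, hs0, inputMemory]
  have c11 : s1.nat 11 0 = m := by simp [hs1, eval, hs0, inputMemory]
  clear_value s1
  apply wp_cons
  refine (wp_table (B := m) (fun i => i * n) (by decide) (by decide) (by decide) (by omega)
    (fun s' h => ?_) fun q hq s' h h' => ?_).mono fun s2 ⟨a2, e30⟩ => ?_
  · simp [eval, h.nat 11, c11]
  · simp only [Term.val, eval, h', h.nat 10, c10, Term.Fits, true_and]
    omega
  apply wp_cons
  have c10' : s2.nat 10 0 = n := by rw [a2.nat 10, c10]
  have c11' : s2.nat 11 0 = m := by rw [a2.nat 11, c11]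
  refine wp_assign (by decide) (by decide) ⟨trivial, trivial, ?_⟩ fun s3 a3 => ?_
  · simp only [Term.val, eval, c11']
    omega
  simp only [Term.val, eval, c10', c11']
  apply wp_cons_nat
  apply wp_cons
  have a4 : Ag [10, 11, 24, 25, 30, 35, 55] [] s0 (s3.setNat 35 0 (m * n)) :=
    ((a1.weaken.trans a2).trans a3).setNat
  have d10 : (s3.setNat 35 0 (m * n)).nat 10 0 = n := by simp [a3.nat 10, c10']
  have d11 : (s3.setNat 35 0 (m * n)).nat 11 0 = m := by simp [a3.nat 11, c11']
  have d30 : ∀ i < m, (s3.setNat 35 0 (m * n)).nat 30 i = i * n := by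
    simpa [a3.nat 30] using e30
  have d35 : (s3.setNat 35 0 (m * n)).nat 35 0 = m * n := by simp
  generalize s3.setNat 35 0 (m * n) = s4 at *
  -- the powers of two
  refine wp_for m (by omega) (fun k s' => Ag [22, 55] [] s4 s' ∧ s'.nat 22 0 = 2 ^ k) (by decide)
    ⟨(Ag.refl _ _ _).setNat, by simp [eval]⟩ (fun k s' x h =>
      ⟨h.1.setNat, by simpa using h.2⟩) (fun k s' h => ?_) (fun k s' _ _ h =>
      wp_setNat ⟨h.1.setNat, ?_⟩) fun s5 ⟨a5, d22⟩ => ?_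
  · simp [eval, h.1.nat 11, d11]
  · simp [eval, h.2, pow_succ, mul_two]
  apply wp_cons
  -- the maximal processing time
  have a5' : Ag [10, 11, 22, 24, 25, 30, 35, 55] [] s0 s5 :=
    a4.weaken.trans a5
  have d3 : ∀ s', Ag [12, 55] [] s5 s' → s'.nat 3 = s0.nat 3 := fun s' h => by
    rw [h.nat 3, a5'.nat 3]
  refine wp_for (m * n) hmn (fun k s' => Ag [12, 55] [] s5 s' ∧ s'.nat 12 0 ≤ I.pmax ∧
    ∀ q < k, s0.nat 3 q ≤ s'.nat 12 0) (by decide)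
    ⟨Ag.refl _ _ _, by simp [a5'.nat 12, hs0, inputMemory], by simp⟩ (fun k s' x h =>
      ⟨h.1.setNat, by simpa using h.2⟩) (fun k s' h => ?_)
      (fun k s' _ hk h => wp_ifLe (fun hle => wp_setNat ⟨h.1.setNat, ?_⟩) fun hle => ?_)
      fun s6 ⟨a6, h12, h12'⟩ => ?_
  · simp [eval, h.1.nat 35, a5.nat 35, d35]
  · simp only [eval, hk, d3 s' h.1, setNat_nat, and_self, if_true] at hle ⊢
    refine ⟨inputMemory_le_pmax k, fun q hq => ?_⟩
    rcases lt_succ_iff_lt_or_eq.1 hq with hq | rfl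
    exacts [(h.2.2 q hq).trans hle, le_rfl]
  · simp only [eval, hk, d3 s' h.1] at hle
    refine ⟨h.1, h.2.1, fun q hq => ?_⟩
    rcases lt_succ_iff_lt_or_eq.1 hq with hq | rfl
    exacts [h.2.2 q hq, by omega]
  apply wp_cons
  have e12 : s6.nat 12 0 = I.pmax := by
    refine le_antisymm h12 (Finset.sup_le fun i _ => Finset.sup_le fun j _ => ?_)
    rw [← inputMemory_proc]
    exact h12' _ (index_lt i.2 j.2)
  have a6' : Ag [12, 22, 55] [] s4 s6 := a5.weaken.trans a6
  have e10 : s6.nat 10 0 = n := by rw [a6'.nat 10, d10]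
  have e11 : s6.nat 11 0 = m := by rw [a6'.nat 11, d11]
  have e22 : s6.nat 22 0 = 2 ^ m := by rw [a6.nat 22, d22]
  -- the parameters
  obtain ⟨vN, vG, vKH, vR, vQ, vW⟩ := val_param (I := I) (E := E) e10 e12
  have fN : termN.Fits Z s6 := by simp [termN, Term.Fits, Term.val, eval, e10]; omega
  have fG : termG.Fits Z s6 := by simp [termG, Term.Fits, Term.val, eval, fN]; omega
  have fKH : (termKH E).Fits Z s6 := by
    simp [termKH, Term.Fits, Term.val, eval, fG, e10]; omega
  have fR : (termR E).Fits Z s6 := by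
    simp [termR, Term.Fits, Term.val, eval, fKH, e10]; omega
  have fQ : (termQ E).Fits Z s6 := by simp [termQ, Term.Fits, Term.val, eval, fR]; omega
  have fW : (termW E).Fits Z s6 := by
    simp [termW, Term.Fits, Term.val, eval, fQ, e12]; omega
  have fcap : (termCap mode).Fits Z s6 := by
    cases mode <;> simp [termCap, Term.Fits, Term.val, eval, e11]; omega
  have vcap : (termCap mode).val s6 = (I.par mode E p fun _ => 0).cap := by
    cases mode <;> simp [termCap, SchedInstance.par, Term.val, eval, e11, e22]
  refine (wp_assigns (s := s6) ?_ ?_ ?_ ?_).mono fun s7 ⟨a7, g⟩ => ?_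
  · cases mode <;> exact of_decide_eq_true rfl
  · cases mode <;> exact of_decide_eq_true rfl
  · cases mode <;> exact of_decide_eq_true rfl
  · simp only [paramTerms, forall_mem_cons, not_mem_nil, false_imp_iff, implies_true,
      and_true, Term.Fits, fN, fG, fKH, fR, fQ, fW, fcap, vQ, vKH, vN, b8, bKH, bN]
  simp only [paramTerms, forall_mem_cons, not_mem_nil, false_imp_iff, implies_true,
    and_true, Term.val, eval, vN, vG, vKH, vR, vQ, vW, vcap] at g
  obtain ⟨g13, g14, g15, g16, g17, g18, g19, g20, g21, g23⟩ := g
  replace a7 : Ag [12, 13, 14, 15, 16, 17, 18, 19, 20, 21, 22, 23, 24, 25, 55] [] s4 s7 :=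
    a6'.weaken.trans a7 (of_decide_eq_true rfl) (by decide)
  apply wp_cons
  -- the speeds
  have k3 : s4.nat 3 = s0.nat 3 := a4.nat 3
  refine (wp_table (B := m * n) (fun k => I.units E / s0.nat 3 k) (by decide) (by decide) (by decide)
    hmn (fun s' h => ?_) fun q hq s' h h' => ?_).mono fun s8 ⟨a8, g31⟩ => ?_
  · simp [eval, h.nat 35, a7.nat 35, d35]
  · simp only [Term.val, eval, h', h.nat 18, g18, Term.Fits, true_and,
      h.nat 3, a7.nat 3, k3, b7]
  replace a8 : Ag [12, 13, 14, 15, 16, 17, 18, 19, 20, 21, 22, 23, 24, 25, 31, 55] [] s4 s8 ∧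
    Ag [24, 25, 31, 55] [] s7 s8 :=
    ⟨a7.weaken.trans a8, a8⟩
  apply wp_cons
  refine (scan_spec (n := n) (G := 4 * I.flowBound) (r := I.release) bn ?_ ?_ (fun j => ?_) ?_ ?_
    fun j => ?_).mono fun s9 ⟨a9, ρ, hρ, hρn, g32⟩ => ?_
  · rw [a8.1.nat 10, d10]
  · rw [a8.2.nat 14, g14]
  · rw [a8.1.nat 1, a4.nat 1]
    simp [hs0, inputMemory]
  · simp [a8.1.nat 28, a4.nat 28, hs0, inputMemory]
  · simp [a8.1.nat 29, a4.nat 29, hs0, inputMemory]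
  · simp [a8.1.nat 32, a4.nat 32, hs0, inputMemory]
  apply wp_cons
  refine (wp_table (B := n) (I.par mode E p ρ).rs (by decide) (by decide) (by decide)
    bn (fun s' h => ?_) fun q hq s' h h' => ?_).mono fun s10 ⟨a10, g33⟩ => ?_
  · simp [eval, h.nat 10, a9.nat 10, a8.1.nat 10, d10]
  · have h2 := hρn ⟨q, hq⟩
    have h3 := SchedInstance.par_rs (I := I) (mode := mode) (E := E) (p := p) (ρ := ρ) ⟨q, hq⟩
    simp only [Term.val, eval, h', h.nat 17, a9.nat 17,
      a8.2.nat 17, g17, Term.Fits, true_and, h.nat 32, g32 ⟨q, hq⟩, h3]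
    exact ⟨mul_comm _ _, by omega⟩
  iterate 3 apply wp_cons_nat
  have a12 : Ag [24, 25, 26, 28, 29, 32, 33, 34, 55] [] s8 s10 :=
    a9.weaken.trans a10
  have a13 : Ag [24, 25, 26, 28, 29, 31, 32, 33, 34, 55] [] s7 s10 :=
    a8.2.weaken.trans a12
  have a14 : Ag [12, 13, 14, 15, 16, 17, 18, 19, 20, 21, 22, 23, 24, 25, 26, 28, 29, 31, 32, 33, 34, 55]
      [] s4 s10 := a7.weaken.trans a13
  have a15 : Ag [10, 11, 12, 13, 14, 15, 16, 17, 18, 19, 20, 21, 22, 23, 24, 25, 26, 28, 29, 30, 31, 32,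
      33, 34, 35, 55] [] s0 s10 := a4.weaken.trans a14
  have z : ∀ a ∈ [4, 40, 41, 42, 43, 44, 45, 50, 54], ∀ k, s10.nat a k = 0 := by
    intro a ha k
    rw [a15.1 a (by revert a; decide)]
    simp only [mem_cons, not_mem_nil, or_false] at ha
    rcases ha with rfl | rfl | rfl | rfl | rfl | rfl | rfl | rfl | rfl <;> rfl
  simp only [eval, setNat_nat, reduceEqDiff, false_and, if_false, a14.nat 10, d10]
  set s11 := ((s10.setNat 51 0 1).setNat 52 0 1).setNat 53 0 n with hs11
  refine wp_nil ((wp_realTable (fun a : ℕ => (((a : ℝ) + 2) / E) ^ p) _).mono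
    fun s12 ⟨a11, g41⟩ => ?_)
  have a16 : Ag [51, 52, 53] [41] s10 s12 := (Ag.refl _ _ _).setNat.setNat.setNat.trans a11
  refine ⟨ρ, hρ, hρn, ⟨⟨?_, ?_, ?_, ?_, ?_, ?_, ?_, ?_, ?_, fun i hi => ?_,
    fun i hi j hj => ?_, fun j hj => ?_, fun j hj => ?_, fun a ha => ?_⟩, ?_, ?_, ?_, ?_, ?_,
    fun q hq => ?_, by simp⟩, ?_, fun j => ?_, ?_, ?_, ?_, ?_⟩
  · rw [a16.nat 10, a14.nat 10, d10]; rfl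
  · rw [a16.nat 11, a14.nat 11, d11]; rfl
  · rw [a16.nat 13, a13.nat 13, g13]; rfl
  · rw [a16.nat 15, a13.nat 15, g15]; rfl
  · rw [a16.nat 16, a13.nat 16, g16]; rfl
  · rw [a16.nat 19, a13.nat 19, g19]; rfl
  · rw [a16.nat 20, a13.nat 20, g20]
    change _ = I.slots E * I.ticks E + I.slots E + 1
    ring
  · rw [a16.nat 21, a13.nat 21, g21]; rfl
  · rw [a16.nat 23, a13.nat 23, g23]; rfl
  · rw [a16.nat 30, a14.nat 30]; exact d30 i hi
  · rw [a16.nat 31, a12.nat 31]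
    change i < m at hi
    change j < n at hj
    change s8.nat 31 (i * n + j) = _
    rw [g31 _ (index_lt hi hj), hs0, inputMemory_proc I ⟨i, hi⟩ ⟨j, hj⟩]
    exact (SchedInstance.par_v ⟨i, hi⟩ ⟨j, hj⟩).symm
  · rw [a16.nat 33]; exact g33 j hj
  · rw [a16.nat 2, a15.nat 2]; rfl
  · exact g41 a (Nat.lt_succ_of_le ha)
  · rw [a16.nat 50]; exact z 50 (by decide) 0
  · simp [a11.1 51, hs11]
  · simp [a11.1 52, hs11]
  · simp [a11.1 53, hs11, SchedInstance.par]
  · rw [a16.nat 54]; exact z 54 (by decide) 0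
  · obtain rfl : q = 0 := by simpa using hq
    refine ⟨⟨?_, fun k _ => ?_, fun k _ => ?_, fun k _ => ?_, fun k _ => ?_, ?_⟩, rfl⟩
    · rw [a16.nat 40, z 40 (by decide)]; simp
    · rw [a16.nat 41, z 41 (by decide)]; rfl
    · rw [a16.nat 42, z 42 (by decide)]; rfl
    · rw [a16.nat 43, z 43 (by decide)]; rfl
    · rw [a16.nat 44, z 44 (by decide)]; rfl
    · rw [a16.real 40, a15.real 40]; rfl
  · rw [a16.nat 17, a13.nat 17, g17]
  · rw [a16.nat 32, a10.nat 32, g32 j]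
  · rw [a16.nat 1, a15.nat 1]
  · rw [a16.nat 3, a15.nat 3]
  · rw [a16.nat 4, a15.nat 4]
  · rw [a16.real 44, a15.real 44]; rfl

end

/-! ### Output of a schedule -/

/-- Set `57` to the cheapest record of the last layer. -/
def pickBest : Prog := .seq (sv 57 (nv 50)) (forN 94 (.sub (nv 51) (nv 50))
  (.ite (.realLe (.get 40 (nv 57)) (.get 40 (.add (nv 50) (nv 94)))) .skip
    (sv 57 (.add (nv 50) (nv 94)))))

/-- Output the piece that results from the last decision of record `57`, and pass on to its
parent. The real array `44` holds the processed fractions of the jobs. -/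
noncomputable def outputStep : Prog := .seq
  (ifLe (.lit 1) (.get 46 (nv 57)) (block [
    sv 55 (.sub (.get 46 (nv 57)) (.lit 1)),
    sv 56 (.get 47 (nv 57)),
    .ite (.realLe (.lit 1) (.get 44 (nv 55))) .skip (block [
      .setReal 45 (.lit 0) (.cast (.get 3 (.add (.get 30 (nv 56)) (nv 55)))),
      .setReal 46 (.lit 0) (.div (.lit 1) (.cast (nv 17))),
      .setReal 47 (.lit 0) (.mul (.sub (.lit 1) (.get 44 (nv 55))) (.get 45 (.lit 0))),
      .ite (.realLe (.get 46 (.lit 0)) (.get 47 (.lit 0))) .skip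
        (.setReal 46 (.lit 0) (.get 47 (.lit 0))),
      .setReal 0 (nv 4) (.sub (.add (.div (.cast (.get 48 (nv 57))) (.cast (nv 17)))
        (.cast (.get 1 (nv 55)))) (.cast (.get 32 (nv 55)))),
      .setReal 1 (nv 4) (.add (.get 0 (nv 4)) (.get 46 (.lit 0))),
      .setNat 5 (nv 4) (nv 55),
      .setNat 6 (nv 4) (nv 56),
      .setReal 44 (nv 55) (.add (.get 44 (nv 55)) (.div (.get 46 (.lit 0)) (.get 45 (.lit 0)))),
      sv 4 (.add (nv 4) (.lit 1))])]))
  (sv 57 (.get 45 (nv 57)))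

/-- Write the schedule encoded by a record of least cost in the last layer. -/
noncomputable def output : Prog := .seq pickBest (.loop (.natLe (.lit 1) (nv 57)) outputStep)

theorem pickBest_spec {P : Par} {Z now lo : ℕ} {l : List Rec} {s : Memory} (h : St P now lo l [] s)
    (hl : l ≠ []) (hZ : l.length ≤ Z) : Wp Z pickBest s fun s' => Ag [57, 94] [] s s' ∧
      ∃ x ∈ l, Chain s (s'.nat 57 0) x.hist ∧ ∀ y ∈ l, x.cost ≤ y.cost := by
  have hc : ∀ s', Ag [57, 94] [] s s' → ∀ q (hq : q < l.length), s'.real 40 (lo + q) = l[q].cost :=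
    fun s' h' q hq => by rw [h'.real 40, (h.cur q hq).1.cost]
  have h50 : ∀ s', Ag [57, 94] [] s s' → s'.nat 50 0 = lo := fun s' h' => by
    rw [h'.nat 50, h.lo_eq]
  refine wp_seq (wp_setNat (wp_for l.length hZ (fun k s' => Ag [57, 94] [] s s' ∧ ∃ q,
    ∃ hq : q < l.length, s'.nat 57 0 = lo + q ∧ ∀ q', (hq' : q' < l.length) → q' < k →
      l[q].cost ≤ l[q'].cost) (by decide) ⟨(Ag.refl _ _ _).setNat, 0,
        List.length_pos_iff.2 hl, by simp [eval, h.lo_eq], by simp⟩ ?_ ?_ ?_ ?_))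
  · rintro k s' x ⟨h1, h2⟩
    exact ⟨h1.setNat, by simpa using h2⟩
  · rintro k s' ⟨h1, -⟩
    simp [eval, h1.nat 51, h50 s' h1, h.hi]
  · rintro k s' hk hv ⟨h1, q, hq, h2, h3⟩
    refine wp_ite (fun h4 => wp_skip ⟨h1, q, hq, h2, fun q' hq' hlt => ?_⟩) fun h4 =>
      wp_setNat ⟨h1.setNat, k, hk, by simp [eval, hv, h50 s' h1],
        fun q' hq' hlt => ?_⟩
    all_goals
      simp only [Cond.eval, RExpr.eval, eval, h2, hv, h50 s' h1, hc s' h1 q hq,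
        hc s' h1 k hk] at h4
      rcases lt_succ_iff_lt_or_eq.1 hlt with hlt | rfl
    exacts [h3 q' hq' hlt, h4, (not_le.1 h4).le.trans (h3 q' hq' hlt), le_rfl]
  · rintro s' ⟨h1, q, hq, h2, h3⟩
    refine ⟨h1, l[q], getElem_mem _, by rw [h2]; exact (h.cur q hq).2, fun y hy => ?_⟩
    obtain ⟨q', hq', rfl⟩ := List.mem_iff_getElem.1 hy
    exact h3 q' hq' hq'

section

variable {n m : ℕ} {I : SchedInstance n m} {ρ : Fin n → ℕ} {Q G Z : ℕ}

/-- The memory holds the data that are needed to compute the pieces. -/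
structure OutData (I : SchedInstance n m) (ρ : Fin n → ℕ) (Q : ℕ) (s : Memory) : Prop where
  release : ∀ j : Fin n, s.nat 1 j = I.release j
  proc : ∀ (i : Fin m) (j : Fin n), s.nat 3 (i * n + j) = (I.proc i j).toNat
  row : ∀ i < m, s.nat 30 i = i * n
  rho : ∀ j : Fin n, s.nat 32 j = ρ j
  slots : s.nat 17 0 = Q

/-- The schedule `S` has been output so far. -/
structure OutInv (I : SchedInstance n m) (S : Schedule n m) (s : Memory) : Prop where
  outputs : Outputs s S
  frac : ∀ j : Fin n, s.real 44 j = fracOf I S j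

theorem OutInv.congr {S : Schedule n m} {s s' : Memory} (h : OutInv I S s)
    (h' : Ag [55, 56, 57, 94] [] s s') : OutInv I S s' := by
  refine ⟨⟨by rw [h'.nat 4, h.outputs.1], fun q hq => ?_⟩, fun j => ?_⟩
  · rw [h'.nat 5, h'.nat 6, h'.real 0, h'.real 1]
    exact h.outputs.2 q hq
  · rw [h'.real 44, h.frac]

theorem outputStep_spec {l : List (ℕ × ℕ × ℕ)} {e : ℕ × ℕ × ℕ} {S : Schedule n m} {s : Memory}
    (hs : OutData I ρ Q s) (hS : OutInv I S s) (h : Emitted I ρ Q l S) (hQ : 1 ≤ Q)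
    (hρ : ShiftEquiv I.release ρ G) (hl : ∀ e ∈ l, ValidDec I ρ Q G e) (he : ValidDec I ρ Q G e)
    (hd : ∀ a ∈ l, a.1 ≠ 0 → e.1 ≠ 0 → (a.2.1 = e.2.1 ∨ a.1 = e.1) → a.2.2 ≠ e.2.2)
    (h46 : s.nat 46 (s.nat 57 0) = e.1) (h47 : s.nat 47 (s.nat 57 0) = e.2.1)
    (h48 : s.nat 48 (s.nat 57 0) = e.2.2) :
    Wp Z outputStep s fun s' => Ag [4, 5, 6, 55, 56, 57] [0, 1, 44, 45, 46, 47] s s' ∧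
      s'.nat 57 0 = s.nat 45 (s.nat 57 0) ∧ ∃ S', Emitted I ρ Q (l ++ [e]) S' ∧ OutInv I S' s' := by
  have last : ∀ s', Ag [4, 5, 6, 55, 56] [0, 1, 44, 45, 46, 47] s s' →
      (∃ S', Emitted I ρ Q (l ++ [e]) S' ∧ OutInv I S' s') →
      Wp Z (sv 57 (.get 45 (nv 57))) s' fun s' => Ag [4, 5, 6, 55, 56, 57] [0, 1, 44, 45, 46, 47] s s' ∧
        s'.nat 57 0 = s.nat 45 (s.nat 57 0) ∧
        ∃ S', Emitted I ρ Q (l ++ [e]) S' ∧ OutInv I S' s' := fun s' h1 ⟨S', h2, h3⟩ =>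
    wp_setNat ⟨h1.weaken.setNat,
      by simp [eval, h1.nat 45, h1.nat 57], S', h2,
      h3.congr ((Ag.refl _ _ _).setNat)⟩
  refine wp_seq (wp_ifLe (fun h1 => ?_) fun h1 => last s (Ag.refl _ _ _) ⟨S, h.skip e fun j hj => ?_, hS⟩)
  swap
  · simp only [eval, h46] at h1
    omega
  simp only [eval, h46] at h1
  obtain ⟨j, i, t, rfl⟩ : ∃ j i t, e = (j + 1, i, t) := ⟨e.1 - 1, e.2.1, e.2.2, by
    rw [Nat.sub_add_cancel h1]⟩
  obtain ⟨hj, hi, hp, -⟩ := he j rfl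
  lift j to Fin n using hj
  lift i to Fin m using hi
  iterate 2 apply wp_cons_nat
  set s1 := (s.setNat 55 _ _).setNat 56 _ _ with hs1
  have a1 : Ag [55, 56] [] s s1 := (Ag.refl _ _ _).setNat.setNat
  have c55 : s1.nat 55 0 = j := by simp [hs1, eval, h46]
  have c56 : s1.nat 56 0 = i := by simp [hs1, eval, h47]
  have hS1 : OutInv I S s1 := hS.congr (a1.weaken)
  clear_value s1
  apply wp_cons
  refine wp_ite (fun h2 => wp_skip (wp_nil (last s1 (a1.weaken)
    ⟨S, h.skip _ fun j' hj' => ?_, hS1⟩))) fun h2 => ?_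
  all_goals simp only [Cond.eval, RExpr.eval, eval, c55, hS1.frac] at h2
  · rwa [← Fin.ext (Nat.succ_injective hj')]
  -- the piece is not empty
  have hS' := h.append hQ hρ hl he (fun a ha h3 => hd a ha h3 (Nat.succ_ne_zero _)) (not_le.1 h2)
  set b := nextPiece I ρ Q S j i t with hb
  have e4 : s1.nat 4 0 = S.length := hS1.outputs.1
  have e17 : s1.nat 17 0 = Q := by rw [a1.nat 17, hs.slots]
  have ep : s1.nat 3 (s1.nat 30 i + j) = (I.proc i j).toNat := by
    rw [a1.nat 3, a1.nat 30, hs.row i i.2, hs.proc]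
  have er : s1.nat 1 j = I.release j := by rw [a1.nat 1, hs.release]
  have eρ : s1.nat 32 j = ρ j := by rw [a1.nat 32, hs.rho]
  have et : s1.nat 48 (s1.nat 57 0) = t := by rw [a1.nat 48, a1.nat 57, h48]
  have eδ : b.finish - b.start = min (1 / (Q : ℝ)) ((1 - fracOf I S j) * (I.proc i j).toNat) :=
    add_sub_cancel_left _ _
  iterate 3 apply wp_cons_real
  set s2 := ((s1.setReal 45 _ _).setReal 46 _ _).setReal 47 _ _ with hs2
  have a2 : Ag [] [45, 46, 47] s1 s2 := (Ag.refl _ _ _).setReal.setReal.setReal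
  have c45 : s2.real 45 0 = (I.proc i j).toNat := by simp [hs2, eval, RExpr.eval, c55, c56, ep]
  have c46 : s2.real 46 0 = 1 / Q := by simp [hs2, eval, RExpr.eval, e17]
  have c47 : s2.real 47 0 = (1 - fracOf I S j) * (I.proc i j).toNat := by
    simp [hs2, eval, RExpr.eval, c55, c56, ep, hS1.frac]
  clear_value s2
  apply wp_cons
  have step : ∀ s3, Ag [] [46] s2 s3 → s3.real 46 0 = b.finish - b.start → Wp Z (block [
      .setReal 0 (nv 4) (.sub (.add (.div (.cast (.get 48 (nv 57))) (.cast (nv 17)))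
        (.cast (.get 1 (nv 55)))) (.cast (.get 32 (nv 55)))),
      .setReal 1 (nv 4) (.add (.get 0 (nv 4)) (.get 46 (.lit 0))),
      .setNat 5 (nv 4) (nv 55),
      .setNat 6 (nv 4) (nv 56),
      .setReal 44 (nv 55) (.add (.get 44 (nv 55)) (.div (.get 46 (.lit 0)) (.get 45 (.lit 0)))),
      sv 4 (.add (nv 4) (.lit 1))]) s3 fun s' => Wp Z (block []) s' fun s' =>
        Wp Z (sv 57 (.get 45 (nv 57))) s' fun s' =>
        Ag [4, 5, 6, 55, 56, 57] [0, 1, 44, 45, 46, 47] s s' ∧ s'.nat 57 0 = s.nat 45 (s.nat 57 0) ∧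
        ∃ S', Emitted I ρ Q (l ++ [((j : ℕ) + 1, (i : ℕ), t)]) S' ∧ OutInv I S' s' := by
    intro s3 a3 c46
    have a13 : Ag [] [45, 46, 47] s1 s3 := a2.trans a3
    have hS3 := hS1.outputs.2
    have hn : s3.nat = s1.nat := funext fun a => a13.1 a (by simp)
    iterate 2 apply wp_cons_real
    iterate 2 apply wp_cons_nat
    apply wp_cons_real
    apply wp_cons_nat
    refine wp_nil (wp_nil (last _ ?_ ⟨_, hS', ⟨?_, fun q hq => ?_⟩, fun j' => ?_⟩))
    · exact ((a1.weaken.trans a13).setReal.setReal.setNat.setNat.setReal.setNat)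
    · simp [eval, hn, e4]
    · simp only [eval, RExpr.eval, setNat_nat, setReal_nat, setNat_real, setReal_real, hn, e4, e17,
        c55, c56, et, er, eρ, c46, reduceEqDiff, false_and, if_false, true_and, and_self, if_true]
      rcases (lt_succ_iff_lt_or_eq.1 (by simpa using hq) : q < S.length ∨ q = S.length) with hq' | rfl
      · rw [List.getElem_append_left hq', a13.real 0, a13.real 1]
        simpa [hq'.ne] using hS3 q hq'
      · simp [hb, nextPiece]
    · rw [fracOf_append]
      simp only [eval, RExpr.eval, setNat_nat, setReal_nat, setNat_real, setReal_real, hn, e4, c55,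
        c46, reduceEqDiff, false_and, if_false, true_and, a3.real 45, c45,
        a13.real 44, hS1.frac, Fin.val_inj]
      by_cases hj' : j' = j
      · subst hj'
        simp [hb, nextPiece]
      · simp [hb, nextPiece, hj', Ne.symm hj']
  refine wp_ite (fun h3 => wp_skip (step s2 (Ag.refl _ _ _) ?_)) fun h3 => wp_setReal (step _
    ((Ag.refl _ _ _).setReal) ?_)
  all_goals simp only [Cond.eval, RExpr.eval, eval, c46, c47] at h3
  · rw [eδ, c46, min_eq_left h3]
  · simp only [setReal_real, eval, RExpr.eval, and_self, if_true, eδ, c47,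
      min_eq_right (not_le.1 h3).le]

theorem output_spec {P : Par} {now lo : ℕ} {l : List Rec} {s : Memory} (h : St P now lo l [] s)
    (hl : l ≠ []) (hZ : l.length ≤ Z) (hZ' : ∀ x ∈ l, x.hist.length ≤ Z) (hs : OutData I ρ Q s)
    (h4 : s.nat 4 0 = 0) (h44 : ∀ j, s.real 44 j = 0) (hQ : 1 ≤ Q) (hρ : ShiftEquiv I.release ρ G)
    (hv : ∀ x ∈ l, ∀ e ∈ x.hist, ValidDec I ρ Q G e)
    (hd : ∀ x ∈ l, x.hist.Pairwise fun a b => a.1 ≠ 0 → b.1 ≠ 0 → (a.2.1 = b.2.1 ∨ a.1 = b.1) →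
      a.2.2 ≠ b.2.2) :
    Wp Z output s fun s' => ∃ S, Outputs s' S ∧ ∃ x ∈ l, Emitted I ρ Q x.hist S ∧
      ∀ y ∈ l, x.cost ≤ y.cost := by
  refine wp_seq ((pickBest_spec h hl hZ).mono fun s1 ⟨a1, x, hx, hch, hmin⟩ => ?_)
  refine wp_loop x.hist.length (hZ' x hx) (fun k s' => Ag [4, 5, 6, 55, 56, 57, 94]
    [0, 1, 44, 45, 46, 47] s s' ∧ ∃ l1 l2, x.hist = l1 ++ l2 ∧ l1.length = k ∧
      Chain s (s'.nat 57 0) l2 ∧ ∃ S, Emitted I ρ Q l1 S ∧ OutInv I S s')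
    ⟨a1.weaken, [], x.hist, rfl, rfl, hch, [], emitted_nil,
      ⟨by rw [a1.nat 4, h4]; rfl, by simp⟩, fun j => ?_⟩ ?_ ?_ ?_
  · rw [a1.real 44, h44]
    rfl
  · rintro k s' hk ⟨-, l1, l2, h1, h2, h3, -⟩
    have h5 := congrArg List.length h1
    rw [length_append] at h5
    simp only [Cond.eval, eval]
    cases l2 with
    | nil =>
      have : s'.nat 57 0 = 0 := h3
      simp at h5
      omega
    | cons e l2 =>
      have := h3.1
      simp at h5
      omega
  · rintro k s' hk ⟨a2, l1, l2, h1, h2, h3, S, h5, h6⟩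
    cases l2 with
    | nil =>
      rw [h1] at hk
      simp [h2] at hk
    | cons e l2 =>
      obtain ⟨-, c46, c47, c48, -, c⟩ := h3
      have hp := List.pairwise_append.1 (h1 ▸ hd x hx)
      refine (outputStep_spec ⟨?_, ?_, ?_, ?_, ?_⟩ h6 h5 hQ hρ
        (fun a ha => hv x hx a (by rw [h1]; exact mem_append_left _ ha))
        (hv x hx e (by rw [h1]; simp)) (fun a ha => hp.2.2 a ha e mem_cons_self) ?_ ?_ ?_).mono
        fun s2 ⟨a3, e57, hS⟩ => ⟨a2.trans a3, l1 ++ [e], l2, by simp [h1],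
          by simp [h2], by rw [e57, a2.nat 45]; exact c, hS⟩
      · rw [a2.nat 1]; exact hs.release
      · rw [a2.nat 3]; exact hs.proc
      · rw [a2.nat 30]; exact hs.row
      · rw [a2.nat 32]; exact hs.rho
      · rw [a2.nat 17]; exact hs.slots
      · rw [a2.nat 46, c46]
      · rw [a2.nat 47, c47]
      · rw [a2.nat 48, c48]
  · rintro s' ⟨-, l1, l2, h1, h2, -, S, h5, h6⟩
    obtain rfl : l2 = [] := by
      have := congrArg List.length h1
      rw [length_append] at this
      exact List.length_eq_zero_iff.1 (by omega)
    rw [List.append_nil] at h1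
    exact ⟨S, h6.outputs, x, hx, h1 ▸ h5, hmin⟩

end

/-! ### The algorithm -/

/-- The approximation scheme with `E` ticks per time unit. -/
noncomputable def algorithm (mode : Setting) (E : ℕ) (p : ℝ) : Prog :=
  .ite (.natLe (.lit 1) (.get 0 (.lit 0)))
    (.seq (preprocess mode E p) (.seq (mainLoop E (2 ^ p)) output)) .skip

set_option maxRecDepth 4000 in
theorem notMem_mainLoop (E : ℕ) (tp : ℝ) : (∀ a ∈ [1, 3, 4, 17, 32], a ∉ (mainLoop E tp).mods) ∧
    44 ∉ (mainLoop E tp).rmods := by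
  have h1 : ∀ a ∈ [1, 3, 4, 17, 32], a ∉ (opA E tp).mods := of_decide_eq_true rfl
  have h2 : ∀ a ∈ [1, 3, 4, 17, 32], a ∉ opB.mods := by decide +kernel
  have h3 : 44 ∉ (opA E tp).rmods := of_decide_eq_true rfl
  have h4 : 44 ∉ opB.rmods := of_decide_eq_true rfl
  refine ⟨fun a ha => ?_, by simp [mainLoop, block, Prog.rmods, layerStep, forN, h3, h4]⟩
  have h1 := h1 a ha
  have h2 := h2 a ha
  simp only [mainLoop, block, Prog.mods, layerStep, forN, mem_append, h1, h2]
  clear h1 h2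
  revert a
  decide

section

variable {n m : ℕ} {I : SchedInstance n m} {mode : Setting} {E Z : ℕ} {p : ℝ} {ρ : Fin n → ℕ}

/-- The cheapest partial schedule in the last layer is at most slightly more expensive than any feasible
schedule. -/
theorem LInv.exists_le {l : List Rec} (h : LInv (I.par mode E p ρ) (fun F => F ^ p)
      (I.par mode E p ρ).H n m l) (hE : 1 ≤ E) (hp : 0 < p) (hn : 0 < n)
    (hρ : ShiftEquiv I.release ρ (4 * I.flowBound)) (hρn : ∀ j, ρ j ≤ n * (4 * I.flowBound))
    {S : Schedule n m} (hS : Feasible I mode S) :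
    ∃ x ∈ l, x.cost ≤ ∑ j, (I.weight j : ℝ) *
      ((1 + 1 / E) * (1 + 3 / E) * (completion S j - I.release j)) ^ p := by
  obtain ⟨pl, hOK, hfl⟩ := hS.exists_plan (p := p) hE hn hρ hρn
  obtain ⟨x, hx, y, hy, -, hxy⟩ := h.plan pl hOK
  refine ⟨x, hx, hxy.trans ?_⟩
  rw [hy.cost, show (I.par mode E p ρ).n = n from rfl, sum_range]
  refine sum_le_sum fun j _ => ?_
  have h1 : pl.cost (I.par mode E p ρ) j = I.weight j *
      (I.par mode E p ρ).flow (pl.kk j) (pl.aa j) ^ p := by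
    rw [Plan.cost, SchedInstance.par_w, SchedInstance.par_kap hE]
  have h2 : 0 ≤ (I.par mode E p ρ).flow (pl.kk j) (pl.aa j) := by
    unfold Par.flow
    positivity
  have h3 : pl.cost (I.par mode E p ρ) j ≤ I.weight j *
      ((1 + 1 / E) * (1 + 3 / E) * (completion S j - I.release j)) ^ p := by
    rw [h1]
    gcongr
    exact hfl j
  split_ifs
  · exact h3
  · refine le_trans ?_ h3
    rw [h1]
    positivity

theorem algorithm_spec (hE : 1 ≤ E) (hp : 0 < p) (hF : Fits (I.par mode E p fun _ => 0) Z)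
    (hmn : m * n ≤ Z) (hX : (I.par mode E p fun _ => 0).X ≤ Z)
    (hH : ((I.par mode E p fun _ => 0).H + 1) * (n + m) ≤ Z) :
    Wp Z (algorithm mode E p) (inputMemory I) fun s => ∃ S, Outputs s S ∧ Feasible I mode S ∧
      ∀ S', Feasible I mode S' → cost I p S ≤ (1 + 1 / E) * (1 + 3 / E) * cost I p S' := by
  refine wp_ite (fun h => ?_) fun h => ?_
  · have hn : 0 < n := h
    have hR := I.one_le_slots hE hn
    have hV : 1 ≤ E * I.slots E * I.units E :=
      Nat.mul_pos (Nat.mul_pos hE hR) (Nat.mul_pos (I.one_le_pmax ⟨0, hn⟩) (succ_pos _))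
    refine wp_seq ((preprocess_spec hE hn hF hmn).mono ?_)
    rintro s ⟨ρ, hρ, hρn, hSt, h17, h32, h1, h3, h4, h44⟩
    have hF' : Fits (I.par mode E p ρ) Z :=
      ⟨hF.n, hF.m, hF.E, hF.N, hF.KH, hF.V, hF.H⟩
    have hX' : (I.par mode E p ρ).X ≤ Z := hX
    refine wp_seq ((mainLoop_spec (phi := fun F => F ^ p) hF' hX' hn hR hV
      (SchedInstance.par_kap hE) (fun j hj => ?_) hSt).mono_frame ?_)
    · calc (I.par mode E p ρ).rs j = E * I.slots E * ρ ⟨j, hj⟩ := SchedInstance.par_rs ⟨j, hj⟩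
        _ ≤ E * I.slots E * (n * (4 * I.flowBound)) := by gcongr; exact hρn _
        _ ≤ E * I.slots E * ((n + 1) * (4 * I.flowBound)) := by gcongr; omega
        _ = I.ticks E * I.slots E := by unfold SchedInstance.ticks; ring
    rintro s' hf ⟨now, lo, l, hSt', hL, hlen⟩
    have hsound := fun x hx => Sound.feasible (hL.sound x hx) hE hp hρn
    have hmods := (notMem_mainLoop E (2 ^ p)).1
    have hrmods := (notMem_mainLoop E (2 ^ p)).2
    have hD : OutData I ρ (E * I.slots E) s' := by
      refine ⟨fun j => ?_, fun i j => ?_, hSt'.const.row, fun j => ?_, ?_⟩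
      · rw [hf.1 1 (hmods 1 (by simp)), h1]
        simp [inputMemory]
      · rw [hf.1 3 (hmods 3 (by simp)), h3, inputMemory_proc]
      · rw [hf.1 32 (hmods 32 (by simp)), h32]
      · rw [hf.1 17 (hmods 17 (by simp)), h17]
    refine (output_spec (G := 4 * I.flowBound) hSt' ?_ ((length_le_X hR le_rfl hL.sound hL.pw).trans hX)
      (fun x hx => (hlen x hx).trans hH) hD ?_ (fun j => ?_) (Nat.mul_pos hE hR) hρ (fun x hx => (hsound x hx).1)
      fun x hx => (hL.sound x hx).pair).mono ?_
    · rintro rfl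
      obtain ⟨S, hS⟩ := I.exists_feasible mode
      obtain ⟨x, hx, -⟩ := hL.exists_le hE hp hn hρ hρn hS
      exact not_mem_nil hx
    · rw [hf.1 4 (hmods 4 (by simp)), h4]
      rfl
    · rw [hf.2 44 hrmods, h44]
    · rintro s'' ⟨S, hS, x, hx, hxS, hmin⟩
      obtain ⟨hfeas, hcost⟩ := (hsound x hx).2 S hxS
      refine ⟨S, hS, hfeas, fun S' hS' => ?_⟩
      obtain ⟨y, hy, hyS⟩ := hL.exists_le hE hp hn hρ hρn hS'
      have hc : (0 : ℝ) ≤ (1 + 1 / E) * (1 + 3 / E) := by positivity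
      have h0 : ∀ {S : Schedule n m}, Feasible I mode S → ∀ j,
        0 ≤ completion S j - I.release j := fun h j => zero_le_one.trans (h.one_le_flow j)
      have h5 : ∑ j, (I.weight j : ℝ) * (completion S j - I.release j) ^ p ≤
          ((1 + 1 / E) * (1 + 3 / E)) ^ p *
            ∑ j, (I.weight j : ℝ) * (completion S' j - I.release j) ^ p := by
        refine hcost.trans ((hmin y hy).trans (hyS.trans_eq ?_))
        rw [mul_sum]
        refine sum_congr rfl fun j _ => ?_
        rw [Real.mul_rpow hc (h0 hS' j)]
        ring
      have h6 : ∀ {S : Schedule n m}, Feasible I mode S →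
          0 ≤ ∑ j, (I.weight j : ℝ) * (completion S j - I.release j) ^ p := fun h =>
        sum_nonneg fun j _ => mul_nonneg (cast_nonneg _) (Real.rpow_nonneg (h0 h j) _)
      calc cost I p S ≤ (((1 + 1 / E) * (1 + 3 / E)) ^ p *
            ∑ j, (I.weight j : ℝ) * (completion S' j - I.release j) ^ p) ^ (1 / p) :=
          Real.rpow_le_rpow (h6 hfeas) h5 (by positivity)
        _ = _ := by
          rw [Real.mul_rpow (by positivity) (h6 hS'), ← Real.rpow_mul hc, mul_one_div_cancel hp.ne',
            Real.rpow_one]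
          rfl
  · obtain rfl : n = 0 := Nat.lt_one_iff.1 (not_le.1 h)
    refine wp_skip ⟨[], ⟨rfl, by simp⟩, ⟨by simp, by simp, by simp, by simp, fun j => j.elim0, by simp⟩,
      fun S' _ => ?_⟩
    simp [cost, Real.zero_rpow (inv_pos.2 hp).ne']

end

/-! ### The running time -/

/-- The number of steps of a program whose loops run for one round. -/
def Prog.size : Prog → ℕ
  | .skip => 1
  | .setNat _ i e => i.steps + e.steps + 1
  | .setReal _ i e => i.steps + e.steps + 1
  | .seq P Q => P.size + Q.size
  | .ite c P Q => c.steps + (P.size + Q.size)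
  | .loop c P => c.steps + c.steps + P.size

/-- The nesting depth of the loops. -/
def Prog.depth : Prog → ℕ
  | .skip => 0
  | .setNat _ _ _ => 0
  | .setReal _ _ _ => 0
  | .seq P Q => max P.depth Q.depth
  | .ite _ P Q => max P.depth Q.depth
  | .loop _ P => P.depth + 1

theorem Prog.bound_le (Z : ℕ) (P : Prog) : P.bound Z ≤ P.size * (Z + 1) ^ P.depth := by
  have hmax : ∀ {a b c d x : ℕ}, a ≤ x * (Z + 1) ^ c → c ≤ d → a ≤ x * (Z + 1) ^ d := fun h h' =>
    h.trans (Nat.mul_le_mul_left _ (Nat.pow_le_pow_right (succ_pos Z) h'))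
  induction P with
  | skip | setNat _ _ _ | setReal _ _ _ => simp [bound, size, depth]
  | seq P Q ih ih' =>
    simp only [bound, size, depth, Nat.add_mul]
    exact Nat.add_le_add (hmax (b := 0) ih (le_max_left _ _)) (hmax (b := 0) ih' (le_max_right _ _))
  | ite c P Q ih ih' =>
    simp only [bound, size, depth, Nat.add_mul]
    exact Nat.add_le_add (le_mul_of_pos_right _ (Nat.pow_pos (succ_pos Z))) (Nat.add_le_add
      (hmax (b := 0) ih (le_max_left _ _)) (hmax (b := 0) ih' (le_max_right _ _)))
  | loop c P ih =>
    simp only [bound, size, depth]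
    have h1 : 1 ≤ (Z + 1) ^ P.depth := Nat.one_le_pow _ _ (succ_pos Z)
    calc c.steps + Z * (c.steps + P.bound Z)
        ≤ c.steps * ((Z + 1) ^ P.depth * (Z + 1)) +
          (Z + 1) * (c.steps * (Z + 1) ^ P.depth + P.size * (Z + 1) ^ P.depth) := by
          gcongr
          · exact le_mul_of_pos_right _ (by positivity)
          · exact Nat.le_succ Z
          · exact le_mul_of_pos_right _ h1
      _ = _ := by ring

theorem realTable_size (a : ℕ) (f : ℕ → ℝ) (l : List ℕ) :
    (block (l.map fun k => .setReal a (.lit k) (.lit (f k)))).size = 3 * l.length + 1 ∧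
      (block (l.map fun k => .setReal a (.lit k) (.lit (f k)))).depth = 0 := by
  induction l with
  | nil => exact ⟨rfl, rfl⟩
  | cons k l ih =>
    constructor
    · change 3 + Prog.size _ = _
      rw [ih.1, List.length_cons]
      ring
    · change max 0 (Prog.depth _) = 0
      rw [ih.2]
      rfl

theorem algorithm_size (mode : Setting) {E : ℕ} (p : ℝ) :
    (algorithm mode E p).size ≤ 100000 + 6 * E ∧ (algorithm mode E p).depth ≤ 12 := by
  have h1 : (mainLoop E (2 ^ p)).size ≤ 80000 := by
    rw [show (mainLoop E (2 ^ p)).size = (mainLoop 0 0).size from rfl]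
    decide +kernel
  have h2 : (mainLoop E (2 ^ p)).depth ≤ 12 := by
    rw [show (mainLoop E (2 ^ p)).depth = (mainLoop 0 0).depth from rfl]
    decide +kernel
  have h3 : output.size ≤ 1000 := by decide +kernel
  have h4 : output.depth ≤ 12 := by decide +kernel
  have h5 : (tables mode E).size ≤ 10000 := by
    rw [show (tables mode E).size = (tables mode 0).size from rfl]
    cases mode <;> decide +kernel
  have h6 : (tables mode E).depth ≤ 12 := by
    rw [show (tables mode E).depth = (tables mode 0).depth from rfl]
    cases mode <;> decide +kernel
  simp only [algorithm, preprocess, Prog.size, Prog.depth, Cond.steps, NExpr.steps,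
    (realTable_size _ _ _).1, (realTable_size _ _ _).2, List.length_range]
  omega

theorem pow_add_one_le {K : ℕ} (hK : 2 ≤ K) (i : ℕ) : K ^ i + 1 ≤ K ^ (i + 1) := by
  have := Nat.one_le_pow i K (by omega)
  rw [pow_succ]
  nlinarith

section

variable {n m : ℕ} {I : SchedInstance n m} {mode : Setting} {E : ℕ} {p : ℝ}

/-- A bound on the number of rounds of all loops. -/
theorem exists_rounds (hE : 7 ≤ E) : ∃ Z, Fits (I.par mode E p fun _ => 0) Z ∧ m * n ≤ Z ∧
    (I.par mode E p fun _ => 0).X ≤ Z ∧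
    ((I.par mode E p fun _ => 0).H + 1) * (n + m) ≤ Z ∧ (2 ≤ n * I.pmax →
      Z = (n * I.pmax * E) ^ (2232 * (m * 2 ^ m * Nat.log 2 (n * I.pmax) * E))) := by
  set P := I.par mode E p fun _ => 0 with hP
  by_cases ha : 2 ≤ n * I.pmax
  swap
  · exact ⟨P.n + (P.m + 1) + (2 * P.E + 1) + P.N + P.KH + P.V + (P.H + 1) + m * n + P.X +
      (P.H + 1) * (n + m), ⟨by omega, by omega, by omega, by omega, by omega, by omega, by omega⟩,
      by omega, by omega, by omega, fun h => absurd h ha⟩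
  have hn : 0 < n := Nat.pos_of_ne_zero fun h => by simp [h] at ha
  have hpm := I.one_le_pmax ⟨0, hn⟩
  have hm : 1 ≤ m := by
    obtain ⟨i, -⟩ := I.runnable ⟨0, hn⟩
    exact Fin.pos i
  set a := n * I.pmax with hadef
  set K := a * E with hK
  set l := Nat.log 2 a with hl
  have hl1 : 1 ≤ l := Nat.log_pos (by norm_num) ha
  set M := m * 2 ^ m * l * E with hM
  have hna : n ≤ a := le_mul_of_pos_right _ hpm
  have hpa : I.pmax ≤ a := Nat.le_mul_of_pos_left _ hn
  have haK : 7 * a ≤ K := by rw [hK, mul_comm]; exact Nat.mul_le_mul_left _ hE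
  have hEK : 2 * E ≤ K := Nat.mul_le_mul_right _ ha
  have hK2 : 2 ≤ K := by omega
  have up : ∀ {i j : ℕ}, i ≤ j → K ^ i ≤ K ^ j := fun h => Nat.pow_le_pow_right (by omega) h
  have hm2 : m * 2 ^ m ≤ M := by
    rw [hM, mul_assoc _ l]
    exact le_mul_of_pos_right _ (Nat.mul_pos hl1 (by omega))
  have hmM : m ≤ M := (le_mul_of_pos_right _ (by positivity)).trans hm2
  have hM1 : 1 ≤ M := hm.trans hmM
  have hmK : m + 1 ≤ K ^ M := calc
    m + 1 ≤ 2 ^ m := Nat.lt_two_pow_self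
    _ ≤ K ^ m := pow_le_pow_left hK2 _
    _ ≤ K ^ M := up hmM
  -- the parameters are bounded by powers of `K`
  have bN : P.N ≤ K ^ 1 := by
    change 2 * n * I.pmax ≤ _
    rw [pow_one, mul_assoc]
    omega
  have bKH : P.KH ≤ K ^ 4 := by
    change E * ((n + 1) * (4 * (2 * n * I.pmax))) ≤ _
    calc E * ((n + 1) * (4 * (2 * n * I.pmax))) = K * (8 * (n + 1)) := by rw [hK, hadef]; ring
      _ ≤ K * (K * K * K) := by
        refine Nat.mul_le_mul_left _ ?_
        calc 8 * (n + 1) ≤ K * K * 1 := by rw [mul_one]; exact Nat.mul_le_mul (by omega) (by omega)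
          _ ≤ K * K * K := by gcongr; omega
      _ = _ := by ring
  have bR : P.R ≤ K ^ 5 := by
    change 2 * (n + 1) * I.ticks E ≤ _
    calc 2 * (n + 1) * I.ticks E ≤ K * K ^ 4 := Nat.mul_le_mul (by omega) bKH
      _ = _ := by ring
  have bQ : E * I.slots E ≤ K ^ 6 := calc
    E * I.slots E ≤ K * K ^ 5 := Nat.mul_le_mul (by omega) bR
    _ = _ := by ring
  have bW : I.units E ≤ K ^ 8 := calc
    I.pmax * (E * I.slots E + 1) ≤ K * K ^ 7 :=
      Nat.mul_le_mul (by omega) ((Nat.add_le_add_right bQ 1).trans (pow_add_one_le hK2 6))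
    _ = _ := by ring
  have bV : P.V ≤ K ^ 14 := calc
    E * I.slots E * I.units E ≤ K ^ 6 * K ^ 8 := Nat.mul_le_mul bQ bW
    _ = _ := by ring
  have bH : P.H + 2 ≤ K ^ 12 := calc
    P.R * P.KH + P.R + 2 ≤ K ^ 5 * K ^ 4 + K ^ 9 + 2 :=
      Nat.add_le_add_right (Nat.add_le_add (Nat.mul_le_mul bR bKH) (bR.trans (up (by omega)))) 2
    _ = 2 * K ^ 9 + 1 + 1 := by ring
    _ ≤ K * K ^ 9 + 1 + 1 := by gcongr
    _ = K ^ 10 + 1 + 1 := by ring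
    _ ≤ _ := (Nat.add_le_add_right (pow_add_one_le hK2 10) 1).trans (pow_add_one_le hK2 11)
  have bX : P.X ≤ K ^ (2232 * M) := by
    have h1 : n * P.V + 1 ≤ K ^ 16 := calc
      n * P.V + 1 ≤ K * K ^ 14 + 1 := by gcongr; omega
      _ = K ^ 15 + 1 := by ring
      _ ≤ _ := pow_add_one_le hK2 15
    have h2 : n * ((P.V + 1) * (P.H + 2)) + 1 ≤ K ^ 29 := calc
      n * ((P.V + 1) * (P.H + 2)) + 1 ≤ K * (K ^ 15 * K ^ 12) + 1 := by
        gcongr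
        · omega
        · exact (Nat.add_le_add_right bV 1).trans (pow_add_one_le hK2 14)
      _ = K ^ 28 + 1 := by ring
      _ ≤ _ := pow_add_one_le hK2 28
    have h3 : P.cap ≤ 8 * (m * 2 ^ m) := by
      cases mode <;> simp [hP, SchedInstance.par]
    have h4 : Nat.log 2 P.N + 1 ≤ 3 * l := by
      have : P.N = a * 2 := by change 2 * n * I.pmax = _; rw [hadef]; ring
      rw [this, Nat.log_mul_base (by norm_num) (by omega)]
      omega
    have h5 : m ≤ m * 2 ^ m := le_mul_of_pos_right _ (by positivity)
    -- `2232 = 248 * 9`, where `16 * m + 29 * P.cap ≤ 248 * (m * 2 ^ m)`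
    calc P.X ≤ ((K ^ 16) ^ m * (K ^ 29) ^ P.cap) ^ ((Nat.log 2 P.N + 1) * (2 * E + 4)) :=
          pow_le_pow_left (Nat.mul_le_mul (pow_le_pow_left h1 _) (pow_le_pow_left h2 _)) _
      _ = K ^ ((16 * m + 29 * P.cap) * ((Nat.log 2 P.N + 1) * (2 * E + 4))) := by
          rw [← pow_mul, ← pow_mul, ← pow_add, ← pow_mul]
      _ ≤ K ^ ((248 * (m * 2 ^ m)) * ((3 * l) * (3 * E))) := by
          refine up (Nat.mul_le_mul ?_ (Nat.mul_le_mul h4 (by omega)))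
          omega
      _ = _ := by rw [hM]; congr 1; ring
  have top : ∀ {i : ℕ}, i ≤ 2232 → K ^ i ≤ K ^ (2232 * M) := fun h => up (by nlinarith)
  refine ⟨K ^ (2232 * M), ⟨?_, ?_, ?_, bN.trans (top (by omega)), bKH.trans (top (by omega)),
    bV.trans (top (by omega)), ?_⟩, ?_, bX, ?_, fun _ => rfl⟩
  · exact (show n ≤ K ^ 1 by rw [pow_one]; omega).trans (top (by omega))
  · exact hmK.trans (up (by omega))
  · exact (show 2 * E + 1 ≤ K ^ 2 from
      (Nat.add_le_add_right (by rw [pow_one]; exact hEK) 1).trans (pow_add_one_le hK2 1)).trans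
        (top (by omega))
  · exact (Nat.le_succ _).trans (bH.trans (top (by omega)))
  · calc m * n ≤ K ^ M * K ^ 1 := Nat.mul_le_mul (by omega) (by rw [pow_one]; omega)
      _ = K ^ (M + 1) := by rw [pow_add]
      _ ≤ _ := up (by omega)
  · calc (P.H + 1) * (n + m) ≤ K ^ 12 * (K ^ M * K) := by
          refine Nat.mul_le_mul (by omega) ?_
          nlinarith [Nat.mul_le_mul (show m ≤ K ^ M by omega) (show 1 ≤ K by omega)]
      _ = K ^ (M + 13) := by ring
      _ ≤ _ := up (by omega)

theorem le_timeBound {ε : ℝ} (hε : 0 < ε) (hε1 : ε ≤ 1) (hE : 7 ≤ E) (hEε : (E : ℝ) ≤ 8 / ε)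
    (ha : 2 ≤ n * I.pmax) {t : ℕ} (ht : t ≤ (algorithm mode E p).bound ((n * I.pmax * E) ^
      (2232 * (m * 2 ^ m * Nat.log 2 (n * I.pmax) * E)))) : (t : ℝ) ≤ timeBound 2000000 ε I := by
  have hn : 0 < n := Nat.pos_of_ne_zero fun h => by simp [h] at ha
  have hm : 1 ≤ m := by
    obtain ⟨i, -⟩ := I.runnable ⟨0, hn⟩
    exact Fin.pos i
  set a := n * I.pmax with hadef
  set K := a * E with hK
  set l := Nat.log 2 a with hl
  have hl1 : 1 ≤ l := Nat.log_pos (by norm_num) ha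
  set M := m * 2 ^ m * l * E with hM
  have hM1 : 1 ≤ M := Nat.mul_pos (Nat.mul_pos (by positivity) hl1) (by omega)
  have hK14 : 14 ≤ K := Nat.mul_le_mul ha hE
  have hEK : E ≤ K := Nat.le_mul_of_pos_left _ (by omega)
  have h1 : t ≤ K ^ (26802 * M) := by
    obtain ⟨h1, h2⟩ := algorithm_size mode (E := E) p
    calc t ≤ _ := ht.trans (Prog.bound_le _ _)
      _ ≤ (100000 + 6 * E) * (K ^ (2232 * M) + 1) ^ 12 := by
        refine Nat.mul_le_mul h1 (Nat.pow_le_pow_right (succ_pos _) h2)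
      _ ≤ K ^ 6 * (K ^ (2232 * M + 1)) ^ 12 := by
        refine Nat.mul_le_mul ?_ (pow_le_pow_left (pow_add_one_le (by omega) _) _)
        calc 100000 + 6 * E ≤ 14 ^ 5 * K := by omega
          _ ≤ K ^ 5 * K := Nat.mul_le_mul_right _ (pow_le_pow_left hK14 5)
          _ = _ := by ring
      _ = K ^ (26784 * M + 18) := by ring
      _ ≤ _ := Nat.pow_le_pow_right (by omega) (by omega)
  have ha2 : (2 : ℝ) ≤ (n : ℝ) * I.pmax := by exact_mod_cast ha
  set x : ℝ := (n : ℝ) * I.pmax / ε with hx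
  have hx2 : 2 ≤ x := by rw [hx, le_div_iff₀ hε]; nlinarith
  have hKx : (K : ℝ) ≤ x ^ 4 := by
    calc (K : ℝ) = (n : ℝ) * I.pmax * E := by rw [hK, hadef]; push_cast; ring
      _ ≤ (n : ℝ) * I.pmax * (8 / ε) := by gcongr
      _ = 2 ^ 3 * x := by rw [hx]; ring
      _ ≤ x ^ 3 * x := by gcongr
      _ = x ^ 4 := by ring
  have hlog : (l : ℝ) ≤ 2 * Real.log ((n : ℝ) * I.pmax) := by
    have h2 : ((2 : ℝ) ^ l) ≤ (n : ℝ) * I.pmax := by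
      exact_mod_cast Nat.pow_log_le_self 2 (show a ≠ 0 by omega)
    have h3 := Real.log_le_log (by positivity) h2
    rw [Real.log_pow] at h3
    have := Real.log_two_gt_d9
    nlinarith [(cast_nonneg l : (0 : ℝ) ≤ l)]
  set Y : ℝ := (2 : ℝ) ^ m * m * Real.log ((n : ℝ) * I.pmax) / ε with hY
  have hlog0 : 0 ≤ Real.log ((n : ℝ) * I.pmax) := Real.log_nonneg (by linarith)
  have hMY : (M : ℝ) ≤ 16 * Y := by
    calc (M : ℝ) = m * 2 ^ m * l * E := by rw [hM]; push_cast; ring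
      _ ≤ m * 2 ^ m * (2 * Real.log ((n : ℝ) * I.pmax)) * (8 / ε) := by gcongr
      _ = 16 * Y := by rw [hY]; ring
  have hnlog : 0 ≤ (n : ℝ) * Real.log n := mul_nonneg (cast_nonneg n) (Real.log_natCast_nonneg n)
  calc (t : ℝ) ≤ (K : ℝ) ^ (26802 * M) := by exact_mod_cast h1
    _ ≤ (x ^ 4) ^ (26802 * M) := by gcongr
    _ = x ^ ((4 * (26802 * M) : ℕ) : ℝ) := by rw [← pow_mul, Real.rpow_natCast]
    -- `4 * 26802 * 16 < 2000000`
    _ ≤ x ^ (2000000 * Y) := by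
      refine Real.rpow_le_rpow_of_exponent_le (by linarith) ?_
      push_cast
      nlinarith [(cast_nonneg M : (0 : ℝ) ≤ M)]
    _ ≤ timeBound 2000000 ε I := le_add_of_nonneg_left (by positivity)

end

end FlowTime

theorem mainTheorem3 :
    ∃ C : ℝ, 0 < C ∧
      ∀ (setting : FlowTime.Setting) (ε p : ℝ), 0 < ε → 0 < p →
        ∃ P : FlowTime.Prog,
          ∀ (n m : ℕ) (I : FlowTime.SchedInstance n m),
            ∃ (t : ℕ) (s : FlowTime.Memory) (S : FlowTime.Schedule n m),
              FlowTime.Runs P (FlowTime.inputMemory I) t s ∧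
              FlowTime.Outputs s S ∧
              FlowTime.Feasible I setting S ∧
              (∀ S' : FlowTime.Schedule n m, FlowTime.Feasible I setting S' →
                FlowTime.cost I p S ≤ (1 + ε) * FlowTime.cost I p S') ∧
              (2 ≤ n * I.pmax → (t : ℝ) ≤ FlowTime.timeBound C (min ε 1) I) := by
  refine ⟨2000000, by norm_num, fun setting ε p hε hp => ?_⟩
  have hε' : 0 < min ε 1 := lt_min hε one_pos
  have hε1 : min ε 1 ≤ 1 := min_le_right _ _
  -- the flow times grow by a factor of `(1 + 1 / E) * (1 + 3 / E) ≤ 1 + 7 / E` at most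
  set E := ⌈7 / min ε 1⌉₊ with hE
  have h7 : 7 / min ε 1 ≤ E := Nat.le_ceil _
  have hE7 : 7 ≤ E := by
    have : (7 : ℝ) ≤ E := le_trans (by rw [le_div_iff₀ hε']; linarith) h7
    exact_mod_cast this
  have hE8 : (E : ℝ) ≤ 8 / min ε 1 := by
    refine (Nat.ceil_lt_add_one (by positivity)).le.trans ?_
    have : 1 ≤ 1 / min ε 1 := by rwa [le_div_iff₀ hε', one_mul]
    calc 7 / min ε 1 + 1 ≤ 7 / min ε 1 + 1 / min ε 1 := by gcongr
      _ = _ := by ring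
  refine ⟨FlowTime.algorithm setting E p, fun n m I => ?_⟩
  obtain ⟨Z, hF, hmn, hX, hH, hZ⟩ := FlowTime.exists_rounds (I := I) (mode := setting) (p := p) hE7
  obtain ⟨t, s, hrun, ht, S, hS, hfeas, hcost⟩ := FlowTime.algorithm_spec (by omega) hp hF hmn hX hH
  refine ⟨t, s, S, hrun, hS, hfeas, fun S' hS' => (hcost S' hS').trans ?_, fun ha => ?_⟩
  · have h0 : 0 ≤ FlowTime.cost I p S' := by
      refine Real.rpow_nonneg (Finset.sum_nonneg fun j _ => mul_nonneg (Nat.cast_nonneg _)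
        (Real.rpow_nonneg (zero_le_one.trans (hS'.one_le_flow j)) _)) _
    refine mul_le_mul_of_nonneg_right ?_ h0
    have hE0 : (7 : ℝ) ≤ E := by exact_mod_cast hE7
    calc (1 + 1 / (E : ℝ)) * (1 + 3 / E) = 1 + (4 + 3 / E) / E := by field_simp; ring
      _ ≤ 1 + (4 + 3) / E := by
        gcongr
        exact div_le_self (by norm_num) (by linarith)
      _ ≤ 1 + min ε 1 := by
        gcongr
        rw [div_le_iff₀ (by linarith)]
        rw [div_le_iff₀ hε'] at h7
        linarith
      _ ≤ 1 + ε := by gcongr; exact min_le_left _ _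
  · exact FlowTime.le_timeBound hε' hε1 hE7 hE8 ha (hZ ha ▸ ht)
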